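/- **Notation.** Let $F$ be a $p$-adic field (a finite extension of $\mathbb{Q}_p$) with $p\neq 2$, ring of integers $\mathcal{O}$, residue field $\mathfrak{k}$ of order $q=p^f$, normalised valuation $v$ and a fixed uniformizer $\varpi$. Let $E$ be an algebraically closed field of characteristic $p$ with a fixed embedding $\mathfrak{k}\hookrightarrow E$. Let $(a,b)_F\in\{\pm1\}$ be the quadratic Hilbert symbol; it is the sign $\overline{u}^{(q-1)/2}$, where $u=(-1)^{v(a)v(b)}b^{v(a)}/a^{v(b)}$. *The group.* For $g=\begin{pmatrix}a&b\\c&d\end{pmatrix}\in SL_2(F)$ put $X(g)=c$ if $c\neq0$ and $X(g)=d$ if $c=0$. The metaplectic group $\widetilde G$ is $SL_2(F)\times\{\pm1\}$ with the product $(g,\zeta)(g',\zeta')=(gg',\zeta\zeta'\Delta(g,g'))$, where $\Delta(g,g')=\bigl(X(gg')/X(g),\,X(gg')/X(g')\bigr)_F$. On $SL_2(\mathcal{O})$ put $\theta(k)=1$ if $c$ is $0$ or a unit, and $\theta(k)=(c,d)_F$ otherwise; $k\mapsto(k,\theta(k))$ is a homomorphism to $\widetilde G$, and $\widetilde G$ has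 the group topology for which it identifies $SL_2(\mathcal{O})$ with an open subgroup. Let $\widetilde K$, $\widetilde T$, $\widetilde{\overline B}$ be the preimages of $SL_2(\mathcal{O})$, of the diagonal torus and of the lower triangular Borel subgroup. Write $h(x)=\mathrm{diag}(x,x^{-1})$ and $\tilde h(x)=(h(x),(-1,x)_F)$. All representations are on $E$-vector spaces. A representation or character is genuine if $(1,-1)$ acts by $-1$, and smooth if stabilizers of vectors are open. *Principal series.* For a smooth genuine character $\chi:\widetilde T\to E^\times$, inflated to $\widetilde{\overline B}$ (trivially on the lower unipotent subgroup, lifted by $\bar u\mapsto(\bar u,1)$), $\mathrm{Ind}_{\widetilde{\overline B}}^{\widetilde G}(\chi)$ is the space of functions $\phi:\widetilde G\to E$ that are right invariant under some open subgroup and satisfy $\phi(bg)=\chi(b)\phi(g)$ for $b\in\widetilde{\overline B}$, with $\widetilde G$ acting by right translation. For a nontrivial continuous additive character $\psi$ of $F$ with complex values, let $\gamma_F(a,\psi)\in\mu_4(\mathbb{C})$ be the quotient of the Weil index of $x\mapsto\psi(ax^2)$ by that of $x\mapsto\psi(x^2)$, the Weil index of $x\mapsto\psi(ax^2)$ being the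 eventually constant value of $I_n/|I_n|$, $I_n=\int_{v(x)\ge -n}\psi(ax^2)\,dx$. Put $\chi_\psi(h(a),\zeta)=\zeta\,\gamma_F(a,\psi)^{-1}$, where $\mu_4(\mathbb{C})$ is identified with $\mu_4(E)$ by any isomorphism. For a smooth character $\mu:F^\times\to E^\times$ put $(\mu\cdot\chi_\psi)(h(a),\zeta)=\mu(a)\chi_\psi(h(a),\zeta)$ and $\lambda_{\mu,\psi}=(\mu\cdot\chi_\psi)(\tilde h(\varpi))$. *Weights and cokernel modules.* For $\vec r=(r_0,\dots,r_{f-1})$ with $0\le r_i\le p-1$ let $\sigma_{\vec r}=\bigotimes_{i}(\mathrm{Sym}^{r_i}E^2)^{\mathrm{Fr}^i}$, a representation of $SL_2(\mathfrak{k})$, and let $\tilde\sigma_{\vec r}$ be the representation of $\widetilde K$ on the same space $V$ in which $(k,\zeta)$ acts by $\zeta\,\theta(k)\,\sigma_{\vec r}(\bar k)$. Let $\rho_{\vec r}\in\mathrm{End}_E(V)$ be the composite $V\twoheadrightarrow V_{\overline U(\mathfrak{k})}\xrightarrow{\ j^{-1}\ }V^{U(\mathfrak{k})}\hookrightarrow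 V$, where $U$ and $\overline U$ are the upper and lower unipotent subgroups and $j$ is the natural isomorphism $V^{U(\mathfrak{k})}\to V_{\overline U(\mathfrak{k})}$. Let $\varphi:\widetilde G\to\mathrm{End}_E(V)$ be the function supported on $\widetilde K\tilde h(\varpi)^{-1}\widetilde K$ with $\varphi(kgl)=\tilde\sigma_{\vec r}(k)\varphi(g)\tilde\sigma_{\vec r}(l)$ for $k,l\in\widetilde K$ and $\varphi(\tilde h(\varpi)^{-1})=\rho_{\vec r}$. Let $\mathrm{ind}_{\widetilde K}^{\widetilde G}\tilde\sigma_{\vec r}$ be the compact induction (smooth compactly supported functions $\phi:\widetilde G\to V$ with $\phi(kg)=\tilde\sigma_{\vec r}(k)\phi(g)$, under right translation), let $T$ be its endomorphism $(T\phi)(g)=\sum_{\widetilde Kx\in\widetilde K\backslash\widetilde G}\varphi(gx^{-1})\phi(x)$, and for $\lambda\in E$ put $\pi(\vec r,\lambda)=\mathrm{ind}_{\widetilde K}^{\widetilde G}\tilde\sigma_{\vec r}/(T-\lambda)$. **Theorem 6.8.** Let $\psi$ be a nontrivial continuous additive character of $F$ with complex values and let $\mu:F^\times\to E^\times$ be a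 smooth character. 1. $\mathrm{Ind}_{\widetilde{\overline B}}^{\widetilde G}(\mu\cdot\chi_\psi)$ is an irreducible representation of $\widetilde G$. 2. For every $\vec r$ with $\mathrm{Hom}_{\widetilde K}\bigl(\tilde\sigma_{\vec r},\mathrm{Ind}_{\widetilde{\overline B}}^{\widetilde G}(\mu\cdot\chi_\psi)\bigr)\neq0$ there is an isomorphism of $\widetilde G$-representations $\pi(\vec r,\lambda_{\mu,\psi})\cong\mathrm{Ind}_{\widetilde{\overline B}}^{\widetilde G}(\mu\cdot\chi_\psi)$. In particular, there are no genuine special representations: for every smooth genuine character $\chi:\widetilde T\to E^\times$ the principal series $\mathrm{Ind}_{\widetilde{\overline B}}^{\widetilde G}(\chi)$ is irreducible, so that it has no proper nonzero subquotient. -/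

import Mathlib

open ValuativeRel
set_option linter.unusedSectionVars false

noncomputable section

namespace Metaplectic

section HilbertSymbol

variable {F : Type*} [Field F] [ValuativeRel F] [TopologicalSpace F]
  [IsNonarchimedeanLocalField F]

/-- The valuation of a local field, normalised to take the value `1` on uniformizers. -/
def ord (x : Fˣ) : ℤ :=
  -WithZero.log (IsNonarchimedeanLocalField.valueGroupWithZeroIsoInt F (valuation F (x : F)))

/-- Reduction of integral elements to the residue field (and `0` off the ring of integers). -/
def red (x : F) : 𝓀[F] :=
  open scoped Classical in
  if h : x ∈ 𝒪[F] then IsLocalRing.residue 𝒪[F] ⟨x, h⟩ else 0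

/-- The unit `(-1)^(v(a)v(b)) b^v(a) / a^v(b)` attached to a pair of nonzero elements. -/
def tame (a b : Fˣ) : Fˣ := (-1) ^ (ord a * ord b) * b ^ ord a / a ^ ord b

/-- The quadratic Hilbert symbol (in odd residue characteristic, where it is tame): the sign
`ω(u)^((q-1)/2)`, `u = (-1)^(v(a)v(b)) b^v(a) / a^v(b)`.  This sign is `1` exactly
when `u` reduces to a square of the residue field. -/
def hilb (a b : Fˣ) : ℤˣ :=
  open scoped Classical in if IsSquare (red (tame a b : F)) then 1 else -1

lemma ord_mul (a b : Fˣ) : ord (a * b) = ord a + ord b := by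
  have ha : valuation F (a : F) ≠ 0 := by simp
  have hb : valuation F (b : F) ≠ 0 := by simp
  simp only [ord, Units.val_mul, map_mul]
  rw [WithZero.log_mul (by simp) (by simp)]
  ring

/-- The normalised valuation as a homomorphism. -/
def ordHom : Fˣ →* Multiplicative ℤ := MonoidHom.mk' (fun a => Multiplicative.ofAdd (ord a)) (by
  intro a b; rw [ord_mul]; rfl)

lemma ord_one : ord (1 : Fˣ) = 0 := congrArg Multiplicative.toAdd (map_one (ordHom (F := F)))

lemma ord_zpow (a : Fˣ) (n : ℤ) : ord (a ^ n) = n * ord a :=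
  (congrArg Multiplicative.toAdd (map_zpow (ordHom (F := F)) a n)).trans (by
    rw [toAdd_zpow]; simp [ordHom])

lemma ord_inv (a : Fˣ) : ord a⁻¹ = -ord a := by
  simpa using ord_zpow a (-1)

lemma ord_div (a b : Fˣ) : ord (a / b) = ord a - ord b := by
  rw [div_eq_mul_inv, ord_mul, ord_inv]; ring

lemma ord_eq_zero_iff (a : Fˣ) : ord a = 0 ↔ valuation F (a : F) = 1 := by
  set e := IsNonarchimedeanLocalField.valueGroupWithZeroIsoInt F
  have h : e (valuation F (a : F)) ≠ 0 := by simp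
  rw [ord, neg_eq_zero, ← WithZero.log_one, ← map_one e]
  constructor
  · intro h'
    have h2 := congrArg WithZero.exp h'
    rw [WithZero.exp_log h, WithZero.exp_log (by simp)] at h2
    exact e.injective h2
  · intro h'; rw [h']

lemma ord_nonneg_iff (a : Fˣ) : 0 ≤ ord a ↔ valuation F (a : F) ≤ 1 := by
  set e := IsNonarchimedeanLocalField.valueGroupWithZeroIsoInt F
  have h : e (valuation F (a : F)) ≠ 0 := by simp
  rw [ord, Left.nonneg_neg_iff, ← WithZero.log_one, ← map_one e,
    WithZero.log_le_log h (by simp), OrderIsoClass.map_le_map_iff]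

lemma ord_pos_iff (a : Fˣ) : 0 < ord a ↔ valuation F (a : F) < 1 := by
  rw [lt_iff_le_and_ne, lt_iff_le_and_ne, ord_nonneg_iff, ne_comm, Ne, ord_eq_zero_iff]

lemma ord_neg_one : ord (-1 : Fˣ) = 0 := by
  rw [ord_eq_zero_iff]; simp [Valuation.map_neg]

lemma ord_tame (a b : Fˣ) : ord (tame a b) = 0 := by
  simp only [tame, ord_div, ord_mul, ord_zpow, ord_neg_one]; ring

lemma mem_int_iff (x : F) : x ∈ 𝒪[F] ↔ valuation F x ≤ 1 := Iff.rfl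

lemma red_of_mem {x : F} (h : x ∈ 𝒪[F]) : red x = IsLocalRing.residue 𝒪[F] ⟨x, h⟩ :=
  dif_pos h

lemma red_coe (x : 𝒪[F]) : red (x : F) = IsLocalRing.residue 𝒪[F] x := red_of_mem x.2

lemma red_add {x y : F} (hx : x ∈ 𝒪[F]) (hy : y ∈ 𝒪[F]) : red (x + y) = red x + red y := by
  rw [red_of_mem hx, red_of_mem hy, red_of_mem (add_mem hx hy), ← map_add]; rfl

lemma red_mul {x y : F} (hx : x ∈ 𝒪[F]) (hy : y ∈ 𝒪[F]) : red (x * y) = red x * red y := by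
  rw [red_of_mem hx, red_of_mem hy, red_of_mem (mul_mem hx hy), ← map_mul]; rfl

lemma red_neg {x : F} (hx : x ∈ 𝒪[F]) : red (-x) = -red x := by
  rw [red_of_mem hx, red_of_mem (neg_mem hx), ← map_neg]; rfl

lemma red_one : red (1 : F) = 1 := by
  rw [red_of_mem (one_mem _)]; exact map_one _

lemma red_zero : red (0 : F) = 0 := by
  rw [red_of_mem (zero_mem _)]; exact map_zero _

lemma red_eq_zero_iff {x : F} (hx : x ∈ 𝒪[F]) : red x = 0 ↔ valuation F x < 1 := by
  rw [red_of_mem hx, IsLocalRing.residue_eq_zero_iff, IsLocalRing.mem_maximalIdeal,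
    mem_nonunits_iff, (Valuation.integer.integers (valuation F)).isUnit_iff_valuation_eq_one]
  exact (lt_iff_le_and_ne.trans (and_iff_right hx)).symm

lemma unit_mem {a : Fˣ} (h : ord a = 0) : (a : F) ∈ 𝒪[F] :=
  ((ord_eq_zero_iff a).1 h).le

lemma red_unit_ne {a : Fˣ} (h : ord a = 0) : red (a : F) ≠ 0 := by
  rw [Ne, red_eq_zero_iff (unit_mem h), (ord_eq_zero_iff a).1 h]; exact lt_irrefl _

/-- Reduction as a homomorphism on the units of the ring of integers. -/
def redHom : (ordHom (F := F)).ker →* 𝓀[F] where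
  toFun a := red ((a : Fˣ) : F)
  map_one' := by simp [red_one]
  map_mul' a b := by
    have ha : ord (a : Fˣ) = 0 := a.2
    have hb : ord (b : Fˣ) = 0 := b.2
    simp only [Subgroup.coe_mul, Units.val_mul, red_mul (unit_mem ha) (unit_mem hb)]

lemma red_zpow {a : Fˣ} (h : ord a = 0) (n : ℤ) : red ((a ^ n : Fˣ) : F) = red (a : F) ^ n := by
  obtain ⟨n, rfl | rfl⟩ := n.eq_nat_or_neg
  · have := map_pow (redHom (F := F)) ⟨a, h⟩ n
    simpa [redHom] using this
  · have h1 := map_pow (redHom (F := F)) ⟨a, h⟩ n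
    have h2 := map_mul (redHom (F := F)) (⟨a, h⟩ ^ n) (⟨a, h⟩ ^ n)⁻¹
    rw [mul_inv_cancel, map_one, h1] at h2
    rw [zpow_neg, zpow_natCast, zpow_neg, zpow_natCast]
    exact eq_inv_of_mul_eq_one_right h2.symm

/-- The sign `±1` as an element of `ZMod 2`. -/
def sgn2 (z : ℤˣ) : ZMod 2 := if z = 1 then 0 else 1

lemma sgn2_mul (z w : ℤˣ) : sgn2 (z * w) = sgn2 z + sgn2 w := by revert z w; decide

lemma sgn2_inj {z w : ℤˣ} (h : sgn2 z = sgn2 w) : z = w := by revert z w; decide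

lemma sgn2_one : sgn2 1 = 0 := rfl

/-- The Hilbert symbol with values in `ZMod 2`. -/
def hl (a b : Fˣ) : ZMod 2 := sgn2 (hilb a b)

lemma sq_sign_mul {x y : 𝓀[F]} (hx : x ≠ 0) (hy : y ≠ 0) : open scoped Classical in
    (if IsSquare (x * y) then (1 : ℤˣ) else -1) =
      (if IsSquare x then 1 else -1) * (if IsSquare y then 1 else -1) := by
  classical
  have := Fintype.ofFinite 𝓀[F]
  have h := map_mul (quadraticChar 𝓀[F]) x y
  simp only [quadraticChar_apply, quadraticCharFun, hx, hy, mul_eq_zero, or_self, if_false] at h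
  split_ifs at h ⊢ <;> simp_all

lemma tame_mul_left (a b c : Fˣ) : tame (a * b) c = tame a c * tame b c := by
  simp only [tame, ord_mul, add_mul, zpow_add, mul_zpow, div_eq_mul_inv, mul_inv]
  simp only [mul_assoc, mul_comm, mul_left_comm]

lemma tame_symm (a b : Fˣ) : tame b a = (tame a b)⁻¹ := by
  have h : ((-1 : Fˣ) ^ (ord a * ord b))⁻¹ = (-1) ^ (ord a * ord b) := by
    rw [← inv_zpow]; simp
  rw [tame, tame, div_eq_mul_inv, div_eq_mul_inv, mul_inv, mul_inv, inv_inv, h, mul_comm (ord b)]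
  simp only [mul_comm, mul_left_comm]

lemma hl_mul_left (a b c : Fˣ) : hl (a * b) c = hl a c + hl b c := by
  rw [hl, hl, hl, ← sgn2_mul]
  congr 1
  rw [hilb, hilb, hilb, tame_mul_left, Units.val_mul,
    red_mul (unit_mem (ord_tame a c)) (unit_mem (ord_tame b c))]
  exact sq_sign_mul (red_unit_ne (ord_tame a c)) (red_unit_ne (ord_tame b c))

lemma hl_one_left (c : Fˣ) : hl 1 c = 0 := by
  have := hl_mul_left 1 1 c; rw [mul_one] at this; simpa using this

lemma hl_eq_zero_of_red {a b : Fˣ} (h : red (tame a b : F) = 1) : hl a b = 0 := by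
  rw [hl, hilb, h, if_pos (IsSquare.one)]; rfl

lemma hl_symm (a b : Fˣ) : hl a b = hl b a := by
  rw [hl, hl, hilb, hilb, tame_symm a b, ← zpow_neg_one, red_zpow (ord_tame a b), zpow_neg_one,
    isSquare_inv]

lemma hl_mul_right (a b c : Fˣ) : hl c (a * b) = hl c a + hl c b := by
  rw [hl_symm, hl_mul_left, hl_symm a, hl_symm b]

lemma hl_one_right (c : Fˣ) : hl c 1 = 0 := by rw [hl_symm, hl_one_left]

lemma hl_inv_left (a c : Fˣ) : hl a⁻¹ c = hl a c := by
  have h := hl_mul_left a a⁻¹ c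
  rw [mul_inv_cancel, hl_one_left] at h
  have : ∀ x y : ZMod 2, 0 = x + y → y = x := by decide
  exact this _ _ h

lemma hl_inv_right (a c : Fˣ) : hl c a⁻¹ = hl c a := by
  rw [hl_symm, hl_inv_left, hl_symm]

lemma hl_div_left (a b c : Fˣ) : hl (a / b) c = hl a c + hl b c := by
  rw [div_eq_mul_inv, hl_mul_left, hl_inv_left]

lemma hl_div_right (a b c : Fˣ) : hl c (a / b) = hl c a + hl c b := by
  rw [div_eq_mul_inv, hl_mul_right, hl_inv_right]

lemma two_zmod (z : ZMod 2) : z + z = 0 := by revert z; decide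

lemma hl_neg_self (a : Fˣ) : hl a (-1 * a) = 0 := by
  apply hl_eq_zero_of_red
  have : tame a (-1 * a) = 1 := by
    rw [tame, ord_mul, ord_neg_one, zero_add, mul_zpow, ← mul_assoc, ← zpow_add,
      Even.neg_one_zpow, one_mul, div_self']
    have h := Int.even_mul_succ_self (ord a)
    rwa [mul_add, mul_one] at h
  rw [this]; exact red_one

lemma hl_self (a : Fˣ) : hl a a = hl a (-1) := by
  have h := hl_neg_self a
  rw [hl_mul_right] at h
  have : ∀ x y : ZMod 2, x + y = 0 → y = x := by decide
  exact this _ _ h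

lemma hl_units {a b : Fˣ} (ha : ord a = 0) (hb : ord b = 0) : hl a b = 0 := by
  apply hl_eq_zero_of_red
  rw [tame, ha, hb]; simp [red_one]

lemma hl_of_red_one {a : Fˣ} (ha : ord a = 0) (h : red (a : F) = 1) (b : Fˣ) : hl a b = 0 := by
  apply hl_eq_zero_of_red
  rw [tame, ha, zero_mul, zpow_zero, zpow_zero, one_mul, one_div, ← zpow_neg_one, ← zpow_mul,
    red_zpow ha, h, one_zpow]

/-- On units, the symbol only depends on the reduction. -/
lemma hl_congr {a a' : Fˣ} (ha : ord a = 0) (ha' : ord a' = 0)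
    (h : red (a : F) = red (a' : F)) (b : Fˣ) : hl a b = hl a' b := by
  have h0 : ord (a / a') = 0 := by rw [ord_div, ha, ha']; rfl
  have h1 : red ((a / a' : Fˣ) : F) = 1 := by
    have := red_mul (unit_mem h0) (unit_mem ha')
    rw [← Units.val_mul, div_mul_cancel, h] at this
    exact (mul_eq_right₀ (red_unit_ne ha')).1 this.symm
  have h2 := hl_of_red_one h0 h1 b
  rw [hl_div_left] at h2
  have : ∀ x y : ZMod 2, x + y = 0 → x = y := by decide
  exact this _ _ h2

lemma red_of_add_eq_one {a b : F} (ha : valuation F a < 1) (h : a + b = 1) :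
    valuation F b = 1 ∧ red b = 1 := by
  have hb : b = 1 + -a := by rw [← h]; ring
  have ham : a ∈ 𝒪[F] := ha.le
  constructor
  · rw [hb, add_comm]
    rw [Valuation.map_add_eq_of_lt_right, map_one]
    rw [Valuation.map_neg, map_one]; exact ha
  · rw [hb, red_add (one_mem _) (neg_mem ham), red_neg ham, (red_eq_zero_iff ham).2 ha, red_one]
    simp

/-- The Steinberg relation. -/
lemma hl_steinberg {a b : Fˣ} (h : (a : F) + b = 1) : hl a b = 0 := by
  rcases lt_trichotomy (ord a) 0 with ha | ha | ha
  · -- both `a` and `b` have the same negative valuation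
    have h1 : ((a⁻¹ : Fˣ) : F) + ((-1 * b * a⁻¹ : Fˣ) : F) = 1 := by
      have : (a : F) ≠ 0 := a.ne_zero
      push_cast
      field_simp
      linear_combination -h
    have h2 : 0 < ord a⁻¹ := by rw [ord_inv]; omega
    obtain ⟨h3, h4⟩ := red_of_add_eq_one ((ord_pos_iff _).1 h2) h1
    have h5 : hl (-1 * b * a⁻¹) a = 0 := hl_of_red_one ((ord_eq_zero_iff _).2 h3) h4 a
    rw [hl_mul_left, hl_mul_left, hl_inv_left, hl_self a, hl_symm (-1), hl_symm b] at h5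
    have : ∀ x y : ZMod 2, x + y + x = 0 → y = 0 := by decide
    exact this _ _ h5
  · rcases lt_trichotomy (ord b) 0 with hb | hb | hb
    · exfalso
      have : valuation F (b : F) ≤ 1 := by
        have hb' : (b : F) = 1 + -a := by rw [← h]; ring
        rw [hb']
        have h1 : (1 : F) + -a ∈ 𝒪[F] := add_mem (one_mem _) (neg_mem (unit_mem ha))
        exact h1
      exact absurd ((ord_nonneg_iff b).2 this) (by omega)
    · exact hl_units ha hb
    · obtain ⟨h3, h4⟩ := red_of_add_eq_one ((ord_pos_iff _).1 hb) ((add_comm _ _).trans h)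
      exact hl_of_red_one ha h4 b
  · obtain ⟨h3, h4⟩ := red_of_add_eq_one ((ord_pos_iff _).1 ha) h
    rw [hl_symm]
    exact hl_of_red_one ((ord_eq_zero_iff _).2 h3) h4 a

end HilbertSymbol

section Cocycle

open Matrix

variable {F : Type*} [Field F] [ValuativeRel F] [TopologicalSpace F]
  [IsNonarchimedeanLocalField F]

lemma sl_det {R : Type*} [CommRing R] (g : SpecialLinearGroup (Fin 2) R) :
    g 0 0 * g 1 1 - g 0 1 * g 1 0 = 1 := by
  rw [← Matrix.det_fin_two]; exact g.2

lemma sl_mul {R : Type*} [CommRing R] (g h : SpecialLinearGroup (Fin 2) R) (i j : Fin 2) :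
    (g * h) i j = g i 0 * h 0 j + g i 1 * h 1 j := by
  rw [Matrix.SpecialLinearGroup.coe_mul, Matrix.mul_apply, Fin.sum_univ_two]

lemma sl_lower_ne {g : SpecialLinearGroup (Fin 2) F} (h : g 1 0 = 0) : g 1 1 ≠ 0 := by
  intro h'
  have := sl_det g
  rw [h, h'] at this
  simp at this

/-- `X(g)` is the lower left entry of `g` if this is nonzero, and the lower right entry
otherwise. -/
def X (g : SpecialLinearGroup (Fin 2) F) : Fˣ :=
  open scoped Classical in
  if h : g 1 0 = 0 then Units.mk0 (g 1 1) (sl_lower_ne h) else Units.mk0 (g 1 0) h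

/-- Kubota's cocycle. -/
def cocyc (g h : SpecialLinearGroup (Fin 2) F) : ℤˣ :=
  hilb (X (g * h) / X g) (X (g * h) / X h)

lemma X_of_eq {g : SpecialLinearGroup (Fin 2) F} (h : g 1 0 = 0) : (X g : F) = g 1 1 := by
  rw [X, dif_pos h]; rfl

lemma X_of_ne {g : SpecialLinearGroup (Fin 2) F} (h : g 1 0 ≠ 0) : (X g : F) = g 1 0 := by
  rw [X, dif_neg h]; rfl

lemma X_mul_left {g : SpecialLinearGroup (Fin 2) F} (hg : g 1 0 = 0)
    (h : SpecialLinearGroup (Fin 2) F) : X (g * h) = X g * X h := by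
  have hd := sl_lower_ne hg
  ext
  by_cases h0 : h 1 0 = 0
  · rw [X_of_eq, Units.val_mul, X_of_eq hg, X_of_eq h0, sl_mul, hg]
    · ring
    · rw [sl_mul, hg, h0]; ring
  · rw [X_of_ne, Units.val_mul, X_of_eq hg, X_of_ne h0, sl_mul, hg]
    · ring
    · rw [sl_mul, hg, zero_mul, zero_add]; exact mul_ne_zero hd h0

lemma X_mul_right {g h : SpecialLinearGroup (Fin 2) F} (hg : g 1 0 ≠ 0) (hh : h 1 0 = 0) :
    X (g * h) = X g / X h := by
  have hd := sl_lower_ne hh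
  have := sl_det h
  rw [hh, mul_zero, sub_zero] at this
  have ha : h 0 0 ≠ 0 := left_ne_zero_of_mul_eq_one this
  rw [eq_div_iff_mul_eq']
  ext
  rw [Units.val_mul, X_of_eq hh, X_of_ne hg, X_of_ne, sl_mul, hh]
  · linear_combination (g 1 0) * this
  · rw [sl_mul, hh, mul_zero, add_zero]; exact mul_ne_zero hg ha

lemma X_mul_zero {g h : SpecialLinearGroup (Fin 2) F} (hg : g 1 0 ≠ 0) (hh : h 1 0 ≠ 0)
    (h0 : (g * h) 1 0 = 0) : X (g * h) = -1 * X g / X h := by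
  rw [eq_div_iff_mul_eq']
  ext
  rw [Units.val_mul, Units.val_mul, X_of_ne hh, X_of_ne hg, X_of_eq h0]
  rw [sl_mul] at h0 ⊢
  push_cast
  linear_combination (-g 1 0) * sl_det h + h 1 1 * h0

lemma cocyc_add (g h : SpecialLinearGroup (Fin 2) F) :
    sgn2 (cocyc g h) = hl (X (g * h) / X g) (X (g * h) / X h) := rfl

lemma cocyc_assoc (g₁ g₂ g₃ : SpecialLinearGroup (Fin 2) F) :
    cocyc g₁ g₂ * cocyc (g₁ * g₂) g₃ = cocyc g₁ (g₂ * g₃) * cocyc g₂ g₃ := by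
  apply sgn2_inj
  rw [sgn2_mul, sgn2_mul, cocyc_add, cocyc_add, cocyc_add, cocyc_add, ← mul_assoc g₁]
  have ht := two_zmod
  by_cases h1 : g₁ 1 0 = 0
  · have e1 := X_mul_left h1 g₂
    have e2 := X_mul_left h1 (g₂ * g₃)
    rw [← mul_assoc] at e2
    rw [e1, e2]
    simp only [hl_mul_left, hl_mul_right, hl_div_left, hl_div_right, hl_self, hl_symm _ (-1 : Fˣ)]
    grind [hl_symm]
  by_cases h3 : g₃ 1 0 = 0
  · have e1 : ∀ x : SpecialLinearGroup (Fin 2) F, (∀ b : Fˣ, hl (X (x * g₃)) b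
        = hl (X x) b + hl (X g₃) b) ∧ (∀ b : Fˣ, hl b (X (x * g₃)) = hl b (X x) + hl b (X g₃)) := by
      intro x
      by_cases hx : x 1 0 = 0
      · rw [X_mul_left hx]; exact ⟨fun b => hl_mul_left _ _ _, fun b => hl_mul_right _ _ _⟩
      · rw [X_mul_right hx h3]; exact ⟨fun b => hl_div_left _ _ _, fun b => hl_div_right _ _ _⟩
    simp only [hl_div_left, hl_div_right, e1]
    grind [hl_symm, hl_self]
  by_cases h2 : g₂ 1 0 = 0
  · rw [X_mul_right h1 h2, X_mul_left h2 g₃]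
    simp only [hl_mul_left, hl_mul_right, hl_div_left, hl_div_right]
    grind [hl_symm, hl_self]
  by_cases h12 : (g₁ * g₂) 1 0 = 0
  · rw [X_mul_left h12, X_mul_zero h1 h2 h12]
    simp only [hl_mul_left, hl_mul_right, hl_div_left, hl_div_right]
    grind [hl_symm, hl_self]
  by_cases h23 : (g₂ * g₃) 1 0 = 0
  · rw [mul_assoc, X_mul_right h1 h23, X_mul_zero h2 h3 h23]
    simp only [hl_mul_left, hl_mul_right, hl_div_left, hl_div_right]
    grind [hl_symm, hl_self]
  by_cases h123 : (g₁ * g₂ * g₃) 1 0 = 0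
  · have e1 := X_mul_zero h12 h3 h123
    have e2 := X_mul_zero h1 h23 (by rwa [← mul_assoc])
    rw [← mul_assoc, e1] at e2
    have e3 : X (g₂ * g₃) = X g₁ * X g₃ / X (g₁ * g₂) := by
      rw [div_eq_div_iff_mul_eq_mul] at e2
      rw [eq_div_iff_mul_eq']
      have : -1 * (X (g₁ * g₂) * X (g₂ * g₃)) = -1 * (X g₁ * X g₃) := by
        rw [← mul_assoc, e2, mul_assoc]
      rw [mul_comm (X (g₂ * g₃))]
      exact mul_left_cancel this
    rw [e1, e3]
    simp only [hl_mul_left, hl_mul_right, hl_div_left, hl_div_right]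
    grind [hl_symm, hl_self]
  · have key : ((X (g₁ * g₂ * g₃) * X g₂ / (X (g₁ * g₂) * X (g₂ * g₃)) : Fˣ) : F) +
        ((X g₁ * X g₃ / (X (g₁ * g₂) * X (g₂ * g₃)) : Fˣ) : F) = 1 := by
      push_cast
      rw [X_of_ne h1, X_of_ne h2, X_of_ne h3, X_of_ne h12, X_of_ne h23, X_of_ne h123]
      field_simp
      simp only [sl_mul]
      linear_combination (-g₁ 1 0 * g₃ 1 0) * sl_det g₂
    have st := hl_steinberg key
    simp only [hl_mul_left, hl_mul_right, hl_div_left, hl_div_right] at st ⊢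
    grind [hl_symm, hl_self]

lemma X_one : X (1 : SpecialLinearGroup (Fin 2) F) = 1 := by
  ext; rw [X_of_eq] <;> simp

lemma cocyc_one_left (g : SpecialLinearGroup (Fin 2) F) : cocyc 1 g = 1 := by
  apply sgn2_inj
  rw [cocyc_add, one_mul, div_self', hl_one_right]; rfl

lemma cocyc_one_right (g : SpecialLinearGroup (Fin 2) F) : cocyc g 1 = 1 := by
  apply sgn2_inj
  rw [cocyc_add, mul_one, div_self', hl_one_left]; rfl

end Cocycle

section Group

open Matrix

/-- The metaplectic double cover of `SL₂(F)`: pairs `(g, ζ)` with `ζ = ±1`. -/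
@[ext] structure Mp (F : Type*) [Field F] where
  g : SpecialLinearGroup (Fin 2) F
  ζ : ℤˣ

variable {F : Type*} [Field F] [ValuativeRel F] [TopologicalSpace F]
  [IsNonarchimedeanLocalField F]

namespace Mp

instance : Mul (Mp F) := ⟨fun x y => ⟨x.g * y.g, x.ζ * y.ζ * cocyc x.g y.g⟩⟩
instance : One (Mp F) := ⟨⟨1, 1⟩⟩
instance : Inv (Mp F) := ⟨fun x => ⟨x.g⁻¹, x.ζ * cocyc x.g⁻¹ x.g⟩⟩

@[simp] lemma mul_g (x y : Mp F) : (x * y).g = x.g * y.g := rfl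
@[simp] lemma mul_sign (x y : Mp F) : (x * y).ζ = x.ζ * y.ζ * cocyc x.g y.g := rfl
@[simp] lemma one_g : (1 : Mp F).g = 1 := rfl
@[simp] lemma one_sign : (1 : Mp F).ζ = 1 := rfl

instance : Group (Mp F) :=
  Group.ofLeftAxioms
    (by
      intro x y z
      ext1
      · exact mul_assoc _ _ _
      · have h := cocyc_assoc x.g y.g z.g
        simp only [mul_sign, mul_g]
        calc x.ζ * y.ζ * cocyc x.g y.g * z.ζ * cocyc (x.g * y.g) z.g
            = x.ζ * y.ζ * z.ζ * (cocyc x.g y.g * cocyc (x.g * y.g) z.g) := by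
              simp only [mul_assoc, mul_left_comm]
          _ = _ := by rw [h]; simp only [mul_assoc, mul_comm, mul_left_comm])
    (by
      intro x
      ext1
      · exact one_mul _
      · simp [cocyc_one_left])
    (by
      intro x
      ext1
      · exact inv_mul_cancel _
      · change x.ζ * cocyc x.g⁻¹ x.g * x.ζ * cocyc x.g⁻¹ x.g = 1
        rw [mul_assoc, Int.units_mul_self])

@[simp] lemma inv_g (x : Mp F) : x⁻¹.g = x.g⁻¹ := rfl

end Mp

end Group

section Splitting

open Matrix

variable {F : Type*} [Field F] [ValuativeRel F] [TopologicalSpace F]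
  [IsNonarchimedeanLocalField F]

/-- The sign `θ` which splits the double cover over `SL₂(𝒪)`: it is `1` if the lower left entry
`c` is zero or a unit, and `(c, d)` otherwise. -/
def theta (k : SpecialLinearGroup (Fin 2) F) : ℤˣ :=
  open scoped Classical in
  if h : k 1 0 ≠ 0 ∧ k 1 1 ≠ 0 ∧ valuation F (k 1 0) < 1 then
    hilb (Units.mk0 (k 1 0) h.1) (Units.mk0 (k 1 1) h.2.1) else 1

/-- The matrix has entries in the ring of integers. -/
def IsInt (k : SpecialLinearGroup (Fin 2) F) : Prop := ∀ i j, k i j ∈ 𝒪[F]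

lemma IsInt.one : IsInt (1 : SpecialLinearGroup (Fin 2) F) := by
  intro i j
  rw [Matrix.SpecialLinearGroup.coe_one, Matrix.one_apply]
  split_ifs
  · exact one_mem _
  · exact zero_mem _

lemma IsInt.mul {k l : SpecialLinearGroup (Fin 2) F} (hk : IsInt k) (hl : IsInt l) :
    IsInt (k * l) := by
  intro i j
  rw [sl_mul]
  exact add_mem (mul_mem (hk _ _) (hl _ _)) (mul_mem (hk _ _) (hl _ _))

lemma IsInt.inv {k : SpecialLinearGroup (Fin 2) F} (hk : IsInt k) : IsInt k⁻¹ := by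
  intro i j
  rw [Matrix.SpecialLinearGroup.coe_inv, Matrix.adjugate_fin_two]
  fin_cases i <;> fin_cases j
  · exact hk 1 1
  · exact neg_mem (hk 0 1)
  · exact neg_mem (hk 1 0)
  · exact hk 0 0

lemma red_det {k : SpecialLinearGroup (Fin 2) F} (hk : IsInt k) :
    red (k 0 0) * red (k 1 1) - red (k 0 1) * red (k 1 0) = 1 := by
  rw [← red_mul (hk _ _) (hk _ _), ← red_mul (hk _ _) (hk _ _), sub_eq_add_neg,
    ← red_neg (mul_mem (hk _ _) (hk _ _)),
    ← red_add (mul_mem (hk _ _) (hk _ _)) (neg_mem (mul_mem (hk _ _) (hk _ _))),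
    ← sub_eq_add_neg, sl_det, red_one]

lemma red_sl_mul {k l : SpecialLinearGroup (Fin 2) F} (hk : IsInt k) (hl : IsInt l)
    (i j : Fin 2) :
    red ((k * l) i j) = red (k i 0) * red (l 0 j) + red (k i 1) * red (l 1 j) := by
  rw [sl_mul, red_add (mul_mem (hk _ _) (hl _ _)) (mul_mem (hk _ _) (hl _ _)),
    red_mul (hk _ _) (hl _ _), red_mul (hk _ _) (hl _ _)]

lemma exists_unit_of_red_ne {x : F} (hx : x ∈ 𝒪[F]) (h : red x ≠ 0) :
    ∃ u : Fˣ, (u : F) = x ∧ ord u = 0 := by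
  have h0 : x ≠ 0 := by rintro rfl; exact h red_zero
  refine ⟨Units.mk0 x h0, rfl, ?_⟩
  rw [ord_eq_zero_iff]
  rw [Ne, red_eq_zero_iff hx, not_lt] at h
  exact le_antisymm hx h

lemma theta_of_unit {k : SpecialLinearGroup (Fin 2) F} (hk : IsInt k) (h : red (k 1 0) ≠ 0) :
    theta k = 1 := by
  rw [theta, dif_neg]
  rw [Ne, red_eq_zero_iff (hk _ _)] at h
  exact fun h' => h h'.2.2

lemma theta_of_nonunit {k : SpecialLinearGroup (Fin 2) F} (hk : IsInt k) (h : red (k 1 0) = 0) :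
    ∃ a d : Fˣ, (a : F) = k 0 0 ∧ (d : F) = k 1 1 ∧ ord a = 0 ∧ ord d = 0 ∧
      sgn2 (theta k) = hl (X k) d ∧ ∀ y, hl a y = hl d y := by
  have hd := red_det hk
  rw [h, mul_zero, sub_zero] at hd
  obtain ⟨a, ha, ha'⟩ := exists_unit_of_red_ne (hk 0 0) (left_ne_zero_of_mul_eq_one hd)
  obtain ⟨d, hd1, hd2⟩ := exists_unit_of_red_ne (hk 1 1) (right_ne_zero_of_mul_eq_one hd)
  refine ⟨a, d, ha, hd1, ha', hd2, ?_, ?_⟩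
  · by_cases hc : k 1 0 = 0
    · have hX : X k = d := by ext; rw [X_of_eq hc, hd1]
      rw [hX, hl_units hd2 hd2, theta, dif_neg]
      · rfl
      · exact fun h' => h'.1 hc
    · have hX : X k = Units.mk0 (k 1 0) hc := by ext; rw [X_of_ne hc]; rfl
      have hD : d = Units.mk0 (k 1 1) (hd1 ▸ d.ne_zero) := by ext; exact hd1
      rw [hX, theta, dif_pos ⟨hc, hd1 ▸ d.ne_zero, (red_eq_zero_iff (hk 1 0)).1 h⟩, hl]
      congr 2
      exact hD.symm
  · intro y
    have h0 : ord (a * d) = 0 := by rw [ord_mul, ha', hd2]; rfl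
    have h1 := hl_of_red_one h0 (by
      rw [Units.val_mul, red_mul (unit_mem ha') (unit_mem hd2), ha, hd1, hd]) y
    rw [hl_mul_left] at h1
    have : ∀ x y : ZMod 2, x + y = 0 → x = y := by decide
    exact this _ _ h1

lemma X_of_unit {k : SpecialLinearGroup (Fin 2) F} (hk : IsInt k) (h : red (k 1 0) ≠ 0) :
    (X k : F) = k 1 0 ∧ ord (X k) = 0 := by
  have h0 : k 1 0 ≠ 0 := by intro h'; rw [h'] at h; exact h red_zero
  refine ⟨X_of_ne h0, ?_⟩
  obtain ⟨u, hu, hu'⟩ := exists_unit_of_red_ne (hk 1 0) h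
  rwa [show X k = u by ext; rw [X_of_ne h0, hu]]

/-- The sign `θ` is a splitting of the cocycle over `SL₂(𝒪)`. -/
lemma theta_mul {k l : SpecialLinearGroup (Fin 2) F} (hk : IsInt k) (hl' : IsInt l) :
    theta k * theta l * cocyc k l = theta (k * l) := by
  apply sgn2_inj
  rw [sgn2_mul, sgn2_mul, cocyc_add]
  have ht := two_zmod
  have hkl := hk.mul hl'
  have hm1 : ord (-1 : Fˣ) = 0 := ord_neg_one
  have rc := red_sl_mul hk hl' 1 0
  have rd := red_sl_mul hk hl' 1 1
  by_cases hc1 : red (k 1 0) = 0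
  · obtain ⟨a1, d1, ea1, ed1, oa1, od1, th1, r1⟩ := theta_of_nonunit hk hc1
    rw [hc1, zero_mul, zero_add, ← ed1] at rc rd
    by_cases hc2 : red (l 1 0) = 0
    · obtain ⟨a2, d2, ea2, ed2, oa2, od2, th2, r2⟩ := theta_of_nonunit hl' hc2
      rw [hc2, mul_zero] at rc
      obtain ⟨a3, d3, ea3, ed3, oa3, od3, th3, r3⟩ := theta_of_nonunit hkl rc
      rw [th1, th2, th3]
      have q : ∀ y, hl d3 y = hl d1 y + hl d2 y := by
        intro y
        rw [← hl_mul_left]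
        refine hl_congr od3 (by rw [ord_mul, od1, od2]; rfl) ?_ y
        rw [ed3, rd, Units.val_mul, red_mul (unit_mem od1) (unit_mem od2), ed2]
      have q11 := hl_units od1 od1
      have q12 := hl_units od1 od2
      have q22 := hl_units od2 od2
      by_cases h1 : k 1 0 = 0
      · have e : X k = d1 := by ext; rw [X_of_eq h1, ed1]
        rw [X_mul_left h1, e]
        simp only [hl_mul_left, hl_mul_right, hl_div_left, hl_div_right]
        grind [hl_symm]
      by_cases h2 : l 1 0 = 0
      · have e : X l = d2 := by ext; rw [X_of_eq h2, ed2]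
        rw [X_mul_right h1 h2, e]
        simp only [hl_div_left, hl_div_right]
        grind [hl_symm, hl_self]
      by_cases h3 : (k * l) 1 0 = 0
      · have e : X (k * l) = d3 := by ext; rw [X_of_eq h3, ed3]
        have e' := X_mul_zero h1 h2 h3
        have e1 : X k = -1 * (d3 * X l) := by
          rw [← e, e']
          rw [div_mul_cancel, ← mul_assoc]; simp
        have w1 := hl_units hm1 od1
        have w2 := hl_units hm1 od2
        have w3 := hl_units hm1 hm1
        rw [e, e1]
        simp only [hl_mul_left, hl_div_left, hl_div_right, q]
        grind [hl_symm, hl_self]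
      · have key : ((X k * a2 / X (k * l) : Fˣ) : F) + ((d1 * X l / X (k * l) : Fˣ) : F) = 1 := by
          push_cast
          rw [X_of_ne h1, X_of_ne h2, X_of_ne h3, ea2, ed1]
          field_simp
          rw [sl_mul]
        have st := hl_steinberg key
        simp only [hl_mul_left, hl_mul_right, hl_div_left, hl_div_right, r2] at st ⊢
        grind [hl_symm, hl_self]
    · have hc3 : red ((k * l) 1 0) ≠ 0 := by
        rw [rc]; exact mul_ne_zero (red_unit_ne od1) hc2
      obtain ⟨x2, o2⟩ := X_of_unit hl' hc2
      obtain ⟨x3, o3⟩ := X_of_unit hkl hc3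
      rw [th1, theta_of_unit hl' hc2, theta_of_unit hkl hc3]
      have q := hl_congr o3 (a' := d1 * X l) (by rw [ord_mul, od1, o2]; rfl) (by
        rw [x3, rc, Units.val_mul, red_mul (unit_mem od1) (unit_mem o2), x2])
      have w1 := hl_units o3 o3
      have w2 := hl_units o3 o2
      simp only [hl_mul_left, hl_div_left, hl_div_right, sgn2_one] at q ⊢
      grind [hl_symm]
  · obtain ⟨x1, o1⟩ := X_of_unit hk hc1
    by_cases hc2 : red (l 1 0) = 0
    · obtain ⟨a2, d2, ea2, ed2, oa2, od2, th2, r2⟩ := theta_of_nonunit hl' hc2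
      rw [hc2, mul_zero, add_zero, ← ea2] at rc
      have hc3 : red ((k * l) 1 0) ≠ 0 := by
        rw [rc]; exact mul_ne_zero hc1 (red_unit_ne oa2)
      obtain ⟨x3, o3⟩ := X_of_unit hkl hc3
      rw [th2, theta_of_unit hk hc1, theta_of_unit hkl hc3]
      have q := hl_congr o3 (a' := X k * a2) (by rw [ord_mul, oa2, o1]; rfl) (by
        rw [x3, rc, Units.val_mul, red_mul (unit_mem o1) (unit_mem oa2), x1])
      have w1 := hl_units o3 o3
      have w2 := hl_units o3 o1
      simp only [hl_mul_left, hl_div_left, hl_div_right, sgn2_one, r2] at q ⊢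
      grind [hl_symm]
    · obtain ⟨x2, o2⟩ := X_of_unit hl' hc2
      rw [theta_of_unit hk hc1, theta_of_unit hl' hc2]
      by_cases hc3 : red ((k * l) 1 0) = 0
      · obtain ⟨a3, d3, ea3, ed3, oa3, od3, th3, r3⟩ := theta_of_nonunit hkl hc3
        rw [th3]
        have hd2 := red_det hl'
        have q := hl_congr (a := d3 * X l) (a' := -1 * X k)
          (by rw [ord_mul, od3, o2]; rfl) (by rw [ord_mul, hm1, o1]; rfl) (by
            rw [Units.val_mul, Units.val_mul, red_mul (unit_mem od3) (unit_mem o2),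
              red_mul (unit_mem hm1) (unit_mem o1), Units.val_neg, Units.val_one,
              red_neg (one_mem _), red_one, x1, x2, ed3, rd]
            rw [rc] at hc3
            linear_combination (-red (k 1 0)) * hd2 + red (l 1 1) * hc3)
        have w := hl_units o1 o2
        simp only [hl_mul_left, hl_div_left, hl_div_right, sgn2_one] at q ⊢
        grind [hl_symm, hl_self]
      · obtain ⟨x3, o3⟩ := X_of_unit hkl hc3
        rw [theta_of_unit hkl hc3]
        simp only [hl_div_left, hl_div_right]
        rw [hl_units o3 o3, hl_units o3 o2, hl_units o1 o3, hl_units o1 o2]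
        rfl

/-- The preimage of `SL₂(𝒪)` in the double cover. -/
def Kt (F : Type*) [Field F] [ValuativeRel F] [TopologicalSpace F]
    [IsNonarchimedeanLocalField F] : Subgroup (Mp F) where
  carrier := {x | IsInt x.g}
  mul_mem' := fun hx hy => IsInt.mul hx hy
  one_mem' := IsInt.one
  inv_mem' := fun hx => IsInt.inv hx

/-- Reduction of `SL₂(𝒪)`, pulled back to the double cover. -/
def redK : Kt F →* SpecialLinearGroup (Fin 2) 𝓀[F] where
  toFun x := ⟨Matrix.of fun i j => red (x.1.g i j), by
    rw [Matrix.det_fin_two]; exact red_det x.2⟩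
  map_one' := by
    ext i j
    change red ((1 : SpecialLinearGroup (Fin 2) F) i j) = _
    rw [Matrix.SpecialLinearGroup.coe_one, Matrix.SpecialLinearGroup.coe_one,
      Matrix.one_apply, Matrix.one_apply]
    split_ifs
    · exact red_one
    · exact red_zero
  map_mul' x y := by
    ext i j
    exact (red_sl_mul x.2 y.2 i j).trans
      (sl_mul ⟨Matrix.of fun i j => red (x.1.g i j), _⟩
        ⟨Matrix.of fun i j => red (y.1.g i j), _⟩ i j).symm

/-- The genuine sign character of the preimage of `SL₂(𝒪)`, `(k, ζ) ↦ ζ θ(k)`. -/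
def signK : Kt F →* ℤˣ where
  toFun x := x.1.ζ * theta x.1.g
  map_one' := by
    have h := theta_mul (F := F) IsInt.one IsInt.one
    rw [cocyc_one_left, mul_one, mul_one] at h
    change 1 * theta (1 : SpecialLinearGroup (Fin 2) F) = 1
    rw [one_mul]
    exact mul_eq_left.1 h
  map_mul' x y := by
    have h := theta_mul (F := F) x.2 y.2
    change x.1.ζ * y.1.ζ * cocyc x.1.g y.1.g * theta (x.1.g * y.1.g) = _
    rw [← h]
    calc x.1.ζ * y.1.ζ * cocyc x.1.g y.1.g * (theta x.1.g * theta y.1.g * cocyc x.1.g y.1.g)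
        = (x.1.ζ * theta x.1.g) * (y.1.ζ * theta y.1.g) *
            (cocyc x.1.g y.1.g * cocyc x.1.g y.1.g) := by
          simp only [mul_assoc, mul_left_comm, mul_comm]
      _ = _ := by rw [Int.units_mul_self, mul_one]

/-- The splitting `k ↦ (k, θ(k))` of the double cover over `SL₂(𝒪)`. -/
def splitK (k : {k : SpecialLinearGroup (Fin 2) F // IsInt k}) : Mp F := ⟨k.1, theta k.1⟩

/-- The topology of the double cover: the finest group topology which makes the splitting over
`SL₂(𝒪)` continuous.  (For it, the splitting is an isomorphism of `SL₂(𝒪)` with an open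
subgroup of the double cover.) -/
instance : TopologicalSpace (Mp F) :=
  (GroupTopology.coinduced (splitK (F := F))).toTopologicalSpace

instance : IsTopologicalGroup (Mp F) :=
  (GroupTopology.coinduced (splitK (F := F))).toIsTopologicalGroup

end Splitting

section Induction

variable {E : Type*} [Field E] {G : Type*} [Group G] [TopologicalSpace G] [IsTopologicalGroup G]

/-- Right translation on functions. -/
def rightReg (E G V : Type*) [Field E] [Group G] [AddCommGroup V] [Module E V] :
    Representation E G (G → V) where
  toFun g := { toFun := fun f x => f (x * g), map_add' := fun _ _ => rfl,
               map_smul' := fun _ _ => rfl }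
  map_one' := by ext f x; simp
  map_mul' g h := by ext f x; simp [mul_assoc]

variable {V : Type*} [AddCommGroup V] [Module E V]

lemma rightReg_apply (g : G) (f : G → V) (x : G) : rightReg E G V g f x = f (x * g) := rfl

/-- A function is smooth if it is fixed under right translation by an open subgroup. -/
def Smooth (f : G → V) : Prop :=
  ∃ U : Subgroup G, IsOpen (U : Set G) ∧ ∀ u ∈ U, ∀ x, f (x * u) = f x

lemma Smooth.translate {f : G → V} (hf : Smooth f) (g : G) : Smooth fun x => f (x * g) := by
  obtain ⟨U, hU, h⟩ := hf
  refine ⟨U.comap (MulAut.conj g⁻¹).toMonoidHom, ?_, ?_⟩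
  · refine hU.preimage (f := fun u => g⁻¹ * u * g⁻¹⁻¹) ?_
    fun_prop
  · intro u hu x
    have h1 : g⁻¹ * u * g⁻¹⁻¹ ∈ U := hu
    have h2 := h _ h1 (x * g)
    change f (x * u * g) = f (x * g)
    rw [← h2]
    congr 1
    group

/-- The smooth functions, as a subspace. -/
def smoothFun (E G V : Type*) [Field E] [Group G] [TopologicalSpace G] [AddCommGroup V]
    [Module E V] : Submodule E (G → V) where
  carrier := {f | Smooth f}
  add_mem' := by
    rintro f f' ⟨U, hU, h⟩ ⟨U', hU', h'⟩
    refine ⟨U ⊓ U', hU.inter hU', fun u hu x => ?_⟩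
    simp only [Pi.add_apply, h u hu.1, h' u hu.2]
  zero_mem' := ⟨⊤, isOpen_univ, fun _ _ _ => rfl⟩
  smul_mem' := by
    rintro c f ⟨U, hU, h⟩
    refine ⟨U, hU, fun u hu x => ?_⟩
    simp only [Pi.smul_apply, h u hu]

variable {K : Subgroup G} (σ : Representation E K V)

/-- The space of the compact induction of `σ` from a compact open subgroup `K`: smooth functions
`f` with `f(kg) = σ(k) f(g)` and compact support, i.e. support in finitely many cosets `Kg`. -/
def cIndSpace : Submodule E (G → V) where
  carrier := {f | (∀ (k : K) x, f (k * x) = σ k (f x)) ∧ Smooth f ∧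
    ∃ S : Set G, S.Finite ∧ ∀ x, f x ≠ 0 → ∃ s ∈ S, x * s⁻¹ ∈ K}
  add_mem' := by
    rintro f f' ⟨h1, h2, S, hS, h3⟩ ⟨h1', h2', S', hS', h3'⟩
    refine ⟨fun k x => by simp [h1, h1'], (smoothFun E G V).add_mem h2 h2',
      S ∪ S', hS.union hS', fun x hx => ?_⟩
    by_cases h : f x = 0
    · have h' : f' x ≠ 0 := fun h' => hx (by simp [h, h'])
      obtain ⟨s, hs, hs'⟩ := h3' x h'
      exact ⟨s, Or.inr hs, hs'⟩
    · obtain ⟨s, hs, hs'⟩ := h3 x h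
      exact ⟨s, Or.inl hs, hs'⟩
  zero_mem' := ⟨fun k x => by simp, (smoothFun E G V).zero_mem, ∅, Set.finite_empty,
    fun x hx => (hx rfl).elim⟩
  smul_mem' := by
    rintro c f ⟨h1, h2, S, hS, h3⟩
    refine ⟨fun k x => by simp [h1], (smoothFun E G V).smul_mem c h2, S, hS, fun x hx => ?_⟩
    exact h3 x fun h => hx (by simp [h])

lemma cIndSpace_le (g : G) : cIndSpace σ ≤ (cIndSpace σ).comap (rightReg E G V g) := by
  rintro f ⟨h1, h2, S, hS, h3⟩
  refine ⟨fun k x => ?_, h2.translate g, (· * g⁻¹) '' S, hS.image _, fun x hx => ?_⟩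
  · rw [rightReg_apply, rightReg_apply, mul_assoc, h1]
  · obtain ⟨s, hs, hs'⟩ := h3 (x * g) hx
    exact ⟨_, ⟨s, hs, rfl⟩, by simpa [mul_assoc] using hs'⟩

/-- The compact induction of `σ` from `K` to `G`, acting by right translation. -/
def cInd : Representation E G (cIndSpace σ) := (rightReg E G V).subrepresentation _ (cIndSpace_le σ)

/-- The elements of the Hecke algebra of `σ`: `K`-biequivariant functions `G → End V` of compact
support. -/
structure HeckeFun where
  toFun : G → V →ₗ[E] V
  equivariant : ∀ (k l : K) (g : G), toFun (k * g * l) = σ k ∘ₗ toFun g ∘ₗ σ l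
  finite_support : ∃ S : Set G, S.Finite ∧ ∀ g, toFun g ≠ 0 → ∃ s ∈ S, g * s⁻¹ ∈ K

namespace HeckeFun

variable {σ} (φ : HeckeFun σ)

/-- The summand `φ(g x⁻¹) f(x)` of the convolution, as a function of the coset `Kx`. -/
def term (f : cIndSpace σ) (g : G) : Quotient (QuotientGroup.rightRel K) → V :=
  Quotient.lift (fun x => φ.toFun (g * x⁻¹) (f.1 x)) (by
    intro x y hxy
    have hk : y * x⁻¹ ∈ K := QuotientGroup.rightRel_apply.1 hxy
    obtain ⟨k, hk'⟩ : ∃ k : K, (k : G) = y * x⁻¹ := ⟨⟨_, hk⟩, rfl⟩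
    have hy : y = k * x := by rw [hk']; group
    have h1 := φ.equivariant 1 k⁻¹ (g * x⁻¹)
    have h2 : g * y⁻¹ = ((1 : K) : G) * (g * x⁻¹) * ((k⁻¹ : K) : G) := by
      rw [hy]; push_cast; group
    show φ.toFun (g * x⁻¹) (f.1 x) = φ.toFun (g * y⁻¹) (f.1 y)
    rw [h2, h1, hy, f.2.1 k x]
    have h3 : σ k⁻¹ (σ k (f.1 x)) = f.1 x := by
      rw [← Module.End.mul_apply, ← map_mul, inv_mul_cancel, map_one, Module.End.one_apply]
    rw [LinearMap.comp_apply, LinearMap.comp_apply, h3, map_one, Module.End.one_apply])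

lemma term_mk (f : cIndSpace σ) (g x : G) :
    φ.term f g (Quotient.mk _ x) = φ.toFun (g * x⁻¹) (f.1 x) := rfl

lemma term_finite (f : cIndSpace σ) (g : G) : (Function.support (φ.term f g)).Finite := by
  obtain ⟨S, hS, h⟩ := f.2.2.2
  refine (hS.image (Quotient.mk (QuotientGroup.rightRel K))).subset ?_
  intro q hq
  induction q using Quotient.inductionOn with
  | h x =>
    have hx : f.1 x ≠ 0 := by
      intro h0
      apply hq
      rw [term_mk, h0, map_zero]
    obtain ⟨s, hs, hs'⟩ := h x hx
    exact ⟨s, hs, Quotient.sound (QuotientGroup.rightRel_apply.2 hs')⟩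

/-- The convolution `(φ ⋆ f)(g) = ∑ φ(g x⁻¹) f(x)`, the sum being over the cosets `Kx`. -/
def conv (f : cIndSpace σ) (g : G) : V := ∑ᶠ q, φ.term f g q

lemma conv_translate (f : cIndSpace σ) (h g : G) :
    φ.conv (cInd σ h f) g = φ.conv f (g * h) := by
  let e : Quotient (QuotientGroup.rightRel K) ≃ Quotient (QuotientGroup.rightRel K) :=
    Quotient.congr (Equiv.mulRight h) (by
      intro x y
      change QuotientGroup.rightRel K x y ↔ QuotientGroup.rightRel K (x * h) (y * h)
      rw [QuotientGroup.rightRel_apply, QuotientGroup.rightRel_apply]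
      simp [mul_assoc])
  refine finsum_eq_of_bijective e e.bijective ?_
  intro q
  induction q using Quotient.inductionOn with
  | h x =>
    change φ.toFun (g * x⁻¹) (f.1 (x * h)) = φ.toFun (g * h * (x * h)⁻¹) (f.1 (x * h))
    congr 2
    group

lemma conv_mem (f : cIndSpace σ) : φ.conv f ∈ cIndSpace σ := by
  refine ⟨fun k x => ?_, ?_, ?_⟩
  · rw [conv, conv, map_finsum (σ k) (φ.term_finite f x)]
    refine finsum_congr fun q => ?_
    induction q using Quotient.inductionOn with
    | h y =>
      have := φ.equivariant k 1 (x * y⁻¹)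
      rw [map_one, Subgroup.coe_one, mul_one, ← mul_assoc] at this
      rw [term_mk, term_mk, this]
      rfl
  · obtain ⟨U, hU, h⟩ := f.2.2.1
    refine ⟨U, hU, fun u hu x => ?_⟩
    rw [← conv_translate]
    congr 1
    ext x
    exact h u hu x
  · obtain ⟨S, hS, h⟩ := f.2.2.2
    obtain ⟨S', hS', h'⟩ := φ.finite_support
    refine ⟨Set.image2 (· * ·) S' S, hS'.image2 _ hS, fun g hg => ?_⟩
    have hex : ∃ q, φ.term f g q ≠ 0 := by
      by_contra hcon
      push Not at hcon
      exact hg (by rw [conv, finsum_congr hcon, finsum_zero])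
    obtain ⟨q, hq⟩ := hex
    induction q using Quotient.inductionOn with
    | h x =>
      rw [term_mk] at hq
      have hx : f.1 x ≠ 0 := fun h0 => hq (by rw [h0, map_zero])
      obtain ⟨s, hs, hk⟩ := h x hx
      have h1 := φ.equivariant 1 ⟨_, hk⟩⁻¹ (g * s⁻¹)
      have h2 : ((1 : K) : G) * (g * s⁻¹) * ((⟨_, hk⟩⁻¹ : K) : G) = g * x⁻¹ := by
        push_cast; group
      rw [h2] at h1
      have h3 : φ.toFun (g * s⁻¹) ≠ 0 := by
        intro h0
        rw [h0, LinearMap.zero_comp, LinearMap.comp_zero] at h1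
        exact hq (by rw [h1]; rfl)
      obtain ⟨s', hs', hk'⟩ := h' _ h3
      exact ⟨s' * s, ⟨s', hs', s, hs, rfl⟩, by simpa [mul_assoc] using hk'⟩

/-- The endomorphism of the compact induction given by convolution with `φ`. -/
def op : cIndSpace σ →ₗ[E] cIndSpace σ where
  toFun f := ⟨φ.conv f, φ.conv_mem f⟩
  map_add' f f' := by
    ext g
    change φ.conv (f + f') g = φ.conv f g + φ.conv f' g
    rw [conv, conv, conv, ← finsum_add_distrib (φ.term_finite f g) (φ.term_finite f' g)]
    refine finsum_congr fun q => ?_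
    induction q using Quotient.inductionOn with
    | h x => exact map_add (φ.toFun (g * x⁻¹)) _ _
  map_smul' c f := by
    ext g
    change φ.conv (c • f) g = c • φ.conv f g
    rw [conv, conv, smul_finsum]
    refine finsum_congr fun q => ?_
    induction q using Quotient.inductionOn with
    | h x => exact map_smul (φ.toFun (g * x⁻¹)) _ _

lemma op_comm (h : G) (f : cIndSpace σ) : φ.op (cInd σ h f) = cInd σ h (φ.op f) := by
  ext g
  exact φ.conv_translate f h g

lemma range_le (c : E) (g : G) : LinearMap.range (φ.op - c • LinearMap.id) ≤
    (LinearMap.range (φ.op - c • LinearMap.id)).comap (cInd σ g) := by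
  rintro _ ⟨f, rfl⟩
  refine ⟨cInd σ g f, ?_⟩
  simp [op_comm]

/-- The cokernel of `φ - c` on the compact induction of `σ`. -/
def coker (c : E) : Representation E G
    (cIndSpace σ ⧸ LinearMap.range (φ.op - c • LinearMap.id)) :=
  (cInd σ).quotient _ (φ.range_le c)

end HeckeFun

end Induction

section Weights

open Matrix
open scoped TensorProduct

/-- The action of a `2 × 2` matrix on polynomials in two variables by linear substitution. -/
def linSubst {E : Type*} [Field E] (M : Matrix (Fin 2) (Fin 2) E) :
    MvPolynomial (Fin 2) E →ₐ[E] MvPolynomial (Fin 2) E :=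
  MvPolynomial.aeval fun j => ∑ i, MvPolynomial.C (M i j) * MvPolynomial.X i

lemma linSubst_one {E : Type*} [Field E] :
    linSubst (1 : Matrix (Fin 2) (Fin 2) E) = AlgHom.id E _ := by
  refine MvPolynomial.algHom_ext fun j => ?_
  rw [linSubst, MvPolynomial.aeval_X]
  rw [Fin.sum_univ_two]
  fin_cases j
  · change MvPolynomial.C ((1 : Matrix (Fin 2) (Fin 2) E) 0 0) * _ +
      MvPolynomial.C ((1 : Matrix (Fin 2) (Fin 2) E) 1 0) * _ = _
    simp
  · change MvPolynomial.C ((1 : Matrix (Fin 2) (Fin 2) E) 0 1) * _ +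
      MvPolynomial.C ((1 : Matrix (Fin 2) (Fin 2) E) 1 1) * _ = _
    simp

lemma linSubst_mul {E : Type*} [Field E] (M N : Matrix (Fin 2) (Fin 2) E) :
    linSubst (M * N) = (linSubst M).comp (linSubst N) := by
  refine MvPolynomial.algHom_ext fun j => ?_
  simp only [linSubst, MvPolynomial.aeval_X, AlgHom.comp_apply, Matrix.mul_apply,
    Fin.sum_univ_two, map_add, map_mul, MvPolynomial.algHom_C, MvPolynomial.algebraMap_eq]
  ring

/-- `Symⁿ E²`, the homogeneous polynomials of degree `n` in two variables. -/
abbrev SymPow (E : Type*) [Field E] (n : ℕ) : Type _ := MvPolynomial.homogeneousSubmodule (Fin 2) E n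

/-- The standard representation of `SL₂(E)` on `Symⁿ E²`. -/
def symPow (E : Type*) [Field E] (n : ℕ) :
    Representation E (SpecialLinearGroup (Fin 2) E) (SymPow E n) where
  toFun g := (linSubst g.1).toLinearMap.restrict (fun P hP => by
    have h := MvPolynomial.IsHomogeneous.aeval (n := 1)
      ((MvPolynomial.mem_homogeneousSubmodule n P).1 hP)
      (fun j => ∑ i, MvPolynomial.C (g.1 i j) * MvPolynomial.X i) (fun j =>
        MvPolynomial.IsHomogeneous.sum _ _ _ fun i _ =>
          (MvPolynomial.isHomogeneous_X E i).C_mul _)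
    rw [one_mul] at h
    exact h)
  map_one' := by
    ext P : 2
    change linSubst ((1 : SpecialLinearGroup (Fin 2) E) : Matrix (Fin 2) (Fin 2) E) P.1 = P.1
    rw [Matrix.SpecialLinearGroup.coe_one, linSubst_one]; rfl
  map_mul' g h := by
    ext P : 2
    change linSubst ((g * h : SpecialLinearGroup (Fin 2) E) : Matrix (Fin 2) (Fin 2) E) P.1 = _
    rw [Matrix.SpecialLinearGroup.coe_mul, linSubst_mul]; rfl

/-- The space of the weight `r = (r_0, …, r_{f-1})`. -/
abbrev WeightSpace (E : Type*) [Field E] {f : ℕ} (r : Fin f → ℕ) : Type _ :=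
  ⨂[E] i, SymPow E (r i)

/-- The representation `⊗_i (Sym^{r_i} E²)^{Fr^i}` of `SL₂(k)`, for a finite field `k` embedded
in a field `E` of characteristic `p`. -/
def weight {k E : Type*} [Field k] [Field E] (p : ℕ) [ExpChar E p] (emb : k →+* E) {f : ℕ}
    (r : Fin f → ℕ) : Representation E (SpecialLinearGroup (Fin 2) k) (WeightSpace E r) :=
  PiTensorProduct.mapMonoidHom.comp (MonoidHom.pi fun i : Fin f =>
    (symPow E (r i)).comp (SpecialLinearGroup.map ((iterateFrobenius E p i).comp emb)))

variable {k : Type*} [Field k]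

/-- The upper unipotent subgroup of `SL₂(k)`. -/
def upper (k : Type*) [Field k] : Subgroup (SpecialLinearGroup (Fin 2) k) where
  carrier := {g | g 0 0 = 1 ∧ g 1 0 = 0 ∧ g 1 1 = 1}
  one_mem' := by simp
  mul_mem' := by
    rintro g h ⟨h1, h2, h3⟩ ⟨h1', h2', h3'⟩
    refine ⟨?_, ?_, ?_⟩ <;> rw [sl_mul] <;> simp [h1, h2, h3, h1', h2', h3']
  inv_mem' := by
    rintro g ⟨h1, h2, h3⟩
    refine ⟨?_, ?_, ?_⟩ <;> rw [Matrix.SpecialLinearGroup.coe_inv, Matrix.adjugate_fin_two] <;>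
      simp [h1, h2, h3]

/-- The lower unipotent subgroup of `SL₂(k)`. -/
def lower (k : Type*) [Field k] : Subgroup (SpecialLinearGroup (Fin 2) k) where
  carrier := {g | g 0 0 = 1 ∧ g 0 1 = 0 ∧ g 1 1 = 1}
  one_mem' := by simp
  mul_mem' := by
    rintro g h ⟨h1, h2, h3⟩ ⟨h1', h2', h3'⟩
    refine ⟨?_, ?_, ?_⟩ <;> rw [sl_mul] <;> simp [h1, h2, h3, h1', h2', h3']
  inv_mem' := by
    rintro g ⟨h1, h2, h3⟩
    refine ⟨?_, ?_, ?_⟩ <;> rw [Matrix.SpecialLinearGroup.coe_inv, Matrix.adjugate_fin_two] <;>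
      simp [h1, h2, h3]

variable {E V : Type*} [Field E] [AddCommGroup V] [Module E V]
  (τ : Representation E (SpecialLinearGroup (Fin 2) k) V)

/-- The projection of `V` to the coinvariants of the lower unipotent subgroup. -/
def toLower : V →ₗ[E] Representation.Coinvariants (τ.comp (lower k).subtype) :=
  Representation.Coinvariants.mk _

/-- The composite of the inclusion of the invariants of the upper unipotent subgroup with the
projection to the coinvariants of the lower one. -/
def jMap : Representation.invariants (τ.comp (upper k).subtype) →ₗ[E]
    Representation.Coinvariants (τ.comp (lower k).subtype) :=
  toLower τ ∘ₗ Submodule.subtype _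

/-- The composite `V ↠ V_{lower} ≅ V^{upper} ↪ V`, where the middle isomorphism is the inverse of
`jMap`, which is bijective whenever `τ` is irreducible (the value is `0` if `jMap` is not
bijective). -/
def rho : V →ₗ[E] V :=
  open scoped Classical in
  if h : Function.Bijective (jMap τ) then
    Submodule.subtype _ ∘ₗ (LinearEquiv.ofBijective (jMap τ) h).symm.toLinearMap ∘ₗ toLower τ
  else 0

lemma toLower_map {t : SpecialLinearGroup (Fin 2) k} (ht : t 0 1 = 0) {v w : V}
    (h : toLower τ v = toLower τ w) : toLower τ (τ t v) = toLower τ (τ t w) := by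
  have hdet : t 0 0 * t 1 1 = 1 := by
    have := sl_det t
    rwa [ht, zero_mul, sub_zero] at this
  have key : Representation.Coinvariants.ker (τ.comp (lower k).subtype) ≤
      (Representation.Coinvariants.ker (τ.comp (lower k).subtype)).comap (τ t) := by
    rw [Representation.Coinvariants.ker, Submodule.span_le]
    rintro _ ⟨⟨u, x⟩, rfl⟩
    obtain ⟨h1, h2, h3⟩ := u.2
    refine Representation.Coinvariants.mem_ker_of_eq
      (⟨t * u.1 * t⁻¹, ?_⟩ : lower k) (τ t x) _ ?_
    · refine ⟨?_, ?_, ?_⟩ <;>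
        rw [sl_mul, sl_mul, sl_mul, Matrix.SpecialLinearGroup.coe_inv, Matrix.adjugate_fin_two] <;>
        simp [h1, h2, h3, ht, hdet]
      rw [mul_comm]; exact hdet
    · change τ (t * u.1 * t⁻¹) (τ t x) - τ t x = τ t (τ u.1 x - x)
      rw [← Module.End.mul_apply, ← map_mul, inv_mul_cancel_right, map_mul, map_sub]
      rfl
  rw [toLower, Representation.Coinvariants.mk_eq_iff] at h ⊢
  rw [← map_sub]
  exact key h

lemma toLower_lower {u : SpecialLinearGroup (Fin 2) k} (hu : u ∈ lower k) (v : V) :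
    toLower τ (τ u v) = toLower τ v :=
  Representation.Coinvariants.mk_self_apply (τ.comp (lower k).subtype) ⟨u, hu⟩ v

/-- Equivariance of `rho` under pairs of an upper and a lower triangular matrix with the same
diagonal. -/
lemma rho_equivariant {a b : SpecialLinearGroup (Fin 2) k} (ha : a 1 0 = 0) (hb : b 0 1 = 0)
    (h0 : a 0 0 = b 0 0) (h1 : a 1 1 = b 1 1) : τ a ∘ₗ rho τ = rho τ ∘ₗ τ b := by
  by_cases h : Function.Bijective (jMap τ)
  · have hdet : b 0 0 * b 1 1 = 1 := by
      have := sl_det b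
      rwa [hb, zero_mul, sub_zero] at this
    rw [rho, dif_pos h]
    ext v
    set e := LinearEquiv.ofBijective (jMap τ) h
    set w := e.symm (toLower τ v) with hw
    change τ a w.1 = (e.symm (toLower τ (τ b v))).1
    have hinv : τ a w.1 ∈ Representation.invariants (τ.comp (upper k).subtype) := by
      rw [Representation.mem_invariants]
      intro u
      obtain ⟨u1, u2, u3⟩ := u.2
      have hu : a⁻¹ * u.1 * a ∈ upper k := by
        refine ⟨?_, ?_, ?_⟩ <;>
          rw [sl_mul, sl_mul, sl_mul, Matrix.SpecialLinearGroup.coe_inv,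
            Matrix.adjugate_fin_two] <;> simp [u1, u2, u3, ha, h0, h1]
        · rw [mul_comm]; exact hdet
        · exact hdet
      have h2 := (Representation.mem_invariants _ _).1 w.2 ⟨_, hu⟩
      change τ u.1 (τ a w.1) = τ a w.1
      change τ (a⁻¹ * u.1 * a) w.1 = w.1 at h2
      conv_rhs => rw [← h2]
      rw [← Module.End.mul_apply, ← Module.End.mul_apply, ← map_mul, ← map_mul]
      congr 2
      group
    suffices hs : (⟨_, hinv⟩ : Representation.invariants (τ.comp (upper k).subtype)) =
        e.symm (toLower τ (τ b v)) from congrArg Subtype.val hs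
    rw [LinearEquiv.eq_symm_apply]
    change toLower τ (τ a w.1) = toLower τ (τ b v)
    have hwv : toLower τ w.1 = toLower τ v := by
      change e w = _
      rw [hw, LinearEquiv.apply_symm_apply]
    let t : SpecialLinearGroup (Fin 2) k := ⟨!![b 0 0, 0; 0, b 1 1], by
      rw [Matrix.det_fin_two_of, hdet]; ring⟩
    have t00 : t 0 0 = b 0 0 := rfl
    have t01 : t 0 1 = 0 := rfl
    have t10 : t 1 0 = 0 := rfl
    have t11 : t 1 1 = b 1 1 := rfl
    have hta : t⁻¹ * a ∈ upper k := by
      refine ⟨?_, ?_, ?_⟩ <;>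
        rw [sl_mul, Matrix.SpecialLinearGroup.coe_inv, Matrix.adjugate_fin_two] <;>
        simp [t00, t01, t10, t11, ha, h0, h1, hdet]
      rw [mul_comm]; exact hdet
    have htb : t⁻¹ * b ∈ lower k := by
      refine ⟨?_, ?_, ?_⟩ <;>
        rw [sl_mul, Matrix.SpecialLinearGroup.coe_inv, Matrix.adjugate_fin_two] <;>
        simp [t00, t01, t10, t11, hb, hdet]
      rw [mul_comm]; exact hdet
    have e1 : τ (t⁻¹ * a) w.1 = w.1 := (Representation.mem_invariants _ _).1 w.2 ⟨_, hta⟩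
    have e2 : τ a w.1 = τ t w.1 := by
      conv_rhs => rw [← e1]
      rw [← Module.End.mul_apply, ← map_mul, mul_inv_cancel_left]
    have e3 : τ b v = τ t (τ (t⁻¹ * b) v) := by
      rw [← Module.End.mul_apply, ← map_mul, mul_inv_cancel_left]
    rw [e2, e3]
    exact toLower_map τ t01 (hwv.trans (toLower_lower τ htb v).symm)
  · rw [rho, dif_neg h]; simp

end Weights

section Hecke

open Matrix

variable {F : Type*} [Field F] [ValuativeRel F] [TopologicalSpace F]
  [IsNonarchimedeanLocalField F]

/-- A uniformizer as an element of `Fˣ`. -/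
def unif {ϖ : 𝒪[F]} (hϖ : Irreducible ϖ) : Fˣ :=
  Units.mk0 (ϖ : F) fun h => hϖ.ne_zero (Subtype.ext h)

/-- The diagonal matrix with entries `x, x⁻¹`. -/
def diagSL (x : Fˣ) : SpecialLinearGroup (Fin 2) F :=
  ⟨!![(x : F), 0; 0, (x⁻¹ : Fˣ)], by rw [Matrix.det_fin_two_of]; simp⟩

/-- The lift `h̃(x) = (diag(x, x⁻¹), (-1, x))` to the double cover. -/
def hTilde (x : Fˣ) : Mp F := ⟨diagSL x, hilb (-1) x⟩

variable {E V : Type*} [Field E] [AddCommGroup V] [Module E V]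

/-- A sign as an element of `E`. -/
def signE (E : Type*) [Field E] : ℤˣ →* E := (Int.castRingHom E).toMonoidHom.comp (Units.coeHom ℤ)

/-- The genuine representation of the preimage of `SL₂(𝒪)` attached to a representation `τ` of
`SL₂` of the residue field: `(k, ζ)` acts by `ζ θ(k) τ(k mod ϖ)`. -/
def genuineLift (τ : Representation E (SpecialLinearGroup (Fin 2) 𝓀[F]) V) :
    Representation E (Kt F) V where
  toFun x := signE E (signK x) • τ (redK x)
  map_one' := by simp
  map_mul' x y := by
    rw [map_mul, map_mul, map_mul, map_mul, smul_mul_smul_comm]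

variable {ϖ : 𝒪[F]} (hϖ : Irreducible ϖ)

lemma hl_X_mul_right {g h : SpecialLinearGroup (Fin 2) F} (hh : h 1 0 = 0) (b : Fˣ) :
    hl (X (g * h)) b = hl (X g) b + hl (X h) b := by
  by_cases hx : g 1 0 = 0
  · rw [X_mul_left hx]; exact hl_mul_left _ _ _
  · rw [X_mul_right hx hh]; exact hl_div_left _ _ _

/-- Conjugation by `h̃(ϖ)` between elements of the preimage of `SL₂(𝒪)`: the two elements have
the same genuine sign, and opposite triangular reductions with the same diagonal. -/
lemma conj_facts {k l : Kt F} (h : (k : Mp F) * (hTilde (unif hϖ))⁻¹ =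
      (hTilde (unif hϖ))⁻¹ * l) :
    signK k = signK l ∧ redK k 1 0 = 0 ∧ redK l 0 1 = 0 ∧ redK k 0 0 = redK l 0 0 ∧
      redK k 1 1 = redK l 1 1 := by
  have ht := two_zmod
  set x := unif hϖ with hx
  have hx0 : (x : F) ≠ 0 := x.ne_zero
  have hxi : (x : F) ∈ 𝒪[F] := ϖ.2
  have hxr : red (x : F) = 0 := by
    change red (ϖ : F) = 0
    rw [red_coe, IsLocalRing.residue_eq_zero_iff, IsLocalRing.mem_maximalIdeal, mem_nonunits_iff]
    exact hϖ.not_isUnit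
  have hg := congrArg Mp.g h
  have hs := congrArg Mp.ζ h
  rw [Mp.mul_sign, Mp.mul_sign, mul_comm (hTilde x)⁻¹.ζ, mul_assoc, mul_assoc] at hs
  rw [Mp.mul_g, Mp.mul_g] at hg
  set m := (hTilde x)⁻¹.g with hm
  have m00 : m 0 0 = (x : F)⁻¹ := by
    rw [hm, Mp.inv_g, Matrix.SpecialLinearGroup.coe_inv, Matrix.adjugate_fin_two]
    simp [hTilde, diagSL]
  have m01 : m 0 1 = 0 := by
    rw [hm, Mp.inv_g, Matrix.SpecialLinearGroup.coe_inv, Matrix.adjugate_fin_two]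
    simp [hTilde, diagSL]
  have m10 : m 1 0 = 0 := by
    rw [hm, Mp.inv_g, Matrix.SpecialLinearGroup.coe_inv, Matrix.adjugate_fin_two]
    simp [hTilde, diagSL]
  have m11 : m 1 1 = x := by
    rw [hm, Mp.inv_g, Matrix.SpecialLinearGroup.coe_inv, Matrix.adjugate_fin_two]
    simp [hTilde, diagSL]
  have ent : ∀ i j, (k.1.g * m) i j = (m * l.1.g) i j := fun i j => by rw [hg]
  have e00 := ent 0 0
  have e01 := ent 0 1
  have e10 := ent 1 0
  have e11 := ent 1 1
  rw [sl_mul, sl_mul, m00, m10, m01] at e00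
  rw [sl_mul, sl_mul, m00, m01, m11] at e01
  rw [sl_mul, sl_mul, m00, m10, m11] at e10
  rw [sl_mul, sl_mul, m11, m10, m01] at e11
  have f00 : k.1.g 0 0 = l.1.g 0 0 := by field_simp at e00; linear_combination e00
  have f01 : l.1.g 0 1 = x * (x * k.1.g 0 1) := by field_simp at e01; linear_combination -e01
  have f10 : k.1.g 1 0 = x * (x * l.1.g 1 0) := by field_simp at e10; linear_combination e10
  have f11 : k.1.g 1 1 = l.1.g 1 1 := by
    rw [mul_zero, zero_add, zero_mul, zero_add, mul_comm] at e11
    exact mul_left_cancel₀ hx0 e11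
  have r10 : red (k.1.g 1 0) = 0 := by
    rw [f10, red_mul hxi (mul_mem hxi (l.2 1 0)), hxr, zero_mul]
  have r01 : red (l.1.g 0 1) = 0 := by
    rw [f01, red_mul hxi (mul_mem hxi (k.2 0 1)), hxr, zero_mul]
  refine ⟨?_, r10, r01, congrArg red f00, congrArg red f11⟩
  -- the sign
  have hXm : X m = x := by ext; rw [X_of_eq m10, m11]
  have hX : ∀ b, hl (X k.1.g) b = hl (X l.1.g) b := by
    intro b
    have h1 := hl_X_mul_right (g := k.1.g) m10 b
    rw [hg, X_mul_left m10, hl_mul_left] at h1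
    grind
  have h1 : k.1.ζ = l.1.ζ := by
    apply sgn2_inj
    have hs' := congrArg sgn2 hs
    rw [sgn2_mul, sgn2_mul, sgn2_mul, sgn2_mul, cocyc_add, cocyc_add] at hs'
    have hc : hl (X (k.1.g * m) / X k.1.g) (X (k.1.g * m) / X m) =
        hl (X (m * l.1.g) / X m) (X (m * l.1.g) / X l.1.g) := by
      have q := fun b => hl_X_mul_right (g := k.1.g) m10 b
      have q' : ∀ b, hl b (X (k.1.g * m)) = hl b (X k.1.g) + hl b (X m) := fun b => by
        rw [hl_symm, q, hl_symm b, hl_symm b]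
      have hX' : ∀ b, hl b (X k.1.g) = hl b (X l.1.g) := fun b => by
        rw [hl_symm, hX, hl_symm]
      rw [X_mul_left m10]
      simp only [hl_mul_left, hl_mul_right, hl_div_left, hl_div_right, q, q', hX, hX']
      grind [hl_symm]
    rw [hc] at hs'
    grind
  have h2 : theta k.1.g = theta l.1.g := by
    apply sgn2_inj
    obtain ⟨a, d, -, ed, -, od, th, -⟩ := theta_of_nonunit k.2 r10
    rw [th, hX]
    by_cases hl1 : red (l.1.g 1 0) = 0
    · obtain ⟨a', d', -, ed', -, od', th', -⟩ := theta_of_nonunit l.2 hl1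
      have : d' = d := by ext; rw [ed, ed', f11]
      rw [th', this]
    · rw [theta_of_unit l.2 hl1, hl_units (X_of_unit l.2 hl1).2 od]; rfl
  change k.1.ζ * theta k.1.g = l.1.ζ * theta l.1.g
  rw [h1, h2]

/-- The double coset of `h̃(ϖ)⁻¹` is a finite union of cosets. -/
lemma double_coset_finite : ∃ S : Set (Mp F), S.Finite ∧
    ∀ k l : Kt F, ∃ s ∈ S, (k : Mp F) * (hTilde (unif hϖ))⁻¹ * l * s⁻¹ ∈ Kt F := by
  have hm : Finite (𝒪[F] ⧸ 𝓂[F]) := inferInstanceAs (Finite 𝓀[F])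
  have hfin : Finite (𝒪[F] ⧸ 𝓂[F] ^ 2) :=
    Ideal.finite_quotient_pow (IsNoetherian.noetherian 𝓂[F]) 2
  let q : Kt F → (𝒪[F] ⧸ 𝓂[F] ^ 2) × (𝒪[F] ⧸ 𝓂[F] ^ 2) := fun l =>
    (Ideal.Quotient.mk _ ⟨l.1.g 0 0, l.2 0 0⟩, Ideal.Quotient.mk _ ⟨l.1.g 0 1, l.2 0 1⟩)
  refine ⟨Set.range fun t : Set.range q => (hTilde (unif hϖ))⁻¹ * (t.2.choose : Mp F),
    Set.finite_range _, fun k l => ?_⟩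
  refine ⟨_, ⟨⟨q l, l, rfl⟩, rfl⟩, ?_⟩
  set l' : Kt F := (⟨l, rfl⟩ : ∃ y, q y = q l).choose with hl'
  have hq : q l' = q l := (⟨l, rfl⟩ : ∃ y, q y = q l).choose_spec
  have h1 : ∃ y ∈ 𝒪[F], l'.1.g 0 0 = l.1.g 0 0 + ϖ * ϖ * y := by
    have h := Ideal.Quotient.eq.1 (congrArg Prod.fst hq)
    rw [hϖ.maximalIdeal_eq, Ideal.span_singleton_pow, Ideal.mem_span_singleton] at h
    obtain ⟨y, hy⟩ := h
    have hy' := congrArg Subtype.val hy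
    refine ⟨y, y.2, ?_⟩
    push_cast at hy'
    linear_combination hy'
  have h2 : ∃ y ∈ 𝒪[F], l'.1.g 0 1 = l.1.g 0 1 + ϖ * ϖ * y := by
    have h := Ideal.Quotient.eq.1 (congrArg Prod.snd hq)
    rw [hϖ.maximalIdeal_eq, Ideal.span_singleton_pow, Ideal.mem_span_singleton] at h
    obtain ⟨y, hy⟩ := h
    have hy' := congrArg Subtype.val hy
    refine ⟨y, y.2, ?_⟩
    push_cast at hy'
    linear_combination hy'
  obtain ⟨y, hy, h1⟩ := h1
  obtain ⟨z, hz, h2⟩ := h2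
  have hϖ0 : (ϖ : F) ≠ 0 := (unif hϖ).ne_zero
  have hκ : ((hTilde (unif hϖ))⁻¹ * ((l : Mp F) * (l' : Mp F)⁻¹) * hTilde (unif hϖ)) ∈ Kt F := by
    have hκi : IsInt (l.1.g * l'.1.g⁻¹) := IsInt.mul l.2 (IsInt.inv l'.2)
    have hb : (l.1.g * l'.1.g⁻¹) 0 1 = ϖ * ϖ * (l.1.g 0 1 * y - l.1.g 0 0 * z) := by
      rw [sl_mul, Matrix.SpecialLinearGroup.coe_inv, Matrix.adjugate_fin_two]
      change l.1.g 0 0 * (-l'.1.g 0 1) + l.1.g 0 1 * l'.1.g 0 0 = _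
      rw [h1, h2]; ring
    change IsInt ((diagSL (unif hϖ))⁻¹ * (l.1.g * l'.1.g⁻¹) * diagSL (unif hϖ))
    generalize l.1.g * l'.1.g⁻¹ = κ at hκi hb ⊢
    set m := (diagSL (unif hϖ))⁻¹ with hm
    have d00 : diagSL (unif hϖ) 0 0 = (ϖ : F) := rfl
    have d01 : diagSL (unif hϖ) 0 1 = 0 := rfl
    have d10 : diagSL (unif hϖ) 1 0 = 0 := rfl
    have d11 : diagSL (unif hϖ) 1 1 = (ϖ : F)⁻¹ := by
      change (((unif hϖ)⁻¹ : Fˣ) : F) = _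
      rw [Units.val_inv_eq_inv_val]; rfl
    have m00 : m 0 0 = (ϖ : F)⁻¹ := by
      rw [hm, Matrix.SpecialLinearGroup.coe_inv, Matrix.adjugate_fin_two]; exact d11
    have m01 : m 0 1 = 0 := by
      rw [hm, Matrix.SpecialLinearGroup.coe_inv, Matrix.adjugate_fin_two]; exact neg_zero
    have m10 : m 1 0 = 0 := by
      rw [hm, Matrix.SpecialLinearGroup.coe_inv, Matrix.adjugate_fin_two]; exact neg_zero
    have m11 : m 1 1 = (ϖ : F) := by
      rw [hm, Matrix.SpecialLinearGroup.coe_inv, Matrix.adjugate_fin_two]; exact d00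
    have ex : ∀ i j, (m * κ * diagSL (unif hϖ)) i j =
        (m i 0 * κ 0 0 + m i 1 * κ 1 0) * diagSL (unif hϖ) 0 j +
          (m i 0 * κ 0 1 + m i 1 * κ 1 1) * diagSL (unif hϖ) 1 j := fun i j => by
      rw [sl_mul, sl_mul m κ, sl_mul m κ]
    intro i j
    rw [ex]
    fin_cases i <;> fin_cases j
    · change (m 0 0 * κ 0 0 + m 0 1 * κ 1 0) * diagSL (unif hϖ) 0 0 +
        (m 0 0 * κ 0 1 + m 0 1 * κ 1 1) * diagSL (unif hϖ) 1 0 ∈ 𝒪[F]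
      rw [m00, m01, d00, d10]
      convert hκi 0 0 using 1
      field_simp; ring
    · change (m 0 0 * κ 0 0 + m 0 1 * κ 1 0) * diagSL (unif hϖ) 0 1 +
        (m 0 0 * κ 0 1 + m 0 1 * κ 1 1) * diagSL (unif hϖ) 1 1 ∈ 𝒪[F]
      rw [m00, m01, d01, d11, hb]
      convert sub_mem (mul_mem (l.2 0 1) hy) (mul_mem (l.2 0 0) hz) using 1
      field_simp; ring
    · change (m 1 0 * κ 0 0 + m 1 1 * κ 1 0) * diagSL (unif hϖ) 0 0 +
        (m 1 0 * κ 0 1 + m 1 1 * κ 1 1) * diagSL (unif hϖ) 1 0 ∈ 𝒪[F]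
      rw [m10, m11, d00, d10]
      convert mul_mem (mul_mem ϖ.2 (hκi 1 0)) ϖ.2 using 1
      ring
    · change (m 1 0 * κ 0 0 + m 1 1 * κ 1 0) * diagSL (unif hϖ) 0 1 +
        (m 1 0 * κ 0 1 + m 1 1 * κ 1 1) * diagSL (unif hϖ) 1 1 ∈ 𝒪[F]
      rw [m10, m11, d01, d11]
      convert hκi 1 1 using 1
      field_simp; ring
  have h3 := (Kt F).mul_mem k.2 hκ
  convert h3 using 1
  change _ * ((hTilde (unif hϖ))⁻¹ * (l' : Mp F))⁻¹ = _
  group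

variable (τ : Representation E (SpecialLinearGroup (Fin 2) 𝓀[F]) V)

lemma genuineLift_apply (x : Kt F) :
    genuineLift τ x = signE E (signK x) • τ (redK x) := rfl

lemma hecke_wd {k₁ l₁ k₂ l₂ : Kt F}
    (h : (k₁ : Mp F) * (hTilde (unif hϖ))⁻¹ * l₁ = k₂ * (hTilde (unif hϖ))⁻¹ * l₂) :
    genuineLift τ k₁ ∘ₗ rho τ ∘ₗ genuineLift τ l₁ =
      genuineLift τ k₂ ∘ₗ rho τ ∘ₗ genuineLift τ l₂ := by
  have h' : ((k₂⁻¹ * k₁ : Kt F) : Mp F) * (hTilde (unif hϖ))⁻¹ =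
      (hTilde (unif hϖ))⁻¹ * (l₂ * l₁⁻¹ : Kt F) := by
    push_cast
    rw [← mul_assoc, eq_mul_inv_iff_mul_eq, mul_assoc, mul_assoc, ← mul_assoc _ _ (l₁ : Mp F), h]
    group
  obtain ⟨hs, h1, h2, h3, h4⟩ := conj_facts hϖ h'
  have h5 := rho_equivariant τ h1 h2 h3 h4
  have h6 : genuineLift τ (k₂⁻¹ * k₁) ∘ₗ rho τ = rho τ ∘ₗ genuineLift τ (l₂ * l₁⁻¹) := by
    rw [genuineLift_apply, genuineLift_apply, LinearMap.smul_comp, LinearMap.comp_smul, h5, hs]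
  have h7 : genuineLift τ k₁ = genuineLift τ k₂ ∘ₗ genuineLift τ (k₂⁻¹ * k₁) := by
    rw [← Module.End.mul_eq_comp, ← map_mul, mul_inv_cancel_left]
  have h8 : genuineLift τ l₂ = genuineLift τ (l₂ * l₁⁻¹) ∘ₗ genuineLift τ l₁ := by
    rw [← Module.End.mul_eq_comp, ← map_mul, inv_mul_cancel_right]
  rw [h7, h8, LinearMap.comp_assoc, ← LinearMap.comp_assoc _ (rho τ), h6, LinearMap.comp_assoc]

/-- The biequivariant function supported on the double coset of `h̃(ϖ)⁻¹`, with value `rho τ` at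
`h̃(ϖ)⁻¹`. -/
def phiOneFun (g : Mp F) : V →ₗ[E] V :=
  open scoped Classical in
  if h : ∃ kl : Kt F × Kt F, g = kl.1 * (hTilde (unif hϖ))⁻¹ * kl.2 then
    genuineLift τ h.choose.1 ∘ₗ rho τ ∘ₗ genuineLift τ h.choose.2 else 0

lemma phiOneFun_eq (k l : Kt F) : phiOneFun hϖ τ (k * (hTilde (unif hϖ))⁻¹ * l) =
    genuineLift τ k ∘ₗ rho τ ∘ₗ genuineLift τ l := by
  have h : ∃ kl : Kt F × Kt F, (k : Mp F) * (hTilde (unif hϖ))⁻¹ * l =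
      kl.1 * (hTilde (unif hϖ))⁻¹ * kl.2 := ⟨(k, l), rfl⟩
  rw [phiOneFun, dif_pos h]
  exact hecke_wd hϖ τ h.choose_spec.symm

/-- The element of the Hecke algebra supported on the double coset of `h̃(ϖ)⁻¹`, with value
`rho τ` at `h̃(ϖ)⁻¹`. -/
def phiOne : HeckeFun (genuineLift (F := F) τ) where
  toFun := phiOneFun hϖ τ
  equivariant k l g := by
    by_cases h : ∃ kl : Kt F × Kt F, g = kl.1 * (hTilde (unif hϖ))⁻¹ * kl.2
    · obtain ⟨⟨k', l'⟩, rfl⟩ := h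
      have h1 : (k : Mp F) * (k' * (hTilde (unif hϖ))⁻¹ * l') * l =
          (k * k' : Kt F) * (hTilde (unif hϖ))⁻¹ * (l' * l : Kt F) := by
        push_cast; group
      rw [h1, phiOneFun_eq, phiOneFun_eq, map_mul, map_mul]
      rfl
    · rw [phiOneFun, phiOneFun, dif_neg h, dif_neg]
      · simp
      · rintro ⟨⟨k', l'⟩, h'⟩
        refine h ⟨(k⁻¹ * k', l' * l⁻¹), ?_⟩
        have : g = (k : Mp F)⁻¹ * (k * g * l) * (l : Mp F)⁻¹ := by group
        rw [this, h']
        push_cast; group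
  finite_support := by
    obtain ⟨S, hS, h⟩ := double_coset_finite hϖ
    refine ⟨S, hS, fun g hg => ?_⟩
    by_cases h' : ∃ kl : Kt F × Kt F, g = kl.1 * (hTilde (unif hϖ))⁻¹ * kl.2
    · obtain ⟨⟨k, l⟩, rfl⟩ := h'
      exact h k l
    · exact (hg (by rw [phiOneFun, dif_neg h'])).elim

/-- The cokernel module `π(τ, λ) = ind τ̃ / (T - λ)`, where `T` is the Hecke operator of
`phiOne`. -/
def cokerModule (c : E) := (phiOne (F := F) hϖ τ).coker c

end Hecke

section PrincipalSeries

open Matrix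

variable {F : Type*} [Field F] [ValuativeRel F] [TopologicalSpace F]
  [IsNonarchimedeanLocalField F]

/-- The preimage of the diagonal torus in the double cover. -/
def Tt (F : Type*) [Field F] [ValuativeRel F] [TopologicalSpace F]
    [IsNonarchimedeanLocalField F] : Subgroup (Mp F) where
  carrier := {x | x.g 0 1 = 0 ∧ x.g 1 0 = 0}
  mul_mem' := by
    rintro x y ⟨h1, h2⟩ ⟨h1', h2'⟩
    constructor <;> rw [Mp.mul_g, sl_mul] <;> simp [h1, h2, h1', h2']
  one_mem' := by constructor <;> simp
  inv_mem' := by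
    rintro x ⟨h1, h2⟩
    constructor <;>
      rw [Mp.inv_g, Matrix.SpecialLinearGroup.coe_inv, Matrix.adjugate_fin_two] <;> simp [h1, h2]

/-- The entry `a` of an element `(diag(a, a⁻¹), ζ)` of the torus. -/
def torusCoord (t : Tt F) : Fˣ := Units.mk0 (t.1.g 0 0) (by
  intro h
  have := sl_det t.1.g
  rw [h, t.2.1] at this
  simp at this)

/-- The element `h̃(x)` of the torus. -/
def hTorus (x : Fˣ) : Tt F := ⟨hTilde x, rfl, rfl⟩

/-- The central element `(1, -1)`. -/
def negOne (F : Type*) [Field F] [ValuativeRel F] [TopologicalSpace F]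
    [IsNonarchimedeanLocalField F] : Tt F :=
  ⟨⟨1, -1⟩, by simp, by simp⟩

/-- The lift `(ū(y), 1)` of a lower unipotent matrix to the double cover. -/
def lowerMp (y : F) : Mp F := ⟨⟨!![1, 0; y, 1], by rw [Matrix.det_fin_two_of]; simp⟩, 1⟩

variable {E : Type*} [Field E]

/-- The space of the smooth induction of a character `χ` of the torus, inflated to the preimage
of the lower triangular Borel subgroup: smooth functions `f` with `f(t ū g) = χ(t) f(g)` for
`t` in the torus and `ū` in the (canonically lifted) lower unipotent subgroup. -/
def psSpace (χ : Tt F → E) : Submodule E (Mp F → E) where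
  carrier := {f | (∀ (t : Tt F) (y : F) (g : Mp F), f (t * lowerMp y * g) = χ t * f g) ∧ Smooth f}
  add_mem' := by
    rintro f f' ⟨h1, h2⟩ ⟨h1', h2'⟩
    exact ⟨fun t y g => by simp [h1, h1', mul_add], (smoothFun E (Mp F) E).add_mem h2 h2'⟩
  zero_mem' := ⟨fun t y g => by simp, (smoothFun E (Mp F) E).zero_mem⟩
  smul_mem' := by
    rintro c f ⟨h1, h2⟩
    exact ⟨fun t y g => by simp [h1, mul_left_comm], (smoothFun E (Mp F) E).smul_mem c h2⟩

lemma psSpace_le (χ : Tt F → E) (g : Mp F) :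
    psSpace χ ≤ (psSpace χ).comap (rightReg E (Mp F) E g) := by
  rintro f ⟨h1, h2⟩
  exact ⟨fun t y x => by rw [rightReg_apply, rightReg_apply, mul_assoc, h1], h2.translate g⟩

/-- The principal series representation, acting by right translation. -/
def principalSeries (χ : Tt F → E) : Representation E (Mp F) (psSpace χ) :=
  (rightReg E (Mp F) E).subrepresentation _ (psSpace_le χ)

end PrincipalSeries

section WeilIndex

variable {F : Type*} [Field F] [ValuativeRel F] [TopologicalSpace F]
  [IsNonarchimedeanLocalField F]

/-- The fractional ideal of elements of valuation at least `-n`. -/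
def fracIdeal (F : Type*) [Field F] [ValuativeRel F] [TopologicalSpace F]
    [IsNonarchimedeanLocalField F] (n : ℕ) : Set F :=
  {x | ∀ u : Fˣ, (u : F) = x → -(n : ℤ) ≤ ord u}

/-- The integral of `ψ(a x²)` over the elements `x` of valuation at least `-n`, for a Haar
measure on `F`. -/
def gaussInt (ψ : AddChar F ℂ) (a : Fˣ) (n : ℕ) : ℂ :=
  letI : MeasurableSpace F := borel F
  haveI : BorelSpace F := ⟨rfl⟩
  ∫ x in fracIdeal F n, ψ (a * x ^ 2) ∂(MeasureTheory.Measure.addHaar)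

/-- The Weil index of the character of second degree `x ↦ ψ(a x²)`: the phase of the Gauss
integrals of `ψ(a x²)` over large fractional ideals (which is eventually constant). -/
def weilIndex (ψ : AddChar F ℂ) (a : Fˣ) : ℂ :=
  Filter.limUnder Filter.atTop fun n : ℕ => gaussInt ψ a n / ‖gaussInt ψ a n‖

/-- The ratio `γ_F(a, ψ)` of the Weil indices of `ψ(a x²)` and `ψ(x²)`; it is a fourth root of
unity. -/
def gammaF (ψ : AddChar F ℂ) (a : Fˣ) : ℂ := weilIndex ψ a / weilIndex ψ 1

variable {E : Type*} [Field E]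

/-- Transport of a complex fourth root of unity to `E` (and `0` on other complex numbers). -/
def transport (i : rootsOfUnity 4 ℂ ≃* rootsOfUnity 4 E) (z : ℂ) : E :=
  open scoped Classical in
  if h : ∃ u : rootsOfUnity 4 ℂ, ((u : ℂˣ) : ℂ) = z then ((i h.choose : Eˣ) : E) else 0

/-- The genuine character `χ_ψ : (diag(a, a⁻¹), ζ) ↦ ζ γ_F(a, ψ)⁻¹` of the torus. -/
def chiPsi (i : rootsOfUnity 4 ℂ ≃* rootsOfUnity 4 E) (ψ : AddChar F ℂ) (t : Tt F) : E :=
  signE E t.1.ζ * transport i (gammaF ψ (torusCoord t))⁻¹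

/-- The product `μ · χ_ψ`, where `μ` is a character of `Fˣ`, seen as the character
`(diag(a, a⁻¹), ζ) ↦ μ(a)` of the torus. -/
def muChiPsi (i : rootsOfUnity 4 ℂ ≃* rootsOfUnity 4 E) (ψ : AddChar F ℂ) (μ : Fˣ →* Eˣ)
    (t : Tt F) : E :=
  μ (torusCoord t) * chiPsi i ψ t

/-- The parameter `λ_{μ,ψ}`, the value of `μ · χ_ψ` at `h̃(ϖ)`. -/
def lambdaParam {ϖ : 𝒪[F]} (hϖ : Irreducible ϖ) (i : rootsOfUnity 4 ℂ ≃* rootsOfUnity 4 E)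
    (ψ : AddChar F ℂ) (μ : Fˣ →* Eˣ) : E :=
  muChiPsi i ψ μ (hTorus (unif hϖ))

/-- The genuine weight `σ̃_r` of the preimage of `SL₂(𝒪)`. -/
def genuineWeight (p : ℕ) [ExpChar E p] (emb : 𝓀[F] →+* E) {f : ℕ} (r : Fin f → Fin p) :
    Representation E (Kt F) (WeightSpace E fun j => (r j : ℕ)) :=
  genuineLift (V := WeightSpace E fun j => (r j : ℕ)) (weight p emb fun j => (r j : ℕ))

/-- The cokernel module `π(r, c) = ind σ̃_r / (T - c)`. -/
def piModule {ϖ : 𝒪[F]} (hϖ : Irreducible ϖ) (p : ℕ) [ExpChar E p] (emb : 𝓀[F] →+* E) {f : ℕ}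
    (r : Fin f → Fin p) (c : E) :=
  cokerModule (V := WeightSpace E fun j => (r j : ℕ)) hϖ (weight p emb fun j => (r j : ℕ)) c

end WeilIndex

end Metaplectic

end

open Metaplectic

/-!
The principal series of the double cover of `SL₂(F)` is treated through the pro-`p` Iwahori
subgroup. Write `u(x)` and `ū(y)` for the upper and lower unipotent elements and `w` for the Weyl
element.

Irreducibility. A nonzero stable subspace contains a nonzero function invariant under the pro-`p`
Iwahori subgroup, because a `p`-group acting on a nonzero finite `𝔽_p`-vector space has a nonzero
fixed vector (`exists_iwahoriInv`). By the Iwasawa decomposition such a function `f` is determined by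
the values `f(1)` and `f(w)`. The operators `∑ u(x) h̃(ϖ)` (`uOp`, over `x` modulo `ϖ²`) and
`∑ u(x) w` (`sOp`, over `x` modulo `ϖ`) map `f` to multiples of the function `cellFun` supported on
the cell of the identity, with factors computed in `uOp_one_of_trivial` and `sOp_one_of_nontrivial`.
If `χ` is nontrivial on units, then the second factor is `f(w)`, and for `f(w) = 0` the first one is
`χ(h̃(ϖ)) f(1)`. If `χ` is trivial on units, the first factor is `χ(h̃(ϖ)) f(1)` for every `f`: the
term which `f(w)` contributes for the linear group is here weighted by the quadratic character
`u ↦ (ϖ, u)`, and sums to zero. This is why there are no genuine special representations. In both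
cases one of the factors is nonzero, so `cellFun` lies in the subspace (`cellFun_mem_of_iwahoriInv`);
and `cellFun` generates the principal series, its translates having arbitrarily small supports modulo
the lower triangular group (`mem_of_cellFun_mem`).

Cokernel modules. The pair `(Ind χ, cellFun)` is universal among the vectors on which the Iwahori
subgroup and the operator `∑ u(x) h̃(ϖ)` act as they do on `cellFun` (`IwahoriEigen`,
`exists_intertwining`): by the relation for that operator every vector of the representation
generated by such a `v` is a combination of vectors `k h̃(ϖ)ⁿ v` with `k ∈ K` and `n` fixed, and for
fixed `n` all the relations between the translates of `cellFun` are proportionalities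
(`level_relation`). So a representation generated by a nonzero vector of this kind is isomorphic to
`Ind χ` (`nonempty_equiv`). In the cokernel module of a weight occurring in `Ind χ` let `s` be the
class of the highest weight vector. It generates, and it is nonzero, because the linear form given by
Frobenius reciprocity vanishes on the image of `T - λ` (`frobForm_op`). For a nontrivial weight the
explicit Hecke operator (`op_brick`) shows that `s` is a vector of the required kind. For the trivial
weight `s` is a spherical eigenvector, and `∑ u(x) h̃(ϖ) s` is of the required kind and generates the
same representation as `s`; here the sums that obstruct this for the linear group are again
annihilated by the quadratic character (`sum_unif_lower`).

The characters `μ · χ_ψ`. The Weil indices are computed from the conductor of `ψ` and the quadratic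
Gauss sum over the residue field (`exists_weilIndex`). Hence `γ_F(·, ψ)` is multiplicative up to the
Hilbert symbol (`gammaF_mul`), and `μ · χ_ψ` is a smooth genuine character (`muChiPsiHom`).
-/

noncomputable section

namespace Metaplectic

/-! ### Unipotent, diagonal and Weyl elements of the double cover -/

section Elements

open Matrix

variable {F : Type*} [Field F] [ValuativeRel F] [TopologicalSpace F]
  [IsNonarchimedeanLocalField F]

/-- The lift `(u(x), 1)` of an upper unipotent matrix to the double cover. -/
def upperMp (x : F) : Mp F := ⟨⟨!![1, x; 0, 1], by rw [Matrix.det_fin_two_of]; simp⟩, 1⟩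

/-- The lift `(w, 1)` of the Weyl element `w = (0, 1; -1, 0)` to the double cover. -/
def weyl : Mp F := ⟨⟨!![0, 1; -1, 0], by rw [Matrix.det_fin_two_of]; simp⟩, 1⟩

/-- The central element `(1, ζ)` of the double cover. -/
def central (z : ℤˣ) : Mp F := ⟨1, z⟩

lemma X_eq_of_ne {g : SpecialLinearGroup (Fin 2) F} (u : Fˣ) (h : g 1 0 = u) : X g = u := by
  ext; rw [X_of_ne (h ▸ u.ne_zero), h]

lemma X_eq_of_eq {g : SpecialLinearGroup (Fin 2) F} (u : Fˣ) (h0 : g 1 0 = 0) (h : g 1 1 = u) :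
    X g = u := by
  ext; rw [X_of_eq h0, h]

@[simp] lemma upperMp_00 (x : F) : (upperMp x).g 0 0 = 1 := rfl
@[simp] lemma upperMp_01 (x : F) : (upperMp x).g 0 1 = x := rfl
@[simp] lemma upperMp_10 (x : F) : (upperMp x).g 1 0 = 0 := rfl
@[simp] lemma upperMp_11 (x : F) : (upperMp x).g 1 1 = 1 := rfl
@[simp] lemma upperMp_sign (x : F) : (upperMp x).ζ = 1 := rfl
@[simp] lemma lowerMp_00 (x : F) : (lowerMp x).g 0 0 = 1 := rfl
@[simp] lemma lowerMp_01 (x : F) : (lowerMp x).g 0 1 = 0 := rfl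
@[simp] lemma lowerMp_10 (x : F) : (lowerMp x).g 1 0 = x := rfl
@[simp] lemma lowerMp_11 (x : F) : (lowerMp x).g 1 1 = 1 := rfl
@[simp] lemma lowerMp_sign (x : F) : (lowerMp x).ζ = 1 := rfl
@[simp] lemma weyl_00 : (weyl (F := F)).g 0 0 = 0 := rfl
@[simp] lemma weyl_01 : (weyl (F := F)).g 0 1 = 1 := rfl
@[simp] lemma weyl_10 : (weyl (F := F)).g 1 0 = -1 := rfl
@[simp] lemma weyl_11 : (weyl (F := F)).g 1 1 = 0 := rfl
@[simp] lemma weyl_sign : (weyl (F := F)).ζ = 1 := rfl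
@[simp] lemma hTilde_00 (a : Fˣ) : (hTilde a).g 0 0 = a := rfl
@[simp] lemma hTilde_01 (a : Fˣ) : (hTilde a).g 0 1 = 0 := rfl
@[simp] lemma hTilde_10 (a : Fˣ) : (hTilde a).g 1 0 = 0 := rfl
@[simp] lemma hTilde_11 (a : Fˣ) : (hTilde a).g 1 1 = (a : F)⁻¹ := by
  change ((a⁻¹ : Fˣ) : F) = _
  rw [Units.val_inv_eq_inv_val]
@[simp] lemma hTilde_sign (a : Fˣ) : (hTilde a).ζ = hilb (-1) a := rfl
@[simp] lemma central_g (z : ℤˣ) : (central z : Mp F).g = 1 := rfl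
@[simp] lemma central_sign (z : ℤˣ) : (central z : Mp F).ζ = z := rfl

lemma X_upper (x : F) : X (upperMp x).g = 1 := X_eq_of_eq 1 rfl rfl

lemma X_hTilde (a : Fˣ) : X (hTilde a).g = a⁻¹ := X_eq_of_eq _ rfl rfl

lemma X_weyl : X (weyl (F := F)).g = -1 := X_eq_of_ne _ (by simp)

lemma X_mul_upper (g : SpecialLinearGroup (Fin 2) F) (x : F) : X (g * (upperMp x).g) = X g := by
  by_cases h : g 1 0 = 0
  · rw [X_mul_left h, X_upper, mul_one]
  · rw [X_mul_right h rfl, X_upper, div_one]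

lemma cocyc_upper_right (g : SpecialLinearGroup (Fin 2) F) (x : F) :
    cocyc g (upperMp x).g = 1 := by
  apply sgn2_inj
  rw [cocyc_add, X_mul_upper, div_self', hl_one_left]; rfl

lemma cocyc_upper_left (g : SpecialLinearGroup (Fin 2) F) (x : F) :
    cocyc (upperMp x).g g = 1 := by
  apply sgn2_inj
  rw [cocyc_add, X_mul_left rfl, X_upper, one_mul, div_self', hl_one_right]; rfl

lemma Mp_ext_entries {x y : Mp F} (h00 : x.g 0 0 = y.g 0 0) (h01 : x.g 0 1 = y.g 0 1)
    (h10 : x.g 1 0 = y.g 1 0) (h11 : x.g 1 1 = y.g 1 1) (hz : x.ζ = y.ζ) : x = y := by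
  ext1
  · ext i j
    fin_cases i <;> fin_cases j
    · exact h00
    · exact h01
    · exact h10
    · exact h11
  · exact hz

lemma central_mul_apply (z : ℤˣ) (g : Mp F) : central z * g = ⟨g.g, z * g.ζ⟩ := by
  ext1
  · simp
  · simp [cocyc_one_left]

lemma mul_central_apply (z : ℤˣ) (g : Mp F) : g * central z = ⟨g.g, z * g.ζ⟩ := by
  ext1
  · simp
  · simp [cocyc_one_right, mul_comm]

lemma central_comm (z : ℤˣ) (g : Mp F) : central z * g = g * central z := by
  rw [central_mul_apply, mul_central_apply]

lemma central_mul (z z' : ℤˣ) : (central (z * z') : Mp F) = central z * central z' := by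
  rw [central_mul_apply]; rfl

lemma central_one : (central 1 : Mp F) = 1 := rfl

lemma eq_central_mul {x y : Mp F} (h : x.g = y.g) : x = central (x.ζ * y.ζ) * y := by
  rw [central_mul_apply]
  ext1
  · exact h
  · simp [mul_assoc]

lemma upperMp_add (x y : F) : upperMp (x + y) = upperMp x * upperMp y := by
  refine Mp_ext_entries ?_ ?_ ?_ ?_ ?_
  all_goals simp [sl_mul, cocyc_upper_left, add_comm]

lemma upperMp_zero : upperMp (0 : F) = 1 := by
  refine Mp_ext_entries ?_ ?_ ?_ ?_ ?_ <;> simp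

lemma lowerMp_zero : lowerMp (0 : F) = 1 := by
  refine Mp_ext_entries ?_ ?_ ?_ ?_ ?_ <;> simp

lemma weyl_mul_upper (x : F) : weyl * upperMp x = lowerMp (-x) * weyl := by
  refine Mp_ext_entries ?_ ?_ ?_ ?_ ?_
  · simp [sl_mul]
  · simp [sl_mul]
  · simp [sl_mul]
  · simp [sl_mul]
  · simp only [Mp.mul_sign, cocyc_upper_right, weyl_sign, upperMp_sign, lowerMp_sign, mul_one]
    apply sgn2_inj
    have h : X ((lowerMp (-x)).g * weyl.g) = -1 := X_eq_of_ne _ (by simp [sl_mul])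
    rw [one_mul, cocyc_add, h, X_weyl, div_self', hl_one_right]; rfl

lemma weyl_mul_weyl : weyl * weyl = hTilde (-1 : Fˣ) := by
  refine Mp_ext_entries ?_ ?_ ?_ ?_ ?_
  · simp [sl_mul]
  · simp [sl_mul]
  · simp [sl_mul]
  · simp [sl_mul]
  · simp only [Mp.mul_sign, weyl_sign, mul_one, one_mul, hTilde_sign]
    apply sgn2_inj
    have h : X (weyl.g * weyl.g) = (-1 : Fˣ) := X_eq_of_eq _ (by simp [sl_mul]) (by simp [sl_mul])
    rw [cocyc_add, h, X_weyl, div_self', hl_one_right]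
    exact (hl_units ord_neg_one ord_neg_one).symm

lemma weyl_mul_hTilde (a : Fˣ) : weyl * hTilde a = hTilde a⁻¹ * weyl := by
  refine Mp_ext_entries ?_ ?_ ?_ ?_ ?_
  · simp [sl_mul]
  · simp [sl_mul]
  · simp [sl_mul]
  · simp [sl_mul]
  · simp only [Mp.mul_sign, weyl_sign, mul_one, one_mul, hTilde_sign]
    apply sgn2_inj
    have h : X (weyl.g * (hTilde a).g) = -a := X_eq_of_ne _ (by simp [sl_mul])
    have h' : X ((hTilde a⁻¹).g * weyl.g) = -a := X_eq_of_ne _ (by simp [sl_mul])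
    have hn : -a = -1 * a := by simp
    rw [sgn2_mul, sgn2_mul, cocyc_add, cocyc_add, h, h', X_weyl, X_hTilde, X_hTilde, hn]
    change hl (-1) a + _ = hl (-1) a⁻¹ + _
    have h0 := hl_units (F := F) ord_neg_one ord_neg_one
    simp only [hl_mul_left, hl_mul_right, hl_div_left, hl_div_right, hl_inv_right,
      inv_inv, hl_self a, hl_symm a (-1), h0]
    have ht := two_zmod
    grind

lemma hTilde_mul (a b : Fˣ) : hTilde a * hTilde b = central (hilb a b) * hTilde (a * b) := by
  rw [central_mul_apply]
  refine Mp_ext_entries ?_ ?_ ?_ ?_ ?_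
  · simp [sl_mul]
  · simp [sl_mul]
  · simp [sl_mul]
  · simp [sl_mul]; ring
  · simp only [Mp.mul_sign, hTilde_sign]
    apply sgn2_inj
    rw [sgn2_mul, sgn2_mul, sgn2_mul, cocyc_add, X_mul_left rfl, X_hTilde, X_hTilde]
    change hl (-1) a + hl (-1) b + _ = hl a b + hl (-1) (a * b)
    simp only [hl_mul_left, hl_mul_right, hl_div_left, hl_div_right, hl_inv_left, hl_inv_right,
      hl_self a, hl_self b, hl_symm _ (-1 : Fˣ)]
    have ht := two_zmod
    have hs := hl_symm a b
    grind

lemma hTilde_mul_upper (a : Fˣ) (x : F) :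
    hTilde a * upperMp x = upperMp ((a : F) * a * x) * hTilde a := by
  refine Mp_ext_entries ?_ ?_ ?_ ?_ ?_
  · simp [sl_mul]
  · simp [sl_mul]; field_simp
  · simp [sl_mul]
  · simp [sl_mul]
  · simp [cocyc_upper_right, cocyc_upper_left]

lemma hTilde_one : hTilde (1 : Fˣ) = 1 := by
  refine Mp_ext_entries ?_ ?_ ?_ ?_ ?_
  · simp
  · simp
  · simp
  · simp
  · apply sgn2_inj; exact hl_one_right _

lemma lowerMp_eq (x : F) : lowerMp x = weyl * upperMp (-x) * weyl⁻¹ := by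
  rw [weyl_mul_upper, neg_neg, mul_inv_cancel_right]

lemma lowerMp_add (x y : F) : lowerMp (x + y) = lowerMp x * lowerMp y := by
  rw [lowerMp_eq, lowerMp_eq, lowerMp_eq, neg_add, upperMp_add]; group

lemma weyl_mul_lower (x : F) : weyl * lowerMp x = upperMp (-x) * weyl := by
  have h := weyl_mul_upper (-x)
  rw [neg_neg] at h
  have h1 : weyl * lowerMp x * weyl = upperMp (-x) * weyl * weyl := by
    rw [mul_assoc, ← h, ← mul_assoc, mul_assoc (upperMp (-x)), weyl_mul_weyl, hTilde_mul_upper]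
    simp
  exact mul_right_cancel h1

lemma hTilde_mul_lower (a : Fˣ) (y : F) :
    hTilde a * lowerMp y = lowerMp (y / (a * a)) * hTilde a := by
  have h1 : weyl * hTilde a⁻¹ = hTilde a * weyl := by rw [weyl_mul_hTilde, inv_inv]
  have h2 : weyl⁻¹ * hTilde a = hTilde a⁻¹ * weyl⁻¹ := by
    rw [inv_mul_eq_iff_eq_mul, ← mul_assoc, h1, mul_inv_cancel_right]
  have h3 : ((a⁻¹ : Fˣ) : F) * (a⁻¹ : Fˣ) * -y = -(y / (a * a)) := by
    rw [Units.val_inv_eq_inv_val]; field_simp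
  rw [lowerMp_eq, lowerMp_eq, ← mul_assoc, ← mul_assoc, ← h1, mul_assoc weyl, hTilde_mul_upper,
    mul_assoc _ weyl⁻¹, h2, h3]
  simp only [mul_assoc]

lemma lower_mul_hTilde (a : Fˣ) (y : F) :
    lowerMp y * hTilde a = hTilde a * lowerMp (a * a * y) := by
  rw [hTilde_mul_lower]
  congr 2
  field_simp

lemma upper_mul_hTilde (a : Fˣ) (y : F) :
    upperMp y * hTilde a = hTilde a * upperMp (y / (a * a)) := by
  rw [hTilde_mul_upper]
  congr 2
  field_simp

/-- The big cell decomposition of an upper unipotent element: with the lifts chosen here, no sign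
occurs. -/
lemma upper_eq (x : Fˣ) :
    upperMp (x : F) = lowerMp (x : F)⁻¹ * (hTilde x * (weyl * lowerMp (x : F)⁻¹)) := by
  have hx := x.ne_zero
  refine Mp_ext_entries ?_ ?_ ?_ ?_ ?_
  · simp [sl_mul]
  · simp [sl_mul]
  · simp [sl_mul]
  · simp [sl_mul]
  · simp only [Mp.mul_sign, weyl_sign, mul_one, one_mul, hTilde_sign, upperMp_sign, lowerMp_sign,
      Mp.mul_g]
    apply sgn2_inj
    have h1 : X (weyl.g * (lowerMp (x : F)⁻¹).g) = -1 := X_eq_of_ne _ (by simp [sl_mul])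
    have h2 : X (lowerMp (x : F)⁻¹).g = x⁻¹ := X_eq_of_ne _ (by simp)
    have h3 : X ((hTilde x).g * (weyl.g * (lowerMp (x : F)⁻¹).g)) = -1 * x⁻¹ := by
      rw [X_mul_left rfl, X_hTilde, h1, mul_comm]
    have h4 : X ((lowerMp (x : F)⁻¹).g * ((hTilde x).g * (weyl.g * (lowerMp (x : F)⁻¹).g))) = 1 :=
      X_eq_of_eq _ (by simp [sl_mul]) (by simp [sl_mul])
    rw [sgn2_mul, sgn2_mul, sgn2_mul, cocyc_add, cocyc_add, cocyc_add, h4, h3, h2, h1, X_weyl,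
      X_hTilde]
    change sgn2 1 = hl (-1) x + _ + _ + _
    have h0 := hl_units (F := F) ord_neg_one ord_neg_one
    have hm : (-1 : Fˣ) = -1 * 1 := by simp
    simp only [hl_mul_left, hl_mul_right, hl_div_left, hl_div_right, hl_inv_left, hl_inv_right,
      hl_self x, hl_symm _ (-1 : Fˣ), h0, sgn2_one, hl_one_left, hl_one_right]
    have ht := two_zmod
    grind

/-- The decomposition of a lower unipotent element opposite to `upper_eq`. -/
lemma lower_eq (y : Fˣ) :
    lowerMp (y : F) = upperMp (y : F)⁻¹ * (hTilde (-y⁻¹) * (weyl * upperMp (y : F)⁻¹)) := by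
  have h := upper_eq (-y)
  have h1 : lowerMp (y : F) = weyl * upperMp ((-y : Fˣ) : F) * weyl⁻¹ := by
    rw [lowerMp_eq]; simp
  have h2 : weyl * lowerMp ((-y : Fˣ) : F)⁻¹ = upperMp (y : F)⁻¹ * weyl := by
    rw [weyl_mul_lower]; simp
  rw [h1, h, h2, ← mul_assoc, ← mul_assoc, h2, mul_assoc _ weyl, weyl_mul_hTilde, inv_neg]
  have h3 : weyl * (upperMp (y : F)⁻¹ * weyl) * weyl⁻¹ = weyl * upperMp (y : F)⁻¹ := by group
  simp only [mul_assoc] at h3 ⊢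
  rw [h3]

lemma upperMp_inv (x : F) : (upperMp x)⁻¹ = upperMp (-x) := by
  rw [inv_eq_iff_mul_eq_one, ← upperMp_add, add_neg_cancel, upperMp_zero]

lemma lowerMp_inv (x : F) : (lowerMp x)⁻¹ = lowerMp (-x) := by
  rw [inv_eq_iff_mul_eq_one, ← lowerMp_add, add_neg_cancel, lowerMp_zero]

lemma central_sq (z : ℤˣ) : (central z : Mp F) * central z = 1 := by
  rw [← central_mul, Int.units_mul_self]; rfl

lemma hTilde_inv (a : Fˣ) : (hTilde a)⁻¹ = central (hilb a (-1)) * hTilde a⁻¹ := by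
  rw [inv_eq_iff_mul_eq_one, ← mul_assoc, ← central_comm, mul_assoc, hTilde_mul, mul_inv_cancel,
    hTilde_one, mul_one, ← central_mul]
  have : hilb a a⁻¹ = hilb a (-1) := by
    apply sgn2_inj
    change hl a a⁻¹ = hl a (-1)
    rw [hl_inv_right, hl_self]
  rw [this, Int.units_mul_self]; rfl

/-- The torus elements `h̃(a)` with coefficients of the center exhaust the torus. -/
lemma torus_eq (t : Tt F) :
    (t : Mp F) = central (t.1.ζ * hilb (-1) (torusCoord t)) * hTilde (torusCoord t) := by
  have hdet := sl_det t.1.g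
  rw [t.2.1, zero_mul, sub_zero] at hdet
  have : t.1.g = (hTilde (torusCoord t)).g := by
    ext i j
    fin_cases i <;> fin_cases j
    · rfl
    · exact t.2.1
    · exact t.2.2
    · change t.1.g 1 1 = (hTilde (torusCoord t)).g 1 1
      rw [hTilde_11]
      exact eq_inv_of_mul_eq_one_right hdet
  exact eq_central_mul this

end Elements

/-! ### Fractional ideals and representatives -/

section Lattices

variable {F : Type*} [Field F] [ValuativeRel F] [TopologicalSpace F]
  [IsNonarchimedeanLocalField F]

lemma ord_le_ord_iff (a b : Fˣ) : ord a ≤ ord b ↔ valuation F (b : F) ≤ valuation F (a : F) := by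
  have h := ord_nonneg_iff (b / a)
  rw [ord_div, Units.val_div_eq_div_val, map_div₀, div_le_one₀ (by simp [zero_lt_iff])] at h
  rw [← h]; omega

variable (F) in
/-- The fractional ideal of elements of valuation at least `n`. -/
def lat (n : ℤ) : AddSubgroup F where
  carrier := {x | ∀ u : Fˣ, (u : F) = x → n ≤ ord u}
  zero_mem' := fun u hu => (u.ne_zero hu).elim
  neg_mem' := by
    intro x hx u hu
    have := hx (-1 * u) (by rw [Units.val_mul, hu]; simp)
    rwa [ord_mul, ord_neg_one, zero_add] at this
  add_mem' := by
    intro x y hx hy u hu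
    by_cases hx0 : x = 0
    · exact hy u (by rw [hu, hx0, zero_add])
    by_cases hy0 : y = 0
    · exact hx u (by rw [hu, hy0, add_zero])
    have h1 := hx (Units.mk0 x hx0) rfl
    have h2 := hy (Units.mk0 y hy0) rfl
    have h3 := (valuation F).map_add x y
    rw [← hu] at h3
    rcases le_max_iff.1 h3 with h | h
    · exact h1.trans ((ord_le_ord_iff _ _).2 h)
    · exact h2.trans ((ord_le_ord_iff _ _).2 h)

lemma unit_mem_lat {u : Fˣ} {n : ℤ} : (u : F) ∈ lat F n ↔ n ≤ ord u :=
  ⟨fun h => h u rfl, fun h v hv => by rwa [Units.ext hv]⟩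

lemma mem_lat_zero {x : F} : x ∈ lat F 0 ↔ x ∈ 𝒪[F] := by
  by_cases hx : x = 0
  · rw [hx]; exact ⟨fun _ => zero_mem _, fun _ => zero_mem _⟩
  · obtain ⟨u, rfl⟩ : ∃ u : Fˣ, (u : F) = x := ⟨Units.mk0 x hx, rfl⟩
    rw [unit_mem_lat, ord_nonneg_iff]; rfl

lemma mul_mem_lat {x y : F} {m n : ℤ} (hx : x ∈ lat F m) (hy : y ∈ lat F n) :
    x * y ∈ lat F (m + n) := by
  intro u hu
  have hx0 : x ≠ 0 := fun h => u.ne_zero (by rw [hu, h, zero_mul])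
  have hy0 : y ≠ 0 := fun h => u.ne_zero (by rw [hu, h, mul_zero])
  have : u = Units.mk0 x hx0 * Units.mk0 y hy0 := by ext; rw [hu]; rfl
  rw [this, ord_mul]
  exact add_le_add (hx _ rfl) (hy _ rfl)

lemma lat_anti {m n : ℤ} (h : m ≤ n) {x : F} (hx : x ∈ lat F n) : x ∈ lat F m :=
  fun u hu => h.trans (hx u hu)

lemma lat_int {n : ℤ} (h : 0 ≤ n) {x : F} (hx : x ∈ lat F n) : x ∈ 𝒪[F] :=
  mem_lat_zero.1 (lat_anti h hx)

lemma int_mul_mem_lat {x y : F} {n : ℤ} (hx : x ∈ 𝒪[F]) (hy : y ∈ lat F n) :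
    x * y ∈ lat F n := by
  have := mul_mem_lat (mem_lat_zero.2 hx) hy
  rwa [zero_add] at this

lemma unit_mul_mem_lat {u : Fˣ} {x : F} {n : ℤ} :
    (u : F) * x ∈ lat F n ↔ x ∈ lat F (n - ord u) := by
  constructor
  · intro h
    have := mul_mem_lat (unit_mem_lat.2 (le_refl (ord u⁻¹))) h
    rw [← mul_assoc, ← Units.val_mul, inv_mul_cancel, Units.val_one, one_mul, ord_inv] at this
    rwa [sub_eq_add_neg, add_comm]
  · intro h
    have := mul_mem_lat (unit_mem_lat.2 (le_refl (ord u))) h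
    rwa [add_sub_cancel] at this

lemma mem_lat_one {x : F} (hx : x ∈ 𝒪[F]) : x ∈ lat F 1 ↔ red x = 0 := by
  by_cases h0 : x = 0
  · rw [h0, red_zero]; exact ⟨fun _ => rfl, fun _ => zero_mem _⟩
  · obtain ⟨u, rfl⟩ : ∃ u : Fˣ, (u : F) = x := ⟨Units.mk0 x h0, rfl⟩
    rw [unit_mem_lat, red_eq_zero_iff hx, ← ord_pos_iff]; exact Iff.rfl

lemma red_sub {x y : F} (hx : x ∈ 𝒪[F]) (hy : y ∈ 𝒪[F]) : red (x - y) = red x - red y := by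
  rw [sub_eq_add_neg, red_add hx (neg_mem hy), red_neg hy, sub_eq_add_neg]

lemma sub_mem_lat_one {x y : F} (hx : x ∈ 𝒪[F]) (hy : y ∈ 𝒪[F]) :
    x - y ∈ lat F 1 ↔ red x = red y := by
  rw [mem_lat_one (sub_mem hx hy), red_sub hx hy, sub_eq_zero]

lemma exists_ord_eq_one : ∃ u : Fˣ, ord u = 1 := by
  set e := IsNonarchimedeanLocalField.valueGroupWithZeroIsoInt F
  obtain ⟨x, hx⟩ := ValuativeRel.valuation_surjective (e.symm (WithZero.exp (-1)))
  have hx0 : x ≠ 0 := by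
    rintro rfl
    rw [map_zero] at hx
    have h := congrArg e hx.symm
    rw [OrderMonoidIso.apply_symm_apply, map_zero] at h
    exact WithZero.exp_ne_zero h
  refine ⟨Units.mk0 x hx0, ?_⟩
  rw [ord, Units.val_mk0, hx]
  change -WithZero.log (e (e.symm _)) = 1
  simp

variable {ϖ : 𝒪[F]}

@[simp] lemma unif_coe (hϖ : Irreducible ϖ) : ((unif hϖ : Fˣ) : F) = ϖ := rfl

lemma ord_unif (hϖ : Irreducible ϖ) : ord (unif hϖ) = 1 := by
  obtain ⟨u, hu⟩ := exists_ord_eq_one (F := F)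
  have h1 : 0 < ord (unif hϖ) := by
    rw [ord_pos_iff]
    refine lt_of_le_of_ne ϖ.2 fun h => hϖ.not_isUnit ?_
    exact ((Valuation.integer.integers (valuation F)).isUnit_iff_valuation_eq_one).2 h
  by_contra hne
  have hu' : (u : F) ∈ 𝒪[F] := mem_lat_zero.1 (unit_mem_lat.2 (by omega))
  have h2 : 0 < ord (unif hϖ / u) := by rw [ord_div]; omega
  have hv' : ((unif hϖ / u : Fˣ) : F) ∈ 𝒪[F] := mem_lat_zero.1 (unit_mem_lat.2 h2.le)
  have h3 : ϖ = ⟨_, hu'⟩ * ⟨_, hv'⟩ := by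
    ext
    change _ = ((u : F) * ((unif hϖ / u : Fˣ) : F))
    rw [← Units.val_mul, mul_div_cancel]; rfl
  rcases hϖ.isUnit_or_isUnit h3 with h | h
  · have h4 := ((Valuation.integer.integers (valuation F)).isUnit_iff_valuation_eq_one).1 h
    have h5 := (ord_eq_zero_iff u).2 h4
    omega
  · have h4 := ((Valuation.integer.integers (valuation F)).isUnit_iff_valuation_eq_one).1 h
    have h5 := (ord_eq_zero_iff (unif hϖ / u)).2 h4
    omega

lemma unif_mul_mem_lat (hϖ : Irreducible ϖ) {x : F} {n : ℤ} (hx : x ∈ lat F n) :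
    (ϖ : F) * x ∈ lat F (n + 1) := by
  have := unit_mul_mem_lat (u := unif hϖ) (x := x) (n := n + 1)
  rw [ord_unif, add_sub_cancel_right] at this
  exact this.2 hx

lemma exists_unif_mul (hϖ : Irreducible ϖ) {x : F} {n : ℤ} (hx : x ∈ lat F (n + 1)) :
    ∃ y ∈ lat F n, x = (ϖ : F) * y := by
  have h0 : (ϖ : F) ≠ 0 := (unif hϖ).ne_zero
  refine ⟨(ϖ : F)⁻¹ * x, ?_, by rw [mul_inv_cancel_left₀ h0]⟩
  have := unit_mul_mem_lat (u := unif hϖ) (x := (ϖ : F)⁻¹ * x) (n := n + 1)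
  rw [ord_unif, add_sub_cancel_right, unif_coe, mul_inv_cancel_left₀ h0] at this
  exact this.1 hx

/-- A noncanonical finite enumeration of the residue field. -/
instance residueFintype : Fintype 𝓀[F] := Fintype.ofFinite _

/-- A section of the reduction map, which maps `0` to `0`. -/
def rep (x : 𝓀[F]) : F :=
  open scoped Classical in
  if x = 0 then 0 else ((IsLocalRing.residue_surjective x).choose : 𝒪[F])

lemma rep_zero : rep (0 : 𝓀[F]) = 0 := if_pos rfl

lemma rep_mem (x : 𝓀[F]) : rep x ∈ 𝒪[F] := by
  rw [rep]; split_ifs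
  · exact zero_mem _
  · exact Subtype.property _

lemma red_rep (x : 𝓀[F]) : red (rep x) = x := by
  rw [rep]; split_ifs with h
  · rw [red_zero, h]
  · rw [red_coe]; exact (IsLocalRing.residue_surjective x).choose_spec

/-- The family `r` represents the classes of the ring of integers modulo elements of valuation at
least `n`. -/
structure IsReps {ι : Type*} (r : ι → F) (n : ℤ) : Prop where
  mem : ∀ i, r i ∈ 𝒪[F]
  inj : ∀ i j, r i - r j ∈ lat F n → i = j
  surj : ∀ x ∈ 𝒪[F], ∃ i, x - r i ∈ lat F n

lemma isReps_rep : IsReps (rep (F := F)) 1 where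
  mem := rep_mem
  inj i j h := by
    rwa [sub_mem_lat_one (rep_mem i) (rep_mem j), red_rep, red_rep] at h
  surj x hx := ⟨red x, by rw [sub_mem_lat_one hx (rep_mem _), red_rep]⟩

/-- Representatives with one more `ϖ`-adic digit. -/
lemma IsReps.cons (hϖ : Irreducible ϖ) {ι : Type*} {r : ι → F} {n : ℤ} (hn : 0 ≤ n)
    (h : IsReps r n) :
    IsReps (fun p : 𝓀[F] × ι => rep p.1 + ϖ * r p.2) (n + 1) where
  mem p := add_mem (rep_mem _) (mul_mem ϖ.2 (h.mem _))
  inj p p' hp := by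
    have hr : ∀ q : 𝓀[F] × ι, red (rep q.1 + ϖ * r q.2) = q.1 := fun q => by
      have h1 : (ϖ : F) * r q.2 ∈ lat F 1 := unif_mul_mem_lat hϖ (mem_lat_zero.2 (h.mem q.2))
      have h2 : (ϖ : F) * r q.2 ∈ 𝒪[F] := mul_mem ϖ.2 (h.mem _)
      rw [red_add (rep_mem _) h2, (mem_lat_one h2).1 h1, red_rep, add_zero]
    have h1 := lat_anti (show (1 : ℤ) ≤ n + 1 by omega) hp
    rw [sub_mem_lat_one (add_mem (rep_mem _) (mul_mem ϖ.2 (h.mem _)))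
      (add_mem (rep_mem _) (mul_mem ϖ.2 (h.mem _))), hr, hr] at h1
    refine Prod.ext h1 (h.inj _ _ ?_)
    have h2 : rep p.1 + ϖ * r p.2 - (rep p'.1 + ϖ * r p'.2) = ((unif hϖ : Fˣ) : F) *
        (r p.2 - r p'.2) := by
      rw [h1, unif_coe]; ring
    rwa [h2, unit_mul_mem_lat, ord_unif, add_sub_cancel_right] at hp
  surj x hx := by
    have h1 : x - rep (red x) ∈ lat F 1 := by rw [sub_mem_lat_one hx (rep_mem _), red_rep]
    obtain ⟨y, hy, hxy⟩ := exists_unif_mul hϖ (n := 0) (by simpa using h1)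
    obtain ⟨i, hi⟩ := h.surj y (mem_lat_zero.1 hy)
    refine ⟨(red x, i), ?_⟩
    have h2 : x - (rep (red x) + ϖ * r i) = ϖ * (y - r i) := by linear_combination hxy
    simp only
    rw [h2]
    exact unif_mul_mem_lat hϖ hi

lemma exists_reps (n : ℕ) : ∃ (ι : Type) (_ : Fintype ι) (r : ι → F), IsReps r n := by
  obtain ⟨ϖ, hϖ⟩ := IsDiscreteValuationRing.exists_irreducible 𝒪[F]
  induction n with
  | zero =>
    refine ⟨Unit, inferInstance, fun _ => 0, fun _ => zero_mem _, fun _ _ _ => rfl,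
      fun x hx => ⟨(), ?_⟩⟩
    rw [sub_zero]; exact mem_lat_zero.2 hx
  | succ n ih =>
    obtain ⟨ι, _, r, hr⟩ := ih
    have h := IsReps.cons hϖ (by positivity) hr
    let e : Fin (Fintype.card (𝓀[F] × ι)) ≃ 𝓀[F] × ι := (Fintype.equivFin _).symm
    refine ⟨Fin (Fintype.card (𝓀[F] × ι)), inferInstance, fun i => rep (e i).1 + ϖ * r (e i).2,
      fun i => h.mem _, fun i j hij => e.injective (h.inj _ _ (by push_cast at hij; exact hij)),
      fun x hx => ?_⟩
    obtain ⟨p, hp⟩ := h.surj x hx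
    exact ⟨e.symm p, by simpa using hp⟩

/-- The representatives `rep x + ϖ * rep y` of the integers modulo `ϖ²`. -/
def rep2 (ϖ : 𝒪[F]) (p : 𝓀[F] × 𝓀[F]) : F := rep p.1 + ϖ * rep p.2

lemma isReps_rep2 (hϖ : Irreducible ϖ) : IsReps (rep2 (F := F) ϖ) 2 :=
  IsReps.cons hϖ (by norm_num) isReps_rep

section Sums

variable {ι M : Type*} [Fintype ι] [AddCommMonoid M] {r : ι → F} {n : ℤ}

/-- A sum over representatives does not change under a substitution which is injective on
classes. -/
lemma IsReps.sum_comp (h : IsReps r n) {f : F → M}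
    (hf : ∀ x ∈ 𝒪[F], ∀ y ∈ lat F n, x + y ∈ 𝒪[F] → f (x + y) = f x) {σ : F → F}
    (hσ : ∀ x ∈ 𝒪[F], σ x ∈ 𝒪[F])
    (hσi : ∀ x ∈ 𝒪[F], ∀ y ∈ 𝒪[F], σ x - σ y ∈ lat F n → x - y ∈ lat F n) :
    ∑ i, f (σ (r i)) = ∑ i, f (r i) := by
  choose c hc using h.surj
  let e : ι → ι := fun i => c (σ (r i)) (hσ _ (h.mem i))
  have he : Function.Injective e := by
    intro i j hij
    refine h.inj _ _ (hσi _ (h.mem i) _ (h.mem j) ?_)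
    have h1 := hc (σ (r i)) (hσ _ (h.mem i))
    have h2 := hc (σ (r j)) (hσ _ (h.mem j))
    have h3 : r (c (σ (r i)) (hσ _ (h.mem i))) = r (c (σ (r j)) (hσ _ (h.mem j))) :=
      congrArg r hij
    have h4 := sub_mem h1 h2
    rwa [h3, sub_sub_sub_cancel_right] at h4
  rw [← (Equiv.ofBijective e (Finite.injective_iff_bijective.1 he)).sum_comp (fun i => f (r i))]
  refine Finset.sum_congr rfl fun i _ => ?_
  have h1 := hc (σ (r i)) (hσ _ (h.mem i))
  have h2 := hf (r (e i)) (h.mem _) _ h1 (by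
    rw [add_sub_cancel]; exact hσ _ (h.mem i))
  rw [add_sub_cancel] at h2
  exact h2

lemma IsReps.sum_translate (h : IsReps r n) {f : F → M}
    (hf : ∀ x ∈ 𝒪[F], ∀ y ∈ lat F n, x + y ∈ 𝒪[F] → f (x + y) = f x) {c : F} (hc : c ∈ 𝒪[F]) :
    ∑ i, f (r i + c) = ∑ i, f (r i) :=
  h.sum_comp hf (σ := fun x => x + c) (fun x hx => add_mem hx hc)
    (fun x _ y _ hxy => by rwa [add_sub_add_right_eq_sub] at hxy)

lemma IsReps.sum_single (h : IsReps r n) {f : F → M} {x : F} (hx : x ∈ 𝒪[F])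
    (hf : ∀ y ∈ 𝒪[F], x - y ∉ lat F n → f y = 0) :
    ∃ y ∈ 𝒪[F], x - y ∈ lat F n ∧ ∑ i, f (r i) = f y := by
  classical
  obtain ⟨i, hi⟩ := h.surj x hx
  refine ⟨r i, h.mem i, hi, ?_⟩
  refine Finset.sum_eq_single i (fun j _ hj => hf _ (h.mem j) fun h' => hj ?_) (by simp)
  refine h.inj _ _ ?_
  have := sub_mem hi h'
  rwa [sub_sub_sub_cancel_left] at this

lemma sum_rep2 (f : F → M) :
    ∑ p, f (rep2 ϖ p) = ∑ x : 𝓀[F], ∑ y : 𝓀[F], f (rep x + ϖ * rep y) :=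
  Fintype.sum_prod_type _

end Sums

end Lattices

/-! ### The split maximal compact subgroup and its congruence subgroups -/

section Compact

open Matrix

variable {F : Type*} [Field F] [ValuativeRel F] [TopologicalSpace F]
  [IsNonarchimedeanLocalField F]

/-- The element lies in the split copy of `SL₂(𝒪)`. -/
def IsSplit (x : Mp F) : Prop := ∃ h : x ∈ Kt F, signK ⟨x, h⟩ = 1

lemma IsSplit.mul {x y : Mp F} (hx : IsSplit x) (hy : IsSplit y) : IsSplit (x * y) := by
  obtain ⟨hx, hx'⟩ := hx
  obtain ⟨hy, hy'⟩ := hy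
  refine ⟨(Kt F).mul_mem hx hy, ?_⟩
  have := map_mul (signK (F := F)) ⟨x, hx⟩ ⟨y, hy⟩
  rwa [hx', hy', mul_one] at this

lemma IsSplit.ext {x y : Mp F} (hx : IsSplit x) (hy : IsSplit y) (h : x.g = y.g) : x = y := by
  obtain ⟨hx, hx'⟩ := hx
  obtain ⟨hy, hy'⟩ := hy
  change x.ζ * theta x.g = 1 at hx'
  change y.ζ * theta y.g = 1 at hy'
  rw [h] at hx'
  ext1
  · exact h
  · exact mul_right_cancel (hx'.trans hy'.symm)

lemma IsSplit.ext_entries {x y : Mp F} (hx : IsSplit x) (hy : IsSplit y)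
    (h00 : x.g 0 0 = y.g 0 0) (h01 : x.g 0 1 = y.g 0 1)
    (h10 : x.g 1 0 = y.g 1 0) (h11 : x.g 1 1 = y.g 1 1) : x = y := by
  refine hx.ext hy ?_
  ext i j
  fin_cases i <;> fin_cases j
  · exact h00
  · exact h01
  · exact h10
  · exact h11

lemma isInt_of {g : SpecialLinearGroup (Fin 2) F} (h00 : g 0 0 ∈ 𝒪[F]) (h01 : g 0 1 ∈ 𝒪[F])
    (h10 : g 1 0 ∈ 𝒪[F]) (h11 : g 1 1 ∈ 𝒪[F]) : IsInt g := by
  intro i j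
  fin_cases i <;> fin_cases j
  · exact h00
  · exact h01
  · exact h10
  · exact h11

lemma isSplit_upper {x : F} (hx : x ∈ 𝒪[F]) : IsSplit (upperMp x) := by
  refine ⟨isInt_of (one_mem _) hx (zero_mem _) (one_mem _), ?_⟩
  change 1 * theta (upperMp x).g = 1
  rw [theta, dif_neg (fun h => h.1 rfl), one_mul]

lemma isSplit_weyl : IsSplit (weyl (F := F)) := by
  refine ⟨isInt_of (zero_mem _) (one_mem _) (neg_mem (one_mem _)) (zero_mem _), ?_⟩
  change 1 * theta (weyl (F := F)).g = 1
  rw [theta, dif_neg (fun h => h.2.1 rfl), one_mul]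

lemma IsSplit.inv {x : Mp F} (hx : IsSplit x) : IsSplit x⁻¹ := by
  obtain ⟨hx, hx'⟩ := hx
  refine ⟨(Kt F).inv_mem hx, ?_⟩
  have := map_inv (signK (F := F)) ⟨x, hx⟩
  rwa [hx', inv_one] at this

lemma isSplit_lower {x : F} (hx : x ∈ 𝒪[F]) : IsSplit (lowerMp x) := by
  rw [lowerMp_eq]
  exact (isSplit_weyl.mul (isSplit_upper (neg_mem hx))).mul isSplit_weyl.inv

lemma unit_inv_mem {a : Fˣ} (ha : ord a = 0) : (a : F)⁻¹ ∈ 𝒪[F] := by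
  rw [← Units.val_inv_eq_inv_val]; exact unit_mem (by rw [ord_inv, ha]; rfl)

lemma hilb_units {a b : Fˣ} (ha : ord a = 0) (hb : ord b = 0) : hilb a b = 1 :=
  sgn2_inj (hl_units ha hb)

lemma isSplit_hTilde {a : Fˣ} (ha : ord a = 0) : IsSplit (hTilde a) := by
  refine ⟨isInt_of (unit_mem ha) (zero_mem _) (zero_mem _) ?_, ?_⟩
  · rw [hTilde_11]; exact unit_inv_mem ha
  · change hilb (-1) a * theta (hTilde a).g = 1
    rw [theta, dif_neg (fun h => h.1 rfl), hilb_units ord_neg_one ha, mul_one]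

lemma central_mem (z : ℤˣ) : (central z : Mp F) ∈ Kt F := IsInt.one

lemma signK_central (z : ℤˣ) : signK ⟨(central z : Mp F), central_mem z⟩ = z := by
  have h := map_one (signK (F := F))
  change 1 * theta (1 : SpecialLinearGroup (Fin 2) F) = 1 at h
  change z * theta (1 : SpecialLinearGroup (Fin 2) F) = z
  rw [one_mul] at h
  rw [h, mul_one]

/-- Every element of the preimage of `SL₂(𝒪)` is a central multiple of a split element. -/
lemma Kt_eq_central_mul (k : Kt F) :
    ∃ x, IsSplit x ∧ (k : Mp F) = central (signK k) * x := by
  refine ⟨central (signK k) * (k : Mp F), ⟨(Kt F).mul_mem (central_mem _) k.2, ?_⟩, ?_⟩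
  · have := map_mul (signK (F := F)) ⟨_, central_mem (signK k)⟩ k
    rw [signK_central, Int.units_mul_self] at this
    exact this
  · rw [← mul_assoc, central_sq, one_mul]

/-- A split element whose upper left entry is a unit is a product of torus and unipotent
elements. -/
lemma IsSplit.eq_of_unit {x : Mp F} (hx : IsSplit x) {a : Fˣ} (ha : x.g 0 0 = a)
    (h0 : ord a = 0) :
    x = hTilde a * lowerMp (a * x.g 1 0) * upperMp (x.g 0 1 * (a : F)⁻¹) := by
  have h1 := hx.1
  have hy : (a : F) * x.g 1 0 ∈ 𝒪[F] := mul_mem (unit_mem h0) (h1 1 0)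
  have hz : x.g 0 1 * (a : F)⁻¹ ∈ 𝒪[F] := mul_mem (h1 0 1) (unit_inv_mem h0)
  have hdet := sl_det x.g
  rw [ha] at hdet
  refine hx.ext_entries (((isSplit_hTilde h0).mul (isSplit_lower hy)).mul (isSplit_upper hz))
    ?_ ?_ ?_ ?_
  · simp [sl_mul, ha]
  · simp [sl_mul]; field_simp
  · simp [sl_mul]
  · simp [sl_mul]
    field_simp
    linear_combination hdet

/-- A split element whose upper right entry is a unit, decomposed through the Weyl element. -/
lemma IsSplit.eq_of_unit' {x : Mp F} (hx : IsSplit x) {b : Fˣ} (hb : x.g 0 1 = b)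
    (h0 : ord b = 0) :
    x = hTilde b * lowerMp (b * x.g 1 1) * (weyl * lowerMp (x.g 0 0 * (b : F)⁻¹)) := by
  have h1 := hx.1
  have hy : (b : F) * x.g 1 1 ∈ 𝒪[F] := mul_mem (unit_mem h0) (h1 1 1)
  have hz : x.g 0 0 * (b : F)⁻¹ ∈ 𝒪[F] := mul_mem (h1 0 0) (unit_inv_mem h0)
  have hdet := sl_det x.g
  rw [hb] at hdet
  refine hx.ext_entries (((isSplit_hTilde h0).mul (isSplit_lower hy)).mul
    (isSplit_weyl.mul (isSplit_lower hz))) ?_ ?_ ?_ ?_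
  · simp [sl_mul]; field_simp
  · simp [sl_mul, hb]
  · simp [sl_mul]
    field_simp
    linear_combination -hdet
  · simp [sl_mul]

/-- The element `(1, ζ) h̃(a)` of the torus. -/
def torusElt (z : ℤˣ) (a : Fˣ) : Tt F := ⟨central z * hTilde a, by
  constructor <;> simp⟩

lemma torusElt_coe (z : ℤˣ) (a : Fˣ) : (torusElt z a : Mp F) = central z * hTilde a := rfl

/-- The Iwasawa decomposition, refined by the two cells of the Iwahori subgroup. -/
lemma iwasawa (g : Mp F) : ∃ (t : Tt F) (y : F),
    (∃ x ∈ 𝒪[F], g = (t : Mp F) * lowerMp y * upperMp x) ∨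
    (∃ z ∈ lat F 1, g = (t : Mp F) * lowerMp y * (weyl * lowerMp z)) := by
  have hdet := sl_det g.g
  by_cases ha : g.g 0 0 ≠ 0 ∧ g.g 0 1 / g.g 0 0 ∈ 𝒪[F]
  · obtain ⟨ha, hx⟩ := ha
    obtain ⟨a, ha'⟩ : ∃ u : Fˣ, (u : F) = g.g 0 0 := ⟨Units.mk0 _ ha, rfl⟩
    set k := hTilde a * lowerMp (a * g.g 1 0) * upperMp (g.g 0 1 / g.g 0 0) with hk
    have hg : g.g = k.g := by
      ext i j
      fin_cases i <;> fin_cases j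
      · simp [hk, sl_mul, ha']
      · simp [hk, sl_mul, ← ha']; rw [ha']; field_simp
      · simp [hk, sl_mul]
      · simp [hk, sl_mul, ← ha']
        field_simp
        linear_combination hdet + g.g 1 1 * ha'
    refine ⟨torusElt (g.ζ * k.ζ) a, a * g.g 1 0, Or.inl ⟨_, hx, ?_⟩⟩
    refine (eq_central_mul hg).trans ?_
    rw [torusElt_coe, hk]
    simp only [mul_assoc]
  · have hb : g.g 0 1 ≠ 0 := by
      intro hb
      have ha' : g.g 0 0 ≠ 0 := fun h => by rw [h, hb] at hdet; simp at hdet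
      exact ha ⟨ha', by rw [hb, zero_div]; exact zero_mem _⟩
    obtain ⟨b, hb'⟩ : ∃ u : Fˣ, (u : F) = g.g 0 1 := ⟨Units.mk0 _ hb, rfl⟩
    have hz : g.g 0 0 / g.g 0 1 ∈ lat F 1 := by
      by_cases h0 : g.g 0 0 = 0
      · rw [h0, zero_div]; exact zero_mem _
      · obtain ⟨a, ha'⟩ : ∃ u : Fˣ, (u : F) = g.g 0 0 := ⟨Units.mk0 _ h0, rfl⟩
        rw [← ha', ← hb', ← Units.val_div_eq_div_val, unit_mem_lat, ord_div]
        by_contra hlt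
        refine ha ⟨h0, ?_⟩
        rw [← ha', ← hb', ← Units.val_div_eq_div_val, ← mem_lat_zero, unit_mem_lat, ord_div]
        omega
    set k := hTilde b * lowerMp (b * g.g 1 1) * (weyl * lowerMp (g.g 0 0 / g.g 0 1)) with hk
    have hg : g.g = k.g := by
      ext i j
      fin_cases i <;> fin_cases j
      · simp [hk, sl_mul, ← hb']; rw [hb']; field_simp
      · simp [hk, sl_mul, hb']
      · simp [hk, sl_mul, ← hb']
        field_simp
        linear_combination -hdet + g.g 1 0 * hb'
      · simp [hk, sl_mul]
    refine ⟨torusElt (g.ζ * k.ζ) b, b * g.g 1 1, Or.inr ⟨_, hz, ?_⟩⟩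
    refine (eq_central_mul hg).trans ?_
    rw [torusElt_coe, hk]
    simp only [mul_assoc]

/-- The entries of the matrix have valuation at least `n`. -/
def EntriesIn (n : ℤ) (A : Matrix (Fin 2) (Fin 2) F) : Prop := ∀ i j, A i j ∈ lat F n

lemma EntriesIn.mul {m n : ℤ} {A B : Matrix (Fin 2) (Fin 2) F} (hA : EntriesIn m A)
    (hB : EntriesIn n B) : EntriesIn (m + n) (A * B) := by
  intro i j
  rw [Matrix.mul_apply]
  exact sum_mem fun k _ => mul_mem_lat (hA i k) (hB k j)

lemma EntriesIn.add {n : ℤ} {A B : Matrix (Fin 2) (Fin 2) F} (hA : EntriesIn n A)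
    (hB : EntriesIn n B) : EntriesIn n (A + B) := fun i j => add_mem (hA i j) (hB i j)

lemma EntriesIn.neg {n : ℤ} {A : Matrix (Fin 2) (Fin 2) F} (hA : EntriesIn n A) :
    EntriesIn n (-A) := fun i j => neg_mem (hA i j)

lemma EntriesIn.anti {m n : ℤ} (h : m ≤ n) {A : Matrix (Fin 2) (Fin 2) F} (hA : EntriesIn n A) :
    EntriesIn m A := fun i j => lat_anti h (hA i j)

lemma entriesIn_zero_iff {g : SpecialLinearGroup (Fin 2) F} :
    EntriesIn 0 g.1 ↔ IsInt g :=
  ⟨fun h i j => mem_lat_zero.1 (h i j), fun h i j => mem_lat_zero.2 (h i j)⟩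

lemma entriesIn_zero_one : EntriesIn 0 (1 : Matrix (Fin 2) (Fin 2) F) :=
  entriesIn_zero_iff (g := 1).2 IsInt.one

lemma mul_sub_one_eq {n : ℤ} {A B : Matrix (Fin 2) (Fin 2) F} (hA : EntriesIn n (A - 1))
    (hB : EntriesIn 0 B) (hB' : EntriesIn n (B - 1)) : EntriesIn n (A * B - 1) := by
  have : A * B - 1 = (A - 1) * B + (B - 1) := by noncomm_ring
  rw [this]
  have h := hA.mul hB
  rw [add_zero] at h
  exact h.add hB'

variable (F) in
/-- The split principal congruence subgroup of level `n`. -/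
def congr (n : ℕ) : Subgroup (Mp F) where
  carrier := {x | IsSplit x ∧ EntriesIn n (x.g.1 - 1)}
  one_mem' := ⟨⟨(Kt F).one_mem, map_one _⟩, fun i j => by simp⟩
  mul_mem' := by
    rintro x y ⟨hx, hx'⟩ ⟨hy, hy'⟩
    exact ⟨hx.mul hy, mul_sub_one_eq hx' (entriesIn_zero_iff.2 hy.1) hy'⟩
  inv_mem' := by
    rintro x ⟨hx, hx'⟩
    refine ⟨hx.inv, ?_⟩
    have h1 : (x⁻¹).g.1 * x.g.1 = 1 := by
      have := congrArg Subtype.val (inv_mul_cancel x.g)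
      exact this
    have h2 : (x⁻¹).g.1 - 1 = -((x⁻¹).g.1 * (x.g.1 - 1)) := by
      rw [mul_sub, h1]; simp
    rw [h2]
    have h3 := (entriesIn_zero_iff.2 hx.inv.1).mul hx'
    rw [zero_add] at h3
    exact h3.neg

lemma congr_anti {m n : ℕ} (h : m ≤ n) : congr F n ≤ congr F m :=
  fun _ hx => ⟨hx.1, hx.2.anti (by exact_mod_cast h)⟩

lemma entries_conj {m : ℤ} {A : Matrix (Fin 2) (Fin 2) F} {k : Mp F} {a b : ℤ}
    (hA : EntriesIn m (A - 1)) (hk : EntriesIn a k.g.1) (hk' : EntriesIn b (k⁻¹).g.1) :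
    EntriesIn (a + m + b) (k.g.1 * A * (k⁻¹).g.1 - 1) := by
  have h1 : k.g.1 * (k⁻¹).g.1 = 1 := congrArg Subtype.val (mul_inv_cancel k.g)
  have h2 : k.g.1 * A * (k⁻¹).g.1 - 1 = k.g.1 * (A - 1) * (k⁻¹).g.1 := by
    rw [mul_sub, sub_mul, mul_one, h1]
  rw [h2]
  exact (hk.mul hA).mul hk'

lemma isSplit_conj {k x : Mp F} (hk : k ∈ Kt F) (hx : IsSplit x) : IsSplit (k * x * k⁻¹) := by
  obtain ⟨h, h'⟩ := hx
  refine ⟨(Kt F).mul_mem ((Kt F).mul_mem hk h) ((Kt F).inv_mem hk), ?_⟩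
  have h1 := map_mul (signK (F := F)) (⟨k, hk⟩ * ⟨x, h⟩) ⟨k, hk⟩⁻¹
  have h2 := map_mul (signK (F := F)) ⟨k, hk⟩ ⟨x, h⟩
  rw [h2, h', mul_one, map_inv, mul_inv_cancel] at h1
  exact h1

lemma congr_conj_Kt {k x : Mp F} (hk : k ∈ Kt F) {n : ℕ} (hx : x ∈ congr F n) :
    k * x * k⁻¹ ∈ congr F n := by
  refine ⟨isSplit_conj hk hx.1, ?_⟩
  have := entries_conj hx.2 (entriesIn_zero_iff.2 hk)
    (entriesIn_zero_iff.2 (show (k⁻¹).g ∈ {g | IsInt g} from (Kt F).inv_mem hk))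
  simpa using this

variable {ϖ : 𝒪[F]}

lemma entries_unif (hϖ : Irreducible ϖ) : EntriesIn (-1) (hTilde (unif hϖ)).g.1 ∧
    EntriesIn (-1) ((hTilde (unif hϖ))⁻¹).g.1 := by
  have h1 : (ϖ : F) ∈ lat F (-1) := unit_mem_lat (u := unif hϖ).2 (by rw [ord_unif]; norm_num)
  have h2 : (ϖ : F)⁻¹ ∈ lat F (-1) := by
    rw [← unif_coe hϖ, ← Units.val_inv_eq_inv_val, unit_mem_lat, ord_inv, ord_unif]
  have h0 := (lat F (-1)).zero_mem
  constructor
  · intro i j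
    fin_cases i <;> fin_cases j
    · exact h1
    · exact h0
    · exact h0
    · change (hTilde (unif hϖ)).g 1 1 ∈ _
      rw [hTilde_11]; exact h2
  · rw [hTilde_inv, central_mul_apply]
    intro i j
    fin_cases i <;> fin_cases j
    · change ((unif hϖ)⁻¹ : Fˣ).val ∈ _
      rw [Units.val_inv_eq_inv_val]; exact h2
    · exact h0
    · exact h0
    · change (hTilde (unif hϖ)⁻¹).g 1 1 ∈ _
      rw [hTilde_11, Units.val_inv_eq_inv_val, inv_inv]; exact h1

lemma Kt_of_sub_one {x : Mp F} (h : EntriesIn 0 (x.g.1 - 1)) : x ∈ Kt F := by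
  have h1 := h.add entriesIn_zero_one
  rw [sub_add_cancel] at h1
  exact entriesIn_zero_iff.1 h1

lemma congr_conj_unif (hϖ : Irreducible ϖ) {x : Mp F} {n : ℕ} (hx : x ∈ congr F (n + 2)) :
    hTilde (unif hϖ) * x * (hTilde (unif hϖ))⁻¹ ∈ congr F n ∧
    (hTilde (unif hϖ))⁻¹ * x * hTilde (unif hϖ) ∈ congr F n := by
  obtain ⟨e1, e2⟩ := entries_unif hϖ
  have f1 := entries_conj (k := hTilde (unif hϖ)) hx.2 e1 e2
  have f2 := entries_conj (k := (hTilde (unif hϖ))⁻¹) hx.2 e2 (by rw [inv_inv]; exact e1)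
  rw [inv_inv] at f2
  have hn : (-1 + ((n + 2 : ℕ) : ℤ) + -1) = n := by push_cast; ring
  rw [hn] at f1 f2
  have g1 : hTilde (unif hϖ) * x * (hTilde (unif hϖ))⁻¹ ∈ Kt F :=
    Kt_of_sub_one (f1.anti (by positivity))
  have g2 : (hTilde (unif hϖ))⁻¹ * x * hTilde (unif hϖ) ∈ Kt F :=
    Kt_of_sub_one (f2.anti (by positivity))
  obtain ⟨⟨hx1, hx2⟩, hx3⟩ := hx
  refine ⟨⟨⟨g1, ?_⟩, f1⟩, ⟨⟨g2, ?_⟩, f2⟩⟩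
  · rw [← hx2]
    refine (conj_facts hϖ (k := ⟨x, hx1⟩) (l := ⟨_, g1⟩) ?_).1.symm
    change x * _ = _ * (_ * _ * _)
    group
  · rw [← hx2]
    refine (conj_facts hϖ (k := ⟨_, g2⟩) (l := ⟨x, hx1⟩) ?_).1
    change (_ * _ * _) * _ = _ * x
    group

/-- A subgroup containing the maximal compact subgroup and `h̃(ϖ)` is everything. -/
lemma subgroup_eq_top (hϖ : Irreducible ϖ) {H : Subgroup (Mp F)} (hK : Kt F ≤ H)
    (ht : hTilde (unif hϖ) ∈ H) : H = ⊤ := by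
  have hc : ∀ z : ℤˣ, (central z : Mp F) ∈ H := fun z => hK (central_mem z)
  have hmul : ∀ a b : Fˣ, hTilde a ∈ H → hTilde b ∈ H → hTilde (a * b) ∈ H := by
    intro a b ha hb
    have : hTilde (a * b) = central (hilb a b) * (hTilde a * hTilde b) := by
      rw [hTilde_mul, ← mul_assoc, central_sq, one_mul]
    rw [this]
    exact H.mul_mem (hc _) (H.mul_mem ha hb)
  have hinv : ∀ a : Fˣ, hTilde a ∈ H → hTilde a⁻¹ ∈ H := by
    intro a ha
    have : hTilde a⁻¹ = central (hilb a (-1)) * (hTilde a)⁻¹ := by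
      rw [hTilde_inv, ← mul_assoc, central_sq, one_mul]
    rw [this]
    exact H.mul_mem (hc _) (H.inv_mem ha)
  have hpow : ∀ n : ℕ, hTilde (unif hϖ ^ n) ∈ H := by
    intro n
    induction n with
    | zero => rw [pow_zero, hTilde_one]; exact H.one_mem
    | succ n ih => rw [pow_succ]; exact hmul _ _ ih ht
  have hzpow : ∀ n : ℤ, hTilde (unif hϖ ^ n) ∈ H := by
    intro n
    obtain ⟨n, rfl | rfl⟩ := n.eq_nat_or_neg
    · rw [zpow_natCast]; exact hpow n
    · rw [_root_.zpow_neg, zpow_natCast]; exact hinv _ (hpow n)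
  have hall : ∀ a : Fˣ, hTilde a ∈ H := by
    intro a
    have h1 : a = unif hϖ ^ ord a * (unif hϖ ^ (-ord a) * a) := by
      rw [← mul_assoc, ← _root_.zpow_add, add_neg_cancel, zpow_zero, one_mul]
    rw [h1]
    refine hmul _ _ (hzpow _) (hK ?_)
    refine (isSplit_hTilde ?_).1
    rw [ord_mul, ord_zpow, ord_unif]; ring
  have hlow : ∀ y : F, lowerMp y ∈ H := by
    intro y
    obtain ⟨a, ha⟩ : ∃ a : Fˣ, (a : F) * a * y ∈ 𝒪[F] := by
      by_cases hy : y = 0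
      · exact ⟨1, by rw [hy]; simp⟩
      · obtain ⟨u, rfl⟩ : ∃ u : Fˣ, (u : F) = y := ⟨Units.mk0 y hy, rfl⟩
        refine ⟨unif hϖ ^ |ord u|, ?_⟩
        rw [← Units.val_mul, ← Units.val_mul, ← mem_lat_zero, unit_mem_lat, ord_mul, ord_mul,
          ord_zpow, ord_unif]
        have := neg_abs_le (ord u)
        have := abs_nonneg (ord u)
        omega
    have h1 : lowerMp y = hTilde a * lowerMp (a * a * y) * (hTilde a)⁻¹ := by
      rw [← lower_mul_hTilde, mul_inv_cancel_right]
    rw [h1]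
    exact H.mul_mem (H.mul_mem (hall a) (hK (isSplit_lower ha).1)) (H.inv_mem (hall a))
  have htor : ∀ t : Tt F, (t : Mp F) ∈ H := fun t => by
    rw [torus_eq]; exact H.mul_mem (hc _) (hall _)
  rw [eq_top_iff]
  intro g _
  obtain ⟨t, y, ⟨x, hx, rfl⟩ | ⟨z, hz, rfl⟩⟩ := iwasawa g
  · exact H.mul_mem (H.mul_mem (htor t) (hlow y)) (hK (isSplit_upper hx).1)
  · exact H.mul_mem (H.mul_mem (htor t) (hlow y))
      (hK (isSplit_weyl.mul (isSplit_lower (lat_int zero_le_one hz))).1)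

/-- Conjugation is continuous for the filtration by congruence subgroups. -/
lemma congr_conj (g : Mp F) (n : ℕ) : ∃ m, ∀ x ∈ congr F m, g * x * g⁻¹ ∈ congr F n := by
  obtain ⟨ϖ, hϖ⟩ := IsDiscreteValuationRing.exists_irreducible 𝒪[F]
  let H : Subgroup (Mp F) :=
    { carrier := {g | (∀ n : ℕ, ∃ m, ∀ x ∈ congr F m, g * x * g⁻¹ ∈ congr F n) ∧
        ∀ n : ℕ, ∃ m, ∀ x ∈ congr F m, g⁻¹ * x * g⁻¹⁻¹ ∈ congr F n}
      one_mem' := ⟨fun n => ⟨n, fun x hx => by simpa using hx⟩,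
        fun n => ⟨n, fun x hx => by simpa using hx⟩⟩
      mul_mem' := by
        rintro a b ⟨ha, ha'⟩ ⟨hb, hb'⟩
        constructor
        · intro n
          obtain ⟨m, hm⟩ := ha n
          obtain ⟨l, hl⟩ := hb m
          refine ⟨l, fun x hx => ?_⟩
          have := hm _ (hl x hx)
          rwa [show a * b * x * (a * b)⁻¹ = a * (b * x * b⁻¹) * a⁻¹ by group]
        · intro n
          obtain ⟨m, hm⟩ := hb' n
          obtain ⟨l, hl⟩ := ha' m
          refine ⟨l, fun x hx => ?_⟩
          have := hm _ (hl x hx)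
          rwa [show (a * b)⁻¹ * x * (a * b)⁻¹⁻¹ = b⁻¹ * (a⁻¹ * x * a⁻¹⁻¹) * b⁻¹⁻¹ by group]
      inv_mem' := by
        rintro a ⟨ha, ha'⟩
        exact ⟨ha', by simpa using ha⟩ }
  have hH : H = ⊤ := by
    refine subgroup_eq_top hϖ (fun k hk => ⟨fun n => ⟨n, fun x hx => congr_conj_Kt hk hx⟩,
      fun n => ⟨n, fun x hx => congr_conj_Kt ((Kt F).inv_mem hk) hx⟩⟩) ⟨fun n => ⟨n + 2,
        fun x hx => (congr_conj_unif hϖ hx).1⟩, fun n => ⟨n + 2, fun x hx => ?_⟩⟩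
    rw [inv_inv]
    exact (congr_conj_unif hϖ hx).2
  have hg : g ∈ H := hH ▸ Subgroup.mem_top g
  exact hg.1 n

end Compact

/-! ### The topology of the double cover -/

section Topology

open Filter Topology

variable {F : Type*} [Field F] [ValuativeRel F] [TopologicalSpace F]
  [IsNonarchimedeanLocalField F]

lemma exists_ord_eq (n : ℤ) : ∃ u : Fˣ, ord u = n := by
  obtain ⟨u, hu⟩ := exists_ord_eq_one (F := F)
  exact ⟨u ^ n, by rw [ord_zpow, hu, mul_one]⟩

lemma lat_mem_nhds (n : ℤ) : (lat F n : Set F) ∈ 𝓝 (0 : F) := by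
  obtain ⟨u, hu⟩ := exists_ord_eq (F := F) n
  refine (IsValuativeTopology.hasBasis_nhds_zero' F).mem_iff.2
    ⟨valuation F (u : F), by simp, fun x hx v hv => ?_⟩
  rw [← hu, ord_le_ord_iff, hv]
  exact le_of_lt hx

lemma isOpen_lat (n : ℤ) : IsOpen (lat F n : Set F) :=
  AddSubgroup.isOpen_of_mem_nhds _ (lat_mem_nhds n)

lemma exists_lat_subset {U : Set F} (hU : U ∈ 𝓝 (0 : F)) :
    ∃ n : ℕ, (lat F n : Set F) ⊆ U := by
  obtain ⟨γ, hγ, h⟩ := (IsValuativeTopology.hasBasis_nhds_zero' F).mem_iff.1 hU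
  obtain ⟨x, rfl⟩ := ValuativeRel.valuation_surjective γ
  have hx : x ≠ 0 := fun h => hγ (by rw [h, map_zero])
  obtain ⟨u, rfl⟩ : ∃ u : Fˣ, (u : F) = x := ⟨Units.mk0 x hx, rfl⟩
  refine ⟨(ord u + 1).toNat, fun y hy => h ?_⟩
  change valuation F y < valuation F (u : F)
  by_cases hy0 : y = 0
  · rw [hy0, map_zero]; exact zero_lt_iff.2 hγ
  · obtain ⟨v, rfl⟩ : ∃ v : Fˣ, (v : F) = y := ⟨Units.mk0 y hy0, rfl⟩
    have h1 := unit_mem_lat.1 hy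
    rw [← not_le, ← ord_le_ord_iff]
    have := Int.self_le_toNat (ord u + 1)
    omega

lemma isSplit_splitK (k : {k : Matrix.SpecialLinearGroup (Fin 2) F // IsInt k}) :
    IsSplit (splitK k) := ⟨k.2, Int.units_mul_self _⟩

lemma splitK_eq {x : Mp F} (hx : IsSplit x) : splitK ⟨x.g, hx.1⟩ = x :=
  (isSplit_splitK _).ext hx rfl

variable (F) in
/-- The split congruence subgroups form a basis of neighbourhoods of the identity for a group
topology. -/
@[reducible]
def congrBasis : GroupFilterBasis (Mp F) where
  sets := Set.range fun n => (congr F n : Set (Mp F))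
  nonempty := Set.range_nonempty _
  inter_sets := by
    rintro _ _ ⟨m, rfl⟩ ⟨n, rfl⟩
    exact ⟨_, ⟨max m n, rfl⟩, Set.subset_inter (congr_anti (le_max_left _ _))
      (congr_anti (le_max_right _ _))⟩
  one' := by rintro _ ⟨n, rfl⟩; exact (congr F n).one_mem
  mul' := by
    rintro _ ⟨n, rfl⟩
    exact ⟨_, ⟨n, rfl⟩, by rintro _ ⟨a, ha, b, hb, rfl⟩; exact (congr F n).mul_mem ha hb⟩
  inv' := by
    rintro _ ⟨n, rfl⟩
    exact ⟨_, ⟨n, rfl⟩, fun x hx => (congr F n).inv_mem hx⟩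
  conj' := by
    rintro g _ ⟨n, rfl⟩
    obtain ⟨m, hm⟩ := congr_conj g n
    exact ⟨_, ⟨m, rfl⟩, fun x hx => hm x hx⟩

lemma continuous_splitK_congrBasis :
    @Continuous _ _ _ (congrBasis F).topology (splitK (F := F)) := by
  let := (congrBasis F).topology
  rw [continuous_iff_continuousAt]
  intro k
  have hb := (congrBasis F).nhds_hasBasis (splitK k)
  rw [ContinuousAt, hb.tendsto_right_iff]
  rintro _ ⟨n, rfl⟩
  have hc : Continuous fun l : {k : Matrix.SpecialLinearGroup (Fin 2) F // IsInt k} =>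
      (k.1⁻¹).1 * l.1.1 - 1 :=
    (continuous_const.mul
      (continuous_subtype_val.comp (continuous_subtype_val (p := IsInt (F := F))))).sub
      continuous_const
  have h0 : (k.1⁻¹).1 * k.1.1 - 1 = 0 := by
    rw [sub_eq_zero]; exact congrArg Subtype.val (inv_mul_cancel k.1)
  have hev : ∀ i j, ∀ᶠ l in 𝓝 k, ((k.1⁻¹).1 * l.1.1 - 1) i j ∈ lat F n := by
    intro i j
    have h1 : Continuous fun l : {k : Matrix.SpecialLinearGroup (Fin 2) F // IsInt k} =>
        ((k.1⁻¹).1 * l.1.1 - 1) i j := (continuous_apply_apply i j).comp hc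
    refine h1.continuousAt.eventually_mem ?_
    rw [h0]
    exact lat_mem_nhds n
  have hev' : ∀ᶠ l in 𝓝 k, EntriesIn n ((k.1⁻¹).1 * l.1.1 - 1) := by
    simp only [EntriesIn, eventually_all]
    exact hev
  filter_upwards [hev'] with l hl
  exact ⟨(splitK k)⁻¹ * splitK l, ⟨(isSplit_splitK k).inv.mul (isSplit_splitK l), hl⟩,
    mul_inv_cancel_left _ _⟩

/-- The split congruence subgroups are open. -/
lemma isOpen_congr (n : ℕ) : IsOpen (congr F n : Set (Mp F)) := by
  let b : GroupTopology (Mp F) :=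
    { toTopologicalSpace := (congrBasis F).topology
      toIsTopologicalGroup := (congrBasis F).isTopologicalGroup }
  have h : GroupTopology.coinduced (splitK (F := F)) ≤ b := by
    rw [← GroupTopology.toTopologicalSpace_le]
    refine sInf_le ⟨b, ?_, rfl⟩
    exact continuous_iff_coinduced_le.1 continuous_splitK_congrBasis
  have h1 : IsOpen[b.toTopologicalSpace] (congr F n : Set (Mp F)) := by
    let := (congrBasis F).topology
    have := (congrBasis F).isTopologicalGroup
    exact Subgroup.isOpen_of_mem_nhds _ ((congrBasis F).mem_nhds_one ⟨n, rfl⟩)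
  exact h _ h1

lemma continuous_splitK : Continuous (splitK (F := F)) := GroupTopology.coinduced_continuous _

/-- Every neighbourhood of the identity contains a split congruence subgroup. -/
lemma exists_congr_subset {U : Set (Mp F)} (hU : U ∈ 𝓝 (1 : Mp F)) :
    ∃ n : ℕ, (congr F n : Set (Mp F)) ⊆ U := by
  by_contra hcon
  push Not at hcon
  simp only [Set.not_subset] at hcon
  choose x hx hxU using hcon
  let k : ℕ → {k : Matrix.SpecialLinearGroup (Fin 2) F // IsInt k} := fun n =>
    ⟨(x n).g, (hx n).1.1⟩
  have hk : Tendsto k atTop (𝓝 ⟨1, IsInt.one⟩) := by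
    rw [tendsto_subtype_rng]
    refine tendsto_subtype_rng.2 ?_
    refine tendsto_pi_nhds.2 fun i => tendsto_pi_nhds.2 fun j => ?_
    have h1 : Tendsto (fun n => ((x n).g.1 - 1) i j) atTop (𝓝 0) := by
      rw [tendsto_def]
      intro s hs
      obtain ⟨N, hN⟩ := exists_lat_subset hs
      filter_upwards [eventually_ge_atTop N] with n hn
      exact hN (lat_anti (by exact_mod_cast hn) ((hx n).2 i j))
    have h2 := h1.add_const ((1 : Matrix (Fin 2) (Fin 2) F) i j)
    rw [zero_add] at h2
    refine h2.congr fun n => ?_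
    rw [Matrix.sub_apply, sub_add_cancel]
  have h1 := (continuous_splitK.tendsto (⟨1, IsInt.one⟩ : {k // IsInt (F := F) k})).comp hk
  have h2 : splitK (⟨1, IsInt.one⟩ : {k // IsInt (F := F) k}) = 1 :=
    splitK_eq (x := 1) ⟨(Kt F).one_mem, map_one _⟩
  rw [h2] at h1
  obtain ⟨n, hn⟩ := (h1.eventually_mem hU).exists
  refine hxU n ?_
  have : (splitK ∘ k) n = x n := splitK_eq (hx n).1
  rwa [this] at hn

variable {V : Type*}

lemma smooth_iff {f : Mp F → V} :
    Smooth f ↔ ∃ n : ℕ, ∀ u ∈ congr F n, ∀ x, f (x * u) = f x := by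
  constructor
  · rintro ⟨U, hU, h⟩
    obtain ⟨n, hn⟩ := exists_congr_subset (hU.mem_nhds U.one_mem)
    exact ⟨n, fun u hu => h u (hn hu)⟩
  · rintro ⟨n, hn⟩
    exact ⟨congr F n, isOpen_congr n, hn⟩

lemma lower_mem_congr {n : ℕ} {y : F} (hy : y ∈ lat F n) : lowerMp y ∈ congr F n := by
  refine ⟨isSplit_lower (lat_int (by positivity) hy), fun i j => ?_⟩
  fin_cases i <;> fin_cases j <;> simp
  exact hy

lemma upper_mem_congr {n : ℕ} {y : F} (hy : y ∈ lat F n) : upperMp y ∈ congr F n := by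
  refine ⟨isSplit_upper (lat_int (by positivity) hy), fun i j => ?_⟩
  fin_cases i <;> fin_cases j <;> simp
  exact hy

lemma inv_sub_one_mem {a : Fˣ} (ha : ord a = 0) {n : ℤ} (h : (a : F) - 1 ∈ lat F n) :
    (a : F)⁻¹ - 1 ∈ lat F n := by
  have : (a : F)⁻¹ - 1 = -((a : F)⁻¹ * (a - 1)) := by field_simp; ring
  rw [this]
  exact neg_mem (int_mul_mem_lat (unit_inv_mem ha) h)

end Topology

/-! ### Functions in the principal series -/

section PrincipalSeriesFunctions

variable {F : Type*} [Field F] [ValuativeRel F] [TopologicalSpace F]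
  [IsNonarchimedeanLocalField F] {E : Type*} [Field E]

/-- The character of the torus is genuine and trivial on the elements `h̃(a)` with
`a ≡ 1` modulo the maximal ideal. -/
structure IsTameGenuine (χ : Tt F →* Eˣ) : Prop where
  genuine : χ (negOne F) = -1
  tame : ∀ a : Fˣ, ord a = 0 → (a : F) - 1 ∈ lat F 1 → χ (hTorus a) = 1

/-- The underlying space of the principal series of a character with values in `Eˣ`. -/
abbrev PS (χ : Tt F →* Eˣ) : Submodule E (Mp F → E) := psSpace fun t => (χ t : E)

lemma signE_one : signE E 1 = 1 := map_one _

lemma signE_neg_one : signE E (-1) = -1 := by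
  change ((((-1 : ℤˣ) : ℤ)) : E) = -1
  simp

variable {χ : Tt F →* Eˣ}

lemma char_torusElt (hχ : IsTameGenuine χ) (z : ℤˣ) (a : Fˣ) :
    (χ (torusElt z a) : E) = signE E z * χ (hTorus a) := by
  rcases Int.units_eq_one_or z with rfl | rfl
  · rw [signE_one, one_mul]
    congr 2
    ext1
    rw [torusElt_coe, central_one, one_mul]; rfl
  · have : torusElt (-1) a = negOne F * hTorus a := by
      ext1
      rfl
    rw [this, map_mul, hχ.genuine, signE_neg_one]
    simp

lemma char_mul (hχ : IsTameGenuine χ) (a b : Fˣ) :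
    (χ (hTorus a) : E) * χ (hTorus b) = signE E (hilb a b) * χ (hTorus (a * b)) := by
  rw [← char_torusElt hχ, ← Units.val_mul, ← map_mul]
  congr 2
  ext1
  exact hTilde_mul a b

lemma char_mul_units (hχ : IsTameGenuine χ) {a b : Fˣ} (ha : ord a = 0) (hb : ord b = 0) :
    (χ (hTorus a) : E) * χ (hTorus b) = χ (hTorus (a * b)) := by
  rw [char_mul hχ, hilb_units ha hb, signE_one, one_mul]

lemma sub_one_mem_of_sub_mem {a b : Fˣ} (hb : ord b = 0) {n : ℤ}
    (h : (a : F) - b ∈ lat F n) : ((a / b : Fˣ) : F) - 1 ∈ lat F n := by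
  have : ((a / b : Fˣ) : F) - 1 = (b : F)⁻¹ * (a - b) := by
    rw [Units.val_div_eq_div_val]; field_simp
  rw [this]
  exact int_mul_mem_lat (unit_inv_mem hb) h

lemma char_congr (hχ : IsTameGenuine χ) {a b : Fˣ} (ha : ord a = 0) (hb : ord b = 0)
    (h : (a : F) - b ∈ lat F 1) : χ (hTorus a) = χ (hTorus b) := by
  have h0 : ord (a / b) = 0 := by rw [ord_div, ha, hb]; rfl
  ext
  have := char_mul_units hχ h0 hb
  rw [hχ.tame _ h0 (sub_one_mem_of_sub_mem hb h), div_mul_cancel, Units.val_one, one_mul] at this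
  exact this.symm

section Basic

variable {f : Mp F → E}

lemma ps_torus_lower (hf : f ∈ PS χ) (t : Tt F) (y : F) (g : Mp F) :
    f ((t : Mp F) * lowerMp y * g) = χ t * f g := hf.1 t y g

lemma ps_torus (hf : f ∈ PS χ) (t : Tt F) (g : Mp F) :
    f ((t : Mp F) * g) = χ t * f g := by
  have := hf.1 t 0 g
  rwa [lowerMp_zero, mul_one] at this

lemma ps_hTilde (hf : f ∈ PS χ) (a : Fˣ) (g : Mp F) :
    f (hTilde a * g) = χ (hTorus a) * f g := ps_torus hf (hTorus a) g

lemma ps_lower (hf : f ∈ PS χ) (y : F) (g : Mp F) : f (lowerMp y * g) = f g := by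
  have := ps_torus_lower hf 1 y g
  rwa [Subgroup.coe_one, one_mul, map_one, Units.val_one, one_mul] at this

lemma ps_central (hχ : IsTameGenuine χ) (hf : f ∈ PS χ) (z : ℤˣ) (g : Mp F) :
    f (central z * g) = signE E z * f g := by
  have h := ps_torus hf (torusElt z 1) g
  have h1 : χ (hTorus (1 : Fˣ)) = 1 := by
    rw [← map_one χ]; congr 1; ext1; exact hTilde_one
  rw [char_torusElt hχ, h1, torusElt_coe, hTilde_one, mul_one, Units.val_one, mul_one] at h
  exact h

/-- Value of a function of the principal series on split elements in the small cell. -/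
lemma ps_split' (hf : f ∈ PS χ) {k : Mp F} (hk : IsSplit k) {b : Fˣ} (hb : k.g 0 1 = b)
    (h0 : ord b = 0) (g : Mp F) :
    f (k * g) = χ (hTorus b) * f (weyl * (lowerMp (k.g 0 0 * (b : F)⁻¹) * g)) := by
  conv_lhs => rw [hk.eq_of_unit' hb h0]
  rw [mul_assoc, mul_assoc weyl]
  exact ps_torus_lower hf (hTorus b) _ _

/-- A function of the principal series is determined by its values on `u(𝒪)` and on `w ū(ϖ𝒪)`,
by the Iwasawa decomposition and the Bruhat decomposition over the residue field. -/
lemma ps_ext {f' : Mp F → E} (hf : f ∈ PS χ) (hf' : f' ∈ PS χ)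
    (h1 : ∀ x ∈ 𝒪[F], f (upperMp x) = f' (upperMp x))
    (h2 : ∀ z ∈ lat F 1, f (weyl * lowerMp z) = f' (weyl * lowerMp z)) : f = f' := by
  funext g
  obtain ⟨t, y, ⟨x, hx, rfl⟩ | ⟨z, hz, rfl⟩⟩ := iwasawa g
  · rw [ps_torus_lower hf, ps_torus_lower hf', h1 x hx]
  · rw [ps_torus_lower hf, ps_torus_lower hf', h2 z hz]

/-- Value on an upper unipotent element, computed through the opposite cell. -/
lemma ps_upper (hf : f ∈ PS χ) (x : Fˣ) (g : Mp F) :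
    f (upperMp (x : F) * g) = χ (hTorus x) * f (weyl * (lowerMp (x : F)⁻¹ * g)) := by
  rw [upper_eq, mul_assoc, ps_lower hf, mul_assoc, ps_hTilde hf, mul_assoc]

lemma ps_weyl_lower_hTilde (hf : f ∈ PS χ) (z : F) (a : Fˣ) (g : Mp F) :
    f (weyl * (lowerMp z * (hTilde a * g))) =
      χ (hTorus a⁻¹) * f (weyl * (lowerMp (a * a * z) * g)) := by
  rw [← mul_assoc (lowerMp z), lower_mul_hTilde, mul_assoc, ← mul_assoc weyl, weyl_mul_hTilde,
    mul_assoc, ps_hTilde hf]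

end Basic

/-! ### The function supported on the big Iwahori cell -/

/-- The function of the principal series supported on the big cell of the Iwahori subgroup (the
elements whose first row `(a, b)` satisfies `b / a ∈ 𝒪`), normalised by the value `1` at the
identity. -/
def cellFun (χ : Tt F →* Eˣ) (g : Mp F) : E :=
  open scoped Classical in
  if h : ∃ (t : Tt F), ∃ (y : F), ∃ x ∈ 𝒪[F], g = (t : Mp F) * lowerMp y * upperMp x then
    χ h.choose else 0

lemma torus_00_ne (t : Tt F) : t.1.g 0 0 ≠ 0 := (torusCoord t).ne_zero

lemma cell_unique {t t' : Tt F} {y y' x x' : F}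
    (h : (t : Mp F) * lowerMp y * upperMp x = (t' : Mp F) * lowerMp y' * upperMp x') :
    t = t' := by
  have h00 := congrArg (fun g : Mp F => g.g 0 0) h
  have h01 := congrArg (fun g : Mp F => g.g 0 1) h
  have h10 := congrArg (fun g : Mp F => g.g 1 0) h
  simp only [Mp.mul_g, sl_mul, upperMp_00, upperMp_01, upperMp_10, upperMp_11, lowerMp_00,
    lowerMp_01, lowerMp_10, lowerMp_11, t.2.1, t.2.2, t'.2.1, t'.2.2, mul_one, mul_zero, zero_mul,
    add_zero, zero_add] at h00 h01 h10
  rw [h00] at h01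
  have hx : x = x' := mul_left_cancel₀ (torus_00_ne t') h01
  have hd := sl_det t.1.g
  have hd' := sl_det t'.1.g
  rw [t.2.1, zero_mul, sub_zero] at hd
  rw [t'.2.1, zero_mul, sub_zero, ← h00] at hd'
  have h11 : t.1.g 1 1 = t'.1.g 1 1 := mul_left_cancel₀ (torus_00_ne t) (hd.trans hd'.symm)
  rw [h11] at h10
  have hy : y = y' := mul_left_cancel₀ (right_ne_zero_of_mul_eq_one hd') h10
  rw [hx, hy] at h
  ext1
  exact mul_right_cancel (mul_right_cancel h)

lemma cellFun_cell (t : Tt F) (y : F) {x : F} (hx : x ∈ 𝒪[F]) :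
    cellFun χ ((t : Mp F) * lowerMp y * upperMp x) = χ t := by
  have h : ∃ (t' : Tt F), ∃ (y' : F), ∃ x' ∈ 𝒪[F],
      (t : Mp F) * lowerMp y * upperMp x = (t' : Mp F) * lowerMp y' * upperMp x' :=
    ⟨t, y, x, hx, rfl⟩
  rw [cellFun, dif_pos h]
  obtain ⟨y', x', -, h'⟩ := h.choose_spec
  rw [← cell_unique h']

/-- `cellFun` vanishes on the small Iwahori cell: an element of both cells would have a first row
`(a, b)` with `b / a ∈ 𝒪` and `a / b ∈ ϖ𝒪`. -/
lemma cellFun_weyl (t : Tt F) (y : F) {z : F} (hz : z ∈ lat F 1) :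
    cellFun χ ((t : Mp F) * lowerMp y * (weyl * lowerMp z)) = 0 := by
  rw [cellFun, dif_neg]
  rintro ⟨t', y', x', hx', h⟩
  have h00 := congrArg (fun g : Mp F => g.g 0 0) h
  have h01 := congrArg (fun g : Mp F => g.g 0 1) h
  simp only [Mp.mul_g, sl_mul, upperMp_00, upperMp_01, upperMp_10, upperMp_11, lowerMp_00,
    lowerMp_01, lowerMp_10, lowerMp_11, weyl_00, weyl_01, weyl_10, weyl_11,
    t.2.1, t'.2.1, mul_one, mul_zero, zero_mul, add_zero, zero_add, one_mul] at h00 h01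
  rw [← h00, mul_assoc] at h01
  have h1 : 1 = z * x' := mul_left_cancel₀ (torus_00_ne t) (by rw [mul_one]; exact h01)
  have h2 := int_mul_mem_lat hx' hz
  rw [mul_comm, ← h1, mem_lat_one (one_mem _), red_one] at h2
  exact one_ne_zero h2

lemma lower_mul_torus (t : Tt F) (y : F) :
    ∃ y', lowerMp y * (t : Mp F) = (t : Mp F) * lowerMp y' := by
  refine ⟨torusCoord t * torusCoord t * y, ?_⟩
  rw [torus_eq t, ← mul_assoc, ← central_comm, mul_assoc, lower_mul_hTilde]
  simp only [mul_assoc]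

lemma cellFun_equivariant (t : Tt F) (y : F) (g : Mp F) :
    cellFun χ ((t : Mp F) * lowerMp y * g) = χ t * cellFun χ g := by
  obtain ⟨t', y', ⟨x, hx, rfl⟩ | ⟨z, hz, rfl⟩⟩ := iwasawa g
  · obtain ⟨y'', h⟩ := lower_mul_torus t' y
    have : (t : Mp F) * lowerMp y * ((t' : Mp F) * lowerMp y' * upperMp x) =
        ((t * t' : Tt F) : Mp F) * lowerMp (y'' + y') * upperMp x := by
      rw [lowerMp_add, Subgroup.coe_mul, mul_assoc, mul_assoc, mul_assoc, ← mul_assoc (lowerMp y),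
        h]
      simp only [mul_assoc]
    rw [this, cellFun_cell _ _ hx, cellFun_cell _ _ hx, map_mul, Units.val_mul]
  · obtain ⟨y'', h⟩ := lower_mul_torus t' y
    have : (t : Mp F) * lowerMp y * ((t' : Mp F) * lowerMp y' * (weyl * lowerMp z)) =
        ((t * t' : Tt F) : Mp F) * lowerMp (y'' + y') * (weyl * lowerMp z) := by
      rw [lowerMp_add, Subgroup.coe_mul, mul_assoc, mul_assoc, mul_assoc, ← mul_assoc (lowerMp y),
        h]
      simp only [mul_assoc]
    rw [this, cellFun_weyl _ _ hz, cellFun_weyl _ _ hz, mul_zero]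

/-- Invariance of a function under right translation by the generators of the pro-`p` Iwahori
subgroup. -/
structure IwahoriInv (f : Mp F → E) : Prop where
  upper : ∀ x ∈ 𝒪[F], ∀ g, f (g * upperMp x) = f g
  lower : ∀ z ∈ lat F 1, ∀ g, f (g * lowerMp z) = f g
  diag : ∀ a : Fˣ, ord a = 0 → (a : F) - 1 ∈ lat F 1 → ∀ g, f (g * hTilde a) = f g

lemma exists_unit_of_sub_one {x : F} (h : x - 1 ∈ lat F 1) :
    ∃ a : Fˣ, (a : F) = x ∧ ord a = 0 := by
  have hx : x ∈ 𝒪[F] := by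
    have := add_mem (lat_int zero_le_one h) (one_mem 𝒪[F])
    rwa [sub_add_cancel] at this
  refine exists_unit_of_red_ne hx ?_
  rw [(sub_mem_lat_one hx (one_mem _)).1 h, red_one]
  exact one_ne_zero

lemma smooth_of_iwahoriInv {f : Mp F → E} (h : IwahoriInv f) : Smooth f := by
  refine smooth_iff.2 ⟨1, fun u hu x => ?_⟩
  obtain ⟨hs, hu⟩ := hu
  have h00 : u.g 0 0 - 1 ∈ lat F 1 := by simpa using hu 0 0
  have h10 : u.g 1 0 ∈ lat F 1 := by simpa using hu 1 0
  obtain ⟨a, ha, h0⟩ := exists_unit_of_sub_one h00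
  rw [hs.eq_of_unit ha.symm h0, ← mul_assoc, ← mul_assoc, h.upper, h.lower, h.diag a h0]
  · rwa [ha]
  · exact int_mul_mem_lat (unit_mem h0) h10
  · exact mul_mem (hs.1 0 1) (unit_inv_mem h0)

lemma one_add_sub_one_mem {x z : F} (hx : x ∈ 𝒪[F]) (hz : z ∈ lat F 1) :
    (1 + x * z) - 1 ∈ lat F 1 := by
  rw [add_sub_cancel_left]; exact int_mul_mem_lat hx hz

lemma cellFun_mul_upper {x : F} (hx : x ∈ 𝒪[F]) (g : Mp F) :
    cellFun χ (g * upperMp x) = cellFun χ g := by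
  obtain ⟨t, y, ⟨x', hx', rfl⟩ | ⟨z, hz, rfl⟩⟩ := iwasawa g
  · rw [mul_assoc, ← upperMp_add, cellFun_cell _ _ (add_mem hx' hx), cellFun_cell _ _ hx']
  · obtain ⟨b, hb, h0⟩ := exists_unit_of_sub_one (one_add_sub_one_mem hx hz)
    have hs : IsSplit (weyl * lowerMp z * upperMp x) :=
      (isSplit_weyl.mul (isSplit_lower (lat_int zero_le_one hz))).mul (isSplit_upper hx)
    have hb' : (weyl * lowerMp z * upperMp x).g 0 1 = (b : F) := by
      simp [sl_mul, hb]; ring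
    have ha' : (weyl * lowerMp z * upperMp x).g 0 0 = z := by simp [sl_mul]
    have h1 := hs.eq_of_unit' hb' h0
    rw [cellFun_weyl _ _ hz, mul_assoc ((t : Mp F) * lowerMp y), h1, cellFun_equivariant]
    have h2 := cellFun_weyl (χ := χ) (hTorus b) (b * (weyl * lowerMp z * upperMp x).g 1 1)
      (z := z * (b : F)⁻¹) (by rw [mul_comm]; exact int_mul_mem_lat (unit_inv_mem h0) hz)
    rw [ha']
    exact mul_eq_zero_of_right _ h2

lemma cellFun_mul_hTilde {a : Fˣ} (ha : ord a = 0) (g : Mp F) :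
    cellFun χ (g * hTilde a) = χ (hTorus a) * cellFun χ g := by
  obtain ⟨t, y, ⟨x, hx, rfl⟩ | ⟨z, hz, rfl⟩⟩ := iwasawa g
  · rw [mul_assoc, upper_mul_hTilde, mul_assoc, ← mul_assoc (lowerMp y), lower_mul_hTilde,
      mul_assoc]
    have hx' : x / ((a : F) * a) ∈ 𝒪[F] := by
      rw [div_eq_mul_inv, mul_inv]
      exact mul_mem hx (mul_mem (unit_inv_mem ha) (unit_inv_mem ha))
    have h1 := cellFun_cell (χ := χ) (t * hTorus a) (a * a * y) hx'
    rw [Subgroup.coe_mul] at h1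
    change cellFun χ (t * hTilde a * _ * _) = _ at h1
    simp only [mul_assoc] at h1 ⊢
    rw [h1]
    have h2 := cellFun_cell (χ := χ) t y hx
    rw [mul_assoc] at h2
    rw [h2, map_mul, Units.val_mul, mul_comm]
  · have hz' : (a : F) * a * z ∈ lat F 1 :=
      int_mul_mem_lat (mul_mem (unit_mem ha) (unit_mem ha)) hz
    rw [cellFun_weyl _ _ hz, mul_zero, mul_assoc ((t : Mp F) * lowerMp y), cellFun_equivariant,
      mul_assoc, lower_mul_hTilde, ← mul_assoc, weyl_mul_hTilde, mul_assoc]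
    have h1 := cellFun_weyl (χ := χ) (hTorus a⁻¹) 0 hz'
    rw [lowerMp_zero, mul_one] at h1
    exact mul_eq_zero_of_right _ h1

lemma cellFun_mul_lower (hχ : IsTameGenuine χ) {z : F} (hz : z ∈ lat F 1) (g : Mp F) :
    cellFun χ (g * lowerMp z) = cellFun χ g := by
  obtain ⟨t, y, ⟨x, hx, rfl⟩ | ⟨z', hz', rfl⟩⟩ := iwasawa g
  · obtain ⟨a, ha, h0⟩ := exists_unit_of_sub_one (one_add_sub_one_mem hx hz)
    have hs : IsSplit (upperMp x * lowerMp z) :=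
      (isSplit_upper hx).mul (isSplit_lower (lat_int zero_le_one hz))
    have ha' : (upperMp x * lowerMp z).g 0 0 = a := by simp [sl_mul, ha]
    rw [cellFun_cell _ _ hx, mul_assoc, hs.eq_of_unit ha' h0, cellFun_equivariant]
    have h2 := cellFun_cell (χ := χ) (hTorus a) (a * (upperMp x * lowerMp z).g 1 0)
      (x := (upperMp x * lowerMp z).g 0 1 * (a : F)⁻¹)
      (mul_mem (hs.1 0 1) (unit_inv_mem h0))
    rw [hχ.tame a h0 (by rw [ha]; exact one_add_sub_one_mem hx hz)] at h2
    change cellFun χ (hTilde a * _ * _) = _ at h2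
    rw [h2, Units.val_one, mul_one]
  · rw [mul_assoc, mul_assoc weyl, ← lowerMp_add, cellFun_weyl _ _ (add_mem hz' hz),
      cellFun_weyl _ _ hz']

lemma cellFun_iwahoriInv (hχ : IsTameGenuine χ) : IwahoriInv (cellFun χ) where
  upper x hx g := cellFun_mul_upper hx g
  lower z hz g := cellFun_mul_lower hχ hz g
  diag a ha h g := by rw [cellFun_mul_hTilde ha, hχ.tame a ha h, Units.val_one, one_mul]

lemma cellFun_mem (hχ : IsTameGenuine χ) : cellFun χ ∈ PS χ :=
  ⟨cellFun_equivariant, smooth_of_iwahoriInv (cellFun_iwahoriInv hχ)⟩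

lemma cellFun_one : cellFun χ (1 : Mp F) = 1 := by
  have := cellFun_cell (χ := χ) 1 0 (zero_mem 𝒪[F])
  rw [lowerMp_zero, upperMp_zero, mul_one, mul_one, map_one, Units.val_one] at this
  exact this

lemma cellFun_weyl_lower {z : F} (hz : z ∈ lat F 1) : cellFun χ (weyl * lowerMp z) = 0 := by
  have := cellFun_weyl (χ := χ) 1 0 hz
  rwa [lowerMp_zero, mul_one, Subgroup.coe_one, one_mul] at this

lemma cellFun_upper {x : F} (hx : x ∈ 𝒪[F]) : cellFun χ (upperMp x) = 1 := by
  rw [← one_mul (upperMp x), cellFun_mul_upper hx, cellFun_one]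

lemma cellFun_upper_of_not_mem (hχ : IsTameGenuine χ) {x : F} (hx : x ∉ 𝒪[F]) :
    cellFun χ (upperMp x) = 0 := by
  have h0 : x ≠ 0 := fun h => hx (h ▸ zero_mem _)
  obtain ⟨u, rfl⟩ : ∃ u : Fˣ, (u : F) = x := ⟨Units.mk0 x h0, rfl⟩
  have h1 := ps_upper (cellFun_mem hχ) u 1
  rw [mul_one, mul_one, cellFun_weyl_lower, mul_zero] at h1
  · exact h1
  · rw [← Units.val_inv_eq_inv_val, unit_mem_lat, ord_inv]
    rw [← mem_lat_zero, unit_mem_lat] at hx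
    omega

end PrincipalSeriesFunctions

/-! ### Character sums over the residue field -/

section CharacterSums

variable {F : Type*} [Field F] [ValuativeRel F] [TopologicalSpace F]
  [IsNonarchimedeanLocalField F] {E : Type*} [Field E]

/-- The quadratic character of the residue field with values in `E`. -/
def eta (E : Type*) [Field E] (x : 𝓀[F]) : E :=
  open scoped Classical in ((quadraticChar 𝓀[F] x : ℤ) : E)

lemma eta_zero : eta E (0 : 𝓀[F]) = 0 := by
  rw [eta, MulChar.map_zero]; simp

lemma signE_apply (z : ℤˣ) : signE E z = ((z : ℤ) : E) := rfl

variable {ϖ : 𝒪[F]}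

lemma signE_hilb_unif (hϖ : Irreducible ϖ) {u : Fˣ} (hu : ord u = 0) :
    signE E (hilb (unif hϖ) u) = eta E (red (u : F)) := by
  classical
  have h0 := red_unit_ne hu
  have ht : tame (unif hϖ) u = u := by
    rw [tame, hu, ord_unif]; simp
  rw [hilb, ht, eta, quadraticChar_apply, quadraticCharFun, if_neg h0, signE_apply]
  split_ifs <;> simp

lemma hilb_symm (a b : Fˣ) : hilb a b = hilb b a := sgn2_inj (hl_symm a b)

lemma sum_eta (h2 : ringChar 𝓀[F] ≠ 2) : ∑ x : 𝓀[F], eta E x = 0 := by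
  classical
  have := quadraticChar_sum_zero (F := 𝓀[F]) h2
  have h := congrArg (Int.cast : ℤ → E) this
  rw [Int.cast_zero, Int.cast_sum] at h
  rw [← h]
  refine Finset.sum_congr rfl fun x _ => ?_
  rw [eta]

variable {P : Type*} [AddCommGroup P] [Module E P]

lemma sum_const_eq_zero (hq : (Fintype.card 𝓀[F] : E) = 0) (c : P) :
    ∑ _x : 𝓀[F], c = 0 := by
  rw [Finset.sum_const, Finset.card_univ, ← Nat.cast_smul_eq_nsmul E, hq, zero_smul]

lemma exists_unit_rep {x : 𝓀[F]} (hx : x ≠ 0) : ∃ u : Fˣ, (u : F) = rep x ∧ ord u = 0 :=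
  exists_unit_of_red_ne (rep_mem x) (by rwa [red_rep])

/-- A sum over residue classes which, apart from the zero class, is governed by the quadratic
character, reduces to the term of the zero class. -/
lemma sum_rep_eta (h2 : ringChar 𝓀[F] ≠ 2) {g : F → P} {B : P}
    (hg : ∀ u : Fˣ, ord u = 0 → g u = eta E (red (u : F)) • B) :
    ∑ x : 𝓀[F], g (rep x) = g 0 := by
  classical
  have h : ∀ x : 𝓀[F], g (rep x) = (if x = 0 then g 0 else 0) + eta E x • B := by
    intro x
    split_ifs with hx
    · rw [hx, rep_zero, eta_zero, zero_smul, add_zero]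
    · obtain ⟨u, hu, h0⟩ := exists_unit_rep hx
      rw [← hu, hg u h0, hu, red_rep, zero_add]
  rw [Finset.sum_congr rfl fun x _ => h x, Finset.sum_add_distrib, ← Finset.sum_smul, sum_eta h2,
    zero_smul, add_zero, Finset.sum_ite_eq' Finset.univ]
  simp

end CharacterSums

/-! ### Iwahori-invariant vectors of the principal series -/

section IwahoriVectors

variable {F : Type*} [Field F] [ValuativeRel F] [TopologicalSpace F]
  [IsNonarchimedeanLocalField F] {E : Type*} [Field E] {χ : Tt F →* Eˣ}
  {ϖ : 𝒪[F]}

/-- The operator `∑ u(x) h̃(ϖ)`, the sum being over `x` modulo `ϖ²`, on functions. -/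
def uOp (hϖ : Irreducible ϖ) (f : Mp F → E) (g : Mp F) : E :=
  ∑ p, f (g * (upperMp (rep2 ϖ p) * hTilde (unif hϖ)))

/-- The operator `∑ u(x) w`, the sum being over `x` modulo `ϖ`, on functions. -/
def sOp (f : Mp F → E) (g : Mp F) : E := ∑ x : 𝓀[F], f (g * (upperMp (rep x) * weyl))

lemma uOp_mem (hϖ : Irreducible ϖ) {f : Mp F → E} (hf : f ∈ PS χ) : uOp hϖ f ∈ PS χ := by
  have : uOp hϖ f = ∑ p, rightReg E (Mp F) E (upperMp (rep2 ϖ p) * hTilde (unif hϖ)) f := by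
    funext g
    rw [Finset.sum_apply]; rfl
  rw [this]
  exact Submodule.sum_mem _ fun p _ => psSpace_le (fun t => (χ t : E)) _ hf

lemma sOp_mem {f : Mp F → E} (hf : f ∈ PS χ) : sOp f ∈ PS χ := by
  have : sOp f = ∑ x : 𝓀[F], rightReg E (Mp F) E (upperMp (rep x) * weyl) f := by
    funext g
    rw [Finset.sum_apply]; rfl
  rw [this]
  exact Submodule.sum_mem _ fun p _ => psSpace_le (fun t => (χ t : E)) _ hf

lemma unif_sq_div {x : F} {n : ℤ} (hϖ : Irreducible ϖ) (hx : x ∈ lat F n) :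
    x / (((unif hϖ : Fˣ) : F) * (unif hϖ : Fˣ)) ∈ lat F (n - 2) := by
  have h : x / (((unif hϖ : Fˣ) : F) * (unif hϖ : Fˣ)) =
      (((unif hϖ)⁻¹ * (unif hϖ)⁻¹ : Fˣ) : F) * x := by
    push_cast; field_simp
  rw [h, unit_mul_mem_lat, ord_mul, ord_inv, ord_unif]
  convert hx using 2
  ring

lemma unif_sq_mul {x : F} {n : ℤ} (hϖ : Irreducible ϖ) (hx : x ∈ lat F n) :
    (((unif hϖ : Fˣ) : F) * (unif hϖ : Fˣ)) * x ∈ lat F (n + 2) := by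
  rw [← Units.val_mul, unit_mul_mem_lat, ord_mul, ord_unif]
  convert hx using 2
  ring

variable {f : Mp F → E}

/-- The split element `w ū(z) u(x)`, with `z ∈ ϖ𝒪` and `x ∈ 𝒪`, lies again in the small cell, with
torus part congruent to `1`; so it can be replaced by `w ū(z')` with `z' ∈ ϖ𝒪`. -/
lemma ps_small_cell (hχ : IsTameGenuine χ) (hf : f ∈ PS χ) {z x : F} (hz : z ∈ lat F 1)
    (hx : x ∈ 𝒪[F]) (g : Mp F) :
    ∃ z' ∈ lat F 1, f (weyl * lowerMp z * upperMp x * g) = f (weyl * (lowerMp z' * g)) := by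
  obtain ⟨b, hb, h0⟩ := exists_unit_of_sub_one (one_add_sub_one_mem hx hz)
  have hs : IsSplit (weyl * lowerMp z * upperMp x) :=
    (isSplit_weyl.mul (isSplit_lower (lat_int zero_le_one hz))).mul (isSplit_upper hx)
  have hb' : (weyl * lowerMp z * upperMp x).g 0 1 = (b : F) := by
    simp [sl_mul, hb]; ring
  have ha' : (weyl * lowerMp z * upperMp x).g 0 0 = z := by simp [sl_mul]
  refine ⟨z * (b : F)⁻¹, by rw [mul_comm]; exact int_mul_mem_lat (unit_inv_mem h0) hz, ?_⟩
  rw [ps_split' hf hs hb' h0 g, hχ.tame b h0 (by rw [hb]; exact one_add_sub_one_mem hx hz), ha',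
    Units.val_one, one_mul]

lemma ps_weyl_lower_unif (hϖ : Irreducible ϖ) (hf : f ∈ PS χ) (hi : IwahoriInv f) {z : F}
    (hz : z ∈ lat F (-1)) :
    f (weyl * (lowerMp z * hTilde (unif hϖ))) = χ (hTorus (unif hϖ)⁻¹) * f weyl := by
  have h := ps_weyl_lower_hTilde hf z (unif hϖ) 1
  rw [mul_one, mul_one] at h
  have h1 := hi.lower _ (lat_anti (by norm_num) (unif_sq_mul hϖ hz)) weyl
  rw [h, h1]

/-- The operator `∑ u(x) h̃(ϖ)` maps Iwahori-invariant functions to multiples of `cellFun`: on the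
small cell the summands do not depend on `x`, and the number of summands vanishes in `E`. -/
lemma uOp_eq (hϖ : Irreducible ϖ) (hχ : IsTameGenuine χ) (hq : (Fintype.card 𝓀[F] : E) = 0)
    (hf : f ∈ PS χ) (hi : IwahoriInv f) : uOp hϖ f = uOp hϖ f 1 • cellFun χ := by
  refine ps_ext (uOp_mem hϖ hf) ((PS χ).smul_mem _ (cellFun_mem hχ)) ?_ ?_
  · intro y hy
    rw [Pi.smul_apply, cellFun_upper hy, smul_eq_mul, mul_one]
    have h := (isReps_rep2 hϖ).sum_translate (f := fun x => f (upperMp x * hTilde (unif hϖ)))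
      (fun x _ y hy _ => by
        rw [upperMp_add, mul_assoc, upper_mul_hTilde (unif hϖ) y, ← mul_assoc, hi.upper]
        have := unif_sq_div hϖ hy
        rw [sub_self] at this
        exact mem_lat_zero.1 this) hy
    rw [uOp, uOp]
    simp only [one_mul]
    rw [← h]
    refine Finset.sum_congr rfl fun p _ => ?_
    rw [← mul_assoc, ← upperMp_add, add_comm]
  · intro z hz
    rw [Pi.smul_apply, cellFun_weyl_lower hz, smul_zero, uOp, sum_rep2 (ϖ := ϖ)
      (fun x => f (weyl * lowerMp z * (upperMp x * hTilde (unif hϖ))))]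
    have h : ∀ x ∈ 𝒪[F], f (weyl * lowerMp z * (upperMp x * hTilde (unif hϖ))) =
        χ (hTorus (unif hϖ)⁻¹) * f weyl := by
      intro x hx
      obtain ⟨z', hz', h'⟩ := ps_small_cell hχ hf hz hx (hTilde (unif hϖ))
      rw [← mul_assoc, h', ps_weyl_lower_unif hϖ hf hi (lat_anti (by norm_num) hz')]
    rw [Finset.sum_congr rfl fun x _ => Finset.sum_congr rfl fun y _ =>
      h _ (add_mem (rep_mem x) (mul_mem ϖ.2 (rep_mem y)))]
    simp only [sum_const_eq_zero hq]

/-- The operator `∑ u(x) w` maps Iwahori-invariant functions to multiples of `cellFun`, for the same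
reason as `uOp_eq`. -/
lemma sOp_eq (hχ : IsTameGenuine χ) (hq : (Fintype.card 𝓀[F] : E) = 0)
    (hf : f ∈ PS χ) (hi : IwahoriInv f) : sOp f = sOp f 1 • cellFun χ := by
  refine ps_ext (sOp_mem hf) ((PS χ).smul_mem _ (cellFun_mem hχ)) ?_ ?_
  · intro y hy
    rw [Pi.smul_apply, cellFun_upper hy, smul_eq_mul, mul_one]
    have h := isReps_rep.sum_translate (f := fun x => f (upperMp x * weyl))
      (fun x _ y hy _ => by
        have hw : upperMp y * weyl = weyl * lowerMp (-y) := by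
          rw [weyl_mul_lower, neg_neg]
        rw [upperMp_add, mul_assoc, hw, ← mul_assoc, hi.lower _ (neg_mem hy)]) hy
    rw [sOp, sOp]
    simp only [one_mul]
    rw [← h]
    refine Finset.sum_congr rfl fun p _ => ?_
    rw [← mul_assoc, ← upperMp_add, add_comm]
  · intro z hz
    rw [Pi.smul_apply, cellFun_weyl_lower hz, smul_zero, sOp]
    have h : ∀ x ∈ 𝒪[F], f (weyl * lowerMp z * (upperMp x * weyl)) = f (weyl * weyl) := by
      intro x hx
      obtain ⟨z', hz', h'⟩ := ps_small_cell hχ hf hz hx weyl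
      have hw : lowerMp z' * weyl = weyl * upperMp (-z') := by
        rw [weyl_mul_upper, neg_neg]
      rw [← mul_assoc, h', hw, ← mul_assoc,
        hi.upper _ (neg_mem (lat_int zero_le_one hz'))]
    rw [Finset.sum_congr rfl fun x _ => h _ (rep_mem x), sum_const_eq_zero hq]

/-- The value of `uOp` at the identity when the character is trivial on units: here the quadratic
character coming from the double cover makes the contribution of the small cell disappear. -/
lemma uOp_one_of_trivial (hϖ : Irreducible ϖ) (hχ : IsTameGenuine χ)
    (hq : (Fintype.card 𝓀[F] : E) = 0) (h2 : ringChar 𝓀[F] ≠ 2) (hf : f ∈ PS χ)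
    (hi : IwahoriInv f) (h : (∀ a : Fˣ, ord a = 0 → χ (hTorus a) = 1) ∨ f weyl = 0) :
    uOp hϖ f 1 = χ (hTorus (unif hϖ)) * f 1 := by
  have hval : ∀ u : Fˣ, ord u ≤ 1 → f (upperMp (u : F) * hTilde (unif hϖ)) =
      χ (hTorus u) * (χ (hTorus (unif hϖ)⁻¹) * f weyl) := by
    intro u hu
    rw [ps_upper hf, ps_weyl_lower_unif hϖ hf hi]
    rw [← Units.val_inv_eq_inv_val, unit_mem_lat, ord_inv]; omega
  rw [uOp]
  simp only [one_mul]
  rw [sum_rep2 (ϖ := ϖ) (fun x => f (upperMp x * hTilde (unif hϖ)))]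
  -- For `x` a unit the summand does not depend on `y`, and `q = 0` in `E`.
  have h1 : ∀ x : 𝓀[F], x ≠ 0 →
      ∑ y : 𝓀[F], f (upperMp (rep x + ϖ * rep y) * hTilde (unif hϖ)) = 0 := by
    intro x hx
    obtain ⟨u, hu, h0⟩ := exists_unit_rep hx
    have hc : ∀ y : 𝓀[F], f (upperMp (rep x + ϖ * rep y) * hTilde (unif hϖ)) =
        χ (hTorus u) * (χ (hTorus (unif hϖ)⁻¹) * f weyl) := by
      intro y
      have hy : (ϖ : F) * rep y ∈ lat F 1 :=
        unif_mul_mem_lat hϖ (mem_lat_zero.2 (rep_mem y))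
      have hr : red (rep x + ϖ * rep y) ≠ 0 := by
        rw [red_add (rep_mem x) (lat_int zero_le_one hy),
          (mem_lat_one (lat_int zero_le_one hy)).1 hy, add_zero, red_rep]
        exact hx
      obtain ⟨v, hv, hv0⟩ := exists_unit_of_red_ne
        (add_mem (rep_mem x) (lat_int zero_le_one hy)) hr
      rw [← hv, hval v (by omega), char_congr hχ hv0 h0]
      rw [hv, hu, add_sub_cancel_left]
      exact hy
    rw [Finset.sum_congr rfl fun y _ => hc y, sum_const_eq_zero hq]
  rw [Finset.sum_eq_single 0 (fun x _ hx => h1 x hx) (by simp)]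
  simp only [rep_zero, zero_add]
  -- For `x = ϖ u` the summand is a constant times `χ(h̃(ϖ u)) = (ϖ, u) χ(h̃(ϖ)) χ(h̃(u))`. When `χ`
  -- is trivial on units, only the quadratic character `(ϖ, u)` of `u` remains, and its sum
  -- vanishes.
  have h3 := sum_rep_eta (E := E) h2 (g := fun y => f (upperMp ((ϖ : F) * y) * hTilde (unif hϖ)))
    (B := χ (hTorus (unif hϖ)) * (χ (hTorus (unif hϖ)⁻¹) * f weyl)) (by
      intro u hu
      have hm : (ϖ : F) * u = ((unif hϖ * u : Fˣ) : F) := rfl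
      simp only [hm]
      rw [hval _ (by rw [ord_mul, ord_unif, hu]; norm_num), smul_eq_mul]
      rcases h with h | h
      · have h4 := char_mul hχ (unif hϖ) u
        rw [h u hu, Units.val_one, mul_one] at h4
        have h5 : signE E (hilb (unif hϖ) u) * signE E (hilb (unif hϖ) u) = 1 := by
          rw [← map_mul, Int.units_mul_self, map_one]
        rw [← signE_hilb_unif hϖ hu, h4]
        linear_combination
          (-(χ (hTorus (unif hϖ * u)) : E) * (χ (hTorus (unif hϖ)⁻¹) * f weyl)) * h5
      · rw [h]; ring)
  simp only [mul_zero, upperMp_zero, one_mul] at h3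
  rw [h3, ← ps_hTilde hf, mul_one]

/-- The value of `sOp` at the identity: the terms with `x ≠ 0` are the values of `χ` on
units, times a constant multiple of `f 1`; their sum vanishes when `χ` is nontrivial on units. -/
lemma sOp_one_of_nontrivial (hχ : IsTameGenuine χ) (hf : f ∈ PS χ)
    (hi : IwahoriInv f) (h : (∃ a : Fˣ, ord a = 0 ∧ χ (hTorus a) ≠ 1) ∨ f 1 = 0) :
    sOp f 1 = f weyl := by
  classical
  have hval : ∀ u : Fˣ, ord u = 0 → f (upperMp (u : F) * weyl) =
      χ (hTorus u) * (χ (hTorus (-1 : Fˣ)) * f 1) := by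
    intro u hu
    have hw : lowerMp (u : F)⁻¹ * weyl = weyl * upperMp (-(u : F)⁻¹) := by
      rw [weyl_mul_upper, neg_neg]
    have h3 := ps_hTilde hf (-1) 1
    rw [mul_one] at h3
    rw [ps_upper hf, hw, ← mul_assoc, hi.upper _ (neg_mem (unit_inv_mem hu)), weyl_mul_weyl, h3]
  rw [sOp]
  simp only [one_mul]
  set B := (χ (hTorus (-1 : Fˣ)) : E) * f 1 with hB
  -- The terms with `x` a unit, extended by zero.
  let g : F → E := fun x => if hx : x ≠ 0 then
    (if ord (Units.mk0 x hx) = 0 then (χ (hTorus (Units.mk0 x hx)) : E) * B else 0) else 0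
  have hg : ∀ u : Fˣ, g u = if ord u = 0 then (χ (hTorus u) : E) * B else 0 := by
    intro u
    simp only [g, dif_pos u.ne_zero, Units.mk0_val]
  have hg0 : ∀ x ∈ lat F 1, g x = 0 := by
    intro x hx
    by_cases h0 : x = 0
    · simp [g, h0]
    · obtain ⟨u, rfl⟩ : ∃ u : Fˣ, (u : F) = x := ⟨Units.mk0 x h0, rfl⟩
      rw [hg, if_neg]
      rw [unit_mem_lat] at hx
      omega
  have hgu : ∀ x ∈ 𝒪[F], x ∉ lat F 1 → ∃ u : Fˣ, (u : F) = x ∧ ord u = 0 := by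
    intro x hx hx'
    exact exists_unit_of_red_ne hx (by rwa [mem_lat_one hx] at hx')
  have hsum : ∑ x : 𝓀[F], g (rep x) = 0 := by
    rcases h with ⟨a, ha, ha'⟩ | h
    -- the substitution `x ↦ a x` multiplies the sum by `χ(h̃(a)) ≠ 1`
    · have h1 := isReps_rep.sum_comp (f := g) (σ := fun x => (a : F) * x) ?_
        (fun x hx => mul_mem (unit_mem ha) hx) (fun x _ y _ hxy => ?_)
      · have h2 : ∀ x ∈ 𝒪[F], g ((a : F) * x) = χ (hTorus a) * g x := by
          intro x hx
          by_cases hx1 : x ∈ lat F 1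
          · rw [hg0 _ hx1, hg0 _ (int_mul_mem_lat (unit_mem ha) hx1), mul_zero]
          · obtain ⟨u, rfl, hu⟩ := hgu x hx hx1
            rw [← Units.val_mul, hg, hg, if_pos hu, if_pos (by rw [ord_mul, ha, hu]; rfl),
              ← char_mul_units hχ ha hu, mul_assoc]
        rw [Finset.sum_congr rfl fun x _ => h2 _ (rep_mem x), ← Finset.mul_sum] at h1
        have h3 : ((χ (hTorus a) : E) - 1) * ∑ x : 𝓀[F], g (rep x) = 0 := by
          rw [sub_mul, h1, one_mul, sub_self]
        rcases mul_eq_zero.1 h3 with h4 | h4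
        · exact (ha' (Units.ext (sub_eq_zero.1 h4))).elim
        · exact h4
      · intro x hx y hy hxy
        by_cases hx1 : x ∈ lat F 1
        · rw [hg0 _ hx1, hg0 _ (add_mem hx1 hy)]
        · obtain ⟨u, rfl, hu⟩ := hgu x hx hx1
          obtain ⟨v, hv, hv0⟩ := hgu _ hxy (fun h' => hx1 (by
            have := sub_mem h' hy; rwa [add_sub_cancel_right] at this))
          rw [← hv, hg, hg, if_pos hu, if_pos hv0, char_congr hχ hv0 hu]
          rw [hv, add_sub_cancel_left]; exact hy
      · have h5 : (a : F) * x - a * y = a * (x - y) := by ring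
        simp only [h5] at hxy
        rwa [unit_mul_mem_lat, ha, sub_zero] at hxy
    · refine Finset.sum_eq_zero fun x _ => ?_
      simp only [g, hB, h]
      split_ifs <;> simp
  have hterm : ∀ x : 𝓀[F], f (upperMp (rep x) * weyl) =
      (if x = 0 then f weyl else 0) + g (rep x) := by
    intro x
    split_ifs with hx
    · rw [hx, rep_zero, upperMp_zero, one_mul, hg0 0 (zero_mem _), add_zero]
    · obtain ⟨u, hu, h0⟩ := exists_unit_rep hx
      rw [← hu, hval u h0, hg, if_pos h0, zero_add]
  rw [Finset.sum_congr rfl fun x _ => hterm x, Finset.sum_add_distrib, hsum, add_zero,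
    Finset.sum_ite_eq' Finset.univ]
  simp

lemma ps_eq_zero (hf : f ∈ PS χ) (hi : IwahoriInv f) (h1 : f 1 = 0) (hw : f weyl = 0) :
    f = 0 := by
  refine ps_ext hf (PS χ).zero_mem (fun x hx => ?_) (fun z hz => ?_)
  · rw [← one_mul (upperMp x), hi.upper x hx, h1]; rfl
  · rw [hi.lower z hz, hw]; rfl

/-- A stable subspace of the principal series which contains a nonzero Iwahori-invariant function
contains the function `cellFun`. -/
lemma cellFun_mem_of_iwahoriInv (hϖ : Irreducible ϖ) (hχ : IsTameGenuine χ)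
    (hq : (Fintype.card 𝓀[F] : E) = 0) (h2 : ringChar 𝓀[F] ≠ 2)
    {W : Submodule E (Mp F → E)} (hW : ∀ g, ∀ f ∈ W, rightReg E (Mp F) E g f ∈ W)
    (hfW : f ∈ W) (hf : f ∈ PS χ) (hi : IwahoriInv f) (hne : f ≠ 0) : cellFun χ ∈ W := by
  have hU : uOp hϖ f ∈ W := by
    have : uOp hϖ f = ∑ p, rightReg E (Mp F) E (upperMp (rep2 ϖ p) * hTilde (unif hϖ)) f := by
      funext g
      rw [Finset.sum_apply]; rfl
    rw [this]
    exact sum_mem fun p _ => hW _ _ hfW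
  have hS : sOp f ∈ W := by
    have : sOp f = ∑ x : 𝓀[F], rightReg E (Mp F) E (upperMp (rep x) * weyl) f := by
      funext g
      rw [Finset.sum_apply]; rfl
    rw [this]
    exact sum_mem fun p _ => hW _ _ hfW
  -- If `cellFun` is not in `W`, both scalars vanish, and this forces `f 1 = f w = 0`.
  rw [uOp_eq hϖ hχ hq hf hi] at hU
  rw [sOp_eq hχ hq hf hi] at hS
  by_contra hcon
  have hU0 : uOp hϖ f 1 = 0 := by
    by_contra h0
    exact hcon (by simpa [smul_smul, h0] using W.smul_mem (uOp hϖ f 1)⁻¹ hU)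
  have hS0 : sOp f 1 = 0 := by
    by_contra h0
    exact hcon (by simpa [smul_smul, h0] using W.smul_mem (sOp f 1)⁻¹ hS)
  refine hne ?_
  by_cases htriv : ∀ a : Fˣ, ord a = 0 → χ (hTorus a) = 1
  · have h1 := uOp_one_of_trivial hϖ hχ hq h2 hf hi (Or.inl htriv)
    rw [hU0, eq_comm, mul_eq_zero] at h1
    have h1' := h1.resolve_left (Units.ne_zero _)
    have h3 := sOp_one_of_nontrivial hχ hf hi (Or.inr h1')
    exact ps_eq_zero hf hi h1' (h3.symm.trans hS0)
  · push Not at htriv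
    have h3 := sOp_one_of_nontrivial hχ hf hi (Or.inl htriv)
    rw [hS0] at h3
    have h1 := uOp_one_of_trivial hϖ hχ hq h2 hf hi (Or.inr h3.symm)
    rw [hU0, eq_comm, mul_eq_zero] at h1
    exact ps_eq_zero hf hi (h1.resolve_left (Units.ne_zero _)) h3.symm

end IwahoriVectors

/-! ### Fixed vectors of pro-`p` groups in characteristic `p` -/

section FixedVectors

/-- A group acting on a representation in characteristic `p`, through a finite orbit and with
every element acting on that orbit with order a power of `p`, fixes a nonzero vector of the
additive group generated by the orbit. -/
lemma exists_fixed_vector {E G A : Type*} [Field E] [Group G] [AddCommGroup A] [Module E A]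
    (p : ℕ) [Fact p.Prime] [CharP E p] (ρ : Representation E G A) (Γ : Subgroup G) {a : A}
    (ha : a ≠ 0) (hfin : (Set.range fun γ : Γ => ρ γ a).Finite)
    (hpow : ∀ γ ∈ Γ, ∃ k : ℕ, ∀ δ ∈ Γ, ρ (γ ^ p ^ k) (ρ δ a) = ρ δ a) :
    ∃ b ∈ AddSubgroup.closure (Set.range fun γ : Γ => ρ γ a), b ≠ 0 ∧ ∀ γ ∈ Γ, ρ γ b = b := by
  set S := AddSubgroup.closure (Set.range fun γ : Γ => ρ γ a) with hS
  have hp0 : ∀ x : A, p • x = 0 := fun x => by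
    rw [← Nat.cast_smul_eq_nsmul E, CharP.cast_eq_zero, zero_smul]
  have haS : a ∈ S := AddSubgroup.subset_closure ⟨1, by simp⟩
  have hSfg : AddGroup.FG S := by
    rw [AddGroup.fg_iff_addSubgroup_fg]
    exact ⟨hfin.toFinset, by rw [Set.Finite.coe_toFinset]⟩
  -- `S` is a finitely generated abelian group killed by `p`, hence finite of order divisible by
  -- `p`; the image of `Γ` in its permutations is a `p`-group, and `0` is not its only fixed point.
  have hSfin : Finite S := by
    have : Module.Finite ℤ S := Module.Finite.iff_addGroup_fg.mpr hSfg
    refine Module.finite_of_fg_torsion S fun x => ⟨⟨(p : ℤ), ?_⟩, ?_⟩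
    · exact mem_nonZeroDivisors_of_ne_zero (by exact_mod_cast (Fact.out : p.Prime).ne_zero)
    · ext1
      change ((p : ℤ) • (x : S) : S).1 = 0
      rw [AddSubgroup.coe_zsmul, natCast_zsmul, hp0]
  have hSρ : ∀ γ ∈ Γ, ∀ x ∈ S, ρ γ x ∈ S := by
    intro γ hγ x hx
    induction hx using AddSubgroup.closure_induction with
    | mem x hx =>
      obtain ⟨δ, rfl⟩ := hx
      refine AddSubgroup.subset_closure ⟨⟨γ, hγ⟩ * δ, ?_⟩
      simp [map_mul]
    | zero => rw [map_zero]; exact S.zero_mem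
    | add x y _ _ h1 h2 => rw [map_add]; exact S.add_mem h1 h2
    | neg x _ h1 => rw [map_neg]; exact S.neg_mem h1
  let act : Γ →* Equiv.Perm S :=
    { toFun := fun γ =>
        { toFun := fun x => ⟨ρ γ x, hSρ γ γ.2 x x.2⟩
          invFun := fun x => ⟨ρ (γ : G)⁻¹ x, hSρ _ (Γ.inv_mem γ.2) x x.2⟩
          left_inv := fun x => by ext1; simp
          right_inv := fun x => by ext1; simp }
      map_one' := by ext x; simp
      map_mul' := fun γ δ => by ext x; simp [map_mul] }
  have hact : ∀ (γ : Γ) (x : S), (act γ x : A) = ρ γ x := fun _ _ => rfl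
  have hP : IsPGroup p act.range := by
    rintro ⟨_, γ, rfl⟩
    obtain ⟨k, hk⟩ := hpow γ γ.2
    refine ⟨k, ?_⟩
    ext1
    change act γ ^ p ^ k = 1
    rw [← map_pow]
    ext x
    rw [hact]
    obtain ⟨x, hx⟩ := x
    change ρ ((γ : G) ^ p ^ k) x = x
    induction hx using AddSubgroup.closure_induction with
    | mem x hx =>
      obtain ⟨δ, rfl⟩ := hx
      exact hk δ δ.2
    | zero => rw [map_zero]
    | add x y _ _ h1 h2 => rw [map_add, h1, h2]
    | neg x _ h1 => rw [map_neg, h1]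
  have hdvd : p ∣ Nat.card S := by
    have h1 : addOrderOf (⟨a, haS⟩ : S) = p := by
      refine addOrderOf_eq_prime (by ext1; simp [hp0]) (fun h => ha (congrArg Subtype.val h))
    rw [← h1]
    exact addOrderOf_dvd_natCard _
  have h0 : (0 : S) ∈ MulAction.fixedPoints act.range S := by
    rintro ⟨_, γ, rfl⟩
    ext1
    change ρ γ (0 : A) = 0
    rw [map_zero]
  obtain ⟨b, hb, hb0⟩ := hP.exists_fixed_point_of_prime_dvd_card_of_fixed_point S hdvd h0
  refine ⟨b, b.2, fun h => hb0 (Subtype.ext h.symm), fun γ hγ => ?_⟩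
  exact congrArg Subtype.val (hb ⟨act ⟨γ, hγ⟩, ⟨γ, hγ⟩, rfl⟩)

end FixedVectors

/-! ### The pro-`p` Iwahori subgroup -/

section Iwahori

variable {F : Type*} [Field F] [ValuativeRel F] [TopologicalSpace F]
  [IsNonarchimedeanLocalField F]

lemma natCast_mem_lat_one (p : ℕ) [CharP 𝓀[F] p] : (p : F) ∈ lat F 1 := by
  have h : (p : F) = ((p : 𝒪[F]) : F) := by push_cast; rfl
  rw [h, mem_lat_one (Subtype.prop _), red_coe, map_natCast, CharP.cast_eq_zero]

lemma EntriesIn.natCast_smul (p : ℕ) [CharP 𝓀[F] p] {m : ℤ} {B : Matrix (Fin 2) (Fin 2) F}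
    (hB : EntriesIn m B) : EntriesIn (m + 1) ((p : F) • B) := fun i j => by
  rw [Matrix.smul_apply, smul_eq_mul, mul_comm]
  exact mul_mem_lat (hB i j) (natCast_mem_lat_one p)

/-- Raising to the `p`-th power improves congruences. -/
lemma pow_sub_one_entriesIn (p : ℕ) [CharP 𝓀[F] p] {m : ℤ} (hm : 0 ≤ m)
    {B : Matrix (Fin 2) (Fin 2) F} (hB : EntriesIn m B) (hB2 : EntriesIn (m + 1) (B * B)) :
    EntriesIn (m + 1) ((1 + B) ^ p - 1) := by
  have h1 : EntriesIn 0 (1 + B) := entriesIn_zero_one.add (hB.anti hm)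
  have h : ∀ j : ℕ, EntriesIn (m + 1) ((1 + B) ^ j - 1 - (j : F) • B) := by
    intro j
    induction j with
    | zero => intro i k; simp
    | succ j ih =>
      have h2 : (1 + B) ^ (j + 1) - 1 - ((j + 1 : ℕ) : F) • B =
          ((1 + B) ^ j - 1 - (j : F) • B) * (1 + B) + (j : F) • (B * B) := by
        rw [pow_succ]
        push_cast
        simp only [add_smul, one_smul, mul_add, sub_mul, mul_one, one_mul, smul_mul_assoc]
        abel
      rw [h2]
      have h3 := ih.mul h1
      rw [add_zero] at h3
      refine h3.add fun i k => ?_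
      rw [Matrix.smul_apply, smul_eq_mul]
      exact int_mul_mem_lat (natCast_mem _ j) (hB2 i k)
  have h3 := (h p).add (hB.natCast_smul p)
  rwa [sub_add_cancel] at h3

variable (F) in
/-- The split pro-`p` Iwahori subgroup: the matrices which reduce to upper unipotent ones. -/
def iwahori : Subgroup (Mp F) where
  carrier := {x | IsSplit x ∧ x.g 1 0 ∈ lat F 1 ∧ x.g 0 0 - 1 ∈ lat F 1 ∧ x.g 1 1 - 1 ∈ lat F 1}
  one_mem' := ⟨⟨(Kt F).one_mem, map_one _⟩, by simp, by simp, by simp⟩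
  mul_mem' := by
    rintro x y ⟨hx, h1, h2, h3⟩ ⟨hy, h1', h2', h3'⟩
    have i : ∀ i j, y.g i j ∈ 𝒪[F] := hy.1
    have i' : ∀ i j, x.g i j ∈ 𝒪[F] := hx.1
    refine ⟨hx.mul hy, ?_, ?_, ?_⟩ <;> rw [Mp.mul_g, sl_mul]
    · exact add_mem (by rw [mul_comm]; exact int_mul_mem_lat (i 0 0) h1)
        (int_mul_mem_lat (i' 1 1) h1')
    · have : x.g 0 0 * y.g 0 0 + x.g 0 1 * y.g 1 0 - 1 =
          y.g 0 0 * (x.g 0 0 - 1) + (y.g 0 0 - 1) + x.g 0 1 * y.g 1 0 := by ring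
      rw [this]
      exact add_mem (add_mem (int_mul_mem_lat (i 0 0) h2) h2') (int_mul_mem_lat (i' 0 1) h1')
    · have : x.g 1 0 * y.g 0 1 + x.g 1 1 * y.g 1 1 - 1 =
          y.g 1 1 * (x.g 1 1 - 1) + (y.g 1 1 - 1) + y.g 0 1 * x.g 1 0 := by ring
      rw [this]
      exact add_mem (add_mem (int_mul_mem_lat (i 1 1) h3) h3') (int_mul_mem_lat (i 0 1) h1)
  inv_mem' := by
    rintro x ⟨hx, h1, h2, h3⟩
    have e : ((x⁻¹).g 1 0 = -x.g 1 0) ∧ ((x⁻¹).g 0 0 = x.g 1 1) ∧ ((x⁻¹).g 1 1 = x.g 0 0) := by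
      rw [Mp.inv_g, Matrix.SpecialLinearGroup.coe_inv, Matrix.adjugate_fin_two]
      exact ⟨rfl, rfl, rfl⟩
    refine ⟨hx.inv, ?_, ?_, ?_⟩
    · rw [e.1]; exact neg_mem h1
    · rw [e.2.1]; exact h3
    · rw [e.2.2]; exact h2

lemma iwahori_le_Kt : iwahori F ≤ Kt F := fun _ hx => hx.1.1

lemma isSplit_pow {x : Mp F} (hx : IsSplit x) (n : ℕ) : IsSplit (x ^ n) := by
  induction n with
  | zero => exact ⟨(Kt F).one_mem, map_one _⟩
  | succ n ih => rw [pow_succ]; exact ih.mul hx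

lemma pow_g (x : Mp F) (n : ℕ) : (x ^ n).g.1 = x.g.1 ^ n := by
  induction n with
  | zero => rfl
  | succ n ih =>
    rw [pow_succ, pow_succ, ← ih]
    rfl

/-- The `pⁿ`-th powers of elements of the pro-`p` Iwahori subgroup lie in the `n`-th congruence
subgroup; the first step uses that the reduction minus `1` has square zero. -/
lemma iwahori_pow_mem (p : ℕ) [CharP 𝓀[F] p] {x : Mp F} (hx : x ∈ iwahori F) (n : ℕ) :
    x ^ p ^ n ∈ congr F n := by
  refine ⟨isSplit_pow hx.1 _, ?_⟩
  obtain ⟨hs, h1, h2, h3⟩ := hx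
  rw [pow_g]
  have h0 : EntriesIn 0 (x.g.1 - 1) := by
    rw [sub_eq_add_neg]
    exact (entriesIn_zero_iff.2 hs.1).add entriesIn_zero_one.neg
  induction n with
  | zero => simpa using h0
  | succ n ih =>
    rw [pow_succ, pow_mul]
    set A := x.g.1 ^ p ^ n with hA
    have h4 : A = 1 + (A - 1) := by abel
    rw [h4]
    push_cast
    refine pow_sub_one_entriesIn p (by positivity) ih ?_
    rcases Nat.eq_zero_or_pos n with rfl | hn
    · have hA' : A = x.g.1 := by rw [hA, pow_zero, pow_one]
      rw [hA']
      intro i j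
      have e : ∀ i j, ((x.g.1 - 1) * (x.g.1 - 1)) i j =
          (x.g.1 - 1) i 0 * (x.g.1 - 1) 0 j + (x.g.1 - 1) i 1 * (x.g.1 - 1) 1 j := fun i j => by
        rw [Matrix.mul_apply, Fin.sum_univ_two]
      have i0 : ∀ i j, (x.g.1 - 1) i j ∈ 𝒪[F] := fun i j => mem_lat_zero.1 (h0 i j)
      have e00 : (x.g.1 - 1) 0 0 ∈ lat F 1 := h2
      have e11 : (x.g.1 - 1) 1 1 ∈ lat F 1 := h3
      have e10 : (x.g.1 - 1) 1 0 ∈ lat F 1 := by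
        change x.g.1 1 0 - 0 ∈ _
        rw [sub_zero]; exact h1
      rw [e]
      have r : ∀ {a b : F}, a ∈ lat F 1 → b ∈ 𝒪[F] → a * b ∈ lat F 1 := fun ha hb => by
        rw [mul_comm]; exact int_mul_mem_lat hb ha
      have l : ∀ {a b : F}, a ∈ 𝒪[F] → b ∈ lat F 1 → a * b ∈ lat F 1 := fun ha hb =>
        int_mul_mem_lat ha hb
      have : ((0 : ℕ) : ℤ) + 1 = 1 := rfl
      rw [this]
      fin_cases i <;> fin_cases j
      · exact add_mem (r e00 (i0 0 0)) (l (i0 0 1) e10)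
      · exact add_mem (r e00 (i0 0 1)) (l (i0 0 1) e11)
      · exact add_mem (r e10 (i0 0 0)) (r e11 (i0 1 0))
      · exact add_mem (r e10 (i0 0 1)) (r e11 (i0 1 1))
    · exact (ih.mul ih).anti (by omega)

end Iwahori

/-! ### Irreducibility of the principal series -/

section Irreducibility

variable {F : Type*} [Field F] [ValuativeRel F] [TopologicalSpace F]
  [IsNonarchimedeanLocalField F] {E : Type*} [Field E] {χ : Tt F →* Eˣ}

/-- A nonzero smooth function generates a space containing nonzero Iwahori-invariant functions. -/
lemma exists_iwahoriInv (p : ℕ) [Fact p.Prime] [CharP 𝓀[F] p] [CharP E p]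
    {W : Submodule E (Mp F → E)} (hW : ∀ g, ∀ f ∈ W, rightReg E (Mp F) E g f ∈ W)
    {f : Mp F → E} (hf : Smooth f) (hfW : f ∈ W) (h0 : f ≠ 0) :
    ∃ f' ∈ W, f' ≠ 0 ∧ IwahoriInv f' := by
  obtain ⟨n, hn⟩ := smooth_iff.1 hf
  have hn' : ∀ u ∈ congr F n, rightReg E (Mp F) E u f = f := fun u hu => funext (hn u hu)
  obtain ⟨ι, _, r, hr⟩ := exists_reps (F := F) n
  choose c hc using hr.surj
  -- The orbit of `f` is finite: the translate by `γ` depends only on the entries of `γ` modulo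
  -- `ϖⁿ`.
  have hfin : (Set.range fun γ : iwahori F => rightReg E (Mp F) E γ f).Finite := by
    let q : iwahori F → Fin 2 → Fin 2 → ι := fun γ i j =>
      c (γ.1.g i j) ((iwahori_le_Kt γ.2 : γ.1 ∈ Kt F) i j)
    have hq : Function.FactorsThrough (fun γ : iwahori F => rightReg E (Mp F) E γ f) q := by
      intro γ δ h
      have h1 : EntriesIn n (γ.1.g.1 - δ.1.g.1) := fun i j => by
        have a1 := hc (γ.1.g i j) ((iwahori_le_Kt γ.2 : γ.1 ∈ Kt F) i j)
        have a2 := hc (δ.1.g i j) ((iwahori_le_Kt δ.2 : δ.1 ∈ Kt F) i j)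
        have a3 : q γ i j = q δ i j := by rw [h]
        simp only [q] at a3
        rw [a3] at a1
        have := sub_mem a1 a2
        rwa [sub_sub_sub_cancel_right] at this
      have h2 : δ.1⁻¹ * γ.1 ∈ congr F n := by
        refine ⟨δ.2.1.inv.mul γ.2.1, ?_⟩
        have a1 : (δ.1⁻¹).g.1 * δ.1.g.1 = 1 := congrArg Subtype.val (inv_mul_cancel δ.1.g)
        have a2 : (δ.1⁻¹ * γ.1).g.1 - 1 = (δ.1⁻¹).g.1 * (γ.1.g.1 - δ.1.g.1) := by
          rw [mul_sub, a1]; rfl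
        rw [a2]
        have a3 := EntriesIn.mul (entriesIn_zero_iff.2 (δ.2.1.inv).1) h1
        rwa [zero_add] at a3
      change rightReg E (Mp F) E γ.1 f = rightReg E (Mp F) E δ.1 f
      have h3 : γ.1 = δ.1 * (δ.1⁻¹ * γ.1) := by group
      rw [h3, map_mul, Module.End.mul_apply, hn' _ h2]
    refine (Set.finite_range (Function.extend q
      (fun γ : iwahori F => rightReg E (Mp F) E γ f) 0)).subset ?_
    rintro _ ⟨γ, rfl⟩
    exact ⟨q γ, hq.extend_apply 0 γ⟩
  -- `γ ^ pⁿ` lies in the `n`-th congruence subgroup, which is normalised by the Iwahori subgroup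
  -- and fixes `f`; so it fixes the orbit pointwise.
  obtain ⟨b, hb, hb0, hbi⟩ := exists_fixed_vector p (rightReg E (Mp F) E) (iwahori F) h0 hfin
    (fun γ hγ => ⟨n, fun δ hδ => by
      have h1 : γ ^ p ^ n * δ = δ * (δ⁻¹ * γ ^ p ^ n * δ⁻¹⁻¹) := by group
      rw [← Module.End.mul_apply, ← map_mul, h1, map_mul, Module.End.mul_apply,
        hn' _ (congr_conj_Kt ((Kt F).inv_mem (iwahori_le_Kt hδ)) (iwahori_pow_mem p hγ n))]⟩)
  have hbW : b ∈ W := by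
    have : AddSubgroup.closure (Set.range fun γ : iwahori F => rightReg E (Mp F) E γ f) ≤
        W.toAddSubgroup := by
      rw [AddSubgroup.closure_le]
      rintro _ ⟨γ, rfl⟩
      exact hW _ _ hfW
    exact this hb
  refine ⟨b, hbW, hb0, ?_, ?_, ?_⟩
  · intro x hx g
    exact congrFun (hbi (upperMp x) ⟨isSplit_upper hx, by simp, by simp, by simp⟩) g
  · intro z hz g
    exact congrFun (hbi (lowerMp z)
      ⟨isSplit_lower (lat_int zero_le_one hz), by simpa using hz, by simp, by simp⟩) g
  · intro a ha ha' g
    refine congrFun (hbi (hTilde a) ⟨isSplit_hTilde ha, by simp, by simpa using ha', ?_⟩) g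
    rw [hTilde_11]
    exact inv_sub_one_mem ha ha'

lemma cellFun_upper_hTilde (hχ : IsTameGenuine χ) (a : Fˣ) (x : F)
    [Decidable (x ∈ lat F (2 * ord a))] :
    cellFun χ (upperMp x * hTilde a) = if x ∈ lat F (2 * ord a) then (χ (hTorus a) : E) else 0 := by
  rw [upper_mul_hTilde, ps_hTilde (cellFun_mem hχ)]
  have h : x / ((a : F) * a) = ((a⁻¹ * a⁻¹ : Fˣ) : F) * x := by
    push_cast; field_simp
  have h1 : x / ((a : F) * a) ∈ 𝒪[F] ↔ x ∈ lat F (2 * ord a) := by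
    rw [← mem_lat_zero, h, unit_mul_mem_lat, ord_mul, ord_inv]
    congr! 2
    ring
  split_ifs with hx
  · rw [cellFun_upper (h1.2 hx), mul_one]
  · rw [cellFun_upper_of_not_mem hχ (fun h' => hx (h1.1 h')), mul_zero]

lemma cellFun_upper_weyl_hTilde {a : Fˣ} (ha : 1 ≤ ord a) {x : F}
    (hx : x ∈ 𝒪[F]) (hχ : IsTameGenuine χ) : cellFun χ (upperMp x * (weyl * hTilde a)) = 0 := by
  have hw : upperMp x * (weyl : Mp F) = weyl * lowerMp (-x) := by rw [weyl_mul_lower, neg_neg]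
  have h := ps_weyl_lower_hTilde (cellFun_mem hχ) (-x) a 1
  rw [mul_one, mul_one] at h
  rw [← mul_assoc, hw, mul_assoc, h, cellFun_weyl_lower, mul_zero]
  rw [← Units.val_mul, unit_mul_mem_lat, ord_mul]
  exact lat_anti (by omega) (mem_lat_zero.2 (neg_mem hx))

lemma cellFun_weyl_lower_upper_hTilde (hχ : IsTameGenuine χ) {a : Fˣ} (ha : 1 ≤ ord a) {x z : F}
    (hx : x ∈ 𝒪[F]) (hz : z ∈ lat F 1) :
    cellFun χ (weyl * lowerMp z * (upperMp x * hTilde a)) = 0 := by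
  obtain ⟨z', hz', h⟩ := ps_small_cell hχ (cellFun_mem hχ) hz hx (hTilde a)
  have h1 := ps_weyl_lower_hTilde (cellFun_mem hχ) z' a 1
  rw [mul_one, mul_one] at h1
  rw [← mul_assoc, h, h1, cellFun_weyl_lower, mul_zero]
  rw [← Units.val_mul, unit_mul_mem_lat, ord_mul]
  exact lat_anti (by omega) hz'

lemma cellFun_upper_lower_weyl_hTilde (hχ : IsTameGenuine χ) {a : Fˣ} (ha : 1 ≤ ord a) {x z : F}
    (hx : x ∈ 𝒪[F]) (hz : z ∈ lat F 1) :
    cellFun χ (upperMp x * (lowerMp z * (weyl * hTilde a))) = 0 := by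
  have hcell := cellFun_mem hχ
  obtain ⟨b, hb, hb0⟩ := exists_unit_of_sub_one (one_add_sub_one_mem hx hz)
  have hs : IsSplit (upperMp x * lowerMp z) :=
    (isSplit_upper hx).mul (isSplit_lower (lat_int zero_le_one hz))
  have hb' : (upperMp x * lowerMp z).g 0 0 = b := by simp [sl_mul, hb]
  rw [← mul_assoc, hs.eq_of_unit hb' hb0, mul_assoc, mul_assoc, ps_hTilde hcell, ps_lower hcell,
    cellFun_upper_weyl_hTilde ha (mul_mem (hs.1 0 1) (unit_inv_mem hb0)) hχ, mul_zero]

lemma sum_translate_mem {W : Submodule E (Mp F → E)}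
    (hW : ∀ g, ∀ f ∈ W, rightReg E (Mp F) E g f ∈ W) {f : Mp F → E} (hf : f ∈ W) {ι : Type*}
    [Fintype ι] (c : ι → E) (γ : ι → Mp F) : (fun g => ∑ i, c i * f (g * γ i)) ∈ W := by
  have h : (fun g => ∑ i, c i * f (g * γ i)) = ∑ i, c i • rightReg E (Mp F) E (γ i) f := by
    funext g
    rw [Finset.sum_apply]; rfl
  rw [h]
  exact Submodule.sum_mem _ fun i _ => W.smul_mem _ (hW _ _ hf)

/-- The function `cellFun` generates the principal series: a function `f` is recovered from its
values on the two Iwahori cells, the translates `u(-r) h̃(a)` and `ū(-r) w h̃(a)` of `cellFun`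
being supported on small neighbourhoods of the points `u(r)` and `w ū(r)` when `a` is highly
divisible. -/
lemma mem_of_cellFun_mem (hχ : IsTameGenuine χ) {W : Submodule E (Mp F → E)}
    (hW : ∀ g, ∀ f ∈ W, rightReg E (Mp F) E g f ∈ W) (h0 : cellFun χ ∈ W) {f : Mp F → E}
    (hf : f ∈ PS χ) : f ∈ W := by
  classical
  obtain ⟨m', hm'⟩ := smooth_iff.1 hf.2
  obtain ⟨m, hm1, hm2⟩ : ∃ m : ℕ, 1 ≤ m ∧ ∀ u ∈ congr F (2 * m), ∀ x, f (x * u) = f x :=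
    ⟨m' + 1, by omega, fun u hu => hm' u (congr_anti (by omega) hu)⟩
  obtain ⟨a, ha⟩ := exists_ord_eq (F := F) m
  obtain ⟨ι, _, r, hr⟩ := exists_reps (F := F) (2 * m)
  have hlat : (2 * ord a : ℤ) = ((2 * m : ℕ) : ℤ) := by rw [ha]; push_cast; rfl
  have ha1 : 1 ≤ ord a := by rw [ha]; exact_mod_cast hm1
  have hcell := cellFun_mem hχ
  set c : E := (χ (hTorus a) : E) with hc
  have hc0 : c ≠ 0 := Units.ne_zero _
  set e : E := (χ (hTorus (-1 : Fˣ)) : E) with he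
  have he0 : e ≠ 0 := Units.ne_zero _
  have hPS : ∀ g, ∀ f ∈ PS χ, rightReg E (Mp F) E g f ∈ PS χ := fun g f hf =>
    psSpace_le (fun t => (χ t : E)) g hf
  -- `g1` agrees with `f` on `u(𝒪)` and vanishes on `w ū(ϖ𝒪)`; for `g2` it is the other way round.
  obtain ⟨g1, hg1, hg1', e1⟩ : ∃ g1 ∈ W, g1 ∈ PS χ ∧ ∀ g, g1 g =
      ∑ i, (c⁻¹ * f (upperMp (r i))) * cellFun χ (g * (upperMp (-r i) * hTilde a)) :=
    ⟨_, sum_translate_mem hW h0 _ _, sum_translate_mem hPS hcell _ _, fun _ => rfl⟩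
  obtain ⟨g2, hg2, hg2', e2⟩ : ∃ g2 ∈ W, g2 ∈ PS χ ∧ ∀ g, g2 g =
      ∑ i, (if r i ∈ lat F 1 then (e * c)⁻¹ * f (weyl * lowerMp (r i)) else 0) *
        cellFun χ (g * (lowerMp (-r i) * (weyl * hTilde a))) :=
    ⟨_, sum_translate_mem hW h0 _ _, sum_translate_mem hPS hcell _ _, fun _ => rfl⟩
  -- Exactly one representative is congruent to a given `y`.
  have hsingle : ∀ (y : F) (b : E), y ∈ 𝒪[F] →
      ∑ i, (if y - r i ∈ lat F (2 * ord a) then b else 0) = b := by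
    intro y b hy
    rw [hlat]
    obtain ⟨y', hy', h1, h2⟩ := hr.sum_single
      (f := fun x => if y - x ∈ lat F ((2 * m : ℕ) : ℤ) then b else 0) hy
      (fun x _ hx => if_neg hx)
    rw [h2, if_pos h1]
  have key : f = g1 + g2 := by
    refine ps_ext hf ((PS χ).add_mem hg1' hg2') ?_ ?_
    · intro y hy
      have h2 : g2 (upperMp y) = 0 := by
        rw [e2]
        refine Finset.sum_eq_zero fun i _ => ?_
        split_ifs with hi
        · rw [cellFun_upper_lower_weyl_hTilde hχ ha1 hy (neg_mem hi), mul_zero]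
        · rw [zero_mul]
      have h3 : ∀ i, c⁻¹ * f (upperMp (r i)) * cellFun χ (upperMp y * (upperMp (-r i) * hTilde a)) =
          if y - r i ∈ lat F (2 * ord a) then f (upperMp y) else 0 := by
        intro i
        rw [← mul_assoc (upperMp y), ← upperMp_add, cellFun_upper_hTilde hχ, ← sub_eq_add_neg]
        split_ifs with hi
        · have h5 : upperMp y = upperMp (r i) * upperMp (y - r i) := by
            rw [← upperMp_add]; congr 1; ring
          rw [h5, hm2 _ (upper_mem_congr (by rw [← hlat]; exact hi)), ← hc]
          field_simp
        · rw [mul_zero]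
      rw [Pi.add_apply, h2, add_zero, e1, Finset.sum_congr rfl fun i _ => h3 i, hsingle _ _ hy]
    · intro z hz
      have h1 : g1 (weyl * lowerMp z) = 0 := by
        rw [e1]
        refine Finset.sum_eq_zero fun i _ => ?_
        rw [cellFun_weyl_lower_upper_hTilde hχ ha1 (neg_mem (hr.mem i)) hz, mul_zero]
      have h3 : ∀ i, (if r i ∈ lat F 1 then (e * c)⁻¹ * f (weyl * lowerMp (r i)) else 0) *
          cellFun χ (weyl * lowerMp z * (lowerMp (-r i) * (weyl * hTilde a))) =
          if z - r i ∈ lat F (2 * ord a) then f (weyl * lowerMp z) else 0 := by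
        intro i
        have h4 : weyl * lowerMp z * (lowerMp (-r i) * (weyl * hTilde a)) =
            hTilde (-1) * (upperMp (-(z - r i)) * hTilde a) := by
          rw [mul_assoc weyl, ← mul_assoc (lowerMp z), ← lowerMp_add, ← mul_assoc weyl,
            weyl_mul_lower, mul_assoc, ← mul_assoc weyl weyl, weyl_mul_weyl, ← mul_assoc,
            ← mul_assoc, hTilde_mul_upper, ← sub_eq_add_neg]
          simp
        rw [h4, ps_hTilde hcell, cellFun_upper_hTilde hχ, neg_mem_iff]
        split_ifs with h5 h6 h6
        · have h7 : weyl * lowerMp z = weyl * lowerMp (r i) * lowerMp (z - r i) := by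
            rw [mul_assoc, ← lowerMp_add]; congr 2; ring
          have h8 : f (weyl * lowerMp z) = f (weyl * lowerMp (r i)) := by
            rw [h7]
            exact hm2 _ (lower_mem_congr (by rw [← hlat]; exact h6)) _
          rw [h8, ← hc, ← he]
          field_simp
        · simp
        · refine (h5 ?_).elim
          have h8 := sub_mem hz (lat_anti (show (1 : ℤ) ≤ 2 * ord a by omega) h6)
          rwa [sub_sub_cancel] at h8
        · simp
      rw [Pi.add_apply, h1, zero_add, e2, Finset.sum_congr rfl fun i _ => h3 i,
        hsingle _ _ (lat_int zero_le_one hz)]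
  rw [key]
  exact W.add_mem hg1 hg2

/-- The principal series of a tame genuine character is irreducible. -/
lemma principalSeries_isIrreducible (p : ℕ) [Fact p.Prime] [CharP 𝓀[F] p] [CharP E p] (hp : p ≠ 2)
    (hχ : IsTameGenuine χ) : (principalSeries fun t => (χ t : E)).IsIrreducible := by
  obtain ⟨ϖ, hϖ⟩ := IsDiscreteValuationRing.exists_irreducible 𝒪[F]
  have hq : (Fintype.card 𝓀[F] : E) = 0 := by
    rw [CharP.cast_eq_zero_iff E p]
    exact (CharP.cast_eq_zero_iff 𝓀[F] p _).1 (Nat.cast_card_eq_zero 𝓀[F])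
  have h2 : ringChar 𝓀[F] ≠ 2 := by rwa [ringChar.eq 𝓀[F] p]
  have hbot : ∀ S : Subrepresentation (principalSeries fun t => (χ t : E)),
      S ≠ ⊥ → S = ⊤ := by
    intro S hS
    let W : Submodule E (Mp F → E) := S.toSubmodule.map (PS χ).subtype
    have hW : ∀ g, ∀ f ∈ W, rightReg E (Mp F) E g f ∈ W := by
      rintro g _ ⟨f, hf, rfl⟩
      exact ⟨_, S.apply_mem_toSubmodule g hf, rfl⟩
    have hWPS : W ≤ PS χ := Submodule.map_subtype_le _ _
    obtain ⟨f, hf, hf0⟩ : ∃ f ∈ S.toSubmodule, f ≠ 0 := by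
      refine S.toSubmodule.exists_mem_ne_zero_of_ne_bot fun h => hS ?_
      exact Subrepresentation.toSubmodule_injective h
    obtain ⟨f', hf', hf'0, hi⟩ := exists_iwahoriInv p hW f.2.2 (⟨f, hf, rfl⟩ : (f : Mp F → E) ∈ W)
      (fun h => hf0 (Subtype.ext h))
    have h1 := cellFun_mem_of_iwahoriInv hϖ hχ hq h2 hW hf' (hWPS hf') hi hf'0
    refine Subrepresentation.toSubmodule_injective (eq_top_iff.2 fun f _ => ?_)
    obtain ⟨f', h2, h3⟩ := mem_of_cellFun_mem hχ hW h1 f.2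
    rwa [← Subtype.ext h3]
  refine { exists_pair_ne := ⟨⊥, ⊤, fun h => ?_⟩, eq_bot_or_eq_top := fun S => ?_ }
  · have h1 : (⟨cellFun χ, cellFun_mem hχ⟩ : PS χ) ∈
        (⊥ : Subrepresentation (principalSeries fun t => (χ t : E))).toSubmodule := by
      rw [h]; exact Submodule.mem_top
    have h3 := congrArg (fun f : PS χ => (f : Mp F → E) 1) ((Submodule.mem_bot E).1 h1)
    simp [cellFun_one] at h3
  · by_cases h : S = ⊥
    · exact Or.inl h
    · exact Or.inr (hbot S h)

/-- A smooth genuine character in characteristic `p` is trivial on the pro-`p` part of the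
torus. -/
lemma isTameGenuine_of_isOpen (p : ℕ) [Fact p.Prime] [CharP 𝓀[F] p] [CharP E p]
    (hopen : IsOpen (χ.ker : Set (Tt F))) (hg : χ (negOne F) = -1) : IsTameGenuine χ := by
  refine ⟨hg, fun a ha h1 => ?_⟩
  obtain ⟨U, hU, hUχ⟩ := isOpen_induced_iff.1 hopen
  have h1U : (1 : Mp F) ∈ U := by
    have : (1 : Tt F) ∈ (χ.ker : Set (Tt F)) := χ.ker.one_mem
    rwa [← hUχ] at this
  obtain ⟨n, hn⟩ := exists_congr_subset (hU.mem_nhds h1U)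
  have h2 : hTilde a ∈ iwahori F :=
    ⟨isSplit_hTilde ha, by simp, by simpa using h1, by rw [hTilde_11]; exact inv_sub_one_mem ha h1⟩
  have h3 : hTorus a ^ p ^ n ∈ (χ.ker : Set (Tt F)) := by
    rw [← hUχ]
    exact hn (iwahori_pow_mem p h2 n)
  have h4 : (χ (hTorus a) : E) ^ p ^ n = 1 := by
    have : χ (hTorus a ^ p ^ n) = 1 := h3
    rw [map_pow] at this
    rw [← Units.val_pow_eq_pow_val, this, Units.val_one]
  ext1
  have : ExpChar E p := ExpChar.prime Fact.out
  exact (iterateFrobenius_inj E p n) (by simpa [iterateFrobenius_def] using h4)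

end Irreducibility

/-! ### The universal property of the principal series -/

section Universal

variable {F : Type*} [Field F] [ValuativeRel F] [TopologicalSpace F]
  [IsNonarchimedeanLocalField F] {E : Type*} [Field E] {χ : Tt F →* Eˣ} {ϖ : 𝒪[F]}
  {P : Type*} [AddCommGroup P] [Module E P]

/-- The properties of the vector `cellFun χ` which characterise the principal series: the Iwahori
subgroup acts by the character `χ`, and the vector is an eigenvector of the operator
`∑ u(x) h̃(ϖ)` for the eigenvalue `χ(h̃(ϖ))`. -/
structure IwahoriEigen (hϖ : Irreducible ϖ) (χ : Tt F →* Eˣ) (ρ : Representation E (Mp F) P)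
    (v : P) : Prop where
  upper : ∀ x ∈ 𝒪[F], ρ (upperMp x) v = v
  lower : ∀ z ∈ lat F 1, ρ (lowerMp z) v = v
  diag : ∀ a : Fˣ, ord a = 0 → ρ (hTilde a) v = (χ (hTorus a) : E) • v
  sign : ∀ z : ℤˣ, ρ (central z) v = signE E z • v
  hecke : ∑ p, ρ (upperMp (rep2 ϖ p) * hTilde (unif hϖ)) v = (χ (hTorus (unif hϖ)) : E) • v

/-- The span of the vectors `k h̃(ϖ)ⁿ v`, for `k` in the maximal compact subgroup. -/
def level (hϖ : Irreducible ϖ) (ρ : Representation E (Mp F) P) (v : P) (n : ℕ) : Submodule E P :=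
  Submodule.span E (Set.range fun k : Kt F => ρ (k * hTilde (unif hϖ) ^ n) v)

variable (hϖ : Irreducible ϖ) {ρ : Representation E (Mp F) P} {v : P}

lemma unif_pow_mul_upper (n : ℕ) {x : F} (hx : x ∈ 𝒪[F]) :
    ∃ x' ∈ 𝒪[F], hTilde (unif hϖ) ^ n * upperMp x = upperMp x' * hTilde (unif hϖ) ^ n := by
  induction n with
  | zero => exact ⟨x, hx, by simp⟩
  | succ n ih =>
    obtain ⟨x', hx', h⟩ := ih
    refine ⟨unif hϖ * unif hϖ * x', mul_mem (mul_mem ϖ.2 ϖ.2) hx', ?_⟩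
    rw [pow_succ', mul_assoc, h, ← mul_assoc, hTilde_mul_upper, mul_assoc]

lemma lower_mul_unif_pow (n : ℕ) (z : F) :
    lowerMp z * hTilde (unif hϖ) ^ n = hTilde (unif hϖ) ^ n * lowerMp (ϖ ^ (2 * n) * z) := by
  induction n with
  | zero => simp
  | succ n ih =>
    rw [pow_succ, ← mul_assoc, ih, mul_assoc, lower_mul_hTilde, ← mul_assoc, ← pow_succ]
    congr 2
    change (ϖ : F) * ϖ * _ = _
    ring

lemma unif_pow_mul_mem_lat {n : ℕ} {z : F} (hz : z ∈ lat F 1) :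
    (ϖ : F) ^ (2 * n) * z ∈ lat F 1 :=
  int_mul_mem_lat (pow_mem ϖ.2 _) hz

lemma hTilde_comm (a b : Fˣ) :
    ∃ s : ℤˣ, hTilde a * hTilde b = central s * (hTilde b * hTilde a) := by
  refine ⟨hilb a b * hilb b a, ?_⟩
  rw [hTilde_mul, hTilde_mul, mul_comm b a, central_mul, mul_assoc,
    ← mul_assoc (central (hilb b a)),
    ← central_mul, Int.units_mul_self, central_one, one_mul]

lemma hTilde_mul_unif_pow (a : Fˣ) (n : ℕ) :
    ∃ s : ℤˣ, hTilde a * hTilde (unif hϖ) ^ n = central s * (hTilde (unif hϖ) ^ n * hTilde a) := by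
  induction n with
  | zero => exact ⟨1, by simp [central_one]⟩
  | succ n ih =>
    obtain ⟨s, h⟩ := ih
    obtain ⟨s', h'⟩ := hTilde_comm a (unif hϖ)
    refine ⟨s * s', ?_⟩
    rw [pow_succ, ← mul_assoc, h, mul_assoc, mul_assoc, h', ← mul_assoc _ (central s'),
      ← central_comm, central_mul]
    simp only [mul_assoc]

lemma hTilde_unif_pow (n : ℕ) :
    ∃ s : ℤˣ, hTilde (unif hϖ ^ n) = central s * hTilde (unif hϖ) ^ n := by
  induction n with
  | zero => exact ⟨1, by simp [central_one, hTilde_one]⟩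
  | succ n ih =>
    obtain ⟨s, h⟩ := ih
    refine ⟨hilb (unif hϖ ^ n) (unif hϖ) * s, ?_⟩
    have h1 := hTilde_mul (unif hϖ ^ n) (unif hϖ)
    rw [h, ← pow_succ] at h1
    rw [central_mul, pow_succ (hTilde (unif hϖ)), mul_assoc, ← mul_assoc (central s), h1,
      ← mul_assoc, ← central_mul, Int.units_mul_self, central_one, one_mul]

/-- Every element of the torus of nonnegative valuation is a unit times a power of `h̃(ϖ)`. -/
lemma hTilde_eq_unit_mul (x : Fˣ) (n : ℕ) (hx : ord x = n) :
    ∃ (s : ℤˣ) (a : Fˣ), ord a = 0 ∧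
      hTilde x = central s * (hTilde (unif hϖ) ^ n * hTilde a) := by
  obtain ⟨s, h⟩ := hTilde_unif_pow hϖ n
  refine ⟨hilb (unif hϖ ^ n) ((unif hϖ ^ n)⁻¹ * x) * s, (unif hϖ ^ n)⁻¹ * x, ?_, ?_⟩
  · rw [ord_mul, ord_inv, hx, ← zpow_natCast, ord_zpow, ord_unif]; ring
  · have h1 := hTilde_mul (unif hϖ ^ n) ((unif hϖ ^ n)⁻¹ * x)
    rw [mul_inv_cancel_left, h] at h1
    rw [central_mul, mul_assoc, ← mul_assoc (central s), h1,
      ← mul_assoc, ← central_mul, Int.units_mul_self, central_one, one_mul]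

lemma mul_left_central (g h : Mp F) (s : ℤˣ) : g * (central s * h) = central s * (g * h) := by
  rw [← mul_assoc, ← central_comm, mul_assoc]

lemma weyl_mul_unif : ∃ s : ℤˣ,
    weyl * hTilde (unif hϖ) = central s * ((hTilde (unif hϖ))⁻¹ * weyl) := by
  refine ⟨hilb (unif hϖ) (-1), ?_⟩
  rw [weyl_mul_hTilde, hTilde_inv, mul_assoc, ← mul_assoc, ← central_mul, Int.units_mul_self,
    central_one, one_mul]

/-- The Bruhat decomposition of the maximal compact subgroup with respect to the Iwahori
subgroup, with the upper unipotent group on the left. -/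
lemma IsSplit.upper_decomp {x : Mp F} (hx : IsSplit x) :
    (∃ b ∈ 𝒪[F], ∃ a : Fˣ, ord a = 0 ∧ ∃ z ∈ lat F 1, x = upperMp b * (hTilde a * lowerMp z)) ∨
    (∃ b ∈ 𝒪[F], ∃ a : Fˣ, ord a = 0 ∧ ∃ y ∈ 𝒪[F],
      x = upperMp b * (weyl * (hTilde a * upperMp y))) := by
  have hi : ∀ i j, x.g i j ∈ 𝒪[F] := hx.1
  have hdet := sl_det x.g
  by_cases hc : red (x.g 1 0) = 0
  · left
    have hc1 := (mem_lat_one (hi 1 0)).2 hc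
    have hd : red (x.g 1 1) ≠ 0 := by
      intro hd
      have h1 := red_det hx.1
      simp [hc, hd] at h1
    obtain ⟨d, hd, hd0⟩ := exists_unit_of_red_ne (hi 1 1) hd
    have hdn : (d : F) ≠ 0 := d.ne_zero
    refine ⟨x.g 0 1 * (d : F)⁻¹, mul_mem (hi 0 1) (unit_inv_mem hd0), d⁻¹,
      by rw [ord_inv, hd0]; rfl, (d : F)⁻¹ * x.g 1 0, int_mul_mem_lat (unit_inv_mem hd0) hc1, ?_⟩
    refine hx.ext_entries ((isSplit_upper (mul_mem (hi 0 1) (unit_inv_mem hd0))).mul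
      ((isSplit_hTilde (by rw [ord_inv, hd0]; rfl)).mul (isSplit_lower
        (lat_int zero_le_one (int_mul_mem_lat (unit_inv_mem hd0) hc1))))) ?_ ?_ ?_ ?_
    all_goals simp [sl_mul, ← hd]
    all_goals rw [← hd] at hdet
    · field_simp
      linear_combination hdet
  · right
    obtain ⟨c, hc, hc0⟩ := exists_unit_of_red_ne (hi 1 0) hc
    have hcn : (c : F) ≠ 0 := c.ne_zero
    have hc0' : ord (-c) = 0 := by
      rw [← neg_one_mul, ord_mul, ord_neg_one, hc0]; rfl
    refine ⟨x.g 0 0 * (c : F)⁻¹, mul_mem (hi 0 0) (unit_inv_mem hc0), -c, hc0',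
      x.g 1 1 * (c : F)⁻¹, mul_mem (hi 1 1) (unit_inv_mem hc0), ?_⟩
    refine hx.ext_entries ((isSplit_upper (mul_mem (hi 0 0) (unit_inv_mem hc0))).mul
      (isSplit_weyl.mul ((isSplit_hTilde hc0').mul
        (isSplit_upper (mul_mem (hi 1 1) (unit_inv_mem hc0)))))) ?_ ?_ ?_ ?_
    all_goals simp [sl_mul, ← hc]
    all_goals rw [← hc] at hdet
    · field_simp
      linear_combination -hdet
    · field_simp

namespace IwahoriEigen

variable {hϖ}

lemma mul_central (H : IwahoriEigen hϖ χ ρ v) (s : ℤˣ) (g : Mp F) :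
    ρ (central s * g) v = signE E s • ρ g v := by
  rw [central_comm, map_mul, Module.End.mul_apply, H.sign, map_smul]

lemma mul_lower (H : IwahoriEigen hϖ χ ρ v) (g : Mp F) {z : F} (hz : z ∈ lat F 1) :
    ρ (g * lowerMp z) v = ρ g v := by
  rw [map_mul, Module.End.mul_apply, H.lower z hz]

lemma mul_hTilde (H : IwahoriEigen hϖ χ ρ v) (g : Mp F) {a : Fˣ} (ha : ord a = 0) :
    ρ (g * hTilde a) v = (χ (hTorus a) : E) • ρ g v := by
  rw [map_mul, Module.End.mul_apply, H.diag a ha, map_smul]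

lemma mem_level (ρ : Representation E (Mp F) P) (v : P) {k : Mp F} (hk : k ∈ Kt F) (n : ℕ) :
    ρ (k * hTilde (unif hϖ) ^ n) v ∈ level hϖ ρ v n :=
  Submodule.subset_span ⟨⟨k, hk⟩, rfl⟩

lemma level_Kt {k : Mp F} (hk : k ∈ Kt F) {n : ℕ} {y : P} (hy : y ∈ level hϖ ρ v n) :
    ρ k y ∈ level hϖ ρ v n := by
  induction hy using Submodule.span_induction with
  | mem y hy =>
    obtain ⟨l, rfl⟩ := hy
    have := mem_level (hϖ := hϖ) ρ v ((Kt F).mul_mem hk l.2) n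
    rwa [mul_assoc, map_mul, Module.End.mul_apply] at this
  | zero => rw [map_zero]; exact zero_mem _
  | add x y _ _ h1 h2 => rw [map_add]; exact add_mem h1 h2
  | smul c x _ h => rw [map_smul]; exact Submodule.smul_mem _ _ h

/-- The levels increase, because the Hecke relation expresses `v` through the vectors
`u(x) h̃(ϖ) v`. -/
lemma level_mono (H : IwahoriEigen hϖ χ ρ v) : Monotone (level hϖ ρ v) := by
  refine monotone_nat_of_le_succ fun n => Submodule.span_le.2 ?_
  rintro _ ⟨k, rfl⟩
  have h1 : ρ (k * hTilde (unif hϖ) ^ n) v = (χ (hTorus (unif hϖ)) : E)⁻¹ •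
      ∑ p, ρ (k * hTilde (unif hϖ) ^ n * (upperMp (rep2 ϖ p) * hTilde (unif hϖ))) v := by
    simp only [map_mul _ (_ * _ ^ n), Module.End.mul_apply]
    rw [← map_sum, H.hecke, map_smul, smul_smul, inv_mul_cancel₀ (Units.ne_zero _), one_smul]
  change ρ (k * hTilde (unif hϖ) ^ n) v ∈ _
  rw [h1]
  refine Submodule.smul_mem _ _ (Submodule.sum_mem _ fun p _ => ?_)
  obtain ⟨x', hx', h2⟩ := unif_pow_mul_upper hϖ n ((isReps_rep2 hϖ).mem p)
  have h3 : (k : Mp F) * hTilde (unif hϖ) ^ n * (upperMp (rep2 ϖ p) * hTilde (unif hϖ)) =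
      k * upperMp x' * hTilde (unif hϖ) ^ (n + 1) := by
    rw [mul_assoc, ← mul_assoc _ (upperMp _), h2, pow_succ]
    simp only [mul_assoc]
  rw [h3]
  exact mem_level ρ v ((Kt F).mul_mem k.2 (isSplit_upper hx').1) (n + 1)

lemma hTilde_mul_mem_iSup (H : IwahoriEigen hϖ χ ρ v) {k : Mp F} (hk : k ∈ Kt F)
    (x : Fˣ) (hx : 0 ≤ ord x) (n : ℕ) :
    ρ (k * (hTilde x * hTilde (unif hϖ) ^ n)) v ∈ ⨆ n, level hϖ ρ v n := by
  obtain ⟨j, hj⟩ := Int.eq_ofNat_of_zero_le hx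
  obtain ⟨s, a, ha, h⟩ := hTilde_eq_unit_mul hϖ x j hj
  obtain ⟨s', h'⟩ := hTilde_mul_unif_pow hϖ a n
  have h1 : k * (hTilde x * hTilde (unif hϖ) ^ n) =
      central s * (central s' * (k * hTilde (unif hϖ) ^ (j + n) * hTilde a)) := by
    rw [h, mul_assoc, mul_assoc, h', mul_left_central _ _ s, mul_left_central _ _ s',
      mul_left_central _ _ s', pow_add]
    simp only [mul_assoc]
  rw [h1, H.mul_central, H.mul_central, H.mul_hTilde _ ha]
  exact Submodule.mem_iSup_of_mem (j + n) (Submodule.smul_mem _ _ (Submodule.smul_mem _ _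
    (Submodule.smul_mem _ _ (mem_level ρ v hk _))))

/-- The non-integral unipotent elements are rewritten through the opposite cell, by
`u(x) = ū(x⁻¹) h̃(x) w ū(x⁻¹)`. -/
lemma upper_mul_mem_iSup (H : IwahoriEigen hϖ χ ρ v) {k : Mp F} (hk : k ∈ Kt F) (u : F) (n : ℕ) :
    ρ (k * (upperMp u * hTilde (unif hϖ) ^ n)) v ∈ ⨆ n, level hϖ ρ v n := by
  by_cases hu : u ∈ 𝒪[F]
  · rw [← mul_assoc]
    exact Submodule.mem_iSup_of_mem n (mem_level ρ v ((Kt F).mul_mem hk (isSplit_upper hu).1) n)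
  · obtain ⟨x, rfl⟩ : ∃ x : Fˣ, (x : F) = u :=
      ⟨Units.mk0 u (fun h => hu (h ▸ zero_mem _)), rfl⟩
    have hx : ord x < 0 := by
      rw [← mem_lat_zero, unit_mem_lat] at hu
      omega
    have hz : (x : F)⁻¹ ∈ lat F 1 := by
      rw [← Units.val_inv_eq_inv_val, unit_mem_lat, ord_inv]; omega
    have h1 : hTilde x * weyl = weyl * hTilde x⁻¹ := by rw [weyl_mul_hTilde, inv_inv]
    have h2 : k * (upperMp (x : F) * hTilde (unif hϖ) ^ n) =
        (k * (lowerMp (x : F)⁻¹ * weyl)) * (hTilde x⁻¹ * hTilde (unif hϖ) ^ n) *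
          lowerMp (ϖ ^ (2 * n) * (x : F)⁻¹) := by
      rw [upper_eq]
      simp only [mul_assoc]
      rw [lower_mul_unif_pow, ← mul_assoc (hTilde x), h1]
      simp only [mul_assoc]
    rw [h2, H.mul_lower _ (unif_pow_mul_mem_lat hz)]
    exact H.hTilde_mul_mem_iSup ((Kt F).mul_mem hk ((Kt F).mul_mem
      (isSplit_lower (lat_int zero_le_one hz)).1 isSplit_weyl.1)) _ (by rw [ord_inv]; omega) n

/-- `h̃(ϖ)` maps each level into the union of the levels: on the first cell of
`IsSplit.upper_decomp` it raises the level by one, on the second cell it lowers it by one, up to a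
unipotent element which need not be integral. -/
lemma unif_mul_mem_iSup (H : IwahoriEigen hϖ χ ρ v) {k : Mp F} (hk : k ∈ Kt F) (n : ℕ) :
    ρ (hTilde (unif hϖ) * (k * hTilde (unif hϖ) ^ (n + 1))) v ∈ ⨆ n, level hϖ ρ v n := by
  obtain ⟨x, hx, hkx⟩ := Kt_eq_central_mul (⟨k, hk⟩ : Kt F)
  change k = _ at hkx
  rw [hkx, mul_assoc, ← mul_assoc, ← central_comm, mul_assoc, H.mul_central]
  refine Submodule.smul_mem _ _ ?_
  have hϖ2 : ∀ b ∈ 𝒪[F], ((unif hϖ : Fˣ) : F) * (unif hϖ : Fˣ) * b ∈ 𝒪[F] := fun b hb =>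
    mul_mem (mul_mem ϖ.2 ϖ.2) hb
  rcases hx.upper_decomp with ⟨b, hb, a, ha, z, hz, rfl⟩ | ⟨b, hb, a, ha, y, hy, rfl⟩
  · obtain ⟨s, hs⟩ := hTilde_comm (unif hϖ) a
    have h1 : hTilde (unif hϖ) * (upperMp b * (hTilde a * lowerMp z) * hTilde (unif hϖ) ^ (n + 1)) =
        central s * (upperMp ((unif hϖ : Fˣ) * (unif hϖ : Fˣ) * b) *
          (hTilde a * hTilde (unif hϖ) ^ (n + 2)) * lowerMp (ϖ ^ (2 * (n + 1)) * z)) := by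
      simp only [mul_assoc]
      rw [lower_mul_unif_pow, ← mul_assoc, hTilde_mul_upper, mul_assoc, ← mul_assoc (hTilde _), hs,
        mul_assoc (central s), mul_left_central, pow_succ' _ (n + 1)]
      simp only [mul_assoc]
    rw [h1, H.mul_central, H.mul_lower _ (unif_pow_mul_mem_lat hz)]
    exact Submodule.smul_mem _ _ (H.hTilde_mul_mem_iSup (isSplit_upper (hϖ2 b hb)).1 a ha.ge _)
  · obtain ⟨s, hs⟩ := weyl_mul_unif hϖ
    obtain ⟨s', hs'⟩ := hTilde_comm (unif hϖ)⁻¹ a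
    have h0 : hTilde (unif hϖ) * weyl = weyl * hTilde (unif hϖ)⁻¹ := by
      rw [weyl_mul_hTilde, inv_inv]
    have h2 : hTilde (unif hϖ)⁻¹ * (upperMp y * hTilde (unif hϖ) ^ (n + 1)) =
        central (hilb (unif hϖ) (-1)) * (upperMp (((unif hϖ)⁻¹ : Fˣ) * ((unif hϖ)⁻¹ : Fˣ) * y) *
          hTilde (unif hϖ) ^ n) := by
      have h3 : hTilde (unif hϖ)⁻¹ = central (hilb (unif hϖ) (-1)) * (hTilde (unif hϖ))⁻¹ := by
        rw [hTilde_inv, ← mul_assoc, ← central_mul, Int.units_mul_self, central_one, one_mul]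
      rw [← mul_assoc, hTilde_mul_upper, h3, pow_succ', mul_assoc, mul_assoc (central _),
        inv_mul_cancel_left, mul_left_central]
    have h1 : hTilde (unif hϖ) * (upperMp b * (weyl * (hTilde a * upperMp y)) *
          hTilde (unif hϖ) ^ (n + 1)) =
        central s' * (central (hilb (unif hϖ) (-1)) *
          ((upperMp ((unif hϖ : Fˣ) * (unif hϖ : Fˣ) * b) * (weyl * hTilde a)) *
          (upperMp (((unif hϖ)⁻¹ : Fˣ) * ((unif hϖ)⁻¹ : Fˣ) * y) * hTilde (unif hϖ) ^ n))) := by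
      have h4 : ∀ g, hTilde (unif hϖ) * (weyl * g) = weyl * (hTilde (unif hϖ)⁻¹ * g) := fun g => by
        rw [← mul_assoc, h0, mul_assoc]
      have h5 : ∀ g, hTilde (unif hϖ)⁻¹ * (hTilde a * g) =
          central s' * (hTilde a * (hTilde (unif hϖ)⁻¹ * g)) := fun g => by
        rw [← mul_assoc, hs', mul_assoc, mul_assoc]
      rw [← mul_assoc, ← mul_assoc, hTilde_mul_upper]
      simp only [mul_assoc _ _ (_ : Mp F)]
      rw [h4, h5, h2]
      rw [mul_left_central weyl, mul_left_central (upperMp _), mul_left_central (hTilde a),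
        mul_left_central weyl, mul_left_central (upperMp _)]
    rw [h1, H.mul_central, H.mul_central]
    exact Submodule.smul_mem _ _ (Submodule.smul_mem _ _ (H.upper_mul_mem_iSup
      ((Kt F).mul_mem (isSplit_upper (hϖ2 b hb)).1 ((Kt F).mul_mem isSplit_weyl.1
        (isSplit_hTilde ha).1)) _ n))

/-- The span of the vectors `k h̃(ϖ)ⁿ v` is stable under the whole group. -/
lemma iSup_level_stable (H : IwahoriEigen hϖ χ ρ v) (g : Mp F) {y : P}
    (hy : y ∈ ⨆ n, level hϖ ρ v n) : ρ g y ∈ ⨆ n, level hϖ ρ v n := by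
  have hdir : Directed (· ≤ ·) (level hϖ ρ v) := H.level_mono.directed_le
  have hK : ∀ k ∈ Kt F, ∀ y ∈ ⨆ n, level hϖ ρ v n, ρ k y ∈ ⨆ n, level hϖ ρ v n := by
    intro k hk y hy
    obtain ⟨n, hn⟩ := (Submodule.mem_iSup_of_directed _ hdir).1 hy
    exact Submodule.mem_iSup_of_mem n (level_Kt hk hn)
  have hT : ∀ y ∈ ⨆ n, level hϖ ρ v n, ρ (hTilde (unif hϖ)) y ∈ ⨆ n, level hϖ ρ v n := by
    intro y hy
    obtain ⟨n, hn⟩ := (Submodule.mem_iSup_of_directed _ hdir).1 hy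
    have hn' := H.level_mono (Nat.le_succ n) hn
    clear hn hy
    induction hn' using Submodule.span_induction with
    | mem y hy =>
      obtain ⟨l, rfl⟩ := hy
      have := H.unif_mul_mem_iSup l.2 n
      rwa [map_mul, Module.End.mul_apply] at this
    | zero => rw [map_zero]; exact zero_mem _
    | add x y _ _ h1 h2 => rw [map_add]; exact add_mem h1 h2
    | smul c x _ h => rw [map_smul]; exact Submodule.smul_mem _ _ h
  let S : Subgroup (Mp F) :=
    { carrier := {g | ∀ y ∈ ⨆ n, level hϖ ρ v n, ρ g y ∈ (⨆ n, level hϖ ρ v n) ∧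
        ρ g⁻¹ y ∈ ⨆ n, level hϖ ρ v n}
      one_mem' := fun y hy => by simpa using hy
      mul_mem' := fun {a b} ha hb y hy => by
        rw [mul_inv_rev, map_mul, map_mul, Module.End.mul_apply, Module.End.mul_apply]
        exact ⟨(ha _ (hb y hy).1).1, (hb _ (ha y hy).2).2⟩
      inv_mem' := fun {a} ha y hy => by
        rw [inv_inv]
        exact ⟨(ha y hy).2, (ha y hy).1⟩ }
  have hS : S = ⊤ := by
    refine subgroup_eq_top hϖ (fun k hk y hy => ⟨hK k hk y hy, hK _ ((Kt F).inv_mem hk) y hy⟩)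
      fun y hy => ⟨hT y hy, ?_⟩
    obtain ⟨s, hs⟩ := weyl_mul_unif hϖ
    have h1 : (hTilde (unif hϖ))⁻¹ = central s * (weyl * (hTilde (unif hϖ) * weyl⁻¹)) := by
      rw [← mul_assoc weyl, hs]
      simp only [mul_assoc, mul_inv_cancel, mul_one]
      rw [← mul_assoc, ← central_mul, Int.units_mul_self, central_one, one_mul]
    rw [h1, map_mul, map_mul, map_mul]
    simp only [Module.End.mul_apply]
    exact hK _ (central_mem s) _ (hK _ isSplit_weyl.1 _ (hT _ (hK _
      ((Kt F).inv_mem isSplit_weyl.1) _ hy)))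
  have hg : g ∈ S := hS ▸ Subgroup.mem_top g
  exact (hg y hy).1

lemma mem_iSup_level (ρ : Representation E (Mp F) P) (v : P) : v ∈ ⨆ n, level hϖ ρ v n := by
  have h := mem_level (hϖ := hϖ) ρ v (Kt F).one_mem 0
  rw [pow_zero, one_mul, map_one, Module.End.one_apply] at h
  exact Submodule.mem_iSup_of_mem 0 h

end IwahoriEigen

/-- The function `cellFun χ` has the defining properties. -/
lemma iwahoriEigen_cellFun (hχ : IsTameGenuine χ) (hq : (Fintype.card 𝓀[F] : E) = 0)
    (h2 : ringChar 𝓀[F] ≠ 2) : IwahoriEigen hϖ χ (rightReg E (Mp F) E) (cellFun χ) where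
  upper x hx := funext fun g => cellFun_mul_upper hx g
  lower z hz := funext fun g => cellFun_mul_lower hχ hz g
  diag a ha := funext fun g => cellFun_mul_hTilde ha g
  sign z := funext fun g => by
    rw [rightReg_apply, ← central_comm, ps_central hχ (cellFun_mem hχ)]; rfl
  hecke := by
    have hi := cellFun_iwahoriInv hχ
    have h := uOp_eq hϖ hχ hq (cellFun_mem hχ) hi
    have hw : cellFun χ (weyl : Mp F) = 0 := by
      have := cellFun_weyl_lower (χ := χ) (zero_mem (lat F 1))
      rwa [lowerMp_zero, mul_one] at this
    rw [uOp_one_of_trivial hϖ hχ hq h2 (cellFun_mem hχ) hi (Or.inr hw), cellFun_one, mul_one] at h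
    rw [← h]
    funext g
    rw [Finset.sum_apply]; rfl

lemma iwahoriEigen_prod {P' : Type*} [AddCommGroup P'] [Module E P']
    {ρ' : Representation E (Mp F) P'} {v' : P'} (H : IwahoriEigen hϖ χ ρ v)
    (H' : IwahoriEigen hϖ χ ρ' v') : IwahoriEigen hϖ χ (ρ.prod ρ') (v, v') where
  upper x hx := Prod.ext (H.upper x hx) (H'.upper x hx)
  lower x hx := Prod.ext (H.lower x hx) (H'.lower x hx)
  diag x hx := Prod.ext (H.diag x hx) (H'.diag x hx)
  sign z := Prod.ext (H.sign z) (H'.sign z)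
  hecke := by
    refine Prod.ext ?_ ?_
    · rw [Prod.fst_sum]; exact H.hecke
    · rw [Prod.snd_sum]; exact H'.hecke

lemma ps_torus_pow_mul {f : Mp F → E} (hf : f ∈ PS χ) (n : ℕ) (g : Mp F) :
    f ((hTilde (unif hϖ) ^ n)⁻¹ * g) = ((χ (hTorus (unif hϖ)) : E) ^ n)⁻¹ * f g := by
  have h := ps_torus hf ((hTorus (unif hϖ) ^ n)⁻¹) g
  rw [map_inv, map_pow, Units.val_inv_eq_inv_val, Units.val_pow_eq_pow_val] at h
  exact h

lemma weyl_mul_unif_pow (n : ℕ) :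
    weyl * hTilde (unif hϖ) ^ n = hTilde (unif hϖ)⁻¹ ^ n * weyl := by
  induction n with
  | zero => simp
  | succ n ih =>
    rw [pow_succ, ← mul_assoc, ih, mul_assoc, weyl_mul_hTilde, ← mul_assoc, ← pow_succ]

/-- An element of `h̃(ϖ)⁻ⁿ K h̃(ϖ)ⁿ` at which `cellFun` does not vanish acts by a scalar on every
vector with the properties of `cellFun`. -/
lemma exists_scalar_of_cellFun_ne_zero (hχ : IsTameGenuine χ) (H : IwahoriEigen hϖ χ ρ v)
    {n : ℕ} (hn : 1 ≤ n) {k : Mp F} (hk : k ∈ Kt F)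
    (h0 : cellFun χ ((hTilde (unif hϖ) ^ n)⁻¹ * (k * hTilde (unif hϖ) ^ n)) ≠ 0) :
    ∃ c : E, ρ ((hTilde (unif hϖ) ^ n)⁻¹ * (k * hTilde (unif hϖ) ^ n)) v = c • v := by
  have hcell := cellFun_mem hχ
  obtain ⟨x, hx, hkx⟩ := Kt_eq_central_mul (⟨k, hk⟩ : Kt F)
  change k = _ at hkx
  set s := signK (⟨k, hk⟩ : Kt F) with hs
  clear_value s
  rw [hkx, mul_assoc, mul_left_central] at h0 ⊢
  rw [ps_central hχ hcell] at h0
  replace h0 := right_ne_zero_of_mul h0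
  suffices h : ∃ c : E, ρ ((hTilde (unif hϖ) ^ n)⁻¹ * (x * hTilde (unif hϖ) ^ n)) v = c • v by
    obtain ⟨c, hc⟩ := h
    exact ⟨signE E s * c, by rw [H.mul_central, hc, smul_smul]⟩
  have hi : ∀ i j, x.g i j ∈ 𝒪[F] := hx.1
  -- If the upper left entry is not a unit, the element lies in the small cell, where `cellFun` is
  -- zero.
  by_cases ha : red (x.g 0 0) = 0
  · exfalso
    have ha1 := (mem_lat_one (hi 0 0)).2 ha
    have hb : red (x.g 0 1) ≠ 0 := by
      intro hb
      have h1 := red_det hx.1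
      simp [ha, hb] at h1
    obtain ⟨b, hb, hb0⟩ := exists_unit_of_red_ne (hi 0 1) hb
    have hz : x.g 0 0 * (b : F)⁻¹ ∈ lat F 1 := by
      rw [mul_comm]; exact int_mul_mem_lat (unit_inv_mem hb0) ha1
    rw [hx.eq_of_unit' hb.symm hb0, ps_torus_pow_mul hϖ hcell] at h0
    replace h0 := right_ne_zero_of_mul h0
    refine h0 ?_
    have h3 := cellFun_weyl_lower (χ := χ) (zero_mem (lat F 1))
    rw [lowerMp_zero, mul_one] at h3
    have h4 := ps_torus hcell (hTorus (unif hϖ)⁻¹ ^ n) weyl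
    change cellFun χ (hTilde (unif hϖ)⁻¹ ^ n * weyl) = _ at h4
    rw [mul_assoc, mul_assoc, ps_hTilde hcell, ps_lower hcell, mul_assoc, lower_mul_unif_pow,
      ← mul_assoc, cellFun_mul_lower hχ (unif_pow_mul_mem_lat hz), weyl_mul_unif_pow, h4, h3,
      mul_zero, mul_zero]
  · obtain ⟨a, ha, ha0⟩ := exists_unit_of_red_ne (hi 0 0) ha
    set y := x.g 0 1 * (a : F)⁻¹ with hy
    set z := (a : F) * x.g 1 0 with hz
    have hz0 : z ∈ 𝒪[F] := mul_mem (unit_mem ha0) (hi 1 0)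
    have hx' := hx.eq_of_unit ha.symm ha0
    obtain ⟨u, hu⟩ : ∃ u : Fˣ, u = unif hϖ ^ n := ⟨_, rfl⟩
    obtain ⟨s1, hs1⟩ := hTilde_unif_pow hϖ n
    -- conjugation by the power of `h̃(ϖ)` expands the upper and shrinks the lower unipotent part
    have hup : upperMp y * hTilde (unif hϖ) ^ n = hTilde (unif hϖ) ^ n * upperMp (y / (u * u)) := by
      have h1 := upper_mul_hTilde u y
      rw [hu, hs1, mul_left_central, mul_assoc, ← hu] at h1
      exact mul_left_cancel h1
    obtain ⟨s2, hs2⟩ := hTilde_mul_unif_pow hϖ a n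
    have hlow : (ϖ : F) ^ (2 * n) * z ∈ lat F 1 := by
      obtain ⟨m, rfl⟩ := Nat.exists_eq_add_of_le hn
      have h1 : (ϖ : F) ^ (2 * (1 + m)) * z = ϖ * (ϖ ^ (2 * m + 1) * z) := by ring
      rw [h1]
      exact unif_mul_mem_lat hϖ (mem_lat_zero.2 (mul_mem (pow_mem ϖ.2 _) hz0))
    have hconj : (hTilde (unif hϖ) ^ n)⁻¹ * (x * hTilde (unif hϖ) ^ n) =
        central s2 * (hTilde a * (lowerMp (ϖ ^ (2 * n) * z) * upperMp (y / (u * u)))) := by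
      rw [hx', mul_assoc, hup, mul_assoc, ← mul_assoc (lowerMp _), lower_mul_unif_pow, mul_assoc,
        ← mul_assoc (hTilde a), hs2]
      simp only [mul_assoc (_ : Mp F)]
      rw [mul_left_central, inv_mul_cancel_left]
    rw [hconj] at h0 ⊢
    rw [ps_central hχ hcell, ps_hTilde hcell, ps_lower hcell] at h0
    have hyi : y / (u * u) ∈ 𝒪[F] := by
      by_contra h
      exact h0 (by rw [cellFun_upper_of_not_mem hχ h]; ring)
    refine ⟨signE E s2 * χ (hTorus a), ?_⟩
    rw [H.mul_central, map_mul, Module.End.mul_apply, map_mul, Module.End.mul_apply,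
      H.upper _ hyi, H.lower _ hlow, H.diag a ha0, smul_smul]

/-- A linear relation between translates of `cellFun` at a fixed level also holds for the
corresponding translates of `v`: two translates of `cellFun` at that level are either proportional,
by a scalar which is the same for `v`, or one vanishes at the point where the other is `1`. -/
lemma level_relation (hχ : IsTameGenuine χ) (H : IwahoriEigen hϖ χ ρ v)
    (H0 : IwahoriEigen hϖ χ (rightReg E (Mp F) E) (cellFun χ)) {n : ℕ} (hn : 1 ≤ n)
    (c : Kt F →₀ E)
    (hc : ∑ k ∈ c.support, c k • rightReg E (Mp F) E (k * hTilde (unif hϖ) ^ n) (cellFun χ) = 0) :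
    ∑ k ∈ c.support, c k • ρ (k * hTilde (unif hϖ) ^ n) v = 0 := by
  classical
  set t := hTilde (unif hϖ) ^ n with ht
  -- The scalars for `cellFun` and for `v` coincide: both come from the pair `(cellFun χ, v)`.
  have hH := iwahoriEigen_prod hϖ H0 H
  let δ : Kt F → Kt F → Mp F := fun k l => t⁻¹ * (((k⁻¹ * l : Kt F) : Mp F) * t)
  have hδ : ∀ k l m, δ k l * δ l m = δ k m := fun k l m => by
    simp only [δ, Subgroup.coe_mul, Subgroup.coe_inv]; group
  have hδ1 : ∀ k, δ k k = 1 := fun k => by simp [δ]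
  have key : ∀ k l, cellFun χ (δ k l) ≠ 0 →
      rightReg E (Mp F) E (δ k l) (cellFun χ) = cellFun χ (δ k l) • cellFun χ ∧
      ρ (δ k l) v = cellFun χ (δ k l) • v := by
    intro k l h
    obtain ⟨e, he⟩ := exists_scalar_of_cellFun_ne_zero hϖ hχ hH hn (k⁻¹ * l).2 h
    have h1 : rightReg E (Mp F) E (δ k l) (cellFun χ) = e • cellFun χ := congrArg Prod.fst he
    have h2 : ρ (δ k l) v = e • v := congrArg Prod.snd he
    have h3 : cellFun χ (δ k l) = e := by
      have := congrFun h1 1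
      rwa [rightReg_apply, one_mul, Pi.smul_apply, cellFun_one, smul_eq_mul, mul_one] at this
    rw [h3]
    exact ⟨h1, h2⟩
  have hmul : ∀ k l m, cellFun χ (δ l m) ≠ 0 →
      cellFun χ (δ k m) = cellFun χ (δ l m) * cellFun χ (δ k l) := by
    intro k l m h
    have h1 := congrFun (key l m h).1 (δ k l)
    rwa [rightReg_apply, hδ, Pi.smul_apply, smul_eq_mul] at h1
  -- Proportionality of the translates is an equivalence relation; the linear relation splits into
  -- one relation for each class.
  let S : Setoid (Kt F) :=
    { r := fun k l => cellFun χ (δ k l) ≠ 0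
      iseqv := by
        refine ⟨fun k => ?_, fun {k l} h => ?_, fun {k l m} h h' => ?_⟩
        · rw [hδ1, cellFun_one]; exact one_ne_zero
        · have h1 := hmul l k l h
          rw [hδ1, cellFun_one] at h1
          exact right_ne_zero_of_mul (h1 ▸ one_ne_zero)
        · rw [hmul k l m h']
          exact mul_ne_zero h' h }
  rw [Finset.sum_partition S]
  refine Finset.sum_eq_zero fun q hq => ?_
  obtain ⟨k, rfl⟩ := Quotient.exists_rep q
  have hterm : ∀ l, cellFun χ (δ k l) ≠ 0 →
      c l • ρ (l * t) v = (c l * cellFun χ (δ k l)) • ρ (k * t) v := by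
    intro l h
    have h1 : (l : Mp F) * t = k * t * δ k l := by
      simp only [δ, Subgroup.coe_mul, Subgroup.coe_inv]; group
    rw [h1, map_mul, Module.End.mul_apply, (key k l h).2, map_smul, smul_smul]
  have hsum : ∑ l ∈ c.support with (⟦l⟧ : Quotient S) = ⟦k⟧, c l * cellFun χ (δ k l) = 0 := by
    -- At this point only the translates in the class of `k` are nonzero.
    have h1 := congrFun hc (t⁻¹ * (k : Mp F)⁻¹)
    rw [Finset.sum_apply] at h1
    rw [Finset.sum_filter]
    refine Eq.trans ?_ h1
    refine Finset.sum_congr rfl fun l _ => ?_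
    have h2 : t⁻¹ * (k : Mp F)⁻¹ * (l * t) = δ k l := by
      simp only [δ, Subgroup.coe_mul, Subgroup.coe_inv]; group
    rw [Pi.smul_apply, rightReg_apply, h2, smul_eq_mul]
    split_ifs with h3
    · rfl
    · by_contra h4
      refine h3 (Quotient.sound (S.symm ?_))
      exact right_ne_zero_of_mul (Ne.symm h4)
  rw [Finset.sum_congr rfl fun l hl => hterm l (S.symm (Quotient.exact (Finset.mem_filter.1 hl).2)),
    ← Finset.sum_smul, hsum, zero_smul]

/-- The universal property of the principal series: a vector on which the Iwahori subgroup and the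
operator `∑ u(x) h̃(ϖ)` act in the same way as on `cellFun χ` is the image of `cellFun χ` under an
equivariant map. -/
lemma exists_intertwining (hχ : IsTameGenuine χ) (hq : (Fintype.card 𝓀[F] : E) = 0)
    (h2 : ringChar 𝓀[F] ≠ 2) (H : IwahoriEigen hϖ χ ρ v) :
    ∃ Θ : Representation.IntertwiningMap (principalSeries fun t => (χ t : E)) ρ,
      Θ ⟨cellFun χ, cellFun_mem hχ⟩ = v := by
  have H0 := iwahoriEigen_cellFun hϖ hχ hq h2
  have hH := iwahoriEigen_prod hϖ H0 H
  -- The subrepresentation `R` generated by `(cellFun χ, v)` is the graph of the required map.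
  set R := ⨆ n, level hϖ ((rightReg E (Mp F) E).prod ρ) (cellFun χ, v) n with hR
  have hst : ∀ g, ∀ y ∈ R, (rightReg E (Mp F) E).prod ρ g y ∈ R := fun g y hy =>
    hH.iSup_level_stable g hy
  have huniq : ∀ y ∈ R, y.1 = 0 → y.2 = 0 := by
    intro y hy h0
    obtain ⟨n, hn⟩ := (Submodule.mem_iSup_of_directed _ hH.level_mono.directed_le).1 hy
    have hn' := hH.level_mono (Nat.le_succ n) hn
    obtain ⟨c, rfl⟩ := Finsupp.mem_span_range_iff_exists_finsupp.1 hn'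
    rw [Finsupp.sum, Prod.fst_sum] at h0
    rw [Finsupp.sum, Prod.snd_sum]
    exact level_relation hϖ hχ H H0 (by omega) c h0
  have hex : ∀ f : PS χ, ∃ y, ((f : Mp F → E), y) ∈ R := by
    intro f
    have := mem_of_cellFun_mem hχ (W := R.map (LinearMap.fst E (Mp F → E) P)) (by
      rintro g _ ⟨y, hy, rfl⟩
      exact ⟨_, hst g y hy, rfl⟩) ⟨_, IwahoriEigen.mem_iSup_level _ _, rfl⟩ f.2
    obtain ⟨y, hy, h⟩ := this
    exact ⟨y.2, by rw [← h]; exact hy⟩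
  have huniq' : ∀ f y y', (f, y) ∈ R → (f, y') ∈ R → y = y' := fun f y y' h h' => by
    have := huniq _ (R.sub_mem h h') (by simp)
    exact sub_eq_zero.1 this
  choose Θ hΘ using hex
  let Θ' : PS χ →ₗ[E] P :=
    { toFun := Θ
      map_add' := fun f f' => huniq' _ _ _ (hΘ (f + f')) (R.add_mem (hΘ f) (hΘ f'))
      map_smul' := fun a f => huniq' _ _ _ (hΘ (a • f)) (R.smul_mem a (hΘ f)) }
  refine ⟨Θ'.intertwiningMap_of_isIntertwiningMap _ _ fun g f =>
    huniq' _ _ _ (hΘ _) (hst g _ (hΘ f)), ?_⟩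
  exact huniq' _ _ _ (hΘ _) (IwahoriEigen.mem_iSup_level _ _)

/-- A representation generated by a nonzero vector with the properties of `cellFun χ` is isomorphic
to the principal series. -/
lemma nonempty_equiv (p : ℕ) [Fact p.Prime] [CharP 𝓀[F] p] [CharP E p] (hp : p ≠ 2)
    (hχ : IsTameGenuine χ) (H : IwahoriEigen hϖ χ ρ v) (hv : v ≠ 0)
    (hgen : ∀ W : Submodule E P, (∀ g, ∀ y ∈ W, ρ g y ∈ W) → v ∈ W → W = ⊤) :
    Nonempty (Representation.Equiv ρ (principalSeries fun t => (χ t : E))) := by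
  have hq : (Fintype.card 𝓀[F] : E) = 0 := by
    rw [CharP.cast_eq_zero_iff E p]
    exact (CharP.cast_eq_zero_iff 𝓀[F] p _).1 (Nat.cast_card_eq_zero 𝓀[F])
  have h2 : ringChar 𝓀[F] ≠ 2 := by rwa [ringChar.eq 𝓀[F] p]
  obtain ⟨Θ, hΘ⟩ := exists_intertwining hϖ hχ hq h2 H
  have hcomm : ∀ g f, Θ (principalSeries (fun t => (χ t : E)) g f) = ρ g (Θ f) := fun g f =>
    LinearMap.congr_fun (Θ.isIntertwining' g) f
  have hirr := principalSeries_isIrreducible p hp hχ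
  have hsurj : Function.Surjective Θ := by
    have := hgen (LinearMap.range Θ.toLinearMap) (by
      rintro g _ ⟨f, rfl⟩
      exact ⟨_, hcomm g f⟩) ⟨_, hΘ⟩
    exact LinearMap.range_eq_top.1 this
  have hne : Θ ≠ 0 := by
    intro h
    rw [h] at hΘ
    exact hv hΘ.symm
  have hinj : Function.Injective Θ :=
    (Representation.IsIrreducible.injective_or_eq_zero Θ).resolve_right hne
  exact ⟨(Θ.ofBijective ⟨hinj, hsurj⟩).symm⟩

end Universal

/-! ### Highest weight vectors -/

section Weights

open Matrix
open scoped TensorProduct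

/-- The matrix `(1 x; 0 1)`. -/
def upperSL {R : Type*} [CommRing R] (x : R) : SpecialLinearGroup (Fin 2) R :=
  ⟨!![1, x; 0, 1], by simp⟩

/-- The matrix `(1 0; y 1)`. -/
def lowerSL {R : Type*} [CommRing R] (y : R) : SpecialLinearGroup (Fin 2) R :=
  ⟨!![1, 0; y, 1], by simp⟩

/-- The data of a highest weight vector `v₀` of a representation of `SL₂(k)` together with a
functional `l`, invariant under the lower unipotent subgroup and normalised by `l v₀ = 1`, in terms
of which the operator `rho` is `v ↦ l(v) v₀`. -/
structure HighestWeight {k E V : Type*} [Field k] [Field E] [AddCommGroup V] [Module E V]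
    (τ : Representation E (SpecialLinearGroup (Fin 2) k) V) (v₀ : V) (l : V →ₗ[E] E) : Prop where
  rho_apply : ∀ v, rho τ v = l v • v₀
  apply_self : l v₀ = 1
  upper_apply : ∀ u ∈ upper k, τ u v₀ = v₀
  lower_apply : ∀ u ∈ lower k, ∀ v, l (τ u v) = l v
  span_lower : Submodule.span E (Set.range fun u : lower k => τ u v₀) = ⊤

/-- Criterion for a highest weight vector: when the lower translates of `v₀` span, and `v₀`
spans the invariants of the upper unipotent subgroup, these map isomorphically onto the coinvariants
of the lower one, so that `rho` takes its nontrivial value. -/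
lemma HighestWeight.of_invariants {k E V : Type*} [Field k] [Field E] [AddCommGroup V] [Module E V]
    {τ : Representation E (SpecialLinearGroup (Fin 2) k) V} {v₀ : V} {l : V →ₗ[E] E}
    (h1 : l v₀ = 1) (h2 : ∀ u ∈ upper k, τ u v₀ = v₀) (h3 : ∀ u ∈ lower k, ∀ v, l (τ u v) = l v)
    (h4 : Submodule.span E (Set.range fun u : lower k => τ u v₀) = ⊤)
    (h5 : ∀ v, (∀ u ∈ upper k, τ u v = v) → ∃ c : E, v = c • v₀) : HighestWeight τ v₀ l where
  apply_self := h1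
  upper_apply := h2
  lower_apply := h3
  span_lower := h4
  rho_apply := by
    have hker : Representation.Coinvariants.ker (τ.comp (lower k).subtype) ≤ LinearMap.ker l := by
      rw [Representation.Coinvariants.ker, Submodule.span_le]
      rintro _ ⟨⟨u, x⟩, rfl⟩
      change l (τ u.1 x - x) = 0
      rw [map_sub, h3 u.1 u.2, sub_self]
    have hl : ∀ v w, toLower τ v = toLower τ w → l v = l w := by
      intro v w h
      rw [toLower, Representation.Coinvariants.mk_eq_iff] at h
      have := hker h
      rwa [LinearMap.mem_ker, map_sub, sub_eq_zero] at this
    have hlow : ∀ v, toLower τ v = toLower τ (l v • v₀) := by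
      have : toLower τ = (toLower τ) ∘ₗ (LinearMap.toSpanSingleton E V v₀) ∘ₗ l := by
        refine LinearMap.ext_on_range h4 fun u => ?_
        change _ = toLower τ (l (τ u.1 v₀) • v₀)
        rw [toLower_lower τ u.2, h3 u.1 u.2, h1, one_smul]
      exact fun v => LinearMap.congr_fun this v
    have hinv : v₀ ∈ Representation.invariants (τ.comp (upper k).subtype) := by
      rw [Representation.mem_invariants]
      exact fun u => h2 u.1 u.2
    have hbij : Function.Bijective (jMap τ) := by
      constructor
      · rw [injective_iff_map_eq_zero]
        rintro ⟨v, hv⟩ h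
        rw [Representation.mem_invariants] at hv
        obtain ⟨c, rfl⟩ := h5 v fun u hu => hv ⟨u, hu⟩
        have h' : toLower τ (c • v₀) = toLower τ 0 := by rw [map_zero]; exact h
        have h6 := hl _ _ h'
        rw [map_smul, h1, map_zero, smul_eq_mul, mul_one] at h6
        ext1
        change c • v₀ = 0
        rw [h6, zero_smul]
      · intro y
        obtain ⟨v, rfl⟩ := Representation.Coinvariants.mk_surjective _ y
        exact ⟨l v • ⟨v₀, hinv⟩, (hlow v).symm⟩
    intro v
    rw [rho, dif_pos hbij]
    change ((LinearEquiv.ofBijective (jMap τ) hbij).symm (toLower τ v)).1 = _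
    have : (LinearEquiv.ofBijective (jMap τ) hbij).symm (toLower τ v) = l v • ⟨v₀, hinv⟩ := by
      rw [LinearEquiv.symm_apply_eq]
      exact hlow v
    rw [this]; rfl

section Polynomials

variable {k E : Type*} [Field k] [Finite k] [Field E] (emb : k →+* E)

/-- The exponent `∑ bᵢ pⁱ` attached to a family of digits. -/
def digitSum {f p : ℕ} {r : Fin f → Fin p} (b : ∀ i, Fin ((r i : ℕ) + 1)) : ℕ :=
  ∑ i, (b i : ℕ) * p ^ (i : ℕ)

lemma digitSum_zero {f p : ℕ} {r : Fin f → Fin p} :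
    digitSum (fun i => (0 : Fin ((r i : ℕ) + 1))) = 0 := by
  simp [digitSum]

lemma digitSum_eq {f p : ℕ} {r : Fin f → Fin p} (b : ∀ i, Fin ((r i : ℕ) + 1)) :
    digitSum b = finFunctionFinEquiv fun i =>
      (⟨b i, by have := (b i).2; have := (r i).2; omega⟩ : Fin p) := by
  rw [finFunctionFinEquiv_apply]; rfl

lemma digitSum_injective {f p : ℕ} {r : Fin f → Fin p} :
    Function.Injective (digitSum (r := r)) := by
  intro b b' h
  rw [digitSum_eq, digitSum_eq] at h
  have h1 := finFunctionFinEquiv.injective (Fin.ext h)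
  funext i
  have h2 := congrFun h1 i
  exact Fin.ext (congrArg Fin.val h2 :)

lemma digitSum_lt {f p : ℕ} {r : Fin f → Fin p} (b : ∀ i, Fin ((r i : ℕ) + 1)) :
    digitSum b < p ^ f := by
  rw [digitSum_eq]; exact Fin.is_lt _

/-- The functions `x ↦ x ^ N`, for `N` smaller than the order of the field, are linearly
independent. -/
lemma eq_zero_of_sum_pow {f p : ℕ} {r : Fin f → Fin p} (hk : Nat.card k = p ^ f)
    (d : (∀ i, Fin ((r i : ℕ) + 1)) → E) (h : ∀ x : k, ∑ b, d b * emb x ^ digitSum b = 0) :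
    d = 0 := by
  classical
  have := Fintype.ofFinite k
  set P : Polynomial E := ∑ b, Polynomial.C (d b) * Polynomial.X ^ digitSum b with hP
  have hdeg : P.degree < p ^ f := by
    refine (Polynomial.degree_sum_le _ _).trans_lt ?_
    rw [Finset.sup_lt_iff (WithBot.bot_lt_coe _)]
    intro b _
    refine (Polynomial.degree_C_mul_X_pow_le _ _).trans_lt ?_
    exact_mod_cast digitSum_lt b
  have hP0 : P = 0 := by
    refine Polynomial.eq_zero_of_degree_lt_of_eval_finset_eq_zero (Finset.univ.image emb) ?_ ?_
    · rw [Finset.card_image_of_injective _ emb.injective, Finset.card_univ,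
        ← Nat.card_eq_fintype_card, hk]
      exact_mod_cast hdeg
    · intro y hy
      obtain ⟨x, -, rfl⟩ := Finset.mem_image.1 hy
      rw [hP, Polynomial.eval_finsetSum]
      simpa using h x
  funext b
  have h1 := congrArg (fun Q => Polynomial.coeff Q (digitSum b)) hP0
  simp only [hP, Polynomial.finsetSum_coeff, Polynomial.coeff_C_mul_X_pow,
    Polynomial.coeff_zero] at h1
  rw [Finset.sum_eq_single b (fun b' _ hb' => if_neg fun h => hb' (digitSum_injective h).symm)
    (by simp), if_pos rfl] at h1
  exact h1

end Polynomials

section SymmetricPowers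

variable {E : Type*} [Field E]

/-- The monomial `X₀ ^ (n - a) X₁ ^ a`. -/
def symMon (E : Type*) [Field E] {n : ℕ} (a : Fin (n + 1)) : SymPow E n :=
  ⟨MvPolynomial.X 0 ^ (n - a : ℕ) * MvPolynomial.X 1 ^ (a : ℕ), by
    have h := ((MvPolynomial.isHomogeneous_X E (0 : Fin 2)).pow (n - a : ℕ)).mul
      ((MvPolynomial.isHomogeneous_X E (1 : Fin 2)).pow (a : ℕ))
    rw [one_mul, one_mul, Nat.sub_add_cancel (Nat.lt_succ_iff.1 a.2)] at h
    exact h⟩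

lemma span_symMon (n : ℕ) : Submodule.span E (Set.range (symMon E (n := n))) = ⊤ := by
  refine eq_top_iff.2 fun P _ => ?_
  have h : (P : MvPolynomial (Fin 2) E) ∈
      (Submodule.span E (Set.range (symMon E (n := n)))).map
        (MvPolynomial.homogeneousSubmodule (Fin 2) E n).subtype := by
    rw [MvPolynomial.as_sum (P : MvPolynomial (Fin 2) E)]
    refine Submodule.sum_mem _ fun d hd => ?_
    have hd' : d 0 + d 1 = n := by
      have : d.degree = n := by
        rw [Finsupp.degree_eq_weight_one]
        exact P.2 (MvPolynomial.mem_support_iff.1 hd)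
      rw [← this, Finsupp.degree_eq_sum, Fin.sum_univ_two]
    refine ⟨MvPolynomial.coeff d P.1 • symMon E ⟨d 1, by omega⟩,
      Submodule.smul_mem _ _ (Submodule.subset_span ⟨_, rfl⟩), ?_⟩
    rw [map_smul]
    change _ • (MvPolynomial.X 0 ^ (n - d 1 : ℕ) * MvPolynomial.X 1 ^ (d 1 : ℕ) :
      MvPolynomial (Fin 2) E) = _
    have e : n - d 1 = d 0 := by omega
    rw [e, MvPolynomial.monomial_eq, Finsupp.prod_fintype _ _ (by simp), Fin.prod_univ_two,
      MvPolynomial.smul_eq_C_mul]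
  obtain ⟨Q, hQ, hQP⟩ := h
  rwa [← Subtype.ext hQP]

/-- Evaluation at a point, on a symmetric power. -/
def symEval (n : ℕ) (x : Fin 2 → E) : SymPow E n →ₗ[E] E :=
  (MvPolynomial.aeval x).toLinearMap ∘ₗ Submodule.subtype _

lemma symEval_symPow (n : ℕ) (g : SpecialLinearGroup (Fin 2) E) (P : SymPow E n) :
    symEval n ![1, 0] (symPow E n g P) = symEval n ![g 0 0, g 0 1] P := by
  change MvPolynomial.aeval ![1, 0] (linSubst g.1 P.1) = MvPolynomial.aeval ![g 0 0, g 0 1] P.1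
  rw [← AlgHom.comp_apply]
  congr 1
  refine MvPolynomial.algHom_ext fun j => ?_
  rw [linSubst, AlgHom.comp_apply, MvPolynomial.aeval_X, Fin.sum_univ_two]
  fin_cases j <;> simp

lemma symEval_symMon {n : ℕ} (a : Fin (n + 1)) (x : Fin 2 → E) :
    symEval n x (symMon E a) = x 0 ^ (n - a : ℕ) * x 1 ^ (a : ℕ) := by
  change MvPolynomial.aeval x (MvPolynomial.X 0 ^ (n - a : ℕ) * MvPolynomial.X 1 ^ (a : ℕ)) = _
  simp

lemma symPow_coe (n : ℕ) (g : SpecialLinearGroup (Fin 2) E) (P : SymPow E n) :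
    (symPow E n g P : MvPolynomial (Fin 2) E) = linSubst g.1 P := rfl

lemma symMon_coe {n : ℕ} (a : Fin (n + 1)) : (symMon E a : MvPolynomial (Fin 2) E) =
    MvPolynomial.X 0 ^ (n - a : ℕ) * MvPolynomial.X 1 ^ (a : ℕ) := rfl

lemma symPow_symMon_zero {n : ℕ} (g : SpecialLinearGroup (Fin 2) E) (h : g 0 0 = 1) :
    symPow E n g (symMon E 0) =
      ∑ a : Fin (n + 1), ((n.choose a : E) * g 1 0 ^ (a : ℕ)) • symMon E a := by
  refine Subtype.ext ?_
  rw [Submodule.coe_sum]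
  simp only [Submodule.coe_smul, symPow_coe, symMon_coe]
  rw [Fin.val_zero, Nat.sub_zero, pow_zero, mul_one, map_pow, linSubst, MvPolynomial.aeval_X,
    Fin.sum_univ_two]
  have h' : g.1 0 0 = 1 := h
  rw [h', map_one, one_mul, add_comm, add_pow, Finset.sum_range]
  refine Finset.sum_congr rfl fun a _ => ?_
  rw [MvPolynomial.smul_eq_C_mul, map_mul, map_pow, mul_pow, map_natCast]
  ring

/-- The zeroth symmetric power is trivial. -/
lemma symPow_of_eq_zero {n : ℕ} (hn : n = 0) (g : SpecialLinearGroup (Fin 2) E) (P : SymPow E n) :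
    symPow E n g P = P := by
  have h : symPow E n g = LinearMap.id := by
    refine LinearMap.ext_on_range (span_symMon n) fun a => Subtype.ext ?_
    have ha := a.2
    have h1 : (a : ℕ) = 0 := by omega
    rw [symPow_coe, LinearMap.id_apply, symMon_coe, h1, hn]
    simp
  rw [h, LinearMap.id_apply]

end SymmetricPowers

section WeightVectors

variable {k E : Type*} [Field k] [Finite k] [Field E] {p : ℕ} [ExpChar E p] (emb : k →+* E)
  {f : ℕ} (r : Fin f → Fin p)

/-- The product of monomials `⊗ X₀ ^ (rᵢ - bᵢ) X₁ ^ bᵢ`. -/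
def weightMon (E : Type*) [Field E] {p f : ℕ} (r : Fin f → Fin p) (b : ∀ i, Fin ((r i : ℕ) + 1)) :
    WeightSpace E fun j => (r j : ℕ) :=
  ⨂ₜ[E] i, symMon E (b i)

/-- The vector of highest weight. -/
def weightVec (E : Type*) [Field E] {p f : ℕ} (r : Fin f → Fin p) :
    WeightSpace E fun j => (r j : ℕ) :=
  weightMon E r fun _ => 0

/-- The functional given by evaluating all the factors at `(1, 0)`; it is invariant under the lower
unipotent subgroup. -/
def weightFun (E : Type*) [Field E] {p f : ℕ} (r : Fin f → Fin p) :
    (WeightSpace E fun j => (r j : ℕ)) →ₗ[E] E :=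
  PiTensorProduct.lift ((MultilinearMap.mkPiAlgebra E (Fin f) E).compLinearMap
    fun i => symEval (r i : ℕ) ![1, 0])

lemma span_weightMon : Submodule.span E (Set.range (weightMon E r)) = ⊤ :=
  PiTensorProduct.submodule_span_eq_top (g := fun i => symMon E (n := (r i : ℕ)))
    fun i => span_symMon (r i : ℕ)

lemma weight_tprod (g : SpecialLinearGroup (Fin 2) k) (P : ∀ i, SymPow E (r i : ℕ)) :
    weight p emb (fun j => (r j : ℕ)) g (⨂ₜ[E] i, P i) =
      ⨂ₜ[E] i, symPow E (r i : ℕ) (SpecialLinearGroup.map ((iterateFrobenius E p i).comp emb) g)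
        (P i) :=
  PiTensorProduct.map_tprod _ _

lemma weightFun_weight_tprod (g : SpecialLinearGroup (Fin 2) k) (P : ∀ i, SymPow E (r i : ℕ)) :
    weightFun E r (weight p emb (fun j => (r j : ℕ)) g (⨂ₜ[E] i, P i)) =
      ∏ i, symEval (r i : ℕ) ![emb (g 0 0) ^ p ^ (i : ℕ), emb (g 0 1) ^ p ^ (i : ℕ)] (P i) := by
  rw [weight_tprod, weightFun, PiTensorProduct.lift.tprod, MultilinearMap.compLinearMap_apply,
    MultilinearMap.mkPiAlgebra_apply]
  refine Finset.prod_congr rfl fun i _ => ?_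
  rw [symEval_symPow]
  rfl

lemma weightFun_weightMon (b : ∀ i, Fin ((r i : ℕ) + 1)) (x : k) :
    weightFun E r (weight p emb (fun j => (r j : ℕ)) (upperSL x) (weightMon E r b)) =
      emb x ^ digitSum b := by
  rw [weightMon, weightFun_weight_tprod, digitSum, ← Finset.prod_pow_eq_pow_sum]
  refine Finset.prod_congr rfl fun i _ => ?_
  rw [symEval_symMon]
  simp [upperSL]
  rw [← pow_mul, mul_comm]

lemma weight_lower_weightVec {u : SpecialLinearGroup (Fin 2) k} (hu : u 0 0 = 1) :
    weight p emb (fun j => (r j : ℕ)) u (weightVec E r) =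
      ∑ b, ((∏ i, ((r i : ℕ).choose (b i) : E)) * emb (u 1 0) ^ digitSum b) • weightMon E r b := by
  classical
  have h := fun i : Fin f => symPow_symMon_zero (n := (r i : ℕ))
    (SpecialLinearGroup.map ((iterateFrobenius E p i).comp emb) u) (by
      change iterateFrobenius E p i (emb (u 0 0)) = 1
      rw [hu, map_one, map_one])
  rw [weightVec, weightMon, weight_tprod]
  simp only [h]
  rw [MultilinearMap.map_sum]
  refine Finset.sum_congr rfl fun b _ => ?_
  rw [MultilinearMap.map_smul_univ, Finset.prod_mul_distrib]
  congr 2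
  rw [digitSum, ← Finset.prod_pow_eq_pow_sum]
  refine Finset.prod_congr rfl fun i _ => ?_
  change (emb (u 1 0) ^ p ^ (i : ℕ)) ^ _ = _
  rw [← pow_mul, mul_comm]

/-- The weights have a highest weight vector. Unipotent elements act through the functions
`x ↦ x ^ digitSum b`, with distinct exponents smaller than the order of `k`; by the linear
independence of these functions the lower translates of `weightVec` span, and the invariants of the
upper unipotent subgroup are the line of `weightVec`. -/
lemma highestWeight_weight [Fact p.Prime] [CharP E p] (hk : Nat.card k = p ^ f) :
    HighestWeight (weight p emb fun j => (r j : ℕ)) (weightVec E r) (weightFun E r) := by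
  classical
  have hfun1 : ∀ u ∈ lower k, ∀ v, weightFun E r (weight p emb (fun j => (r j : ℕ)) u v) =
      weightFun E r v := by
    rintro u ⟨h1, h2, h3⟩ v
    have : weightFun E r ∘ₗ weight p emb (fun j => (r j : ℕ)) u =
        weightFun E r ∘ₗ weight p emb (fun j => (r j : ℕ)) 1 := by
      refine PiTensorProduct.ext (MultilinearMap.ext fun P => ?_)
      change weightFun E r (weight p emb (fun j => (r j : ℕ)) u (⨂ₜ[E] i, P i)) =
        weightFun E r (weight p emb (fun j => (r j : ℕ)) 1 (⨂ₜ[E] i, P i))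
      rw [weightFun_weight_tprod, weightFun_weight_tprod, h1, h2]
      simp
    have h4 := LinearMap.congr_fun this v
    rwa [map_one] at h4
  have hself : weightFun E r (weightVec E r) = 1 := by
    have h1 := weightFun_weightMon emb r (fun _ => 0) 0
    rw [digitSum_zero, pow_zero] at h1
    have h2 : upperSL (0 : k) = 1 := by
      ext i j; fin_cases i <;> fin_cases j <;> rfl
    rwa [h2, map_one, Module.End.one_apply] at h1
  refine HighestWeight.of_invariants hself ?_ hfun1 ?_ ?_
  · rintro u ⟨h1, h2, h3⟩
    rw [weight_lower_weightVec emb r h1, h2, Finset.sum_eq_single (fun _ => 0)]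
    · rw [digitSum_zero]; simp [weightVec]
    · intro b _ hb
      have : digitSum b ≠ 0 := fun h => hb (digitSum_injective (h.trans digitSum_zero.symm))
      rw [map_zero, zero_pow this, mul_zero, zero_smul]
    · simp
  -- A functional `κ` that kills the span of the lower translates kills all monomials: the binomial
  -- coefficients `rᵢ choose bᵢ` are nonzero in `E` since `rᵢ < p`.
  · by_contra hne
    obtain ⟨v, -, hv⟩ := SetLike.exists_of_lt (lt_top_iff_ne_top.2 hne)
    obtain ⟨κ, hκv, hκ⟩ := Submodule.exists_le_ker_of_notMem
      (p := Submodule.span E (Set.range fun u : lower k =>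
        weight p emb (fun j => (r j : ℕ)) u (weightVec E r))) (v := v) hv
    have h1 : (fun b => (∏ i, ((r i : ℕ).choose (b i) : E)) * κ (weightMon E r b)) = 0 := by
      refine eq_zero_of_sum_pow emb hk _ fun y => ?_
      have h2 : κ (weight p emb (fun j => (r j : ℕ)) (lowerSL y) (weightVec E r)) = 0 :=
        hκ (Submodule.subset_span ⟨⟨lowerSL y, rfl, rfl, rfl⟩, rfl⟩)
      rw [weight_lower_weightVec emb r (by simp [lowerSL]), map_sum] at h2
      rw [← h2]
      refine Finset.sum_congr rfl fun b _ => ?_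
      rw [map_smul, smul_eq_mul]
      simp [lowerSL]
      ring
    refine hκv ?_
    have h3 : κ = 0 := by
      refine LinearMap.ext_on_range (span_weightMon r) fun b => ?_
      have h4 := congrFun h1 b
      refine (mul_eq_zero.1 h4).resolve_left (Finset.prod_ne_zero_iff.2 fun i _ h5 => ?_)
      rw [CharP.cast_eq_zero_iff E p] at h5
      have h6 : (r i : ℕ) < p := (r i).2
      have h7 : (b i : ℕ) ≤ r i := Nat.lt_succ_iff.1 (b i).2
      have h8 := (Nat.Prime.dvd_factorial (Fact.out : p.Prime)).1
        (h5.trans (Dvd.intro _ (by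
          have := Nat.choose_mul_factorial_mul_factorial h7
          rwa [mul_assoc] at this)))
      omega
    rw [h3]; rfl
  -- the function `x ↦ l (u(x) v)` is constant for an invariant vector `v`
  · intro v hv
    have hvspan : v ∈ Submodule.span E (Set.range (weightMon E r)) := by
      rw [span_weightMon]; exact Submodule.mem_top
    obtain ⟨c, rfl⟩ := (Submodule.mem_span_range_iff_exists_fun E).1 hvspan
    have h1 : ∀ x : k, ∑ b, c b * emb x ^ digitSum b = c fun _ => 0 := by
      intro x
      have h2 : ∀ x : k, weightFun E r (weight p emb (fun j => (r j : ℕ)) (upperSL x)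
          (∑ b, c b • weightMon E r b)) = ∑ b, c b * emb x ^ digitSum b := by
        intro x
        simp only [map_sum, map_smul, weightFun_weightMon, smul_eq_mul]
      have h3 : ∀ x : k, upperSL x ∈ upper k := fun x => ⟨rfl, rfl, rfl⟩
      rw [← h2, hv _ (h3 x), ← hv _ (h3 0), h2, Finset.sum_eq_single fun _ => 0]
      · rw [digitSum_zero, pow_zero, mul_one]
      · intro b _ hb
        have : digitSum b ≠ 0 := fun h => hb (digitSum_injective (h.trans digitSum_zero.symm))
        rw [map_zero, zero_pow this, mul_zero]
      · simp
    have h4 : (fun b => c b - if b = (fun _ => 0) then c (fun _ => 0) else 0) = 0 := by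
      refine eq_zero_of_sum_pow emb hk _ fun x => ?_
      simp only [sub_mul, Finset.sum_sub_distrib, h1, ite_mul, zero_mul]
      rw [Finset.sum_ite_eq' Finset.univ, if_pos (Finset.mem_univ _), digitSum_zero, pow_zero,
        mul_one, sub_self]
    refine ⟨c fun _ => 0, ?_⟩
    rw [Finset.sum_eq_single (fun _ => 0)]
    · rfl
    · intro b _ hb
      have h5 := congrFun h4 b
      simp only [if_neg hb, sub_zero] at h5
      rw [h5, Pi.zero_apply, zero_smul]
    · simp

/-- For a nontrivial weight, the functional `weightFun` vanishes on elements of the form `g v₀`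
when the upper left entry of `g` is zero. -/
lemma weightFun_eq_zero [Fact p.Prime] {g : SpecialLinearGroup (Fin 2) k} (hg : g 0 0 = 0)
    (hr : ∃ i, (r i : ℕ) ≠ 0) :
    weightFun E r (weight p emb (fun j => (r j : ℕ)) g (weightVec E r)) = 0 := by
  obtain ⟨i, hi⟩ := hr
  rw [weightVec, weightMon, weightFun_weight_tprod]
  refine Finset.prod_eq_zero (Finset.mem_univ i) ?_
  rw [symEval_symMon]
  have hp : p ^ (i : ℕ) ≠ 0 := pow_ne_zero _ (Fact.out : p.Prime).ne_zero
  simp [hg, zero_pow hp, zero_pow hi]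

/-- The weight with all digits zero is trivial. -/
lemma weight_trivial (hr : ∀ i, (r i : ℕ) = 0) (g : SpecialLinearGroup (Fin 2) k)
    (v : WeightSpace E fun j => (r j : ℕ)) : weight p emb (fun j => (r j : ℕ)) g v = v := by
  have h : weight p emb (fun j => (r j : ℕ)) g = LinearMap.id := by
    refine LinearMap.ext_on_range (span_weightMon r) fun b => ?_
    rw [weightMon, weight_tprod]
    simp only [symPow_of_eq_zero (hr _)]
    rfl
  rw [h]; rfl

end WeightVectors

end Weights

/-! ### The Hecke operator on the generators of the compact induction -/

section Bricks

open Matrix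

variable {F : Type*} [Field F] [ValuativeRel F] [TopologicalSpace F]
  [IsNonarchimedeanLocalField F] {E V : Type*} [Field E] [AddCommGroup V] [Module E V]
  (τ : Representation E (SpecialLinearGroup (Fin 2) 𝓀[F]) V)

/-- The representation `genuineLift τ` of the preimage of `SL₂(𝒪)`, extended by zero. -/
def extLift (x : Mp F) : V →ₗ[E] V :=
  open scoped Classical in if h : x ∈ Kt F then genuineLift τ ⟨x, h⟩ else 0

lemma extLift_coe (k : Kt F) : extLift τ (k : Mp F) = genuineLift τ k := dif_pos k.2

lemma extLift_of_notMem {x : Mp F} (h : x ∉ Kt F) : extLift τ x = 0 := dif_neg h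

lemma extLift_one : extLift τ (1 : Mp F) = LinearMap.id :=
  (extLift_coe τ 1).trans (map_one _)

lemma extLift_mul {k : Mp F} (hk : k ∈ Kt F) (x : Mp F) (v : V) :
    extLift τ (k * x) v = extLift τ k (extLift τ x v) := by
  by_cases hx : x ∈ Kt F
  · have := congrArg (fun A => A v) (map_mul (genuineLift τ) ⟨k, hk⟩ ⟨x, hx⟩)
    rw [← extLift_coe, ← extLift_coe] at this
    rw [← extLift_coe] at this
    exact this
  · rw [extLift_of_notMem τ hx, extLift_of_notMem τ (fun h => hx ?_)]
    · simp
    · exact (Subgroup.mul_mem_cancel_left _ hk).1 h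

lemma extLift_mul' (x : Mp F) {k : Mp F} (hk : k ∈ Kt F) (v : V) :
    extLift τ (x * k) v = extLift τ x (extLift τ k v) := by
  by_cases hx : x ∈ Kt F
  · exact extLift_mul τ hx k v
  · rw [extLift_of_notMem τ hx, extLift_of_notMem τ (fun h => hx ?_)]
    · simp
    · exact (Subgroup.mul_mem_cancel_right _ hk).1 h

lemma extLift_split {x : Mp F} (hx : IsSplit x) {m : SpecialLinearGroup (Fin 2) 𝓀[F]}
    (h : ∀ i j, red (x.g i j) = m i j) : extLift τ x = τ m := by
  obtain ⟨hK, hs⟩ := hx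
  rw [extLift, dif_pos hK, genuineLift_apply, hs, signE_one, one_smul]
  congr 1
  ext i j
  exact h i j

/-- The Weyl element of `SL₂`. -/
def weylSL {R : Type*} [CommRing R] : SpecialLinearGroup (Fin 2) R :=
  ⟨!![0, 1; -1, 0], by rw [det_fin_two_of]; simp⟩

lemma extLift_upper {x : F} (hx : x ∈ 𝒪[F]) : extLift τ (upperMp x) = τ (upperSL (red x)) := by
  refine extLift_split τ (isSplit_upper hx) fun i j => ?_
  fin_cases i <;> fin_cases j <;> simp [upperSL, red_one, red_zero]

lemma extLift_lower {x : F} (hx : x ∈ 𝒪[F]) : extLift τ (lowerMp x) = τ (lowerSL (red x)) := by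
  refine extLift_split τ (isSplit_lower hx) fun i j => ?_
  fin_cases i <;> fin_cases j <;> simp [lowerSL, red_one, red_zero]

lemma extLift_weyl : extLift τ (weyl (F := F)) = τ weylSL := by
  refine extLift_split τ isSplit_weyl fun i j => ?_
  fin_cases i <;> fin_cases j <;> simp [weylSL, red_one, red_zero, red_neg (one_mem 𝒪[F])]

lemma extLift_central (z : ℤˣ) (v : V) : extLift τ (central z : Mp F) v = signE E z • v := by
  rw [extLift, dif_pos (central_mem z), genuineLift_apply, signK_central]
  have h : redK (⟨central z, central_mem z⟩ : Kt F) = 1 := map_one redK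
  rw [h, map_one]; rfl

lemma extLift_congr {u : Mp F} (hu : u ∈ congr F 1) : extLift τ u = LinearMap.id := by
  rw [extLift_split τ hu.1 (m := 1), map_one]; rfl
  intro i j
  have h := hu.2 i j
  rw [Matrix.sub_apply] at h
  have h2 : ∀ c : F, c ∈ 𝒪[F] → u.g i j - c ∈ lat F 1 → red (u.g i j) = red c := fun c hc h =>
    (sub_mem_lat_one (hu.1.1 i j) hc).1 h
  fin_cases i <;> fin_cases j
  · exact (h2 1 (one_mem _) (by simpa using h)).trans red_one
  · exact (h2 0 (zero_mem _) (by simpa using h)).trans red_zero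
  · exact (h2 0 (zero_mem _) (by simpa using h)).trans red_zero
  · exact (h2 1 (one_mem _) (by simpa using h)).trans red_one

/-- The element of the compact induction supported on the preimage of `SL₂(𝒪)` with value `v`
at `1`. -/
def brick (v : V) : cIndSpace (genuineLift (F := F) τ) :=
  ⟨fun x => extLift τ x v, fun k x => by
    change extLift τ (k * x) v = _
    rw [extLift_mul τ k.2, extLift_coe],
    smooth_iff.2 ⟨1, fun u hu x => by
      rw [extLift_mul' τ x hu.1.1, extLift_congr τ hu]; rfl⟩,
    {1}, Set.finite_singleton 1, fun x hx => ⟨1, rfl, by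
      by_contra h
      rw [inv_one, mul_one] at h
      refine hx ?_
      change extLift τ x v = 0
      rw [extLift_of_notMem τ h]; rfl⟩⟩

lemma brick_apply (v : V) (x : Mp F) : (brick τ v).1 x = extLift τ x v := rfl

lemma cInd_brick_apply (g x : Mp F) (v : V) :
    (cInd (genuineLift τ) g (brick τ v)).1 x = extLift τ (x * g) v := rfl

lemma cInd_brick {k : Mp F} (hk : k ∈ Kt F) (v : V) :
    cInd (genuineLift τ) k (brick τ v) = brick τ (extLift τ k v) := by
  ext x
  rw [cInd_brick_apply, brick_apply, extLift_mul' τ x hk]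

lemma brick_smul (c : E) (v : V) : brick (F := F) τ (c • v) = c • brick τ v := by
  ext x
  exact map_smul _ _ _

/-- The translates of the elements `brick τ v` span the compact induction. -/
lemma span_brick {W : Submodule E (cIndSpace (genuineLift (F := F) τ))}
    (hW : ∀ g v, cInd (genuineLift τ) g (brick τ v) ∈ W) (f : cIndSpace (genuineLift (F := F) τ)) :
    f ∈ W := by
  classical
  obtain ⟨S, hS, h⟩ := f.2.2.2
  lift S to Finset (Mp F) using hS
  induction S using Finset.induction_on generalizing f with
  | empty =>
    have : f = 0 := by
      ext x
      by_contra hx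
      obtain ⟨s, hs, -⟩ := h x hx
      exact absurd hs (by simp)
    rw [this]; exact W.zero_mem
  | insert s S hs ih =>
    have h1 : f - cInd (genuineLift τ) s⁻¹ (brick τ (f.1 s)) ∈ W := by
      refine ih _ fun x hx => ?_
      have hval : (f - cInd (genuineLift τ) s⁻¹ (brick τ (f.1 s))).1 x =
        f.1 x - extLift τ (x * s⁻¹) (f.1 s) := rfl
      rw [hval] at hx
      by_cases hxs : x * s⁻¹ ∈ Kt F
      · refine (hx ?_).elim
        have := f.2.1 ⟨_, hxs⟩ s
        rw [← extLift_coe] at this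
        rw [← this]; simp
      · rw [extLift_of_notMem τ hxs, LinearMap.zero_apply, sub_zero] at hx
        obtain ⟨s', hs', hk⟩ := h x hx
        rcases Finset.mem_insert.1 hs' with rfl | hs'
        · exact (hxs hk).elim
        · exact ⟨s', hs', hk⟩
    have := W.add_mem h1 (hW s⁻¹ (f.1 s))
    rwa [sub_add_cancel] at this

variable {ϖ : 𝒪[F]} (hϖ : Irreducible ϖ)

lemma op_brick_apply (v : V) (g : Mp F) :
    ((phiOne hϖ τ).op (brick τ v)).1 g = phiOneFun hϖ τ g v := by
  change ∑ᶠ q, (phiOne hϖ τ).term (brick τ v) g q = _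
  rw [finsum_eq_single _ (Quotient.mk _ 1)]
  · rw [HeckeFun.term_mk, inv_one, mul_one, brick_apply, extLift_one]; rfl
  · intro q hq
    induction q using Quotient.inductionOn with
    | h x =>
      rw [HeckeFun.term_mk, brick_apply, extLift_of_notMem]
      · simp
      · intro hx
        refine hq (Quotient.sound (QuotientGroup.rightRel_apply.2 ?_))
        rw [one_mul]; exact (Kt F).inv_mem hx

lemma phiOneFun_eq_extLift {g γ : Mp F} (hγ : γ ∈ Kt F)
    (h : g * (γ * hTilde (unif hϖ)) ∈ Kt F) (v : V) :
    phiOneFun hϖ τ g v = extLift τ (g * (γ * hTilde (unif hϖ))) (rho τ (extLift τ γ⁻¹ v)) := by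
  have := phiOneFun_eq hϖ τ ⟨_, h⟩ (⟨γ, hγ⟩⁻¹ : Kt F)
  have e : g * (γ * hTilde (unif hϖ)) * (hTilde (unif hϖ))⁻¹ * ((⟨γ, hγ⟩⁻¹ : Kt F) : Mp F) = g := by
    push_cast; group
  rw [e] at this
  rw [this, ← extLift_coe, ← extLift_coe]
  rfl

/-- The conjugate `h̃(ϖ)⁻¹ m h̃(ϖ)` is integral if and only if the upper right entry of `m` is
divisible by `ϖ²`; this decides which single cosets meet a given double coset. -/
lemma conj_unif_mem_iff {m : Mp F} (hm : m ∈ Kt F) :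
    (hTilde (unif hϖ))⁻¹ * m * hTilde (unif hϖ) ∈ Kt F ↔ m.g 0 1 ∈ lat F 2 := by
  have h0 : (ϖ : F) ≠ 0 := (unif hϖ).ne_zero
  have hinv : (hTilde (unif hϖ))⁻¹.g = (hTilde (unif hϖ)⁻¹).g := by
    rw [hTilde_inv, Mp.mul_g, central_g, one_mul]
  have h := unit_mul_mem_lat (u := unif hϖ * unif hϖ) (x := (ϖ : F)⁻¹ * m.g 0 1 * (ϖ : F)⁻¹)
    (n := 2)
  have e : ((unif hϖ * unif hϖ : Fˣ) : F) * ((ϖ : F)⁻¹ * m.g 0 1 * (ϖ : F)⁻¹) = m.g 0 1 := by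
    rw [Units.val_mul, unif_coe]; field_simp
  rw [e, ord_mul, ord_unif, show (2 : ℤ) - (1 + 1) = 0 by norm_num, mem_lat_zero] at h
  rw [h]
  have ent : ∀ i j, ((hTilde (unif hϖ))⁻¹ * m * hTilde (unif hϖ)).g i j =
      !![m.g 0 0, (ϖ : F)⁻¹ * m.g 0 1 * (ϖ : F)⁻¹; ϖ * m.g 1 0 * ϖ, m.g 1 1] i j := by
    intro i j
    rw [Mp.mul_g, Mp.mul_g, hinv]
    fin_cases i <;> fin_cases j <;> simp [sl_mul] <;> field_simp
  constructor
  · intro h1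
    have := h1 0 1
    rw [ent] at this
    exact this
  · intro h1 i j
    rw [ent]
    fin_cases i <;> fin_cases j
    · exact hm 0 0
    · exact h1
    · exact mul_mem (mul_mem ϖ.2 (hm 1 0)) ϖ.2
    · exact hm 1 1

lemma lower_weyl_mem {z : F} (hz : z ∈ 𝒪[F]) : lowerMp z * weyl ∈ Kt F :=
  (Kt F).mul_mem (isSplit_lower hz).1 isSplit_weyl.1

/-- The Hecke operator on the generators of the compact induction: the double coset of
`h̃(ϖ)⁻¹` is decomposed into single cosets. -/
lemma op_brick (v : V) : (phiOne hϖ τ).op (brick τ v) =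
    ∑ p, cInd (genuineLift τ) (upperMp (rep2 ϖ p) * hTilde (unif hϖ))
        (brick τ (rho τ (extLift τ (upperMp (rep2 ϖ p))⁻¹ v))) +
      ∑ y : 𝓀[F], cInd (genuineLift τ) (lowerMp ((ϖ : F) * rep y) * weyl * hTilde (unif hϖ))
        (brick τ (rho τ (extLift τ (lowerMp ((ϖ : F) * rep y) * weyl)⁻¹ v))) := by
  have hrep := isReps_rep2 hϖ
  have hlow : ∀ y : 𝓀[F], (ϖ : F) * rep y ∈ lat F 1 := fun y => by
    have := unif_mul_mem_lat hϖ (mem_lat_zero.2 (rep_mem y)); rwa [zero_add] at this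
  have hU : ∀ p, upperMp (rep2 ϖ p) ∈ Kt F := fun p => (isSplit_upper (hrep.mem p)).1
  have hL : ∀ y : 𝓀[F], lowerMp ((ϖ : F) * rep y) * weyl ∈ Kt F := fun y =>
    lower_weyl_mem (lat_int zero_le_one (hlow y))
  ext g
  have hcoe : ∀ a b : cIndSpace (genuineLift (F := F) τ), (a + b).1 g = a.1 g + b.1 g :=
    fun _ _ => rfl
  have hsum : ∀ {ι : Type _} [Fintype ι] (a : ι → cIndSpace (genuineLift (F := F) τ)),
      (∑ i, a i).1 g = ∑ i, (a i).1 g := fun a => by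
    rw [Submodule.coe_sum, Finset.sum_apply]
  rw [op_brick_apply, hcoe, hsum, hsum]
  simp only [cInd_brick_apply]
  by_cases h : ∃ kl : Kt F × Kt F, g = kl.1 * (hTilde (unif hϖ))⁻¹ * kl.2
  · obtain ⟨⟨k, l⟩, hg⟩ := h
    have key : ∀ γ ∈ Kt F, g * (γ * hTilde (unif hϖ)) ∈ Kt F ↔
        ((l : Mp F) * γ).g 0 1 ∈ lat F 2 := by
      intro γ hγ
      have e : g * (γ * hTilde (unif hϖ)) =
          k * ((hTilde (unif hϖ))⁻¹ * (l * γ) * hTilde (unif hϖ)) := by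
        rw [hg]; group
      rw [e, Subgroup.mul_mem_cancel_left _ k.2, conj_unif_mem_iff hϖ ((Kt F).mul_mem l.2 hγ)]
    have kU : ∀ p, g * (upperMp (rep2 ϖ p) * hTilde (unif hϖ)) ∈ Kt F ↔
        l.1.g 0 0 * rep2 ϖ p + l.1.g 0 1 ∈ lat F 2 := fun p => by
      rw [key _ (hU p)]; simp [sl_mul]
    have kL : ∀ y : 𝓀[F], g * (lowerMp ((ϖ : F) * rep y) * weyl * hTilde (unif hϖ)) ∈ Kt F ↔
        l.1.g 0 0 + l.1.g 0 1 * (ϖ * rep y) ∈ lat F 2 := fun y => by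
      rw [key _ (hL y)]; simp [sl_mul]
    -- Exactly one coset contributes: that of some `u(x)` when the upper left entry of `l` is a
    -- unit, and that of some `ū(ϖ y) w` otherwise.
    by_cases h0 : red (l.1.g 0 0) = 0
    · have h0' := (mem_lat_one (l.2 0 0)).2 h0
      have hdet := red_det l.2
      rw [h0, zero_mul, zero_sub, neg_eq_iff_eq_neg] at hdet
      have h1 : red (l.1.g 0 1) ≠ 0 := fun h => by rw [h, zero_mul] at hdet; simp at hdet
      obtain ⟨b, hb, ob⟩ := exists_unit_of_red_ne (l.2 0 1) h1
      obtain ⟨w, hw, hw'⟩ := exists_unif_mul hϖ (n := 0) (x := -(l.1.g 0 0 * (b : F)⁻¹)) (by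
        rw [zero_add]
        refine neg_mem ?_
        rw [mul_comm]; exact int_mul_mem_lat (unit_inv_mem ob) h0')
      rw [mem_lat_zero] at hw
      have hiff : ∀ y : 𝓀[F], l.1.g 0 0 + l.1.g 0 1 * (ϖ * rep y) ∈ lat F 2 ↔ y = red w := by
        intro y
        have e : l.1.g 0 0 + l.1.g 0 1 * (ϖ * rep y) = ((b * unif hϖ : Fˣ) : F) * (rep y - w) := by
          rw [← hb, Units.val_mul, unif_coe]
          have : l.1.g 0 0 = -(ϖ * w) * b := by
            rw [← hw', neg_neg, inv_mul_cancel_right₀ b.ne_zero]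
          rw [this]; ring
        rw [e, unit_mul_mem_lat, ord_mul, ob, ord_unif, show (2 : ℤ) - (0 + 1) = 1 by norm_num,
          sub_mem_lat_one (rep_mem y) hw, red_rep]
      have hz : ∀ p, extLift τ (g * (upperMp (rep2 ϖ p) * hTilde (unif hϖ))) = 0 := fun p => by
        refine extLift_of_notMem τ fun h => h1 ?_
        rw [kU] at h
        rw [← mem_lat_one (l.2 0 1)]
        have h2 := sub_mem (lat_anti (by norm_num : (1 : ℤ) ≤ 2) h)
          (int_mul_mem_lat (hrep.mem p) h0')
        rwa [mul_comm, add_sub_cancel_left] at h2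
      simp only [hz, LinearMap.zero_apply, Finset.sum_const_zero, zero_add]
      rw [Finset.sum_eq_single (red w) _ (by simp)]
      · exact phiOneFun_eq_extLift τ hϖ (hL _) ((kL _).2 ((hiff _).2 rfl)) v
      · intro y _ hy
        rw [extLift_of_notMem τ fun h => hy ((hiff y).1 ((kL y).1 h))]; rfl
    · obtain ⟨a, ha, oa⟩ := exists_unit_of_red_ne (l.2 0 0) h0
      have hw : -(l.1.g 0 1 * (a : F)⁻¹) ∈ 𝒪[F] :=
        neg_mem (mul_mem (l.2 0 1) (unit_inv_mem oa))
      obtain ⟨p₀, hp₀⟩ := hrep.surj _ hw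
      have hiff : ∀ p, l.1.g 0 0 * rep2 ϖ p + l.1.g 0 1 ∈ lat F 2 ↔ p = p₀ := by
        intro p
        have e : l.1.g 0 0 * rep2 ϖ p + l.1.g 0 1 =
            (a : F) * (rep2 ϖ p - -(l.1.g 0 1 * (a : F)⁻¹)) := by
          rw [← ha]; field_simp; ring
        rw [e, unit_mul_mem_lat, oa, sub_zero]
        constructor
        · intro h
          refine hrep.inj _ _ ?_
          have := add_mem h hp₀
          rwa [sub_add_sub_cancel] at this
        · rintro rfl
          have := neg_mem hp₀
          rwa [neg_sub] at this
      have hz : ∀ y : 𝓀[F],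
          extLift τ (g * (lowerMp ((ϖ : F) * rep y) * weyl * hTilde (unif hϖ))) = 0 := fun y => by
        refine extLift_of_notMem τ fun h => h0 ?_
        rw [kL] at h
        rw [← mem_lat_one (l.2 0 0)]
        have h2 := sub_mem (lat_anti (by norm_num : (1 : ℤ) ≤ 2) h)
          (int_mul_mem_lat (l.2 0 1) (hlow y))
        rwa [add_sub_cancel_right] at h2
      simp only [hz, LinearMap.zero_apply, Finset.sum_const_zero, add_zero]
      rw [Finset.sum_eq_single p₀ _ (by simp)]
      · exact phiOneFun_eq_extLift τ hϖ (hU _) ((kU _).2 ((hiff _).2 rfl)) v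
      · intro p _ hp
        rw [extLift_of_notMem τ fun h => hp ((hiff p).1 ((kU p).1 h))]; rfl
  · have hno : ∀ γ ∈ Kt F, extLift τ (g * (γ * hTilde (unif hϖ))) = 0 := by
      intro γ hγ
      refine extLift_of_notMem τ fun hk => h ⟨(⟨_, hk⟩, ⟨γ, hγ⟩⁻¹), ?_⟩
      push_cast; group
    rw [Finset.sum_eq_zero fun p _ => by rw [hno _ (hU p)]; rfl,
      Finset.sum_eq_zero fun y _ => by rw [hno _ (hL y)]; rfl, phiOneFun, dif_neg h]
    simp

end Bricks

/-! ### Unramified vectors -/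

section Spherical

variable {F : Type*} [Field F] [ValuativeRel F] [TopologicalSpace F]
  [IsNonarchimedeanLocalField F] {E : Type*} [Field E] {χ : Tt F →* Eˣ} {ϖ : 𝒪[F]}
  {P : Type*} [AddCommGroup P] [Module E P]

/-- A vector fixed by the splitting of `SL₂(𝒪)`, on which the centre acts by the genuine sign, and
which is an eigenvector of the Hecke operator for the eigenvalue `c`. -/
structure IsSpherical (hϖ : Irreducible ϖ) (ρ : Representation E (Mp F) P) (c : E) (s : P) :
    Prop where
  split : ∀ x, IsSplit x → ρ x s = s
  sign : ∀ z : ℤˣ, ρ (central z) s = signE E z • s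
  hecke : c • s = ∑ p, ρ (upperMp (rep2 ϖ p) * hTilde (unif hϖ)) s +
    ∑ y : 𝓀[F], ρ (lowerMp ((ϖ : F) * rep y) * weyl * hTilde (unif hϖ)) s

variable {hϖ : Irreducible ϖ} {ρ : Representation E (Mp F) P} {c : E} {s : P}

lemma rep_mul_apply (ρ : Representation E (Mp F) P) (g h : Mp F) (y : P) :
    ρ (g * h) y = ρ g (ρ h y) := by
  rw [map_mul]; rfl

namespace IsSpherical

lemma upper_unif (H : IsSpherical hϖ ρ c s) {x : F} (hx : x ∈ lat F 2) :
    ρ (upperMp x * hTilde (unif hϖ)) s = ρ (hTilde (unif hϖ)) s := by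
  rw [upper_mul_hTilde, rep_mul_apply, H.split]
  exact isSplit_upper (mem_lat_zero.1 (unif_sq_div hϖ hx))

/-- The sum of the `u(x) h̃(ϖ) s`, over `x` modulo `ϖ²`, does not change under translation by
`u(𝒪)`. -/
lemma sum_upper_translate (H : IsSpherical hϖ ρ c s) {x : F} (hx : x ∈ 𝒪[F]) :
    ∑ p, ρ (upperMp (rep2 ϖ p)) (ρ (upperMp x * hTilde (unif hϖ)) s) =
      ∑ p, ρ (upperMp (rep2 ϖ p)) (ρ (hTilde (unif hϖ)) s) := by
  have h := (isReps_rep2 hϖ).sum_translate (f := fun z => ρ (upperMp z) (ρ (hTilde (unif hϖ)) s))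
    (fun x _ y hy _ => by
      rw [upperMp_add, rep_mul_apply, ← rep_mul_apply ρ (upperMp y), H.upper_unif hy]) hx
  rw [← h]
  refine Finset.sum_congr rfl fun p _ => ?_
  rw [upperMp_add, rep_mul_apply, rep_mul_apply]

lemma lower_weyl_unif (H : IsSpherical hϖ ρ c s) {z : F} (hz : z ∈ lat F 2) :
    ρ (lowerMp z * weyl * hTilde (unif hϖ)) s = ρ (weyl * hTilde (unif hϖ)) s := by
  have := weyl_mul_upper (-z)
  rw [neg_neg] at this
  rw [← this, mul_assoc, rep_mul_apply, H.upper_unif (neg_mem hz), ← rep_mul_apply]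

/-- The sum of the `ū(ϖ y) w h̃(ϖ) s`, over `y` modulo `ϖ`, does not change under translation by
`ū(ϖ𝒪)`. -/
lemma sum_lower_translate (H : IsSpherical hϖ ρ c s) {w : F} (hw : w ∈ 𝒪[F]) :
    ∑ y : 𝓀[F], ρ (lowerMp ((ϖ : F) * rep y + ϖ * w) * weyl * hTilde (unif hϖ)) s =
      ∑ y : 𝓀[F], ρ (lowerMp ((ϖ : F) * rep y) * weyl * hTilde (unif hϖ)) s := by
  have h := isReps_rep.sum_translate
    (f := fun z => ρ (lowerMp ((ϖ : F) * z) * weyl * hTilde (unif hϖ)) s)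
    (fun x _ y hy _ => by
      have hy' := unif_mul_mem_lat hϖ hy
      rw [mul_add, lowerMp_add, mul_assoc, mul_assoc, rep_mul_apply, ← mul_assoc (lowerMp _) weyl,
        H.lower_weyl_unif hy', ← rep_mul_apply, ← mul_assoc]) hw
  rw [← h]
  exact Finset.sum_congr rfl fun y _ => by rw [mul_add]

lemma unif_weyl_unif (H : IsSpherical hϖ ρ c s) :
    ρ (hTilde (unif hϖ) * (weyl * hTilde (unif hϖ))) s =
      signE E (hilb (unif hϖ) (unif hϖ)⁻¹) • s := by
  rw [weyl_mul_hTilde, ← mul_assoc, hTilde_mul, mul_inv_cancel, hTilde_one, mul_one,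
    rep_mul_apply, H.split _ isSplit_weyl, H.sign]

/-- Moving `h̃(ϖ) ū(ϖ u) w h̃(ϖ)` to the opposite cell produces the torus element `h̃(ϖ u⁻¹)`, up to
sign, and with it the quadratic character of `u`. -/
lemma unif_lower_weyl_unif (H : IsSpherical hϖ ρ c s) {u : Fˣ} (hu : ord u = 0) :
    ρ (hTilde (unif hϖ) * (lowerMp ((ϖ : F) * u) * weyl * hTilde (unif hϖ))) s =
      (eta E (red (u : F)) * (signE E (hilb (unif hϖ) (unif hϖ)⁻¹) *
        signE E (hilb (unif hϖ) (-1)))) •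
          ρ (upperMp ((ϖ : F) * (u : F)⁻¹) * hTilde (unif hϖ)) s := by
  have h0 : (ϖ : F) ≠ 0 := (unif hϖ).ne_zero
  have h1 : hTilde (unif hϖ) * (lowerMp ((ϖ : F) * u) * weyl * hTilde (unif hϖ)) =
      lowerMp ((u * (unif hϖ)⁻¹ : Fˣ) : F) * (hTilde (unif hϖ) * (weyl * hTilde (unif hϖ))) := by
    rw [mul_assoc (lowerMp _), ← mul_assoc (hTilde _) (lowerMp _), hTilde_mul_lower, mul_assoc]
    congr 2
    rw [Units.val_mul, Units.val_inv_eq_inv_val, unif_coe]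
    field_simp
  have h2 : ((u * (unif hϖ)⁻¹ : Fˣ) : F)⁻¹ = (ϖ : F) * (u : F)⁻¹ := by
    rw [Units.val_mul, Units.val_inv_eq_inv_val, unif_coe, mul_inv, inv_inv, mul_comm]
  have h3 : (ϖ : F) * (u : F)⁻¹ ∈ 𝒪[F] := mul_mem ϖ.2 (unit_inv_mem hu)
  have h4 : hilb (unif hϖ) (-1 * u⁻¹) = hilb (unif hϖ) (-1) * hilb (unif hϖ) u := by
    apply sgn2_inj
    rw [sgn2_mul]
    change hl _ _ = hl _ _ + hl _ _
    rw [hl_mul_right, hl_inv_right]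
  have h5 : ρ (hTilde (-(u * (unif hϖ)⁻¹)⁻¹)) s =
      (signE E (hilb (unif hϖ) (-1)) * eta E (red (u : F))) • ρ (hTilde (unif hϖ)) s := by
    have h6 := hTilde_mul (unif hϖ) (-1 * u⁻¹)
    have h7 : ord (-1 * u⁻¹) = 0 := by rw [ord_mul, ord_neg_one, ord_inv, hu]; rfl
    have h8 : (-(u * (unif hϖ)⁻¹)⁻¹ : Fˣ) = unif hϖ * (-1 * u⁻¹) := by
      rw [mul_inv, inv_inv]
      ext
      push_cast
      ring
    have h9 : hTilde (unif hϖ * (-1 * u⁻¹)) =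
        central (hilb (unif hϖ) (-1 * u⁻¹)) * (hTilde (unif hϖ) * hTilde (-1 * u⁻¹)) := by
      rw [h6, ← mul_assoc (central _) (central _), central_sq, one_mul]
    rw [h8, h9, central_comm, rep_mul_apply, H.sign, map_smul, rep_mul_apply,
      H.split _ (isSplit_hTilde h7), h4, map_mul, signE_hilb_unif hϖ hu]
  rw [h1, rep_mul_apply, H.unif_weyl_unif, map_smul, lower_eq, h2, rep_mul_apply, rep_mul_apply,
    H.split _ (isSplit_weyl.mul (isSplit_upper h3)), h5, map_smul, smul_smul, ← rep_mul_apply]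
  congr 1
  ring

/-- A linear map `Q` which takes the same value on the vectors `u(ϖ w) h̃(ϖ) s`, for `w ∈ 𝒪`, and
kills `s` annihilates the sum of the vectors `h̃(ϖ) ū(ϖ y) w h̃(ϖ) s`: the term `y = 0` is a
multiple of `Q s`, and the other terms cancel by the quadratic character. -/
lemma sum_unif_lower (H : IsSpherical hϖ ρ c s) (h2 : ringChar 𝓀[F] ≠ 2) {P' : Type*}
    [AddCommGroup P'] [Module E P'] (Q : P →ₗ[E] P')
    (hQ : ∀ w ∈ 𝒪[F], Q (ρ (upperMp ((ϖ : F) * w) * hTilde (unif hϖ)) s) =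
      Q (ρ (hTilde (unif hϖ)) s)) (hQs : Q s = 0) :
    ∑ y : 𝓀[F],
      Q (ρ (hTilde (unif hϖ) * (lowerMp ((ϖ : F) * rep y) * weyl * hTilde (unif hϖ))) s) = 0 := by
  rw [sum_rep_eta (E := E) h2 (g := fun y =>
    Q (ρ (hTilde (unif hϖ) * (lowerMp ((ϖ : F) * y) * weyl * hTilde (unif hϖ))) s))
    (B := (signE E (hilb (unif hϖ) (unif hϖ)⁻¹) * signE E (hilb (unif hϖ) (-1))) •
      Q (ρ (hTilde (unif hϖ)) s))]
  · rw [mul_zero, lowerMp_zero, one_mul, H.unif_weyl_unif, map_smul, hQs, smul_zero]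
  · intro u hu
    rw [H.unif_lower_weyl_unif hu, map_smul, hQ _ (unit_inv_mem hu), smul_smul]

/-- The vector `∑ u(x) h̃(ϖ) s`, the sum being over `x` modulo `ϖ²`. -/
def upperSum (hϖ : Irreducible ϖ) (ρ : Representation E (Mp F) P) (s : P) : P :=
  ∑ p, ρ (upperMp (rep2 ϖ p) * hTilde (unif hϖ)) s

lemma upper_upperSum (H : IsSpherical hϖ ρ c s) {x : F} (hx : x ∈ 𝒪[F]) :
    ρ (upperMp x) (upperSum hϖ ρ s) = upperSum hϖ ρ s := by
  rw [upperSum, map_sum]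
  have h := H.sum_upper_translate hx
  simp only [← rep_mul_apply] at h
  rw [← h]
  refine Finset.sum_congr rfl fun p _ => ?_
  rw [← rep_mul_apply, ← mul_assoc, ← mul_assoc, ← upperMp_add, ← upperMp_add, add_comm]

/-- The Hecke relation rewrites `upperSum` as a sum over the lower unipotent subgroup. -/
lemma lower_upperSum (H : IsSpherical hϖ ρ c s) {z : F} (hz : z ∈ lat F 1) :
    ρ (lowerMp z) (upperSum hϖ ρ s) = upperSum hϖ ρ s := by
  obtain ⟨w, hw, rfl⟩ := exists_unif_mul hϖ (n := 0) (by rwa [zero_add])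
  rw [mem_lat_zero] at hw
  have h1 : upperSum hϖ ρ s = c • s -
      ∑ y : 𝓀[F], ρ (lowerMp ((ϖ : F) * rep y) * weyl * hTilde (unif hϖ)) s := by
    rw [H.hecke, upperSum, add_sub_cancel_right]
  rw [h1, map_sub, map_smul, H.split _ (isSplit_lower (lat_int zero_le_one hz)), map_sum]
  congr 1
  rw [← H.sum_lower_translate hw]
  refine Finset.sum_congr rfl fun y _ => ?_
  rw [← rep_mul_apply, ← mul_assoc, ← mul_assoc, ← lowerMp_add, add_comm]

lemma hTilde_upperSum (H : IsSpherical hϖ ρ c s) {a : Fˣ} (ha : ord a = 0) :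
    ρ (hTilde a) (upperSum hϖ ρ s) = upperSum hϖ ρ s := by
  have hcomm : hTilde a * hTilde (unif hϖ) = hTilde (unif hϖ) * hTilde a := by
    rw [hTilde_mul, hTilde_mul, mul_comm a, hilb_symm]
  have h := (isReps_rep2 hϖ).sum_comp (f := fun z => ρ (upperMp z * hTilde (unif hϖ)) s)
    (fun x _ y hy _ => by
      rw [upperMp_add, mul_assoc, rep_mul_apply, H.upper_unif hy, ← rep_mul_apply])
    (σ := fun x => (a : F) * a * x) (fun x hx => mul_mem (mul_mem (unit_mem ha) (unit_mem ha)) hx)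
    (fun x _ y _ h => by
      rwa [← mul_sub, ← Units.val_mul, unit_mul_mem_lat, ord_mul, ha, add_zero, sub_zero] at h)
  rw [upperSum, map_sum, ← h]
  refine Finset.sum_congr rfl fun p _ => ?_
  rw [← rep_mul_apply, ← mul_assoc, hTilde_mul_upper, mul_assoc, hcomm, ← mul_assoc,
    rep_mul_apply, H.split _ (isSplit_hTilde ha)]

/-- The map `Q` of `sum_unif_lower` is here the sum of the `u(x)`, over `x` modulo `ϖ²`; it kills
`s` because its number of terms vanishes in `E`. -/
lemma sum_upper_unif_lower (H : IsSpherical hϖ ρ c s) (hq : (Fintype.card 𝓀[F] : E) = 0)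
    (h2 : ringChar 𝓀[F] ≠ 2) : ∑ p, ρ (upperMp (rep2 ϖ p)) (∑ y : 𝓀[F],
      ρ (hTilde (unif hϖ) * (lowerMp ((ϖ : F) * rep y) * weyl * hTilde (unif hϖ))) s) = 0 := by
  have h := H.sum_unif_lower h2 (∑ p, ρ (upperMp (rep2 ϖ p))) (fun w hw => by
    simp only [LinearMap.sum_apply]
    exact H.sum_upper_translate (mul_mem ϖ.2 hw)) (by
    simp only [LinearMap.sum_apply, H.split _ (isSplit_upper ((isReps_rep2 hϖ).mem _))]
    rw [Fintype.sum_prod_type]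
    exact sum_const_eq_zero hq _)
  rwa [← map_sum, LinearMap.sum_apply] at h

/-- The map `Q` of `sum_unif_lower` is here the sum of the `ū(ϖ y) w`, over `y` modulo `ϖ`. -/
lemma sum_lower_unif_lower (H : IsSpherical hϖ ρ c s) (hq : (Fintype.card 𝓀[F] : E) = 0)
    (h2 : ringChar 𝓀[F] ≠ 2) : ∑ y : 𝓀[F], ρ (lowerMp ((ϖ : F) * rep y) * weyl) (∑ y : 𝓀[F],
      ρ (hTilde (unif hϖ) * (lowerMp ((ϖ : F) * rep y) * weyl * hTilde (unif hϖ))) s) = 0 := by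
  have h := H.sum_unif_lower h2 (∑ y : 𝓀[F], ρ (lowerMp ((ϖ : F) * rep y) * weyl)) (fun w hw => by
    simp only [LinearMap.sum_apply, ← rep_mul_apply]
    rw [← H.sum_lower_translate (neg_mem hw)]
    refine Finset.sum_congr rfl fun y _ => ?_
    rw [mul_assoc, ← mul_assoc weyl, weyl_mul_upper, lowerMp_add, mul_neg, mul_assoc, mul_assoc,
      mul_assoc]) (by
    simp only [LinearMap.sum_apply]
    rw [Finset.sum_congr rfl fun y _ => H.split _
      ((isSplit_lower (mul_mem ϖ.2 (rep_mem y))).mul isSplit_weyl)]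
    exact sum_const_eq_zero hq _)
  rwa [← map_sum, LinearMap.sum_apply] at h

lemma unif_hecke (H : IsSpherical hϖ ρ c s) :
    c • ρ (hTilde (unif hϖ)) s = ρ (hTilde (unif hϖ)) (upperSum hϖ ρ s) + ∑ y : 𝓀[F],
      ρ (hTilde (unif hϖ) * (lowerMp ((ϖ : F) * rep y) * weyl * hTilde (unif hϖ))) s := by
  rw [← map_smul, H.hecke, map_add, map_sum (ρ (hTilde (unif hϖ))) (fun y : 𝓀[F] => _)]
  congr 1
  exact Finset.sum_congr rfl fun y _ => (rep_mul_apply ρ _ _ _).symm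

/-- Away from the eigenvalue zero, `∑ u(x) h̃(ϖ) s` generates the same representation as `s`:
applying `∑ ū(ϖ y) w` to `h̃(ϖ)` times the Hecke relation recovers the second half of that
relation. -/
lemma mem_of_upperSum_mem (H : IsSpherical hϖ ρ c s) (hc : c ≠ 0)
    (hq : (Fintype.card 𝓀[F] : E) = 0) (h2 : ringChar 𝓀[F] ≠ 2) {W : Submodule E P}
    (hW : ∀ g, ∀ y ∈ W, ρ g y ∈ W) (h : upperSum hϖ ρ s ∈ W) : s ∈ W := by
  have h1 := LinearMap.congr_arg (f := ∑ y : 𝓀[F], ρ (lowerMp ((ϖ : F) * rep y) * weyl))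
    H.unif_hecke
  rw [map_smul, map_add] at h1
  simp only [LinearMap.sum_apply] at h1
  rw [H.sum_lower_unif_lower hq h2, add_zero] at h1
  simp only [← rep_mul_apply] at h1
  have h3 : c • ∑ y : 𝓀[F], ρ (lowerMp ((ϖ : F) * rep y) * weyl * hTilde (unif hϖ)) s ∈ W := by
    rw [h1]
    exact W.sum_mem fun y _ => hW _ _ h
  have h4 := H.hecke
  have h5 : c • s ∈ W := by
    rw [h4]
    exact W.add_mem h ((W.smul_mem_iff hc).1 h3)
  exact (W.smul_mem_iff hc).1 h5

/-- A spherical eigenvector gives rise to a vector with the properties of `cellFun χ`. The relation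
for `∑ u(x) h̃(ϖ)` is `h̃(ϖ)` times the Hecke relation, summed over the `u(x)`. -/
lemma iwahoriEigen (hc : c = χ (hTorus (unif hϖ))) (H : IsSpherical hϖ ρ c s)
    (hq : (Fintype.card 𝓀[F] : E) = 0) (h2 : ringChar 𝓀[F] ≠ 2)
    (hχ : ∀ a : Fˣ, ord a = 0 → χ (hTorus a) = 1) :
    IwahoriEigen hϖ χ ρ (upperSum hϖ ρ s) where
  upper x hx := H.upper_upperSum hx
  lower z hz := H.lower_upperSum hz
  diag a ha := by rw [H.hTilde_upperSum ha, hχ a ha, Units.val_one, one_smul]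
  sign z := by
    rw [upperSum, map_sum, Finset.smul_sum]
    refine Finset.sum_congr rfl fun p _ => ?_
    rw [← rep_mul_apply, central_comm, rep_mul_apply, H.sign, map_smul]
  hecke := by
    have h1 := LinearMap.congr_arg (f := ∑ p, ρ (upperMp (rep2 ϖ p))) H.unif_hecke
    rw [map_smul, map_add] at h1
    simp only [LinearMap.sum_apply] at h1
    rw [H.sum_upper_unif_lower hq h2, add_zero] at h1
    simp only [← rep_mul_apply] at h1
    rw [← h1, hc]; rfl

end IsSpherical

end Spherical

/-! ### Cokernel modules and principal series -/

section Cokernel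

open Matrix

variable {F : Type*} [Field F] [ValuativeRel F] [TopologicalSpace F]
  [IsNonarchimedeanLocalField F] {E V : Type*} [Field E] [AddCommGroup V] [Module E V]
  {τ : Representation E (SpecialLinearGroup (Fin 2) 𝓀[F]) V} {χ : Tt F →* Eˣ}

/-- A nonzero map, equivariant under the preimage of `SL₂(𝒪)`, of a genuine weight to the
principal series. -/
structure IsWeightMap (τ : Representation E (SpecialLinearGroup (Fin 2) 𝓀[F]) V) (χ : Tt F →* Eˣ)
    (φ : V →ₗ[E] (Mp F → E)) : Prop where
  mem : ∀ v, φ v ∈ PS χ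
  equivariant : ∀ k ∈ Kt F, ∀ v g, φ (extLift τ k v) g = φ v (g * k)
  ne_zero : φ ≠ 0

variable {φ : V →ₗ[E] (Mp F → E)} {v₀ : V} {l : V →ₗ[E] E}

namespace IsWeightMap

/-- Evaluation at the identity is invariant under the lower unipotent subgroup, so it is a multiple
of `l` on the weight. -/
lemma apply_one (Hφ : IsWeightMap τ χ φ) (H : HighestWeight τ v₀ l) (v : V) :
    φ v 1 = l v * φ v₀ 1 := by
  have h : (LinearMap.proj (1 : Mp F) : (Mp F → E) →ₗ[E] E) ∘ₗ φ = (φ v₀ 1) • l := by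
    refine LinearMap.ext_on_range H.span_lower fun u => ?_
    obtain ⟨u, h1, h2, h3⟩ := u
    change φ (τ u v₀) 1 = φ v₀ 1 * l (τ u v₀)
    rw [H.lower_apply u ⟨h1, h2, h3⟩, H.apply_self, mul_one]
    have hu : u = lowerSL (red (rep (u 1 0))) := by
      rw [red_rep]
      ext i j
      fin_cases i <;> fin_cases j
      · exact h1
      · exact h2
      · rfl
      · exact h3
    have hL := isSplit_lower (rep_mem (F := F) (u 1 0))
    rw [hu, ← extLift_lower τ (rep_mem _), Hφ.equivariant _ hL.1, one_mul]
    have := ps_lower (Hφ.mem v₀) (rep (u 1 0)) 1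
    rwa [mul_one] at this
  have := LinearMap.congr_fun h v
  rw [mul_comm]
  exact this

lemma apply_one_ne (Hφ : IsWeightMap τ χ φ) (H : HighestWeight τ v₀ l) : φ v₀ 1 ≠ 0 := by
  intro h
  have h1 : ∀ v, φ v 1 = 0 := fun v => by rw [Hφ.apply_one H, h, mul_zero]
  have h2 : ∀ v, ∀ k ∈ Kt F, φ v k = 0 := fun v k hk => by
    rw [← one_mul k, ← Hφ.equivariant k hk, h1]
  refine Hφ.ne_zero (LinearMap.ext fun v => ?_)
  refine ps_ext (Hφ.mem v) (PS χ).zero_mem (fun x hx => ?_) (fun z hz => ?_)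
  · rw [h2 _ _ (isSplit_upper hx).1]; rfl
  · rw [h2 _ _ (isSplit_weyl.mul (isSplit_lower (lat_int zero_le_one hz))).1]; rfl

/-- The torus acts on the highest weight vector by the restriction of the character of the
principal series. -/
lemma extLift_hTilde (Hφ : IsWeightMap τ χ φ) (H : HighestWeight τ v₀ l) {a : Fˣ}
    (ha : ord a = 0) : extLift τ (hTilde a) v₀ = (χ (hTorus a) : E) • v₀ := by
  have hs := isSplit_hTilde ha
  obtain ⟨hK, hsign⟩ := hs
  set d := redK ⟨hTilde a, hK⟩ with hd
  have hext : extLift τ (hTilde a) = τ d := by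
    rw [extLift_split τ (m := d) ⟨hK, hsign⟩ fun i j => rfl]
  have h10 : d 1 0 = 0 := red_zero
  have h01 : d 0 1 = 0 := red_zero
  have h1 := LinearMap.congr_fun (rho_equivariant τ h10 h01 rfl rfl) v₀
  simp only [LinearMap.comp_apply, H.rho_apply, H.apply_self, one_smul] at h1
  have h2 := Hφ.equivariant _ hK v₀ 1
  rw [one_mul, hext, h1, map_smul] at h2
  have h3 := ps_hTilde (Hφ.mem v₀) a 1
  rw [mul_one] at h3
  have h4 : l (τ d v₀) * φ v₀ 1 = χ (hTorus a) * φ v₀ 1 := h2.trans h3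
  rw [hext, h1, mul_right_cancel₀ (Hφ.apply_one_ne H) h4]

lemma extLift_upper (H : HighestWeight τ v₀ l) {x : F} (hx : x ∈ 𝒪[F]) :
    extLift τ (upperMp x) v₀ = v₀ := by
  rw [Metaplectic.extLift_upper τ hx, H.upper_apply _ ⟨rfl, rfl, rfl⟩]

lemma iwahoriInv (Hφ : IsWeightMap τ χ φ) (hχ : IsTameGenuine χ) (H : HighestWeight τ v₀ l) :
    IwahoriInv (φ v₀) where
  upper x hx g := by rw [← Hφ.equivariant _ (isSplit_upper hx).1, extLift_upper H hx]
  lower z hz g := by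
    rw [← Hφ.equivariant _ (isSplit_lower (lat_int zero_le_one hz)).1,
      extLift_congr τ (lower_mem_congr (n := 1) hz)]
    rfl
  diag a ha h g := by
    rw [← Hφ.equivariant _ (isSplit_hTilde ha).1, Hφ.extLift_hTilde H ha, hχ.tame a ha h,
      Units.val_one, one_smul]

lemma char_units (Hφ : IsWeightMap τ χ φ) (H : HighestWeight τ v₀ l) (hτ : ∀ g v, τ g v = v)
    (a : Fˣ) (ha : ord a = 0) : χ (hTorus a) = 1 := by
  have h1 := congrArg l (Hφ.extLift_hTilde H ha)
  obtain ⟨hK, hs⟩ := isSplit_hTilde ha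
  rw [extLift_split τ (m := redK ⟨hTilde a, hK⟩) ⟨hK, hs⟩ fun i j => rfl, hτ, map_smul,
    H.apply_self, smul_eq_mul, mul_one] at h1
  exact Units.ext h1.symm

variable {ϖ : 𝒪[F]} {hϖ : Irreducible ϖ}

/-- The contribution of the cosets of the `u(x)` to the value at the identity of the Hecke operator
on the principal series. For the trivial weight it is `uOp_one_of_trivial`; for a nontrivial weight
`φ v₀` is a multiple of `cellFun`, and only `x = 0` contributes. -/
lemma sum_upper (Hφ : IsWeightMap τ χ φ) (hχ : IsTameGenuine χ) (H : HighestWeight τ v₀ l)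
    (hq : (Fintype.card 𝓀[F] : E) = 0) (h2 : ringChar 𝓀[F] ≠ 2)
    (hτ : (∀ g v, τ g v = v) ∨ ∀ g, g 0 0 = 0 → l (τ g v₀) = 0) (v : V) :
    ∑ p, l (extLift τ (upperMp (rep2 ϖ p))⁻¹ v) * φ v₀ (upperMp (rep2 ϖ p) * hTilde (unif hϖ)) =
      χ (hTorus (unif hϖ)) * φ v 1 := by
  have hf := Hφ.mem v₀
  have hi := Hφ.iwahoriInv hχ H
  have hrep := isReps_rep2 hϖ
  rcases hτ with hτ | hτ
  · have h1 : ∀ p, l (extLift τ (upperMp (rep2 ϖ p))⁻¹ v) = l v := fun p => by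
      rw [upperMp_inv, Metaplectic.extLift_upper τ (neg_mem (hrep.mem p)), hτ]
    have h3 := uOp_one_of_trivial hϖ hχ hq h2 hf hi (Or.inl (Hφ.char_units H hτ))
    rw [uOp] at h3
    simp only [one_mul] at h3
    simp only [h1]
    rw [← Finset.mul_sum, h3, Hφ.apply_one H v, mul_left_comm]
  · classical
    have hw : φ v₀ weyl = 0 := by
      rw [← one_mul weyl, ← Hφ.equivariant _ isSplit_weyl.1, extLift_weyl, Hφ.apply_one H,
        hτ _ rfl, zero_mul]
    have hcell : φ v₀ = φ v₀ 1 • cellFun χ := by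
      have hc := cellFun_iwahoriInv hχ
      have h3 : φ v₀ - φ v₀ 1 • cellFun χ = 0 := by
        refine ps_eq_zero (χ := χ) ((PS χ).sub_mem hf ((PS χ).smul_mem _ (cellFun_mem hχ)))
          ⟨fun x hx g => ?_, fun z hz g => ?_, fun a ha h g => ?_⟩ ?_ ?_
        · simp [hi.upper x hx, hc.upper x hx]
        · simp [hi.lower z hz, hc.lower z hz]
        · simp [hi.diag a ha h, hc.diag a ha h]
        · simp [cellFun_one]
        · have := cellFun_weyl_lower (χ := χ) (zero_mem (lat F 1))
          rw [lowerMp_zero, mul_one] at this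
          simp [this, hw]
      exact sub_eq_zero.1 h3
    have h00 : rep2 (F := F) ϖ (0, 0) = 0 := by simp [rep2, rep_zero]
    rw [Finset.sum_eq_single (0, 0) _ (by simp)]
    · rw [h00, upperMp_zero, inv_one, extLift_one, one_mul, LinearMap.id_apply, Hφ.apply_one H v]
      have := ps_hTilde hf (unif hϖ) 1
      rw [mul_one] at this
      rw [this, mul_left_comm]
    · intro p _ hp
      rw [hcell, Pi.smul_apply, cellFun_upper_hTilde hχ, if_neg, smul_zero, mul_zero]
      intro h
      rw [ord_unif, mul_one] at h
      exact hp (hrep.inj _ _ (by rwa [h00, sub_zero]))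

/-- The contribution of the cosets of the `ū(ϖ y) w` vanishes: its terms do not depend on `y`. -/
lemma sum_lower (Hφ : IsWeightMap τ χ φ) (hq : (Fintype.card 𝓀[F] : E) = 0) (v : V) :
    ∑ y : 𝓀[F], l (extLift τ (lowerMp ((ϖ : F) * rep y) * weyl)⁻¹ v) *
      φ v₀ (lowerMp ((ϖ : F) * rep y) * weyl * hTilde (unif hϖ)) = 0 := by
  have h : ∀ y : 𝓀[F], l (extLift τ (lowerMp ((ϖ : F) * rep y) * weyl)⁻¹ v) *
      φ v₀ (lowerMp ((ϖ : F) * rep y) * weyl * hTilde (unif hϖ)) =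
        l (extLift τ weyl⁻¹ v) * φ v₀ (weyl * hTilde (unif hϖ)) := by
    intro y
    have hy : (ϖ : F) * rep y ∈ lat F 1 := by
      have := unif_mul_mem_lat hϖ (mem_lat_zero.2 (rep_mem y)); rwa [zero_add] at this
    rw [_root_.mul_inv_rev, extLift_mul τ isSplit_weyl.inv.1, lowerMp_inv,
      extLift_congr τ (lower_mem_congr (n := 1) (neg_mem hy)), mul_assoc, ps_lower (Hφ.mem v₀)]
    rfl
  rw [Finset.sum_congr rfl fun y _ => h y]
  exact sum_const_eq_zero hq _

end IsWeightMap

/-- The linear form on the compact induction attached to a weight map `φ` by Frobenius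
reciprocity: it maps the translate by `g` of `brick τ v` to `φ v g`. -/
def frobForm (τ : Representation E (SpecialLinearGroup (Fin 2) 𝓀[F]) V)
    (φ : V →ₗ[E] (Mp F → E)) : cIndSpace (genuineLift (F := F) τ) →ₗ[E] E :=
  have hfin : ∀ m : cIndSpace (genuineLift (F := F) τ), (Function.support
      fun q : Quotient (QuotientGroup.rightRel (Kt F)) => φ (m.1 q.out) q.out⁻¹).Finite := by
    intro m
    obtain ⟨S, hS, h⟩ := m.2.2.2
    refine (hS.image (Quotient.mk (QuotientGroup.rightRel (Kt F)))).subset fun q hq => ?_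
    have hm : m.1 q.out ≠ 0 := fun h0 => hq (by
      change φ (m.1 q.out) q.out⁻¹ = 0
      rw [h0, map_zero]; rfl)
    obtain ⟨s, hs, hk⟩ := h _ hm
    refine ⟨s, hs, ?_⟩
    rw [← q.out_eq]
    exact Quotient.sound (QuotientGroup.rightRel_apply.2 hk)
  { toFun := fun m => ∑ᶠ q : Quotient (QuotientGroup.rightRel (Kt F)), φ (m.1 q.out) q.out⁻¹
    map_add' := fun m m' => by
      rw [← finsum_add_distrib (hfin m) (hfin m')]
      refine finsum_congr fun q => ?_
      change φ (m.1 q.out + m'.1 q.out) _ = _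
      rw [map_add]; rfl
    map_smul' := fun c m => by
      rw [RingHom.id_apply, smul_finsum]
      refine finsum_congr fun q => ?_
      change φ (c • m.1 q.out) _ = _
      rw [map_smul]; rfl }

lemma frobForm_brick (Hφ : IsWeightMap τ χ φ) (g : Mp F) (v : V) :
    frobForm τ φ (cInd (genuineLift τ) g (brick τ v)) = φ v g := by
  change ∑ᶠ q : Quotient (QuotientGroup.rightRel (Kt F)),
    φ (extLift τ (q.out * g) v) q.out⁻¹ = _
  set q₀ : Quotient (QuotientGroup.rightRel (Kt F)) := Quotient.mk _ g⁻¹ with hq₀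
  have hmem : q₀.out * g ∈ Kt F := by
    have h : QuotientGroup.rightRel (Kt F) g⁻¹ q₀.out :=
      Quotient.exact (s := QuotientGroup.rightRel (Kt F)) (by rw [Quotient.out_eq])
    rw [QuotientGroup.rightRel_apply, inv_inv] at h
    exact h
  rw [finsum_eq_single _ q₀]
  · rw [Hφ.equivariant _ hmem, inv_mul_cancel_left]
  · intro q hq
    rw [extLift_of_notMem, LinearMap.zero_apply, map_zero]
    · rfl
    · intro h
      refine hq ?_
      rw [hq₀, ← q.out_eq]
      refine Quotient.sound (QuotientGroup.rightRel_apply.2 ?_)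
      have := (Kt F).inv_mem h
      rwa [_root_.mul_inv_rev] at this

variable {ϖ : 𝒪[F]} {hϖ : Irreducible ϖ}

/-- The linear form of a weight map annihilates the image of the Hecke operator minus its
eigenvalue on the principal series. -/
lemma frobForm_op (Hφ : IsWeightMap τ χ φ) (hχ : IsTameGenuine χ) (H : HighestWeight τ v₀ l)
    (hq : (Fintype.card 𝓀[F] : E) = 0) (h2 : ringChar 𝓀[F] ≠ 2)
    (hτ : (∀ g v, τ g v = v) ∨ ∀ g, g 0 0 = 0 → l (τ g v₀) = 0)
    (m : cIndSpace (genuineLift (F := F) τ)) :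
    frobForm τ φ ((phiOne hϖ τ).op m - (χ (hTorus (unif hϖ)) : E) • m) = 0 := by
  set c : E := (χ (hTorus (unif hϖ)) : E) with hc
  set D : cIndSpace (genuineLift (F := F) τ) →ₗ[E] cIndSpace (genuineLift (F := F) τ) :=
    (phiOne hϖ τ).op - c • LinearMap.id with hD
  have hDc : ∀ g m, D (cInd (genuineLift τ) g m) = cInd (genuineLift τ) g (D m) := by
    intro g m
    simp [hD, HeckeFun.op_comm]
  -- The function `g ↦ Λ(g (T - c) [v])` belongs to the principal series.
  set Hf : V → Mp F → E := fun v g => frobForm τ φ (cInd (genuineLift τ) g (D (brick τ v)))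
    with hHf
  have hval : ∀ v g, Hf v g =
      ∑ p, l (extLift τ (upperMp (rep2 ϖ p))⁻¹ v) *
          φ v₀ (g * (upperMp (rep2 ϖ p) * hTilde (unif hϖ))) +
        ∑ y : 𝓀[F], l (extLift τ (lowerMp ((ϖ : F) * rep y) * weyl)⁻¹ v) *
          φ v₀ (g * (lowerMp ((ϖ : F) * rep y) * weyl * hTilde (unif hϖ))) - c * φ v g := by
    intro v g
    change frobForm τ φ (cInd (genuineLift τ) g
      ((phiOne hϖ τ).op (brick τ v) - c • brick τ v)) = _
    have h3 : ∀ x w, frobForm τ φ (cInd (genuineLift τ) g (cInd (genuineLift τ) x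
        (brick τ (rho τ w)))) = l w * φ v₀ (g * x) := by
      intro x w
      rw [← Module.End.mul_apply, ← map_mul, frobForm_brick Hφ, H.rho_apply, map_smul]
      rfl
    rw [op_brick, map_sub, map_add, map_sum, map_sum, map_sub, map_add, map_sum, map_sum,
      map_smul, map_smul, frobForm_brick Hφ, smul_eq_mul]
    simp only [h3]
  have hmem : ∀ v, Hf v ∈ PS χ := by
    intro v
    have h3 : Hf v = ∑ p, l (extLift τ (upperMp (rep2 ϖ p))⁻¹ v) •
          rightReg E (Mp F) E (upperMp (rep2 ϖ p) * hTilde (unif hϖ)) (φ v₀) +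
        ∑ y : 𝓀[F], l (extLift τ (lowerMp ((ϖ : F) * rep y) * weyl)⁻¹ v) •
          rightReg E (Mp F) E (lowerMp ((ϖ : F) * rep y) * weyl * hTilde (unif hϖ)) (φ v₀) -
        c • φ v := by
      funext g
      rw [hval]
      simp only [Pi.sub_apply, Pi.add_apply, Finset.sum_apply, Pi.smul_apply, smul_eq_mul,
        rightReg_apply]
    have h4 : ∀ x, rightReg E (Mp F) E x (φ v₀) ∈ PS χ := fun x =>
      psSpace_le _ x (Hφ.mem v₀)
    rw [h3]
    refine (PS χ).sub_mem ((PS χ).add_mem ?_ ?_) ((PS χ).smul_mem _ (Hφ.mem v))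
    · exact (PS χ).sum_mem fun p _ => (PS χ).smul_mem _ (h4 _)
    · exact (PS χ).sum_mem fun p _ => (PS χ).smul_mem _ (h4 _)
  -- It vanishes at `1`, hence on the preimage of `SL₂(𝒪)`, hence everywhere.
  have hone : ∀ v, Hf v 1 = 0 := by
    intro v
    rw [hval]
    simp only [one_mul]
    rw [Hφ.sum_upper hχ H hq h2 hτ, Hφ.sum_lower hq, add_zero, sub_self]
  have hK : ∀ v, ∀ k ∈ Kt F, Hf v k = 0 := by
    intro v k hk
    rw [← hone (extLift τ k v)]
    simp only [hHf]
    rw [← hDc, cInd_brick τ hk, map_one]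
    rfl
  have hzero : ∀ v, Hf v = 0 := by
    intro v
    refine ps_ext (hmem v) (PS χ).zero_mem (fun x hx => ?_) (fun z hz => ?_)
    · rw [hK _ _ (isSplit_upper hx).1]; rfl
    · rw [hK _ _ (isSplit_weyl.mul (isSplit_lower (lat_int zero_le_one hz))).1]; rfl
  have := span_brick τ (W := LinearMap.ker (frobForm τ φ ∘ₗ D)) (fun g v => by
    rw [LinearMap.mem_ker, LinearMap.comp_apply, hDc]
    exact congrFun (hzero v) g) m
  exact this

/-- The class of `brick τ v` in the cokernel module. -/
def brickClass (hϖ : Irreducible ϖ) (τ : Representation E (SpecialLinearGroup (Fin 2) 𝓀[F]) V)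
    (c : E) : V →ₗ[E] (cIndSpace (genuineLift (F := F) τ) ⧸
      LinearMap.range ((phiOne (F := F) hϖ τ).op - c • LinearMap.id)) :=
  Submodule.mkQ _ ∘ₗ
    { toFun := brick τ
      map_add' := fun v w => by
        ext x
        exact map_add (extLift τ x) v w
      map_smul' := fun a v => brick_smul τ a v }

lemma coker_brickClass {k : Mp F} (hk : k ∈ Kt F) (c : E) (v : V) :
    (cokerModule hϖ τ c) k (brickClass hϖ τ c v) = brickClass hϖ τ c (extLift τ k v) := by
  change Submodule.mkQ _ (cInd (genuineLift τ) k (brick τ v)) = _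
  rw [cInd_brick τ hk]; rfl

/-- In the cokernel module the Hecke operator acts by the scalar `c`; its explicit form expresses all
classes through the translates of the class of the highest weight vector. -/
lemma brickClass_hecke (H : HighestWeight τ v₀ l) (c : E) (v : V) :
    c • brickClass hϖ τ c v =
      ∑ p, l (extLift τ (upperMp (rep2 ϖ p))⁻¹ v) • (cokerModule hϖ τ c)
        (upperMp (rep2 ϖ p) * hTilde (unif hϖ)) (brickClass hϖ τ c v₀) +
      ∑ y : 𝓀[F], l (extLift τ (lowerMp ((ϖ : F) * rep y) * weyl)⁻¹ v) • (cokerModule hϖ τ c)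
        (lowerMp ((ϖ : F) * rep y) * weyl * hTilde (unif hϖ)) (brickClass hϖ τ c v₀) := by
  have h1 : Submodule.mkQ (LinearMap.range ((phiOne (F := F) hϖ τ).op - c • LinearMap.id))
      ((phiOne hϖ τ).op (brick τ v)) = c • brickClass hϖ τ c v := by
    rw [← sub_eq_zero]
    change Submodule.mkQ _ _ - c • Submodule.mkQ _ (brick τ v) = 0
    rw [← map_smul, ← map_sub]
    refine (Submodule.Quotient.mk_eq_zero _).2 ⟨brick τ v, ?_⟩
    simp
  rw [← h1, op_brick, map_add, map_sum, map_sum]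
  have h2 : ∀ x w, Submodule.mkQ (LinearMap.range ((phiOne (F := F) hϖ τ).op - c • LinearMap.id))
      (cInd (genuineLift τ) x (brick τ (rho τ w))) =
        l w • (cokerModule hϖ τ c) x (brickClass hϖ τ c v₀) := by
    intro x w
    rw [H.rho_apply, brick_smul, map_smul, map_smul]; rfl
  simp only [h2]

/-- The linear form `frobForm` factors through the cokernel module and does not vanish on the class
of `v₀`. -/
lemma brickClass_ne_zero (Hφ : IsWeightMap τ χ φ) (hχ : IsTameGenuine χ)
    (H : HighestWeight τ v₀ l) (hq : (Fintype.card 𝓀[F] : E) = 0) (h2 : ringChar 𝓀[F] ≠ 2)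
    (hτ : (∀ g v, τ g v = v) ∨ ∀ g, g 0 0 = 0 → l (τ g v₀) = 0) :
    brickClass hϖ τ (χ (hTorus (unif hϖ)) : E) v₀ ≠ 0 := by
  intro h
  obtain ⟨m, hm⟩ := (Submodule.Quotient.mk_eq_zero _).1 h
  have h3 := frobForm_op (hϖ := hϖ) Hφ hχ H hq h2 hτ m
  have h4 := frobForm_brick Hφ 1 v₀
  rw [map_one, Module.End.one_apply] at h4
  refine Hφ.apply_one_ne H ?_
  rw [← h4, ← h3]
  exact congrArg _ hm.symm

/-- The class of the highest weight vector generates the cokernel module. -/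
lemma eq_top_of_brickClass_mem (H : HighestWeight τ v₀ l) {c : E}
    {W : Submodule E (cIndSpace (genuineLift (F := F) τ) ⧸
      LinearMap.range ((phiOne (F := F) hϖ τ).op - c • LinearMap.id))}
    (hW : ∀ g, ∀ y ∈ W, (cokerModule hϖ τ c) g y ∈ W) (h : brickClass hϖ τ c v₀ ∈ W) : W = ⊤ := by
  have h1 : W.comap (brickClass hϖ τ c) = ⊤ := by
    rw [← top_le_iff, ← H.span_lower, Submodule.span_le]
    rintro _ ⟨⟨u, h1, h2, h3⟩, rfl⟩
    have hu : u = lowerSL (red (rep (u 1 0))) := by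
      rw [red_rep]
      ext i j
      fin_cases i <;> fin_cases j
      · exact h1
      · exact h2
      · rfl
      · exact h3
    change brickClass hϖ τ c (τ u v₀) ∈ W
    have hL := isSplit_lower (rep_mem (F := F) (u 1 0))
    rw [hu, ← extLift_lower τ (rep_mem _), ← coker_brickClass hL.1]
    exact hW _ _ h
  refine eq_top_iff.2 fun y _ => ?_
  obtain ⟨m, rfl⟩ := Submodule.mkQ_surjective _ y
  refine span_brick τ (W := W.comap (Submodule.mkQ _)) (fun g v => ?_) m
  have h3 : brickClass hϖ τ c v ∈ W := by
    have : v ∈ W.comap (brickClass hϖ τ c) := by rw [h1]; exact Submodule.mem_top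
    exact this
  exact hW g _ h3

lemma weyl_inv_00 : (weyl (F := F))⁻¹.g 0 0 = 0 := by
  have h : ∀ m : SpecialLinearGroup (Fin 2) F, m⁻¹ 0 0 = m 1 1 := fun m => by
    rw [Matrix.SpecialLinearGroup.coe_inv, adjugate_fin_two]; rfl
  exact h _

/-- A weight with a highest weight vector `v₀` which is trivial, or such that `l` kills `g v₀` for
all `g` with upper left entry zero, and which occurs in the principal series, has a cokernel module
isomorphic to the principal series. -/
lemma cokerModule_equiv (p : ℕ) [Fact p.Prime] [CharP 𝓀[F] p] [CharP E p] (hp : p ≠ 2)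
    (Hφ : IsWeightMap τ χ φ) (hχ : IsTameGenuine χ) (H : HighestWeight τ v₀ l)
    (hτ : (∀ g v, τ g v = v) ∨ ∀ g, g 0 0 = 0 → l (τ g v₀) = 0) :
    Nonempty (Representation.Equiv (cokerModule hϖ τ (χ (hTorus (unif hϖ)) : E))
      (principalSeries fun t => (χ t : E))) := by
  have hq : (Fintype.card 𝓀[F] : E) = 0 := by
    rw [CharP.cast_eq_zero_iff E p]
    exact (CharP.cast_eq_zero_iff 𝓀[F] p _).1 (Nat.cast_card_eq_zero 𝓀[F])
  have h2 : ringChar 𝓀[F] ≠ 2 := by rwa [ringChar.eq 𝓀[F] p]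
  have hne := brickClass_ne_zero (hϖ := hϖ) Hφ hχ H hq h2 hτ
  set c : E := (χ (hTorus (unif hϖ)) : E) with hc
  have hc0 : c ≠ 0 := Units.ne_zero _
  set s := brickClass hϖ τ c v₀ with hs
  have hlow : ∀ y : 𝓀[F], (ϖ : F) * rep y ∈ lat F 1 := fun y => by
    have := unif_mul_mem_lat hϖ (mem_lat_zero.2 (rep_mem y)); rwa [zero_add] at this
  have hsign : ∀ z : ℤˣ, (cokerModule hϖ τ c) (central z) s = signE E z • s := fun z => by
    rw [hs, coker_brickClass (central_mem z), extLift_central, map_smul]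
  rcases hτ with hτ | hτ
  -- trivial weight: the class of `v₀` is spherical, and `upperSum` plays the role of `cellFun`
  · have hext : ∀ x, IsSplit x → ∀ v, extLift τ x v = v := fun x hx v => by
      obtain ⟨hK, hs⟩ := hx
      rw [extLift_split τ (m := redK ⟨x, hK⟩) ⟨hK, hs⟩ fun i j => rfl, hτ]
    have S : IsSpherical hϖ (cokerModule hϖ τ c) c s :=
      { split := fun x hx => by rw [hs, coker_brickClass hx.1, hext x hx]
        sign := hsign
        hecke := by
          have h3 : ∀ y : 𝓀[F], IsSplit (lowerMp ((ϖ : F) * rep y) * weyl) := fun y =>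
            (isSplit_lower (lat_int zero_le_one (hlow y))).mul isSplit_weyl
          rw [hs, brickClass_hecke H]
          simp only [hext _ (isSplit_upper ((isReps_rep2 hϖ).mem _)).inv, hext _ (h3 _).inv,
            H.apply_self, one_smul] }
    have I := S.iwahoriEigen hc hq h2 (Hφ.char_units H hτ)
    have hgen : ∀ W : Submodule E _, (∀ g, ∀ y ∈ W, (cokerModule hϖ τ c) g y ∈ W) →
        IsSpherical.upperSum hϖ (cokerModule hϖ τ c) s ∈ W → W = ⊤ := fun W hW h =>
      eq_top_of_brickClass_mem H hW (S.mem_of_upperSum_mem hc0 hq h2 hW h)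
    refine nonempty_equiv hϖ p hp hχ I (fun h0 => hne ?_) hgen
    have h3 := hgen ⊥ (fun g y hy => by
      rw [(Submodule.mem_bot E).1 hy, map_zero]; exact Submodule.zero_mem _)
      (by rw [h0]; exact Submodule.zero_mem _)
    have h4 : s ∈ (⊥ : Submodule E _) := by rw [h3]; exact Submodule.mem_top
    exact (Submodule.mem_bot E).1 h4
  -- nontrivial weight: the class of `v₀` itself plays the role of `cellFun`, because the cosets of
  -- the `ū(ϖ y) w` do not contribute to the Hecke relation
  · have I : IwahoriEigen hϖ χ (cokerModule hϖ τ c) s :=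
      { upper := fun x hx => by
          rw [hs, coker_brickClass (isSplit_upper hx).1, IsWeightMap.extLift_upper H hx]
        lower := fun z hz => by
          rw [hs, coker_brickClass (isSplit_lower (lat_int zero_le_one hz)).1,
            extLift_congr τ (lower_mem_congr (n := 1) hz), LinearMap.id_apply]
        diag := fun a ha => by
          rw [hs, coker_brickClass (isSplit_hTilde ha).1, Hφ.extLift_hTilde H ha, map_smul]
        sign := hsign
        hecke := by
          rw [← hc, hs, brickClass_hecke H]
          have h3 : ∀ p, l (extLift τ (upperMp (rep2 ϖ p))⁻¹ v₀) = 1 := fun p => by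
            rw [upperMp_inv, IsWeightMap.extLift_upper H (neg_mem ((isReps_rep2 hϖ).mem p)),
              H.apply_self]
          have h4 : ∀ y : 𝓀[F], l (extLift τ (lowerMp ((ϖ : F) * rep y) * weyl)⁻¹ v₀) = 0 := by
            intro y
            have hK := isSplit_weyl (F := F).inv
            rw [_root_.mul_inv_rev, extLift_mul τ hK.1, lowerMp_inv,
              extLift_congr τ (lower_mem_congr (n := 1) (neg_mem (hlow y))), LinearMap.id_apply,
              extLift_split τ (m := redK ⟨weyl⁻¹, hK.1⟩) hK fun i j => rfl]
            refine hτ _ ?_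
            exact (congrArg red weyl_inv_00).trans red_zero
          simp only [h3, h4, one_smul, zero_smul, Finset.sum_const_zero, add_zero] }
    exact nonempty_equiv hϖ p hp hχ I hne fun W hW h => eq_top_of_brickClass_mem H hW h

end Cokernel

/-! ### Gauss integrals -/

section GaussIntegrals

open MeasureTheory Topology Filter

variable {F : Type*} [Field F] [ValuativeRel F] [TopologicalSpace F]
  [IsNonarchimedeanLocalField F]

lemma isCompact_lat (n : ℤ) : IsCompact (lat F n : Set F) := by
  obtain ⟨u, hu⟩ := exists_ord_eq (F := F) n
  convert IsNonarchimedeanLocalField.isCompact_closedBall F (valuation F (u : F)) using 1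
  ext x
  by_cases hx : x = 0
  · rw [hx]
    simp
  · obtain ⟨v, rfl⟩ : ∃ v : Fˣ, (v : F) = x := ⟨Units.mk0 x hx, rfl⟩
    change _ ↔ valuation F (v : F) ≤ valuation F (u : F)
    rw [← ord_le_ord_iff, hu]
    exact unit_mem_lat

/-- Small powers of a complex number are close to `1` only for the number `1`. -/
lemma eq_one_of_norm_pow_sub_one {z : ℂ} (h : ∀ n : ℕ, ‖z ^ n - 1‖ ≤ 1 / 2) : z = 1 := by
  have h1 : ∀ n : ℕ, (3 / 2 : ℝ) ^ n * ‖z - 1‖ ≤ ‖z ^ 2 ^ n - 1‖ := by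
    intro n
    induction n with
    | zero => simp
    | succ n ih =>
      have h2 : z ^ 2 ^ (n + 1) - 1 = (z ^ 2 ^ n - 1) * (z ^ 2 ^ n + 1) := by
        rw [pow_succ, pow_mul]; ring
      have h3 : (3 / 2 : ℝ) ≤ ‖z ^ 2 ^ n + 1‖ := by
        have h4 : (2 : ℂ) = (z ^ 2 ^ n + 1) - (z ^ 2 ^ n - 1) := by ring
        have h5 := norm_sub_le (z ^ 2 ^ n + 1) (z ^ 2 ^ n - 1)
        rw [← h4] at h5
        have := h (2 ^ n)
        norm_num at h5
        linarith
      rw [h2, norm_mul, pow_succ, mul_assoc, mul_comm (3 / 2 : ℝ), ← mul_assoc]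
      gcongr
  by_contra hz
  have hpos : 0 < ‖z - 1‖ := norm_pos_iff.2 (sub_ne_zero.2 hz)
  obtain ⟨n, hn⟩ := pow_unbounded_of_one_lt (1 / ‖z - 1‖) (by norm_num : (1 : ℝ) < 3 / 2)
  have h2 := h1 n
  have h3 := h (2 ^ n)
  rw [div_lt_iff₀ hpos] at hn
  linarith

/-- A nontrivial continuous additive character has a conductor. -/
lemma exists_conductor {ψ : AddChar F ℂ} (hψ : Continuous ψ) (h1 : ψ ≠ 1) :
    ∃ c : ℤ, (∀ x ∈ lat F c, ψ x = 1) ∧ ∃ x ∈ lat F (c - 1), ψ x ≠ 1 := by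
  have hex : ∃ c : ℤ, ∀ x ∈ lat F c, ψ x = 1 := by
    have hnhds : {x | ‖ψ x - 1‖ ≤ 1 / 2} ∈ 𝓝 (0 : F) := by
      have : Tendsto (fun x => ‖ψ x - 1‖) (𝓝 0) (𝓝 ‖ψ 0 - 1‖) :=
        (Continuous.norm (hψ.sub continuous_const)).continuousAt
      rw [AddChar.map_zero_eq_one, sub_self, norm_zero] at this
      filter_upwards [this.eventually (gt_mem_nhds (by norm_num : (0 : ℝ) < 1 / 2))] with x hx
      exact hx.le
    obtain ⟨n, hn⟩ := exists_lat_subset hnhds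
    refine ⟨n, fun x hx => eq_one_of_norm_pow_sub_one fun m => ?_⟩
    rw [← AddChar.map_nsmul_eq_pow]
    exact hn (nsmul_mem hx m)
  obtain ⟨x₀, hx₀⟩ : ∃ x, ψ x ≠ 1 := by
    by_contra! h
    exact h1 (by ext x; simp [h x])
  have hx0 : x₀ ≠ 0 := fun h => hx₀ (by rw [h, AddChar.map_zero_eq_one])
  obtain ⟨u, rfl⟩ : ∃ u : Fˣ, (u : F) = x₀ := ⟨Units.mk0 x₀ hx0, rfl⟩
  obtain ⟨c, hc, hmin⟩ := Int.exists_least_of_bdd (P := fun c => ∀ x ∈ lat F c, ψ x = 1)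
    ⟨ord u, fun c hc => by
      by_contra! h
      exact hx₀ (hc _ (unit_mem_lat.2 h.le))⟩ hex
  refine ⟨c, hc, ?_⟩
  by_contra! h
  have := hmin _ h
  omega

variable [MeasurableSpace F] [BorelSpace F] (μ : Measure F) [μ.IsAddHaarMeasure]

/-- The integral over a translate of a fractional ideal. -/
lemma setIntegral_translate (f : F → ℂ) (j : ℤ) (y : F) :
    ∫ x in {x | x - y ∈ lat F j}, f x ∂μ = ∫ x in (lat F j : Set F), f (y + x) ∂μ := by
  have hm : MeasurableSet (lat F j : Set F) := (isOpen_lat j).measurableSet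
  have hm' : MeasurableSet {x | x - y ∈ lat F j} :=
    ((isOpen_lat (F := F) j).preimage (continuous_id.sub continuous_const)).measurableSet
  rw [← integral_indicator hm, ← integral_indicator hm', ← integral_add_left_eq_self _ y]
  congr 1
  funext x
  by_cases hx : x ∈ lat F j
  · rw [Set.indicator_of_mem hx, Set.indicator_of_mem]
    rwa [Set.mem_ofPred_eq, add_sub_cancel_left]
  · rw [Set.indicator_of_notMem hx, Set.indicator_of_notMem]
    rwa [Set.mem_ofPred_eq, add_sub_cancel_left]

lemma setIntegral_add_mem (f : F → ℂ) {j : ℤ} {y : F} (hy : y ∈ lat F j) :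
    ∫ x in (lat F j : Set F), f (y + x) ∂μ = ∫ x in (lat F j : Set F), f x ∂μ := by
  rw [← setIntegral_translate]
  congr 2
  ext x
  exact ⟨fun h => by simpa using add_mem h hy, fun h => sub_mem h hy⟩

/-- Decomposition of an integral over a fractional ideal along the classes of the residue field. -/
lemma setIntegral_lat {f : F → ℂ} (hf : Continuous f) {u : Fˣ} {j : ℤ} (hu : ord u = j) :
    ∫ x in (lat F j : Set F), f x ∂μ =
      ∑ x : 𝓀[F], ∫ z in (lat F (j + 1) : Set F), f (u * rep x + z) ∂μ := by
  have hiff : ∀ x y : F, (u : F) * x - u * y ∈ lat F (j + 1) ↔ x - y ∈ lat F 1 := fun x y => by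
    rw [← mul_sub, unit_mul_mem_lat, hu, add_sub_cancel_left]
  have hU : (lat F j : Set F) = ⋃ x : 𝓀[F], {z | z - u * rep x ∈ lat F (j + 1)} := by
    ext z
    rw [Set.mem_iUnion]
    constructor
    · intro hz
      have hz' : (u : F)⁻¹ * z ∈ 𝒪[F] := by
        rw [← mem_lat_zero]
        have := unit_mul_mem_lat (u := u) (x := (u : F)⁻¹ * z) (n := j)
        rw [mul_inv_cancel_left₀ u.ne_zero, hu, sub_self] at this
        exact this.1 hz
      refine ⟨red ((u : F)⁻¹ * z), ?_⟩
      have h := (hiff ((u : F)⁻¹ * z) (rep (red ((u : F)⁻¹ * z)))).2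
        ((sub_mem_lat_one hz' (rep_mem _)).2 (red_rep _).symm)
      rwa [mul_inv_cancel_left₀ u.ne_zero] at h
    · rintro ⟨x, hx⟩
      have h1 : (u : F) * rep x ∈ lat F j := by
        rw [unit_mul_mem_lat, hu, sub_self, mem_lat_zero]; exact rep_mem x
      have h2 := add_mem (lat_anti (by omega : j ≤ j + 1) hx) h1
      rwa [sub_add_cancel] at h2
  rw [hU, integral_iUnion_fintype]
  · exact Finset.sum_congr rfl fun x _ => setIntegral_translate μ f _ _
  · exact fun x => ((isOpen_lat (F := F) _).preimage
      (continuous_id.sub continuous_const)).measurableSet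
  · intro x y hxy
    refine Set.disjoint_left.2 fun z hz hz' => hxy ?_
    have hz1 : z - u * rep x ∈ lat F (j + 1) := hz
    have hz2 : z - u * rep y ∈ lat F (j + 1) := hz'
    have h := sub_mem hz2 hz1
    rw [sub_sub_sub_cancel_left, hiff, sub_mem_lat_one (rep_mem x) (rep_mem y), red_rep,
      red_rep] at h
    exact h
  · intro x
    refine (hf.continuousOn.integrableOn_compact' (isCompact_lat j)
      (isOpen_lat j).measurableSet).mono_set fun z hz => ?_
    rw [hU]
    exact Set.mem_iUnion.2 ⟨x, hz⟩

lemma setIntegral_one_pos (j : ℤ) : ∃ V : ℝ, 0 < V ∧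
    ∫ _x in (lat F j : Set F), (1 : ℂ) ∂μ = V := by
  refine ⟨μ.real (lat F j), ?_, by simp⟩
  refine ENNReal.toReal_pos ?_ (isCompact_lat j).measure_lt_top.ne
  exact ((isOpen_lat (F := F) j).measure_pos μ ⟨0, zero_mem _⟩).ne'

variable {ψ : AddChar F ℂ} {c : ℤ}

lemma quadratic_continuous (hψ : Continuous ψ) (a : F) : Continuous fun x => ψ (a * x ^ 2) := by
  fun_prop

lemma two_unit (h2 : ringChar 𝓀[F] ≠ 2) : ∃ t : Fˣ, (t : F) = 2 ∧ ord t = 0 := by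
  have h : red (2 : F) = 2 := by
    have := red_add (one_mem 𝒪[F]) (one_mem 𝒪[F])
    rw [red_one, one_add_one_eq_two, one_add_one_eq_two] at this
    exact this
  refine exists_unit_of_red_ne (by
    have := add_mem (one_mem 𝒪[F]) (one_mem 𝒪[F]); rwa [one_add_one_eq_two] at this) ?_
  rw [h]
  exact Ring.two_ne_zero h2

lemma psi_sq_add (ψ : AddChar F ℂ) (a x y : F) :
    ψ (a * (x + y) ^ 2) = ψ (a * x ^ 2) * ψ (2 * a * x * y) * ψ (a * y ^ 2) := by
  rw [← AddChar.map_add_eq_mul, ← AddChar.map_add_eq_mul]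
  congr 1
  ring

/-- The Gauss integral over a large fractional ideal does not change when the ideal shrinks. -/
lemma gauss_shrink (h2 : ringChar 𝓀[F] ≠ 2) (hψ : Continuous ψ) (hc : ∀ x ∈ lat F c, ψ x = 1)
    (hc' : ∃ x ∈ lat F (c - 1), ψ x ≠ 1) (a : Fˣ) {j : ℤ} (hj : 2 * j + 2 + ord a ≤ c) :
    ∫ x in (lat F j : Set F), ψ (a * x ^ 2) ∂μ =
      ∫ x in (lat F (j + 1) : Set F), ψ (a * x ^ 2) ∂μ := by
  obtain ⟨u, hu⟩ := exists_ord_eq (F := F) j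
  obtain ⟨t, ht, ot⟩ := two_unit h2
  rw [setIntegral_lat μ (quadratic_continuous hψ a) hu, Finset.sum_eq_single 0]
  · simp [rep_zero]
  · intro x _ hx
    obtain ⟨v, hv, ov⟩ := exists_unit_rep hx
    rw [← hv]
    obtain ⟨w, hw, hψw⟩ := hc'
    -- translation by `y` multiplies the integrand by the constant `ψ w ≠ 1`
    set d : Fˣ := t * a * (u * v) with hd
    have od : ord d = ord a + j := by simp only [hd, ord_mul, ot, hu, ov]; ring
    set y : F := (d : F)⁻¹ * w with hy
    have hdy : (d : F) * y = w := mul_inv_cancel_left₀ d.ne_zero w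
    have hy1 : y ∈ lat F (c - 1 - ord a - j) := by
      have := unit_mul_mem_lat (u := d) (x := y) (n := c - 1)
      rw [hdy, od] at this
      convert this.1 hw using 2
      ring
    have hyj : y ∈ lat F (j + 1) := lat_anti (by omega) hy1
    have h3 : ∀ z ∈ (lat F (j + 1) : Set F), ψ (a * (u * v + (y + z)) ^ 2) =
        ψ w * ψ (a * (u * v + z) ^ 2) := by
      intro z hz
      have e : (u : F) * v + (y + z) = (u * v + z) + y := by ring
      have h4 : ψ ((a : F) * y ^ 2) = 1 := by
        refine hc _ ?_
        rw [unit_mul_mem_lat, sq]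
        exact lat_anti (by omega) (mul_mem_lat hy1 hy1)
      have h5 : ψ (2 * a * (u * v + z) * y) = ψ w := by
        have e2 : 2 * (a : F) * (u * v + z) * y = w + ((t * a : Fˣ) : F) * (z * y) := by
          rw [← hdy, hd, ← ht]; push_cast; ring
        rw [e2, AddChar.map_add_eq_mul, hc (((t * a : Fˣ) : F) * (z * y)), mul_one]
        rw [unit_mul_mem_lat, ord_mul, ot]
        exact lat_anti (by omega) (mul_mem_lat hz hy1)
      rw [e, psi_sq_add, h4, h5, mul_one, mul_comm]
    have h6 := setIntegral_add_mem μ (fun z => ψ ((a : F) * (u * v + z) ^ 2)) hyj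
    rw [setIntegral_congr_fun (isOpen_lat (F := F) (j + 1)).measurableSet h3,
      integral_const_mul] at h6
    have h7 : (ψ w - 1) * ∫ z in (lat F (j + 1) : Set F), ψ ((a : F) * (u * v + z) ^ 2) ∂μ = 0 := by
      rw [sub_mul, h6]; ring
    exact (mul_eq_zero.1 h7).resolve_left (sub_ne_zero.2 hψw)
  · simp

/-- The Gauss integrals over large fractional ideals are all equal. -/
lemma gauss_stable (h2 : ringChar 𝓀[F] ≠ 2) (hψ : Continuous ψ) (hc : ∀ x ∈ lat F c, ψ x = 1)
    (hc' : ∃ x ∈ lat F (c - 1), ψ x ≠ 1) (a : Fˣ) {j : ℤ} (hj : 2 * j + ord a ≤ c) (n : ℕ) :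
    ∫ x in (lat F (j - n) : Set F), ψ (a * x ^ 2) ∂μ =
      ∫ x in (lat F j : Set F), ψ (a * x ^ 2) ∂μ := by
  induction n with
  | zero => simp
  | succ n ih =>
    rw [← ih, gauss_shrink μ h2 hψ hc hc' a (by push_cast; omega)]
    congr 4
    push_cast
    ring

/-- On the ideal of elements `x` with `a x² ∈ 𝔭ᶜ` the integrand is `1`. -/
lemma gauss_even (hc : ∀ x ∈ lat F c, ψ x = 1) (a : Fˣ) {j : ℤ} (hj : 2 * j + ord a = c) :
    ∃ V : ℝ, 0 < V ∧ ∫ x in (lat F j : Set F), ψ (a * x ^ 2) ∂μ = V := by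
  obtain ⟨V, hV, h⟩ := setIntegral_one_pos μ j
  refine ⟨V, hV, ?_⟩
  rw [← h]
  refine setIntegral_congr_fun (isOpen_lat (F := F) j).measurableSet fun x hx => hc _ ?_
  rw [unit_mul_mem_lat, sq]
  exact lat_anti (by omega) (mul_mem_lat hx hx)

/-- When the valuation of `a` does not have the parity of the conductor, the Gauss integral is a
Gauss sum over the residue field. -/
lemma gauss_odd (hψ : Continuous ψ) (hc : ∀ x ∈ lat F c, ψ x = 1) (a u : Fˣ) {j : ℤ}
    (hu : ord u = j) (hj : 2 * j + 1 + ord a = c) :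
    ∃ V : ℝ, 0 < V ∧ ∫ x in (lat F j : Set F), ψ (a * x ^ 2) ∂μ =
      V * ∑ x : 𝓀[F], ψ (((a * u ^ 2 : Fˣ) : F) * rep x ^ 2) := by
  obtain ⟨V, hV, h⟩ := setIntegral_one_pos μ (j + 1)
  refine ⟨V, hV, ?_⟩
  rw [setIntegral_lat μ (quadratic_continuous hψ a) hu, Finset.mul_sum]
  refine Finset.sum_congr rfl fun x _ => ?_
  rw [← h, ← integral_mul_const]
  refine setIntegral_congr_fun (isOpen_lat (F := F) (j + 1)).measurableSet fun z hz => ?_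
  have hx : (u : F) * rep x ∈ lat F j := by
    rw [unit_mul_mem_lat, hu, sub_self, mem_lat_zero]; exact rep_mem x
  have h2 : (2 : F) ∈ 𝒪[F] := by
    have := add_mem (one_mem 𝒪[F]) (one_mem 𝒪[F]); rwa [one_add_one_eq_two] at this
  change ψ ((a : F) * (u * rep x + z) ^ 2) = _
  rw [psi_sq_add, hc ((a : F) * z ^ 2), hc (2 * a * (u * rep x) * z), mul_one, mul_one, one_mul]
  · congr 1
    push_cast
    ring
  · have e : 2 * (a : F) * (u * rep x) * z = a * (2 * ((u * rep x) * z)) := by ring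
    rw [e, unit_mul_mem_lat]
    exact int_mul_mem_lat h2 (lat_anti (by omega) (mul_mem_lat hx hz))
  · rw [unit_mul_mem_lat, sq]
    exact lat_anti (by omega) (mul_mem_lat hz hz)

end GaussIntegrals

/-! ### The Weil index -/

section WeilIndexFormula

open MeasureTheory Topology Filter

variable {F : Type*} [Field F] [ValuativeRel F] [TopologicalSpace F]
  [IsNonarchimedeanLocalField F] {ϖ : 𝒪[F]} {ψ : AddChar F ℂ} {c : ℤ}

/-- The additive character of the residue field induced by a character `ψ` that is trivial on the
elements of valuation at least `c`, through multiplication by an element `b` of valuation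
`c - 1`. -/
def residualChar (hc : ∀ x ∈ lat F c, ψ x = 1) {b : Fˣ} (hb : ord b = c - 1) :
    AddChar 𝓀[F] ℂ where
  toFun x := ψ (b * rep x)
  map_zero_eq_one' := by rw [rep_zero, mul_zero, AddChar.map_zero_eq_one]
  map_add_eq_mul' x y := by
    rw [← AddChar.map_add_eq_mul, ← mul_add]
    have h : (b : F) * (rep (x + y) - (rep x + rep y)) ∈ lat F c := by
      rw [unit_mul_mem_lat, hb, sub_sub_cancel,
        sub_mem_lat_one (rep_mem _) (add_mem (rep_mem _) (rep_mem _)),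
        red_add (rep_mem _) (rep_mem _), red_rep, red_rep, red_rep]
    rw [← sub_add_cancel ((b : F) * rep (x + y)) (b * (rep x + rep y)), ← mul_sub,
      AddChar.map_add_eq_mul, hc _ h, one_mul]

lemma residualChar_red (hc : ∀ x ∈ lat F c, ψ x = 1) {b : Fˣ} (hb : ord b = c - 1) {y : F}
    (hy : y ∈ 𝒪[F]) : residualChar hc hb (red y) = ψ (b * y) := by
  change ψ (b * rep (red y)) = _
  have h : (b : F) * (rep (red y) - y) ∈ lat F c := by
    rw [unit_mul_mem_lat, hb, sub_sub_cancel, sub_mem_lat_one (rep_mem _) hy, red_rep]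
  rw [← sub_add_cancel ((b : F) * rep (red y)) (b * y), ← mul_sub, AddChar.map_add_eq_mul,
    hc _ h, one_mul]

lemma residualChar_ne_one (hc : ∀ x ∈ lat F c, ψ x = 1) (hc' : ∃ x ∈ lat F (c - 1), ψ x ≠ 1)
    {b : Fˣ} (hb : ord b = c - 1) : residualChar hc hb ≠ 1 := by
  obtain ⟨x, hx, hne⟩ := hc'
  have hy : (b : F)⁻¹ * x ∈ 𝒪[F] := by
    rw [← mem_lat_zero]
    have := unit_mul_mem_lat (u := b) (x := (b : F)⁻¹ * x) (n := c - 1)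
    rw [mul_inv_cancel_left₀ b.ne_zero, hb, sub_self] at this
    exact this.1 hx
  refine AddChar.ne_one_iff.2 ⟨red ((b : F)⁻¹ * x), ?_⟩
  rwa [residualChar_red hc hb hy, mul_inv_cancel_left₀ b.ne_zero]

/-- The quadratic exponential sum of a nontrivial character of a finite field is a Gauss sum. -/
lemma sum_sq_eq_gaussSum {k : Type*} [Field k] [Fintype k] [DecidableEq k] (h2 : ringChar k ≠ 2)
    {e : AddChar k ℂ} (he : e ≠ 1) {v : k} (hv : v ≠ 0) :
    ∑ x, e (v * x ^ 2) = ((quadraticChar k v : ℤ) : ℂ) *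
      gaussSum ((quadraticChar k).ringHomComp (Int.castRingHom ℂ)) e := by
  have h1 : ∑ x, e (v * x ^ 2) = ∑ y, (((quadraticChar k y : ℤ) : ℂ) + 1) * e (v * y) := by
    have : ∀ x, e (v * x ^ 2) = ∑ y, if x ^ 2 = y then e (v * y) else 0 := fun x => by simp
    rw [Finset.sum_congr rfl fun x _ => this x, Finset.sum_comm]
    refine Finset.sum_congr rfl fun y _ => ?_
    rw [← Finset.sum_filter, Finset.sum_const, nsmul_eq_mul]
    congr 1
    have h := congrArg (Int.cast : ℤ → ℂ) (quadraticChar_card_sqrts h2 y)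
    rw [Int.cast_natCast, Int.cast_add, Int.cast_one] at h
    rw [← h]
    congr 2
    ext x
    simp
  have h3 : ∑ y, e (v * y) = 0 := by
    have := AddChar.sum_eq_zero_of_ne_one (AddChar.IsPrimitive.of_ne_one he hv)
    simpa [AddChar.mulShift_apply] using this
  have h4 := gaussSum_mulShift ((quadraticChar k).ringHomComp (Int.castRingHom ℂ)) e
    (Units.mk0 v hv)
  have h5 : ((quadraticChar k v : ℤ) : ℂ) * ((quadraticChar k v : ℤ) : ℂ) = 1 := by
    rw [← Int.cast_mul, ← sq, quadraticChar_sq_one hv, Int.cast_one]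
  rw [h1, ← h4]
  simp only [add_mul, one_mul, Finset.sum_add_distrib, h3, add_zero]
  rw [← mul_assoc]
  simp only [Units.val_mk0, MulChar.ringHomComp_apply, eq_intCast]
  rw [h5, one_mul]
  simp [gaussSum, AddChar.mulShift_apply, MulChar.ringHomComp_apply]

/-- The phases of the quadratic exponential sums of a nontrivial character are `±g`, the sign being
the quadratic character; the square of the Gauss sum determines `g ^ 2`. -/
lemma exists_phase {k : Type*} [Field k] [Fintype k] [DecidableEq k] (h2 : ringChar k ≠ 2)
    {e : AddChar k ℂ} (he : e ≠ 1) :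
    ∃ g : ℂ, g ^ 2 = ((quadraticChar k (-1) : ℤ) : ℂ) ∧ ∀ (V : ℝ) (v : k), 0 < V → v ≠ 0 →
      (V * ∑ x, e (v * x ^ 2)) / ‖V * ∑ x, e (v * x ^ 2)‖ =
        ((quadraticChar k v : ℤ) : ℂ) * g := by
  set G := gaussSum ((quadraticChar k).ringHomComp (Int.castRingHom ℂ)) e with hG
  have hη : (quadraticChar k).ringHomComp (Int.castRingHom ℂ) ≠ 1 := by
    rw [MulChar.ringHomComp_ne_one_iff (Int.castRingHom ℂ).injective_int]
    exact quadraticChar_ne_one h2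
  have hsq : G ^ 2 = ((quadraticChar k (-1) : ℤ) : ℂ) * Fintype.card k :=
    gaussSum_sq hη ((quadraticChar_isQuadratic k).comp _) (AddChar.IsPrimitive.of_ne_one he)
  have hn : ∀ v : k, v ≠ 0 → ‖((quadraticChar k v : ℤ) : ℂ)‖ = 1 := fun v hv => by
    rcases quadraticChar_dichotomy hv with h | h <;> simp [h]
  have hnG : (‖G‖ : ℂ) ^ 2 = Fintype.card k := by
    have := congrArg norm hsq
    rw [norm_pow, norm_mul, hn _ (by simp), one_mul, Complex.norm_natCast] at this
    exact_mod_cast this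
  have hcard : (Fintype.card k : ℂ) ≠ 0 := by simp
  have hG0 : (‖G‖ : ℂ) ≠ 0 := fun h => hcard (by rw [← hnG, h]; simp)
  refine ⟨G / ‖G‖, ?_, fun V v hV hv => ?_⟩
  · rw [div_pow, hsq, hnG, mul_div_assoc, div_self hcard, mul_one]
  · rw [sum_sq_eq_gaussSum h2 he hv, ← hG, norm_mul, norm_mul, hn v hv, one_mul, Complex.norm_real,
      Real.norm_of_nonneg hV.le]
    have : (V : ℂ) ≠ 0 := by exact_mod_cast hV.ne'
    push_cast
    field_simp

end WeilIndexFormula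

section WeilIndexFormula

open MeasureTheory Topology Filter

variable {F : Type*} [Field F] [ValuativeRel F] [TopologicalSpace F]
  [IsNonarchimedeanLocalField F] {ϖ : 𝒪[F]} {ψ : AddChar F ℂ} {c : ℤ}

lemma gaussInt_eq (h2 : ringChar 𝓀[F] ≠ 2) (hψ : Continuous ψ) (hc : ∀ x ∈ lat F c, ψ x = 1)
    (hc' : ∃ x ∈ lat F (c - 1), ψ x ≠ 1) (a : Fˣ) {j : ℤ} (hj : 2 * j + ord a ≤ c) {n : ℕ}
    (hn : -j ≤ n) :
    letI : MeasurableSpace F := borel F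
    haveI : BorelSpace F := ⟨rfl⟩
    gaussInt ψ a n = ∫ x in (lat F j : Set F), ψ (a * x ^ 2) ∂Measure.addHaar := by
  let : MeasurableSpace F := borel F
  have : BorelSpace F := ⟨rfl⟩
  have h := gauss_stable (Measure.addHaar : Measure F) h2 hψ hc hc' a hj (j + n).toNat
  rw [← h]
  have e : j - (((j + n).toNat : ℕ) : ℤ) = -(n : ℤ) := by omega
  rw [e]
  rfl

/-- The sequence of normalised Gauss integrals defining the Weil index is eventually constant. -/
lemma weilIndex_eq (h2 : ringChar 𝓀[F] ≠ 2) (hψ : Continuous ψ) (hc : ∀ x ∈ lat F c, ψ x = 1)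
    (hc' : ∃ x ∈ lat F (c - 1), ψ x ≠ 1) (a : Fˣ) {j : ℤ} (hj : 2 * j + ord a ≤ c) :
    letI : MeasurableSpace F := borel F
    haveI : BorelSpace F := ⟨rfl⟩
    weilIndex ψ a = (∫ x in (lat F j : Set F), ψ (a * x ^ 2) ∂Measure.addHaar) /
      ‖∫ x in (lat F j : Set F), ψ (a * x ^ 2) ∂Measure.addHaar‖ := by
  let : MeasurableSpace F := borel F
  have : BorelSpace F := ⟨rfl⟩
  refine Tendsto.limUnder_eq (tendsto_const_nhds.congr' ?_)
  filter_upwards [eventually_ge_atTop (-j).toNat] with n hn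
  rw [gaussInt_eq h2 hψ hc hc' a hj (by omega)]

/-- The Weil index of `ψ(a x²)`: it is `1` when the valuation of `a` has the parity of the
conductor of `ψ`, and otherwise it is the quadratic symbol of the unit part of `a` times the
phase `g` of a quadratic Gauss sum over the residue field. -/
lemma exists_weilIndex (hϖ : Irreducible ϖ) (h2 : ringChar 𝓀[F] ≠ 2) (hψ : Continuous ψ)
    (h1 : ψ ≠ 1) : ∃ (c : ℤ) (g : ℂ), g ^ 2 = signE ℂ (hilb (unif hϖ) (-1)) ∧ ∀ a : Fˣ,
      (Even (c - ord a) → weilIndex ψ a = 1) ∧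
      (¬ Even (c - ord a) →
        weilIndex ψ a = signE ℂ (hilb (unif hϖ) (a * unif hϖ ^ (-ord a))) * g) := by
  classical
  obtain ⟨c, hc, hc'⟩ := exists_conductor hψ h1
  have hb : ord (unif hϖ ^ (c - 1)) = c - 1 := by rw [ord_zpow, ord_unif, mul_one]
  obtain ⟨g, hg, hphase⟩ := exists_phase h2 (residualChar_ne_one hc hc' hb)
  let : MeasurableSpace F := borel F
  have : BorelSpace F := ⟨rfl⟩
  refine ⟨c, g, ?_, fun a => ⟨fun he => ?_, fun ho => ?_⟩⟩
  · rw [hg, signE_hilb_unif hϖ ord_neg_one, eta, Units.val_neg, Units.val_one,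
      red_neg (one_mem _), red_one]
  · obtain ⟨j, hj⟩ := he
    obtain ⟨V, hV, h⟩ := gauss_even (Measure.addHaar : Measure F) hc a (j := j) (by omega)
    rw [weilIndex_eq h2 hψ hc hc' a (j := j) (by omega), h, Complex.norm_real,
      Real.norm_of_nonneg hV.le, div_self]
    exact_mod_cast hV.ne'
  · obtain ⟨j, hj⟩ := Int.not_even_iff_odd.1 ho
    have hu : ord (unif hϖ ^ j) = j := by rw [ord_zpow, ord_unif, mul_one]
    obtain ⟨V, hV, h⟩ :=
      gauss_odd (Measure.addHaar : Measure F) hψ hc a (unif hϖ ^ j) hu (by omega)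
    have hv : ord (a * unif hϖ ^ (-ord a)) = 0 := by
      rw [ord_mul, ord_zpow, ord_unif]; ring
    have hvm := unit_mem hv
    have e : a * (unif hϖ ^ j) ^ 2 = unif hϖ ^ (c - 1) * (a * unif hϖ ^ (-ord a)) := by
      rw [mul_left_comm, ← zpow_add, sq, ← zpow_add]
      congr 2
      omega
    have hsum : ∀ x : 𝓀[F], ψ (((a * (unif hϖ ^ j) ^ 2 : Fˣ) : F) * rep x ^ 2) =
        residualChar hc hb (red ((a * unif hϖ ^ (-ord a) : Fˣ) : F) * x ^ 2) := by
      intro x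
      have hx : red (((a * unif hϖ ^ (-ord a) : Fˣ) : F) * rep x ^ 2) =
          red ((a * unif hϖ ^ (-ord a) : Fˣ) : F) * x ^ 2 := by
        rw [sq, sq, red_mul hvm (mul_mem (rep_mem x) (rep_mem x)),
          red_mul (rep_mem x) (rep_mem x), red_rep]
      rw [← hx, residualChar_red hc hb (mul_mem hvm (pow_mem (rep_mem x) 2)), e, Units.val_mul,
        mul_assoc]
    rw [weilIndex_eq h2 hψ hc hc' a (j := j) (by omega), h,
      Finset.sum_congr rfl fun x _ => hsum x, hphase V _ hV (red_unit_ne hv),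
      signE_hilb_unif hϖ hv, eta]

end WeilIndexFormula

section WeilRatio

variable {F : Type*} [Field F] [ValuativeRel F] [TopologicalSpace F]
  [IsNonarchimedeanLocalField F] {ϖ : 𝒪[F]} {ψ : AddChar F ℂ}

lemma hl_zpow_left (a b : Fˣ) (n : ℤ) : hl (a ^ n) b = n * hl a b := by
  induction n with
  | zero => simp [hl_one_left]
  | succ n ih => rw [zpow_add_one, hl_mul_left, ih]; push_cast; ring
  | pred n ih =>
    rw [zpow_sub_one, hl_mul_left, hl_inv_left, ih]
    push_cast
    linear_combination two_zmod (hl a b)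

lemma hl_zpow_right (a b : Fˣ) (n : ℤ) : hl b (a ^ n) = n * hl b a := by
  rw [hl_symm, hl_zpow_left, hl_symm]

/-- The quadratic symbol of the unit part of a nonzero element. -/
def unitSign (hϖ : Irreducible ϖ) (a : Fˣ) : ZMod 2 := hl (unif hϖ) (a * unif hϖ ^ (-ord a))

lemma unitSign_mul (hϖ : Irreducible ϖ) (a b : Fˣ) :
    unitSign hϖ (a * b) = unitSign hϖ a + unitSign hϖ b := by
  rw [unitSign, unitSign, unitSign, ← hl_mul_right, ord_mul, neg_add, zpow_add]
  congr 1
  exact mul_mul_mul_comm _ _ _ _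

/-- The Hilbert symbol in terms of valuations and unit parts. -/
lemma hl_eq_unitSign (hϖ : Irreducible ϖ) (a b : Fˣ) :
    hl a b = ord a * ord b * hl (unif hϖ) (-1) + ord a * unitSign hϖ b +
      ord b * unitSign hϖ a := by
  have ha : a = unif hϖ ^ ord a * (a * unif hϖ ^ (-ord a)) := by
    rw [mul_left_comm, ← zpow_add, add_neg_cancel, zpow_zero, mul_one]
  have hb : b = unif hϖ ^ ord b * (b * unif hϖ ^ (-ord b)) := by
    rw [mul_left_comm, ← zpow_add, add_neg_cancel, zpow_zero, mul_one]
  have h0 : ∀ a : Fˣ, ord (a * unif hϖ ^ (-ord a)) = 0 := fun a => by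
    rw [ord_mul, ord_zpow, ord_unif]; ring
  have h : ∀ x y : Fˣ, ord x = 0 → ord y = 0 → ∀ m n : ℤ,
      hl (unif hϖ ^ m * x) (unif hϖ ^ n * y) =
        m * n * hl (unif hϖ) (-1) + m * hl (unif hϖ) y + n * hl (unif hϖ) x := by
    intro x y hx hy m n
    rw [hl_mul_left, hl_mul_right, hl_mul_right, hl_units hx hy, hl_zpow_left, hl_zpow_left,
      hl_zpow_right, hl_zpow_right, hl_self, hl_symm x]
    ring
  conv_lhs => rw [ha, hb]
  exact h _ _ (h0 a) (h0 b) _ _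

/-- The sign attached to an element of `ZMod 2`. -/
def sgnC (x : ZMod 2) : ℂ := if x = 0 then 1 else -1

lemma sgnC_add (x y : ZMod 2) : sgnC (x + y) = sgnC x * sgnC y := by
  have h2 : ∀ z : ZMod 2, z = 0 ∨ z = 1 := by decide
  have h01 : (1 : ZMod 2) ≠ 0 := by decide
  rcases h2 x with rfl | rfl <;> rcases h2 y with rfl | rfl <;>
    simp [sgnC, h01, two_zmod (1 : ZMod 2)]

lemma signE_eq_sgnC (z : ℤˣ) : signE ℂ z = sgnC (sgn2 z) := by
  rcases Int.units_eq_one_or z with rfl | rfl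
  · simp [sgnC, sgn2]
  · have : sgn2 (-1) ≠ 0 := by decide
    rw [signE_neg_one, sgnC, if_neg this]

end WeilRatio

section WeilRatio

variable {F : Type*} [Field F] [ValuativeRel F] [TopologicalSpace F]
  [IsNonarchimedeanLocalField F] {ϖ : 𝒪[F]} {ψ : AddChar F ℂ}

lemma sgnC_zero : sgnC 0 = 1 := if_pos rfl

lemma sgnC_mul_self (x : ZMod 2) : sgnC x * sgnC x = 1 := by
  rw [← sgnC_add, two_zmod, sgnC_zero]

lemma unitSign_one (hϖ : Irreducible ϖ) : unitSign hϖ 1 = 0 := by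
  have := unitSign_mul hϖ 1 1
  rw [mul_one] at this
  simpa using this

lemma unitSign_of_unit (hϖ : Irreducible ϖ) {a : Fˣ} (ha : ord a = 0)
    (h1 : (a : F) - 1 ∈ lat F 1) : unitSign hϖ a = 0 := by
  rw [unitSign, ha, neg_zero, zpow_zero, mul_one, hl_symm]
  refine hl_of_red_one ha ?_ _
  rw [(sub_mem_lat_one (unit_mem ha) (one_mem _)).1 h1, red_one]

/-- The ratio of Weil indices in terms of the conductor `c` of `ψ` and of the phase `g` of a
quadratic Gauss sum. -/
lemma exists_gammaF (hϖ : Irreducible ϖ) (h2 : ringChar 𝓀[F] ≠ 2) (hψ : Continuous ψ)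
    (h1 : ψ ≠ 1) : ∃ (c : ℤ) (g : ℂ), g * g = sgnC (hl (unif hϖ) (-1)) ∧ ∀ a : Fˣ,
      (Even c → Even (ord a) → gammaF ψ a = 1) ∧
      (Even c → Odd (ord a) → gammaF ψ a = sgnC (unitSign hϖ a) * g) ∧
      (Odd c → Even (ord a) → gammaF ψ a = sgnC (unitSign hϖ a)) ∧
      (Odd c → Odd (ord a) → gammaF ψ a = g * sgnC (hl (unif hϖ) (-1))) := by
  obtain ⟨c, g, hg, h⟩ := exists_weilIndex hϖ h2 hψ h1
  simp only [signE_eq_sgnC] at hg h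
  change ∀ a, _ ∧ (_ → _ = sgnC (unitSign hϖ a) * g) at h
  have hgg : g * g = sgnC (hl (unif hϖ) (-1)) := by rw [← sq]; exact hg
  have hs := sgnC_mul_self (hl (unif hϖ) (-1))
  rw [← hgg] at hs
  have hg0 : g ≠ 0 := fun h0 => by simp [h0] at hs
  refine ⟨c, g, hgg, fun a => ⟨fun hc ha => ?_, fun hc ha => ?_, fun hc ha => ?_, fun hc ha => ?_⟩⟩
  · rw [gammaF, (h a).1 (hc.sub ha), (h 1).1 (by rwa [ord_one, sub_zero]), div_one]
  · rw [gammaF, (h a).2 (Int.not_even_iff_odd.2 (hc.sub_odd ha)),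
      (h 1).1 (by rwa [ord_one, sub_zero]), div_one]
  · rw [gammaF, (h a).2 (Int.not_even_iff_odd.2 (hc.sub_even ha)),
      (h 1).2 (by rwa [ord_one, sub_zero, Int.not_even_iff_odd]), unitSign_one, sgnC_zero, one_mul,
      mul_div_cancel_right₀ _ hg0]
  · rw [gammaF, (h a).1 (hc.sub_odd ha),
      (h 1).2 (by rwa [ord_one, sub_zero, Int.not_even_iff_odd]), unitSign_one, sgnC_zero, one_mul,
      ← hgg, div_eq_iff hg0]
    linear_combination -hs

/-- The ratio of Weil indices is multiplicative up to the Hilbert symbol. -/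
lemma gammaF_mul (h2 : ringChar 𝓀[F] ≠ 2) (hψ : Continuous ψ) (h1 : ψ ≠ 1) (a b : Fˣ) :
    gammaF ψ (a * b) = gammaF ψ a * gammaF ψ b * signE ℂ (hilb a b) := by
  obtain ⟨ϖ, hϖ⟩ := IsDiscreteValuationRing.exists_irreducible 𝒪[F]
  obtain ⟨c, g, hg, h⟩ := exists_gammaF hϖ h2 hψ h1
  obtain ⟨a1, a2, a3, a4⟩ := h a
  obtain ⟨b1, b2, b3, b4⟩ := h b
  obtain ⟨c1, c2, c3, c4⟩ := h (a * b)
  rw [unitSign_mul, sgnC_add] at c2 c3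
  rw [ord_mul] at c1 c2 c3 c4
  have hs := sgnC_mul_self (hl (unif hϖ) (-1))
  have hx := sgnC_mul_self (unitSign hϖ a)
  have hy := sgnC_mul_self (unitSign hϖ b)
  have e0 : ∀ n : ℤ, Even n → (n : ZMod 2) = 0 := fun n hn => by
    obtain ⟨k, rfl⟩ := hn
    push_cast
    exact two_zmod _
  have e1 : ∀ n : ℤ, Odd n → (n : ZMod 2) = 1 := fun n hn => by
    obtain ⟨k, rfl⟩ := hn
    have := e0 (2 * k) (even_two_mul k)
    rw [Int.cast_add, this, zero_add, Int.cast_one]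
  rw [signE_eq_sgnC]
  change _ = _ * _ * sgnC (hl a b)
  rw [hl_eq_unitSign hϖ a b]
  rcases Int.even_or_odd c with hc | hc <;> rcases Int.even_or_odd (ord a) with ha | ha <;>
    rcases Int.even_or_odd (ord b) with hb | hb
  · rw [a1 hc ha, b1 hc hb, c1 hc (ha.add hb), e0 _ ha, e0 _ hb]
    simp [sgnC_zero]
  · rw [a1 hc ha, b2 hc hb, c2 hc (ha.add_odd hb), e0 _ ha, e1 _ hb]
    simp only [zero_mul, one_mul, zero_add]
    ring
  · rw [a2 hc ha, b1 hc hb, c2 hc (ha.add_even hb), e1 _ ha, e0 _ hb]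
    simp only [zero_mul, one_mul, zero_add, add_zero, mul_zero]
    ring
  · rw [a2 hc ha, b2 hc hb, c1 hc (ha.add_odd hb), e1 _ ha, e1 _ hb]
    simp only [one_mul, sgnC_add]
    grind
  · rw [a3 hc ha, b3 hc hb, c3 hc (ha.add hb), e0 _ ha, e0 _ hb]
    simp [sgnC_zero]
  · rw [a3 hc ha, b4 hc hb, c4 hc (ha.add_odd hb), e0 _ ha, e1 _ hb]
    simp only [zero_mul, one_mul, zero_add]
    grind
  · rw [a4 hc ha, b3 hc hb, c4 hc (ha.add_even hb), e1 _ ha, e0 _ hb]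
    simp only [zero_mul, one_mul, zero_add, add_zero, mul_zero]
    grind
  · rw [a4 hc ha, b4 hc hb, c3 hc (ha.add_odd hb), e1 _ ha, e1 _ hb]
    simp only [one_mul, sgnC_add]
    grind

lemma gammaF_pow_four (h2 : ringChar 𝓀[F] ≠ 2) (hψ : Continuous ψ) (h1 : ψ ≠ 1) (a : Fˣ) :
    gammaF ψ a ^ 4 = 1 := by
  obtain ⟨ϖ, hϖ⟩ := IsDiscreteValuationRing.exists_irreducible 𝒪[F]
  obtain ⟨c, g, hg, h⟩ := exists_gammaF hϖ h2 hψ h1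
  obtain ⟨a1, a2, a3, a4⟩ := h a
  have hs := sgnC_mul_self (hl (unif hϖ) (-1))
  have hx := sgnC_mul_self (unitSign hϖ a)
  rcases Int.even_or_odd c with hc | hc <;> rcases Int.even_or_odd (ord a) with ha | ha
  · rw [a1 hc ha, one_pow]
  · rw [a2 hc ha]; grind
  · rw [a3 hc ha]; grind
  · rw [a4 hc ha]; grind

lemma gammaF_of_unit (h2 : ringChar 𝓀[F] ≠ 2) (hψ : Continuous ψ) (h1 : ψ ≠ 1) {a : Fˣ}
    (ha : ord a = 0) (ha1 : (a : F) - 1 ∈ lat F 1) : gammaF ψ a = 1 := by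
  obtain ⟨ϖ, hϖ⟩ := IsDiscreteValuationRing.exists_irreducible 𝒪[F]
  obtain ⟨c, g, hg, h⟩ := exists_gammaF hϖ h2 hψ h1
  have he : Even (ord a) := by rw [ha]; exact Even.zero
  rcases Int.even_or_odd c with hc | hc
  · exact (h a).1 hc he
  · rw [(h a).2.2.1 hc he, unitSign_of_unit hϖ ha ha1, sgnC_zero]

end WeilRatio

/-! ### The characters `μ · χ_ψ` -/

section GenuineCharacter

variable {F : Type*} [Field F] [ValuativeRel F] [TopologicalSpace F]
  [IsNonarchimedeanLocalField F] {E : Type*} [Field E]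
  (i : rootsOfUnity 4 ℂ ≃* rootsOfUnity 4 E) {ψ : AddChar F ℂ}

lemma transport_coe (u : rootsOfUnity 4 ℂ) : transport i ((u : ℂˣ) : ℂ) = ((i u : Eˣ) : E) := by
  have h : ∃ v : rootsOfUnity 4 ℂ, ((v : ℂˣ) : ℂ) = ((u : ℂˣ) : ℂ) := ⟨u, rfl⟩
  rw [transport, dif_pos h]
  have : h.choose = u := Subtype.ext (Units.ext h.choose_spec)
  rw [this]

lemma transport_mul {z w : ℂ} (hz : z ^ 4 = 1) (hw : w ^ 4 = 1) :
    transport i (z * w) = transport i z * transport i w := by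
  have hz' : z = ((rootsOfUnity.mkOfPowEq z hz : ℂˣ) : ℂ) := rfl
  have hw' : w = ((rootsOfUnity.mkOfPowEq w hw : ℂˣ) : ℂ) := rfl
  rw [hz', hw', ← Units.val_mul, ← Subgroup.coe_mul, transport_coe, transport_coe, transport_coe,
    map_mul]
  rfl

lemma transport_one : transport i 1 = 1 := by
  have := transport_coe i 1
  rwa [map_one] at this

lemma transport_neg_one : transport i (-1) = -1 := by
  have h4 : (-1 : ℂ) ^ 4 = 1 := by norm_num
  have h := transport_mul i h4 h4
  rw [neg_one_mul, neg_neg, transport_one] at h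
  rcases mul_self_eq_one_iff.1 h.symm with h1 | h1
  · exfalso
    have h3 := transport_coe i (rootsOfUnity.mkOfPowEq (-1 : ℂ) h4)
    change transport i (-1) = _ at h3
    rw [h1] at h3
    have h5 : i (rootsOfUnity.mkOfPowEq (-1 : ℂ) h4) = 1 := Subtype.ext (Units.ext h3.symm)
    rw [MulEquiv.map_eq_one_iff] at h5
    have h6 : (-1 : ℂ) = 1 := congrArg (fun u : rootsOfUnity 4 ℂ => ((u : ℂˣ) : ℂ)) h5
    norm_num at h6
  · exact h1

lemma transport_signE (z : ℤˣ) : transport i (signE ℂ z) = signE E z := by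
  rcases Int.units_eq_one_or z with rfl | rfl
  · rw [signE_one, signE_one, transport_one]
  · rw [signE_neg_one, signE_neg_one, transport_neg_one]

lemma torusCoord_mul (s t : Tt F) : torusCoord (s * t) = torusCoord s * torusCoord t := by
  ext
  change (s.1.g * t.1.g) 0 0 = s.1.g 0 0 * t.1.g 0 0
  rw [sl_mul, s.2.1, zero_mul, add_zero]

lemma X_torus (t : Tt F) : X t.1.g = (torusCoord t)⁻¹ := by
  refine X_eq_of_eq _ t.2.2 ?_
  rw [Units.val_inv_eq_inv_val]
  refine eq_inv_of_mul_eq_one_right ?_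
  have := sl_det t.1.g
  rw [t.2.1, zero_mul, sub_zero] at this
  exact this

/-- The cocycle of the double cover is the Hilbert symbol on the torus; this is what makes `χ_ψ`
multiplicative, by `gammaF_mul`. -/
lemma cocyc_torus (s t : Tt F) :
    cocyc s.1.g t.1.g = hilb (torusCoord s) (torusCoord t) := by
  apply sgn2_inj
  have h : X (s.1.g * t.1.g) = (torusCoord s * torusCoord t)⁻¹ := by
    rw [← torusCoord_mul, ← X_torus]; rfl
  rw [cocyc_add, h, X_torus, X_torus, div_inv_eq_mul, div_inv_eq_mul, _root_.mul_inv_rev,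
    inv_mul_cancel_right, mul_comm (torusCoord t)⁻¹, inv_mul_cancel_right, hl_inv_left,
    hl_inv_right, hl_symm]
  rfl

lemma chiPsi_mul (h2 : ringChar 𝓀[F] ≠ 2) (hψ : Continuous ψ) (h1 : ψ ≠ 1) (s t : Tt F) :
    chiPsi i ψ (s * t) = chiPsi i ψ s * chiPsi i ψ t := by
  have hz : (s * t).1.ζ = s.1.ζ * t.1.ζ * cocyc s.1.g t.1.g := rfl
  have hi : ∀ a : Fˣ, ((gammaF ψ a)⁻¹) ^ 4 = 1 := fun a => by
    rw [inv_pow, gammaF_pow_four h2 hψ h1, inv_one]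
  have hsi : ∀ z : ℤˣ, (signE ℂ z)⁻¹ = signE ℂ z := fun z => by
    rcases Int.units_eq_one_or z with rfl | rfl
    · rw [signE_one, inv_one]
    · rw [signE_neg_one]; norm_num
  have hs4 : ∀ z : ℤˣ, (signE ℂ z) ^ 4 = 1 := fun z => by
    rcases Int.units_eq_one_or z with rfl | rfl
    · rw [signE_one, one_pow]
    · rw [signE_neg_one]; norm_num
  have hss : ∀ z : ℤˣ, signE E z * signE E z = 1 := fun z => by
    rw [← map_mul, Int.units_mul_self, map_one]
  rw [chiPsi, chiPsi, chiPsi, hz, cocyc_torus, torusCoord_mul, gammaF_mul h2 hψ h1, mul_inv,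
    mul_inv, hsi, transport_mul i (by rw [mul_pow, hi, hi, one_mul]) (hs4 _),
    transport_mul i (hi _) (hi _), transport_signE, map_mul, map_mul]
  linear_combination (signE E s.1.ζ * signE E t.1.ζ * transport i (gammaF ψ (torusCoord s))⁻¹ *
    transport i (gammaF ψ (torusCoord t))⁻¹) * hss (hilb (torusCoord s) (torusCoord t))

lemma chiPsi_ne_zero (h2 : ringChar 𝓀[F] ≠ 2) (hψ : Continuous ψ) (h1 : ψ ≠ 1) (t : Tt F) :
    chiPsi i ψ t ≠ 0 := by
  have hi : ((gammaF ψ (torusCoord t))⁻¹) ^ 4 = 1 := by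
    rw [inv_pow, gammaF_pow_four h2 hψ h1, inv_one]
  rw [chiPsi]
  refine mul_ne_zero (fun h => ?_) ?_
  · have : signE E t.1.ζ * signE E t.1.ζ = 1 := by
      rw [← map_mul, Int.units_mul_self, map_one]
    simp [h] at this
  · change transport i ((rootsOfUnity.mkOfPowEq _ hi : ℂˣ) : ℂ) ≠ 0
    rw [transport_coe]
    exact Units.ne_zero _

variable (μ : Fˣ →* Eˣ)

/-- The function `μ · χ_ψ` as a character of the torus with values in `Eˣ`. -/
def muChiPsiHom (h2 : ringChar 𝓀[F] ≠ 2) (hψ : Continuous ψ) (h1 : ψ ≠ 1) : Tt F →* Eˣ :=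
  MonoidHom.mk' (fun t => μ (torusCoord t) * Units.mk0 (chiPsi i ψ t) (chiPsi_ne_zero i h2 hψ h1 t))
    fun s t => by
      ext
      simp only [Units.val_mul, Units.val_mk0, torusCoord_mul, chiPsi_mul i h2 hψ h1, map_mul]
      ring

lemma muChiPsiHom_coe (h2 : ringChar 𝓀[F] ≠ 2) (hψ : Continuous ψ) (h1 : ψ ≠ 1) (t : Tt F) :
    (muChiPsiHom i μ h2 hψ h1 t : E) = muChiPsi i ψ μ t := rfl

lemma muChiPsiHom_negOne (h2 : ringChar 𝓀[F] ≠ 2) (hψ : Continuous ψ) (h1 : ψ ≠ 1) :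
    muChiPsiHom i μ h2 hψ h1 (negOne F) = -1 := by
  ext
  have h : torusCoord (negOne F) = 1 := by ext; rfl
  have h' : (negOne F).1.ζ = -1 := rfl
  rw [muChiPsiHom_coe, muChiPsi, chiPsi, h, h', map_one, signE_neg_one,
    gammaF_of_unit h2 hψ h1 ord_one (by simp), inv_one, transport_one]
  simp

/-- The kernel contains the torus elements of a small congruence subgroup, on which the ratio of
Weil indices is `1`. -/
lemma isOpen_ker_muChiPsiHom (h2 : ringChar 𝓀[F] ≠ 2) (hψ : Continuous ψ) (h1 : ψ ≠ 1)
    (hμ : IsOpen (μ.ker : Set Fˣ)) : IsOpen ((muChiPsiHom i μ h2 hψ h1).ker : Set (Tt F)) := by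
  obtain ⟨U, hU, hUμ⟩ : (μ.ker : Set Fˣ) ∈ Filter.comap Units.val (nhds ((1 : Fˣ) : F)) := by
    rw [← Units.isEmbedding_val₀.isInducing.nhds_eq_comap]
    exact hμ.mem_nhds (one_mem _)
  have h0 : (fun x : F => 1 + x) ⁻¹' U ∈ nhds (0 : F) := by
    refine (continuous_const.add continuous_id).continuousAt.preimage_mem_nhds ?_
    simpa using hU
  obtain ⟨n, hn⟩ := exists_lat_subset h0
  refine Subgroup.isOpen_mono (H₁ := (congr F (n + 1)).subgroupOf (Tt F)) (fun t ht => ?_)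
    ((isOpen_congr (n + 1)).preimage continuous_subtype_val)
  obtain ⟨⟨hK, hsplit⟩, hcong⟩ : (t : Mp F) ∈ congr F (n + 1) := ht
  have h00 : ((torusCoord t : Fˣ) : F) - 1 ∈ lat F ((n + 1 : ℕ) : ℤ) := by
    have := hcong 0 0
    rwa [Matrix.sub_apply, Matrix.one_apply_eq] at this
  have ha1 : ((torusCoord t : Fˣ) : F) - 1 ∈ lat F 1 := lat_anti (by push_cast; omega) h00
  have ha : ord (torusCoord t) = 0 := by
    obtain ⟨b, hb, hb0⟩ := exists_unit_of_sub_one ha1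
    rwa [show torusCoord t = b from Units.ext hb.symm]
  have hζ : t.1.ζ = 1 := by
    change t.1.ζ * theta t.1.g = 1 at hsplit
    rwa [theta, dif_neg (fun h => h.1 t.2.2), mul_one] at hsplit
  have hμt : μ (torusCoord t) = 1 := by
    refine hUμ (show ((torusCoord t : Fˣ) : F) ∈ U from ?_)
    have := hn (lat_anti (by push_cast; omega) h00)
    rwa [Set.mem_preimage, add_sub_cancel] at this
  rw [MonoidHom.mem_ker]
  ext
  rw [muChiPsiHom_coe, muChiPsi, chiPsi, hζ, hμt, signE_one, gammaF_of_unit h2 hψ h1 ha ha1,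
    inv_one, transport_one]
  simp

end GenuineCharacter

/-! ### Weights in the principal series -/

section WeightsInPrincipalSeries

variable {F : Type*} [Field F] [ValuativeRel F] [TopologicalSpace F]
  [IsNonarchimedeanLocalField F] {E : Type*} [Field E] {χ : Tt F →* Eˣ}

/-- A nonzero intertwining map from a genuine weight to a principal series is a weight map. -/
lemma isWeightMap_of_intertwining {V : Type*} [AddCommGroup V] [Module E V]
    (τ : Representation E (Matrix.SpecialLinearGroup (Fin 2) 𝓀[F]) V)
    (φ : Representation.IntertwiningMap (genuineLift τ)
      ((principalSeries fun t => (χ t : E)).comp (Kt F).subtype)) (hφ : φ ≠ 0) :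
    IsWeightMap τ χ ((psSpace fun t => (χ t : E)).subtype ∘ₗ φ.toLinearMap) where
  mem v := (φ v).2
  equivariant k hk v g := by
    have h := LinearMap.congr_fun (φ.isIntertwining' ⟨k, hk⟩) v
    have h1 := congrFun (congrArg Subtype.val h) g
    rw [show k = ((⟨k, hk⟩ : Kt F) : Mp F) from rfl, extLift_coe]
    exact h1
  ne_zero h := by
    refine hφ (Representation.IntertwiningMap.ext (LinearMap.ext fun v => Subtype.ext ?_))
    exact LinearMap.congr_fun h v

end WeightsInPrincipalSeries

end Metaplectic

end

open Metaplectic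

theorem theorem6p8 {F : Type*} [Field F] [ValuativeRel F] [TopologicalSpace F]
    [IsNonarchimedeanLocalField F] [CharZero F]
    (p f : ℕ) [Fact p.Prime] [CharP 𝓀[F] p] (hp : p ≠ 2) (hf : Nat.card 𝓀[F] = p ^ f)
    (ϖ : 𝒪[F]) (hϖ : Irreducible ϖ)
    {E : Type*} [Field E] [IsAlgClosed E] [CharP E p] (emb : 𝓀[F] →+* E) :
    (∀ (i : rootsOfUnity 4 ℂ ≃* rootsOfUnity 4 E) (ψ : AddChar F ℂ) (μ : Fˣ →* Eˣ),
      Continuous ψ → ψ ≠ 1 → IsOpen (μ.ker : Set Fˣ) →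
        (principalSeries (muChiPsi i ψ μ)).IsIrreducible ∧
        ∀ r : Fin f → Fin p,
          (∃ φ : Representation.IntertwiningMap (genuineWeight p emb r)
            ((principalSeries (muChiPsi i ψ μ)).comp (Kt F).subtype), φ ≠ 0) →
          Nonempty (Representation.Equiv
            (piModule hϖ p emb r (lambdaParam hϖ i ψ μ))
            (principalSeries (muChiPsi i ψ μ)))) ∧
    (∀ χ : Tt F →* Eˣ, IsOpen (χ.ker : Set (Tt F)) → χ (negOne F) = -1 →
      (principalSeries fun t => (χ t : E)).IsIrreducible) := by
  have hirr : ∀ χ : Tt F →* Eˣ, IsOpen (χ.ker : Set (Tt F)) → χ (negOne F) = -1 →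
      (principalSeries fun t => (χ t : E)).IsIrreducible := fun χ hχ hg =>
    principalSeries_isIrreducible p hp (isTameGenuine_of_isOpen p hχ hg)
  refine ⟨fun i ψ μ hψ h1 hμ => ?_, hirr⟩
  have h2 : ringChar 𝓀[F] ≠ 2 := by rwa [ringChar.eq 𝓀[F] p]
  have hopen := isOpen_ker_muChiPsiHom i μ h2 hψ h1 hμ
  have hg := muChiPsiHom_negOne i μ h2 hψ h1
  refine ⟨hirr _ hopen hg, fun r hr => ?_⟩
  obtain ⟨φ, hφ⟩ := hr
  refine cokerModule_equiv (χ := muChiPsiHom i μ h2 hψ h1) p hp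
    (isWeightMap_of_intertwining _ φ hφ) (isTameGenuine_of_isOpen p hopen hg)
    (highestWeight_weight emb r hf) ?_
  by_cases h0 : ∀ j, (r j : ℕ) = 0
  · exact Or.inl fun g v => weight_trivial emb r h0 g v
  · exact Or.inr fun g hg => weightFun_eq_zero emb r hg (not_forall.1 h0)
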